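/- Let $d\ge 1$ be an integer and let $T(D)$, $D=-i\nabla$, be one of the following operators, each realized through the Fourier transform on its maximal domain: 1. $H_0=(-\Delta)^{s/2}$ on $L^2(\mathbb R^d)$, with $0<s<d$; 2. $H_0=(1-\Delta)^{s/2}-1$ on $L^2(\mathbb R^d)$, with $0<s<d$; 3. the massless Dirac operator $H_0=\sum_{j=1}^d\alpha_j(-i\partial_j)$ on $L^2(\mathbb R^d;\mathbb C^n)$, with $d\ge2$ and $s:=1$; 4. the Dirac operator $H_0=\sum_{j=1}^d\alpha_j(-i\partial_j)+\beta$ on $L^2(\mathbb R^d;\mathbb C^n)$, with $d\ge2$ and $s:=1$. Here the $n\times n$ matrices $\alpha_1,\dots,\alpha_d$ (and $\beta=\alpha_{d+1}$ in case 4) satisfy the Clifford relations $\alpha_i\alpha_j+\alpha_j\alpha_i=2\delta_{ij}I_n$. Let $\Lambda_c(H_0)\subset\mathbb R$ be the set of critical values (values at points where the function is differentiable with zero gradient) of the symbol $|\xi|^s$, resp. $(1+|\xi|^2)^{s/2}-1$, in cases 1 and 2, and of the two eigenvalues $\pm|\xi|$, resp. $\pm(1+|\xi|^2)^{1/2}$,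 of the symbol in cases 3 and 4. Let $R_0(z)=(H_0-z)^{-1}$, with domain the range of $H_0-z$ (which is all of $L^2$ if $z\notin\sigma(H_0)$). Let $K$ be a compact subset of $\mathbb C\setminus\Lambda_c(H_0)$. Then there is a constant $C(K)<\infty$, depending only on $K$ and $H_0$ (hence on $d$, $s$ and the matrices), such that for all $z\in K$: a) If $s\ge \frac{2d}{d+1}$ and $\frac{2d}{d+s}\le p\le\frac{2(d+1)}{d+3}$, $\frac1p+\frac1{p'}=1$, then $$\|R_0(z)f\|_{L^{p'}}\le C(K)\,\|f\|_{L^p}$$ for all $f\in L^p$ in the domain of $R_0(z)$; the constant does not depend on $p$. b) If $s<\frac{2d}{d+1}$, then $$\|R_0(z)f\|_{L^{\frac{2d}{d-s}}+L^{\frac{2(d+1)}{d-1}}}\le C(K)\,\|f\|_{L^{\frac{2d}{d+s}}\cap L^{\frac{2(d+1)}{d+3}}}$$ for all $f\in L^{\frac{2d}{d+s}}\cap L^{\frac{2(d+1)}{d+3}}$ in the domain of $R_0(z)$, where $\frac{2(d+1)}{d-1}=\infty$ if $d=1$, $\|f\|_{X\cap Y}=\max(\|f\|_X,\|f\|_Y)$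 and $\|g\|_{X+Y}=\inf\{\|g_1\|_X+\|g_2\|_Y: g=g_1+g_2\}$. -/

import Mathlib

open MeasureTheory FourierTransform
open scoped ENNReal NNReal

noncomputable section

namespace FreeHamiltonian

/-- Euclidean space `ℝ^d`. -/
abbrev E (d : ℕ) : Type := EuclideanSpace ℝ (Fin d)

/-- The Hilbert space `L²(ℝ^d; V)`. -/
abbrev L2 (d : ℕ) (V : Type) [NormedAddCommGroup V] : Type :=
  Lp (α := E d) V 2 (volume : Measure (E d))

section Operators

variable {d : ℕ} {V : Type} [NormedAddCommGroup V] [InnerProductSpace ℂ V] [CompleteSpace V]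

/-- The functions `f` in `L²(ℝ^d; V)` with `m f` in `L²`, for an operator-valued function `m`. -/
def mulDomain (m : E d → V →L[ℂ] V) : Submodule ℂ (L2 d V) where
  carrier := {f | MemLp (fun ξ => m ξ (f ξ)) 2 (volume : Measure (E d))}
  add_mem' := by
    intro f g hf hg
    refine (memLp_congr_ae ?_).mpr (MemLp.add hf hg)
    filter_upwards [Lp.coeFn_add f g] with ξ h
    rw [h]
    exact map_add _ _ _
  zero_mem' := by
    refine (memLp_congr_ae ?_).mpr (MemLp.zero' (ε := V))
    filter_upwards [Lp.coeFn_zero V 2 (volume : Measure (E d))] with ξ h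
    rw [h]
    exact map_zero _
  smul_mem' := by
    intro c f hf
    refine (memLp_congr_ae ?_).mpr (MemLp.const_smul hf c)
    filter_upwards [Lp.coeFn_smul c f] with ξ h
    rw [h]
    exact map_smul _ _ _

/-- Multiplication on `L²(ℝ^d; V)` by the operator-valued function `m`, with its maximal domain. -/
def mulOp (m : E d → V →L[ℂ] V) : L2 d V →ₗ.[ℂ] L2 d V where
  domain := mulDomain m
  toFun :=
    { toFun := fun f => MemLp.toLp (fun ξ => m ξ ((f : L2 d V) ξ)) f.2
      map_add' := by
        intro f g
        refine Eq.trans ?_ (MemLp.toLp_add f.2 g.2)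
        refine MemLp.toLp_congr _ _ ?_
        filter_upwards [Lp.coeFn_add (f : L2 d V) (g : L2 d V)] with ξ h
        have h' : ((f + g : mulDomain m) : L2 d V) ξ = (f : L2 d V) ξ + (g : L2 d V) ξ := h
        rw [h']
        exact map_add _ _ _
      map_smul' := by
        intro c f
        refine Eq.trans ?_ (MemLp.toLp_const_smul c f.2)
        refine MemLp.toLp_congr _ _ ?_
        filter_upwards [Lp.coeFn_smul c (f : L2 d V)] with ξ h
        have h' : ((c • f : mulDomain m) : L2 d V) ξ = c • (f : L2 d V) ξ := h
        rw [h']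
        exact map_smul _ _ _ }

/-- The operator `T(D)`, `D = -i∇`, on `L²(ℝ^d; V)` with symbol `T`: it is unitarily equivalent,
through the Fourier transform, to multiplication by the symbol, on the maximal domain
`{f ∈ L² : T(D) f ∈ L²}`.  With the normalization `𝓕 f ξ = ∫ exp (-2πi x·ξ) f x dx` used here, `D`
becomes multiplication by `2πξ`. -/
def ofSymbol (T : E d → V →L[ℂ] V) : L2 d V →ₗ.[ℂ] L2 d V where
  domain := (mulOp fun ξ => T ((2 * Real.pi) • ξ)).domain.comap
    (Lp.fourierTransformₗᵢ (E d) V).toLinearEquiv.toLinearMap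
  toFun :=
    (Lp.fourierTransformₗᵢ (E d) V).symm.toLinearEquiv.toLinearMap ∘ₗ
      (mulOp fun ξ => T ((2 * Real.pi) • ξ)).toFun ∘ₗ
        ((Lp.fourierTransformₗᵢ (E d) V).toLinearEquiv.toLinearMap.restrict fun _ hf => hf)

/-- The resolvent `R₀(z) = (H - z)⁻¹`, as an operator on `L²(ℝ^d; V)` with domain the range of
`H - z`; this domain is all of `L²` when `z` is in the resolvent set of `H`. -/
def resolvent (H : L2 d V →ₗ.[ℂ] L2 d V) (z : ℂ) : L2 d V →ₗ.[ℂ] L2 d V :=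
  (H - (z • LinearMap.id : L2 d V →ₗ[ℂ] L2 d V).toPMap ⊤).inverse

/-- The norm of `L^p + L^q`, i.e. the infimum of `‖g₁‖_p + ‖g₂‖_q` over all decompositions
`g = g₁ + g₂`; it is `∞` if `g` is not in `L^p + L^q`. -/
def eLpSumNorm (g : E d → V) (p q : ℝ≥0∞) : ℝ≥0∞ :=
  ⨅ (g₁ : E d → V) (g₂ : E d → V) (_ : AEStronglyMeasurable g₁ (volume : Measure (E d)))
    (_ : AEStronglyMeasurable g₂ (volume : Measure (E d)))
    (_ : g =ᵐ[(volume : Measure (E d))] g₁ + g₂),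
    eLpNorm g₁ p (volume : Measure (E d)) + eLpNorm g₂ q (volume : Measure (E d))

/-- The uniform Sobolev inequalities for the resolvent of an operator `H` of order `s`, with a
single constant for all `z ∈ K`.  For `d = 1` the exponent `2(d+1)/(d-1)` is `∞`. -/
def UniformSobolev (H : L2 d V →ₗ.[ℂ] L2 d V) (s : ℝ) (K : Set ℂ) : Prop :=
  ∃ C : ℝ≥0,
    (2 * d / (d + 1) ≤ s →
      ∀ p p' : ℝ, p.HolderConjugate p' → 2 * d / (d + s) ≤ p → p ≤ 2 * (d + 1) / (d + 3) →
      ∀ z ∈ K, ∀ f : (resolvent H z).domain, MemLp (f : L2 d V) (.ofReal p) volume →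
        eLpNorm (resolvent H z f) (.ofReal p') volume ≤
          C * eLpNorm (f : L2 d V) (.ofReal p) volume) ∧
    (s < 2 * d / (d + 1) →
      ∀ z ∈ K, ∀ f : (resolvent H z).domain,
        MemLp (f : L2 d V) (.ofReal (2 * d / (d + s))) volume →
        MemLp (f : L2 d V) (.ofReal (2 * (d + 1) / (d + 3))) volume →
        eLpSumNorm (resolvent H z f)
            (.ofReal (2 * d / (d - s))) (2 * ((d : ℝ≥0∞) + 1) / ((d : ℝ≥0∞) - 1)) ≤
          C * max (eLpNorm (f : L2 d V) (.ofReal (2 * d / (d + s))) volume)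
            (eLpNorm (f : L2 d V) (.ofReal (2 * (d + 1) / (d + 3))) volume))

end Operators

/-- The critical values of a real-valued function on `ℝ^d`: its values at the points where it is
differentiable with vanishing gradient. -/
def criticalValues {d : ℕ} (T : E d → ℝ) : Set ℝ :=
  {c | ∃ η, HasFDerivAt T (0 : E d →L[ℝ] ℝ) η ∧ T η = c}

/-- The compact sets `K ⊂ ℂ ∖ Λ`, for `Λ ⊆ ℝ`. -/
def IsCompactAvoiding (K : Set ℂ) (Λ : Set ℝ) : Prop :=
  IsCompact K ∧ ∀ c ∈ Λ, (c : ℂ) ∉ K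

/-- A real-valued symbol, acting on `ℂ`. -/
def scalarSymbol {d : ℕ} (T : E d → ℝ) (η : E d) : ℂ →L[ℂ] ℂ :=
  (T η : ℂ) • ContinuousLinearMap.id ℂ ℂ

/-- The symbol `|η|^s` of `(-Δ)^{s/2}`. -/
def fracSymbol (d : ℕ) (s : ℝ) (η : E d) : ℝ := ‖η‖ ^ s

/-- The symbol `(1 + |η|²)^{s/2} - 1` of `(1-Δ)^{s/2} - 1`. -/
def besselSymbol (d : ℕ) (s : ℝ) (η : E d) : ℝ := (1 + ‖η‖ ^ 2) ^ (s / 2) - 1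

/-- The Clifford relations `α_i α_j + α_j α_i = 2 δ_{ij} I_n`. -/
def IsClifford {m n : ℕ} (α : Fin m → Matrix (Fin n) (Fin n) ℂ) : Prop :=
  ∀ i j, α i * α j + α j * α i = if i = j then 2 else 0

/-- The symbol `∑_j α_j η_j` of the massless Dirac operator. -/
def diracSymbol {d n : ℕ} (α : Fin d → Matrix (Fin n) (Fin n) ℂ) (η : E d) :
    EuclideanSpace ℂ (Fin n) →L[ℂ] EuclideanSpace ℂ (Fin n) :=
  Matrix.toEuclideanCLM (𝕜 := ℂ) (∑ j, (η j : ℂ) • α j)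

/-- The symbol `∑_{j ≤ d} α_j η_j + β`, `β = α_{d+1}`, of the Dirac operator of mass one. -/
def massiveDiracSymbol {d n : ℕ} (α : Fin (d + 1) → Matrix (Fin n) (Fin n) ℂ) (η : E d) :
    EuclideanSpace ℂ (Fin n) →L[ℂ] EuclideanSpace ℂ (Fin n) :=
  Matrix.toEuclideanCLM (𝕜 := ℂ) (∑ j : Fin d, (η j : ℂ) • α j.castSucc + α (Fin.last d))

/-- The critical values of the two eigenvalues `±|η|` of the massless Dirac symbol. -/
def diracCritical (d : ℕ) : Set ℝ :=
  criticalValues (fun η : E d => ‖η‖) ∪ criticalValues (fun η : E d => -‖η‖)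

/-- The critical values of the two eigenvalues `±(1 + |η|²)^{1/2}` of the massive Dirac symbol. -/
def massiveDiracCritical (d : ℕ) : Set ℝ :=
  criticalValues (fun η : E d => √(1 + ‖η‖ ^ 2)) ∪
    criticalValues (fun η : E d => -√(1 + ‖η‖ ^ 2))

end FreeHamiltonian

end

/-! Every resolvent symbol reduces to a scalar function of |ξ|². For a Dirac symbol M one has M² =
|η|² + ε, hence (M - z)⁻¹ = (M + z)(|η|² + ε - z²)⁻¹, a scalar resolvent with a numerator of degree
one. At frequency scale R the scalar symbol is (φ(x) - z)⁻¹ with x = κ²|ξ|², κ = 2π/R.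

If z is near a regular value φ(x₀), the analytic extension of φ is locally invertible, so z = φ(w)
with w complex near x₀, and (φ(x) - z)⁻¹ has one simple pole at w. `exists_resolventExpansion`
subtracts a model pole c e^{-x} S_w(x), leaving a remainder O((1 + x)^{-σ}) uniformly for z in a
compact set. The Gaussian e^{-x} is split off so that it can absorb numerators: κξ_j e^{-x} is the
transform of an integrable function.

The remainder is handled by Sobolev embedding and its dual (`eLpNorm_le_of_norm_fourier_le`): a
multiplier bounded by |ξ|^{-τ} maps L^{2d/(d+τ)} to L^{2d/(d-τ)}, and every τ ≤ s in question is
available.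

The model pole is a superposition of damped Schrödinger propagators: for Im w > 0, S_w is the
integral over t > 2 of exp((1 + it)(w - κ²|ξ|²)), whose kernels are explicit complex Gaussians
decaying like t^{-d/2}. Inserting a density t^μ gives an analytic family. For μ = -1 + iη its symbol
is bounded, which is an L² estimate; for Re μ ≤ (d-1)/2 its kernel is bounded by van der Corput's
lemma, which is an L¹ → L^∞ estimate. Stein interpolation at μ = 0
(`norm_integral_truncSymbol_le_of_log_le`) gives L^p → L^{p'} for 2/p - 1 between 2/(d+1) and 1.
Everything is done for a truncated time integral and Im w > 0 and then passed to the limit, so real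
w, hence z in the spectrum, is included (`upperSymbol_estimate`).

`exists_splitBound` combines both pieces and tracks the power R^{d(2/p-1)-s} produced by scaling.
Its exponent is nonnegative in regime b), so small R is harmless there; in regime a) the critical
value 0 is excluded and R stays away from 0. The energy z = 0, where no scale exists, is pure
Sobolev. -/

open MeasureTheory FourierTransform
open scoped ENNReal NNReal

noncomputable section

namespace FreeHamiltonian

/-! ### The L² Fourier transform: integral formula and postcomposition -/

section

/-- The `L²` Fourier transform of an `L¹ ∩ L²` function is given by the Fourier integral. -/
theorem fourier_toLp_ae {d : ℕ} {f : E d → ℂ} (h1 : Integrable f) (h2 : MemLp f 2 volume) :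
    (𝓕 (h2.toLp f) : L2 d ℂ) =ᵐ[volume] 𝓕 f := by
  have hcont : Continuous (𝓕 f) := VectorFourier.fourierIntegral_continuous Real.continuous_fourierChar
    continuous_inner h1
  -- Both sides are locally integrable, so it suffices to test against smooth compactly supported
  -- functions. There both transforms can be moved onto the test function, which is Schwartz, and
  -- only f itself remains.
  apply ae_eq_of_integral_contDiff_smul_eq
    ((Lp.memLp (𝓕 (h2.toLp f) : L2 d ℂ)).locallyIntegrable (by norm_num))
    hcont.locallyIntegrable
  intro g hg1 hg2
  have hsm : ContDiff ℝ (⊤ : ℕ∞) (fun x => (g x : ℂ)) := Complex.ofRealCLM.contDiff.comp hg1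
  have hcs : HasCompactSupport (fun x => (g x : ℂ)) := by
    have := hg2.comp_left (g := fun x : ℝ => (x : ℂ)) (by simp)
    exact this
  set φ : SchwartzMap (E d) ℂ := hcs.toSchwartzMap hsm with hφ
  have hφg : ∀ x, φ x = (g x : ℂ) := fun x => rfl
  have key := congrArg (fun T => T φ) (Lp.fourier_toTemperedDistribution_eq (h2.toLp f))
  simp only [TemperedDistribution.fourier_apply, Lp.toTemperedDistribution_apply] at key
  have e1 : ∫ x, g x • (𝓕 (h2.toLp f) : L2 d ℂ) x = ∫ x, φ x • (𝓕 (h2.toLp f) : L2 d ℂ) x := by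
    refine integral_congr_ae (Filter.Eventually.of_forall fun x => ?_)
    simp [hφg]
  have e2 : ∫ x, g x • 𝓕 f x = ∫ x, φ x • 𝓕 f x := by
    refine integral_congr_ae (Filter.Eventually.of_forall fun x => ?_)
    simp [hφg]
  rw [e1, e2, ← key]
  have e3 : ∫ x, (𝓕 φ) x • (h2.toLp f : E d → ℂ) x = ∫ x, (𝓕 φ) x • f x := by
    refine integral_congr_ae ?_
    filter_upwards [h2.coeFn_toLp] with x hx
    rw [hx]
  rw [e3]
  have := VectorFourier.integral_fourierIntegral_smul_eq_flip (𝕜 := ℝ) (e := Real.fourierChar)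
    (μ := (volume : Measure (E d))) (ν := (volume : Measure (E d))) (L := innerₗ (E d))
    Real.continuous_fourierChar continuous_inner φ.integrable h1
  rw [flip_innerₗ] at this
  exact this

/-- The `L²` Fourier transform commutes with postcomposition by a continuous linear map. -/
theorem fourier_compLp {d : ℕ} {V : Type} [NormedAddCommGroup V] [InnerProductSpace ℂ V]
    [CompleteSpace V] (L : V →L[ℂ] ℂ) (f : L2 d V) :
    (𝓕 (L.compLp f) : L2 d ℂ) = L.compLp (𝓕 f : L2 d V) := by
  have hd := SchwartzMap.denseRange_toLpCLM (E := E d) (F := V) (p := 2)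
    (μ := volume) ENNReal.ofNat_ne_top
  -- Both sides are continuous in f, so f may be taken Schwartz, where L passes under the Fourier
  -- integral.
  refine DenseRange.induction_on (p := fun f : L2 d V => (𝓕 (L.compLp f) : L2 d ℂ) =
    L.compLp (𝓕 f : L2 d V)) hd f ?_ ?_
  · have hc : Continuous fun f : L2 d V => L.compLp f :=
      (ContinuousLinearMap.compLpL 2 volume L).continuous
    exact isClosed_eq ((Lp.fourierTransformₗᵢ (E d) ℂ).continuous.comp hc)
      (hc.comp (Lp.fourierTransformₗᵢ (E d) V).continuous)
  · intro φ
    have h0 : ∀ ψ : SchwartzMap (E d) V, L.compLp (ψ.toLp 2 volume : L2 d V) =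
        (SchwartzMap.postcompCLM (𝕜 := ℂ) L ψ).toLp 2 volume := by
      intro ψ
      apply Lp.ext
      filter_upwards [L.coeFn_compLp (ψ.toLp 2 volume : L2 d V), ψ.coeFn_toLp 2 volume,
        (SchwartzMap.postcompCLM (𝕜 := ℂ) L ψ).coeFn_toLp 2 volume] with x h1 h2 h3
      rw [h1, h2, h3]; rfl
    change (𝓕 (L.compLp (φ.toLp 2 volume : L2 d V)) : L2 d ℂ) =
      L.compLp (𝓕 (φ.toLp 2 volume : L2 d V) : L2 d V)
    rw [h0, SchwartzMap.toLp_fourier_eq, SchwartzMap.toLp_fourier_eq, h0]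
    congr 1
    ext x
    simp only [SchwartzMap.fourier_coe]
    exact Real.fourier_eq _ _ |>.trans (by
      change _ = L ((𝓕 φ) x)
      rw [SchwartzMap.fourier_coe, Real.fourier_eq, ← L.integral_comp_comm]
      · refine integral_congr_ae (Filter.Eventually.of_forall fun v => ?_)
        change _ = L ((Real.fourierChar (-inner ℝ v x) : ℂ) • φ v)
        rw [map_smul]; rfl
      · exact (Real.fourierIntegral_convergent_iff x).2 φ.integrable)

end

/-! ### Converse Hölder inequalities, tested on L¹ ∩ L² -/

section

/-- The set where the modulus of `f` lies between `1 / (n + 1)` and `n + 1`. -/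
def band {d : ℕ} (f : E d → ℂ) (n : ℕ) : Set (E d) := {x | 1 / ((n : ℝ) + 1) ≤ ‖f x‖ ∧ ‖f x‖ ≤ n + 1}

section Band

variable {d : ℕ} {f : E d → ℂ}

theorem measurableSet_band (hf : Measurable f) (n : ℕ) : MeasurableSet (band f n) :=
  (measurableSet_le measurable_const hf.norm).inter (measurableSet_le hf.norm measurable_const)

theorem band_mono (f : E d → ℂ) : Monotone (band f) := by
  intro m n hmn x hx
  have h : (m : ℝ) ≤ n := by exact_mod_cast hmn
  refine ⟨le_trans ?_ hx.1, hx.2.trans (by linarith)⟩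
  exact one_div_le_one_div_of_le (by positivity) (by linarith)

theorem iUnion_band (f : E d → ℂ) : ⋃ n, band f n = {x | f x ≠ 0} := by
  ext x
  simp only [Set.mem_iUnion, Set.mem_ofPred_eq]
  constructor
  · rintro ⟨n, hn, -⟩ h0
    rw [h0, norm_zero] at hn
    have : (0 : ℝ) < 1 / ((n : ℝ) + 1) := by positivity
    linarith
  · intro h
    have hx : 0 < ‖f x‖ := norm_pos_iff.2 h
    obtain ⟨n, hn⟩ := exists_nat_ge (max ‖f x‖ (1 / ‖f x‖))
    have h1 := (le_max_left _ _).trans hn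
    have h2 := (le_max_right _ _).trans hn
    refine ⟨n, ?_, by linarith⟩
    rw [div_le_iff₀ (by positivity)]
    rw [div_le_iff₀ hx] at h2
    nlinarith

theorem volume_band_lt_top (hf : MemLp f 2 volume) (n : ℕ) : volume (band f n) < ∞ := by
  refine lt_of_le_of_lt (measure_mono ?_) (hf.meas_ge_lt_top' (ε := ENNReal.ofReal (1 / ((n : ℝ) + 1)))
    (by norm_num) (by norm_num) ?_)
  · intro x hx
    have := hx.1
    change _ ≤ ‖f x‖ₑ
    rw [← ofReal_norm]
    exact ENNReal.ofReal_le_ofReal this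
  · simp only [ne_eq, ENNReal.ofReal_eq_zero, not_le]; positivity

/-- A bounded measurable function vanishing outside a set of finite measure is in all `L^p`. -/
theorem memLp_of_bound_of_support {g : E d → ℂ} {S : Set (E d)} (hS : MeasurableSet S)
    (hS' : volume S < ∞) (hg : Measurable g) {C : ℝ} (hC : ∀ x ∈ S, ‖g x‖ ≤ C)
    (h0 : ∀ x ∉ S, g x = 0) (p : ℝ≥0∞) : MemLp g p volume := by
  refine MemLp.mono (memLp_indicator_const p hS (C : ℝ) (Or.inr hS'.ne)) hg.aestronglyMeasurable
    (Filter.Eventually.of_forall fun x => ?_)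
  by_cases hx : x ∈ S
  · simpa [hx] using (hC x hx).trans (le_abs_self C)
  · simp [h0 x hx]

theorem toReal_eLpNorm_eq {g : E d → ℂ} {p : ℝ} (hp : 0 < p) (hg : Integrable fun x => ‖g x‖ ^ p) :
    (eLpNorm g (.ofReal p) volume).toReal = (∫ x, ‖g x‖ ^ p) ^ (1 / p) := by
  rw [eLpNorm_eq_lintegral_rpow_enorm_toReal (by simpa using hp) (by simp), ENNReal.toReal_ofReal hp.le,
    ← ENNReal.toReal_rpow, integral_eq_lintegral_of_nonneg_ae
      (Filter.Eventually.of_forall fun x => by positivity) hg.aestronglyMeasurable]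
  congr 2
  refine lintegral_congr fun x => ?_
  rw [← ofReal_norm, ENNReal.ofReal_rpow_of_nonneg (norm_nonneg _) hp.le]

end Band

/-- Converse of Hölder's inequality, for a finite dual exponent. -/
theorem eLpNorm_le_of_forall_pairing {d : ℕ} {p p' : ℝ} (hp : p.HolderConjugate p') {G : E d → ℂ}
    (hGm : Measurable G) (hG : MemLp G 2 volume) {M : ℝ} (hM : 0 ≤ M)
    (h : ∀ u : E d → ℂ, MemLp u 1 volume → MemLp u 2 volume →
      ‖∫ x, G x * (starRingEnd ℂ) (u x)‖ ≤ M * (eLpNorm u (.ofReal p) volume).toReal) :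
    eLpNorm G (.ofReal p') volume ≤ ENNReal.ofReal M := by
  have hp1 := hp.lt
  have hp0 : 0 < p := by linarith
  have hp'0 : 0 < p' := hp.symm.pos
  have key : ∀ n, ∫⁻ x in band G n, ‖G x‖ₑ ^ p' ≤ ENNReal.ofReal M ^ p' := by
    intro n
    have hS := measurableSet_band hGm n
    have hS' := volume_band_lt_top hG n
    have hmon : ∀ r : ℝ, 0 ≤ r → ∀ x ∈ band G n, ‖G x‖ ^ r ≤ ((n : ℝ) + 1) ^ r := fun r hr x hx =>
      Real.rpow_le_rpow (norm_nonneg _) hx.2 hr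
    -- The extremal function of Hölder's inequality, cut to a band: there |G| is bounded above and
    -- below and the measure is finite, so u is an admissible test function. Both sides of the
    -- hypothesis become powers of I.
    set u : E d → ℂ := (band G n).indicator (fun x => ((‖G x‖ ^ (p' - 2) : ℝ) : ℂ) * G x) with hu
    have hum : Measurable u := ((Complex.measurable_ofReal.comp
      (hGm.norm.pow_const _)).mul hGm).indicator hS
    have hun : ∀ x ∈ band G n, ‖u x‖ = ‖G x‖ ^ (p' - 1) := by
      intro x hx
      have hx0 : 0 < ‖G x‖ := lt_of_lt_of_le (by positivity) hx.1
      simp only [hu, Set.indicator_of_mem hx, norm_mul, Complex.norm_real, Real.norm_eq_abs]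
      rw [abs_of_nonneg (by positivity)]
      nth_rw 2 [← Real.rpow_one ‖G x‖]
      rw [← Real.rpow_add hx0]; congr 1; ring
    have hu0 : ∀ x ∉ band G n, u x = 0 := fun x hx => by simp [hu, hx]
    have hub := fun q => memLp_of_bound_of_support hS hS' hum
      (C := ((n : ℝ) + 1) ^ (p' - 1)) (fun x hx => by
        rw [hun x hx]; exact hmon _ hp.symm.sub_one_pos.le x hx) hu0 q
    set I : ℝ := ∫ x in band G n, ‖G x‖ ^ p' with hI
    have hII : IntegrableOn (fun x => ‖G x‖ ^ p') (band G n) := by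
      refine Measure.integrableOn_of_bounded (M := ((n : ℝ) + 1) ^ p') hS'.ne
        (hGm.norm.pow_const _).aestronglyMeasurable ?_
      filter_upwards [ae_restrict_mem hS] with x hx
      rw [Real.norm_of_nonneg (by positivity)]
      exact hmon _ hp'0.le x hx
    have hI0 : 0 ≤ I := integral_nonneg fun x => by positivity
    have hpair : ∫ x, G x * (starRingEnd ℂ) (u x) = (I : ℂ) := by
      rw [hI, ← integral_indicator hS, ← integral_complex_ofReal]
      refine integral_congr_ae (Filter.Eventually.of_forall fun x => ?_)
      by_cases hx : x ∈ band G n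
      · have hx0 : 0 < ‖G x‖ := lt_of_lt_of_le (by positivity) hx.1
        simp only [hu, Set.indicator_of_mem hx, map_mul, Complex.conj_ofReal]
        rw [mul_left_comm, Complex.mul_conj, Complex.normSq_eq_norm_sq, ← Complex.ofReal_mul]
        congr 1
        rw [← Real.rpow_natCast ‖G x‖ 2, ← Real.rpow_add hx0]; congr 1; push_cast; ring
      · simp [hu, hx]
    have hpow : (fun x => ‖u x‖ ^ p) = (band G n).indicator fun x => ‖G x‖ ^ p' := by
      funext x
      by_cases hx : x ∈ band G n
      · rw [hun x hx, Set.indicator_of_mem hx, ← Real.rpow_mul (norm_nonneg _)]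
        congr 1
        exact hp.symm.sub_one_mul_conj
      · simp [hu0 x hx, hx, hp0.ne']
    have hnorm : (eLpNorm u (.ofReal p) volume).toReal = I ^ (1 / p) := by
      rw [toReal_eLpNorm_eq hp0 (by rw [hpow]; exact hII.integrable_indicator hS), hpow,
        integral_indicator hS]
    have h1 := h u (hub 1) (hub 2)
    rw [hpair, hnorm, Complex.norm_real, Real.norm_of_nonneg hI0] at h1
    have h2 : I ≤ M ^ p' := by
      rcases hI0.eq_or_lt with h0 | h0
      · rw [← h0]; positivity
      -- The hypothesis reads I ≤ M I^{1/p}. Dividing is legitimate because I is a finite positive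
      -- number, which is the purpose of the truncation.
      · have h3 : I ^ (1 / p') ≤ M := by
          have : I = I ^ (1 / p') * I ^ (1 / p) := by
            rw [← Real.rpow_add h0]
            have := hp.inv_add_inv_eq_one
            rw [one_div, one_div, add_comm, this, Real.rpow_one]
          have h4 : 0 < I ^ (1 / p) := by positivity
          rw [this] at h1
          exact le_of_mul_le_mul_right (by rwa [← this] at h1 ⊢) h4
        calc I = (I ^ (1 / p')) ^ p' := by
              rw [← Real.rpow_mul hI0, one_div, inv_mul_cancel₀ hp'0.ne', Real.rpow_one]
          _ ≤ M ^ p' := Real.rpow_le_rpow (by positivity) h3 hp'0.le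
    have h5 : ∫⁻ x in band G n, ‖G x‖ₑ ^ p' = ENNReal.ofReal I := by
      rw [hI, ofReal_integral_eq_lintegral_ofReal hII
        (Filter.Eventually.of_forall fun x => by positivity)]
      refine lintegral_congr fun x => ?_
      rw [← ofReal_norm, ENNReal.ofReal_rpow_of_nonneg (norm_nonneg _) hp'0.le]
    rw [h5, ENNReal.ofReal_rpow_of_nonneg hM hp'0.le]
    exact ENNReal.ofReal_le_ofReal h2
  -- Monotone convergence along the bands, which exhaust the set where G does not vanish.
  have hall : ∫⁻ x, ‖G x‖ₑ ^ p' ≤ ENNReal.ofReal M ^ p' := by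
    have e : ∫⁻ x, ‖G x‖ₑ ^ p' = ∫⁻ x in ⋃ n, band G n, ‖G x‖ₑ ^ p' := by
      have hms : MeasurableSet {x | G x ≠ 0} := hGm (measurableSet_singleton 0).compl
      rw [iUnion_band, ← lintegral_indicator hms]
      refine lintegral_congr fun x => ?_
      by_cases hx : G x = 0
      · simp [hx, hp'0]
      · rw [Set.indicator_of_mem (by exact hx)]
    rw [e, setLIntegral_iUnion_of_directed _ (band_mono G).directed_le]
    exact iSup_le key
  rw [eLpNorm_eq_lintegral_rpow_enorm_toReal (by simpa using hp'0) (by simp),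
    ENNReal.toReal_ofReal hp'0.le]
  calc _ ≤ (ENNReal.ofReal M ^ p') ^ (1 / p') := ENNReal.rpow_le_rpow hall (by positivity)
    _ = ENNReal.ofReal M := by
      rw [← ENNReal.rpow_mul, one_div, mul_inv_cancel₀ hp'0.ne', ENNReal.rpow_one]

/-- Converse of Hölder's inequality, for the dual exponent `∞`. -/
theorem eLpNorm_top_le_of_forall_pairing {d : ℕ} {G : E d → ℂ}
    (hGm : Measurable G) (hG : MemLp G 2 volume) {M : ℝ} (hM : 0 ≤ M)
    (h : ∀ u : E d → ℂ, MemLp u 1 volume → MemLp u 2 volume →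
      ‖∫ x, G x * (starRingEnd ℂ) (u x)‖ ≤ M * (eLpNorm u 1 volume).toReal) :
    eLpNorm G ∞ volume ≤ ENNReal.ofReal M := by
  rw [eLpNorm_exponent_top]
  refine eLpNormEssSup_le_of_ae_bound ?_
  have key : ∀ n : ℕ, ∀ᵐ x, x ∈ band G n → ‖G x‖ ≤ M := by
    intro n
    -- Testing against the phase of G on S gives ∫_S |G| ≤ M |S|, although |G| > M on S. Hence S is
    -- null.
    set S : Set (E d) := band G n ∩ {x | M < ‖G x‖} with hSdef
    have hS : MeasurableSet S := (measurableSet_band hGm n).inter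
      (measurableSet_lt measurable_const hGm.norm)
    have hS' : volume S < ∞ := (measure_mono Set.inter_subset_left).trans_lt (volume_band_lt_top hG n)
    set u : E d → ℂ := S.indicator (fun x => G x / (‖G x‖ : ℂ)) with hu
    have hum : Measurable u := (hGm.div (Complex.measurable_ofReal.comp hGm.norm)).indicator hS
    have hx0 : ∀ x ∈ S, 0 < ‖G x‖ := fun x hx => lt_of_le_of_lt hM hx.2
    have hun : ∀ x ∈ S, ‖u x‖ = 1 := by
      intro x hx
      simp [hu, hx, (norm_pos_iff.1 (hx0 x hx))]
    have hu0 : ∀ x ∉ S, u x = 0 := fun x hx => by simp [hu, hx]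
    have hub := fun q => memLp_of_bound_of_support hS hS' hum
      (C := 1) (fun x hx => (hun x hx).le) hu0 q
    have h1 := h u (hub 1) (hub 2)
    have hII : IntegrableOn (fun x => ‖G x‖) S := by
      refine Measure.integrableOn_of_bounded (M := (n : ℝ) + 1) hS'.ne
        hGm.norm.aestronglyMeasurable ?_
      filter_upwards [ae_restrict_mem hS] with x hx
      rw [norm_norm]; exact hx.1.2
    have hpair : ∫ x, G x * (starRingEnd ℂ) (u x) = ((∫ x in S, ‖G x‖ : ℝ) : ℂ) := by
      rw [← integral_indicator hS, ← integral_complex_ofReal]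
      refine integral_congr_ae (Filter.Eventually.of_forall fun x => ?_)
      by_cases hx : x ∈ S
      · have h0 : (‖G x‖ : ℂ) ≠ 0 := by exact_mod_cast (hx0 x hx).ne'
        simp only [hu, Set.indicator_of_mem hx, map_div₀, Complex.conj_ofReal]
        rw [mul_div_assoc', Complex.mul_conj, Complex.normSq_eq_norm_sq]
        push_cast
        field_simp
      · simp [hu, hx]
    have hnorm : (eLpNorm u 1 volume).toReal = volume.real S := by
      rw [eLpNorm_one_eq_lintegral_enorm, Measure.real]
      congr 1
      rw [← lintegral_indicator_one hS]
      refine lintegral_congr fun x => ?_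
      by_cases hx : x ∈ S
      · rw [← ofReal_norm, hun x hx]; simp [hx]
      · simp [hu0 x hx, hx]
    rw [hpair, hnorm, Complex.norm_real, Real.norm_of_nonneg (integral_nonneg fun x => norm_nonneg _)] at h1
    have hint : ∫ x in S, (‖G x‖ - M) ≤ 0 := by
      rw [integral_sub hII (integrableOn_const hS'.ne), setIntegral_const, smul_eq_mul]
      linarith
    have hz : volume S = 0 := by
      by_contra hne
      have hpos : 0 < ∫ x in S, (‖G x‖ - M) := by
        rw [setIntegral_pos_iff_support_of_nonneg_ae]
        · refine lt_of_lt_of_le (pos_iff_ne_zero.2 hne) (measure_mono fun x hx => ⟨?_, hx⟩)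
          simp only [Function.mem_support]
          exact (sub_pos.2 hx.2).ne'
        · filter_upwards [ae_restrict_mem hS] with x hx
          exact (sub_pos.2 hx.2).le
        · exact hII.sub (integrableOn_const hS'.ne)
      linarith
    have := measure_eq_zero_iff_ae_notMem.1 hz
    filter_upwards [this] with x hx hxb
    by_contra hlt
    exact hx ⟨hxb, not_le.1 hlt⟩
  filter_upwards [ae_all_iff.2 key] with x hx
  by_cases h0 : G x = 0
  · simpa [h0] using hM
  · have : x ∈ ⋃ n, band G n := by rw [iUnion_band]; exact h0
    obtain ⟨n, hn⟩ := Set.mem_iUnion.1 this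
    exact hx n hn

end

/-! ### Inverse transforms and radial integrals -/

section

/-- The inverse `L²` Fourier transform of an `L¹ ∩ L²` function is given by the integral. -/
theorem fourierInv_toLp_ae {d : ℕ} {f : E d → ℂ} (h1 : Integrable f) (h2 : MemLp f 2 volume) :
    (𝓕⁻ (h2.toLp f) : L2 d ℂ) =ᵐ[volume] 𝓕⁻ f := by
  have hcont : Continuous (𝓕⁻ f) := VectorFourier.fourierIntegral_continuous
    Real.continuous_fourierChar (continuous_inner.neg) h1
  apply ae_eq_of_integral_contDiff_smul_eq
    ((Lp.memLp (𝓕⁻ (h2.toLp f) : L2 d ℂ)).locallyIntegrable (by norm_num))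
    hcont.locallyIntegrable
  intro g hg1 hg2
  have hsm : ContDiff ℝ (⊤ : ℕ∞) (fun x => (g x : ℂ)) := Complex.ofRealCLM.contDiff.comp hg1
  have hcs : HasCompactSupport (fun x => (g x : ℂ)) :=
    hg2.comp_left (g := fun x : ℝ => (x : ℂ)) (by simp)
  set φ : SchwartzMap (E d) ℂ := hcs.toSchwartzMap hsm with hφ
  have hφg : ∀ x, φ x = (g x : ℂ) := fun x => rfl
  have key := congrArg (fun T => T φ) (Lp.fourierInv_toTemperedDistribution_eq (h2.toLp f))
  simp only [TemperedDistribution.fourierInv_apply, Lp.toTemperedDistribution_apply] at key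
  have e1 : ∫ x, g x • (𝓕⁻ (h2.toLp f) : L2 d ℂ) x = ∫ x, φ x • (𝓕⁻ (h2.toLp f) : L2 d ℂ) x := by
    refine integral_congr_ae (Filter.Eventually.of_forall fun x => ?_)
    simp [hφg]
  have e2 : ∫ x, g x • 𝓕⁻ f x = ∫ x, φ x • 𝓕⁻ f x := by
    refine integral_congr_ae (Filter.Eventually.of_forall fun x => ?_)
    simp [hφg]
  rw [e1, e2, ← key]
  have e3 : ∫ x, (𝓕⁻ φ) x • (h2.toLp f : E d → ℂ) x = ∫ x, (𝓕⁻ φ) x • f x := by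
    refine integral_congr_ae ?_
    filter_upwards [h2.coeFn_toLp] with x hx
    rw [hx]
  rw [e3]
  have := VectorFourier.integral_fourierIntegral_smul_eq_flip (𝕜 := ℝ) (e := Real.fourierChar)
    (μ := (volume : Measure (E d))) (ν := (volume : Measure (E d))) (L := -innerₗ (E d))
    Real.continuous_fourierChar continuous_inner.neg φ.integrable h1
  have hflip : (-innerₗ (E d)).flip = -innerₗ (E d) := by
    ext x y; simp [real_inner_comm]
  rw [hflip] at this
  rw [SchwartzMap.fourierInv_coe]
  exact this

theorem norm_fourierInv_le {d : ℕ} (f : E d → ℂ) (x : E d) : ‖𝓕⁻ f x‖ ≤ ∫ v, ‖f v‖ := by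
  rw [Real.fourierInv_eq]
  refine (norm_integral_le_integral_norm _).trans_eq ?_
  simp

theorem norm_fourier_le {d : ℕ} (f : E d → ℂ) (x : E d) : ‖𝓕 f x‖ ≤ ∫ v, ‖f v‖ := by
  rw [Real.fourier_eq]
  refine (norm_integral_le_integral_norm _).trans_eq ?_
  simp

/-- The integral of a homogeneous function of degree `-τ > -d` over a ball. -/
theorem lintegral_ball_rpow {d : ℕ} (hd : 0 < d) {τ : ℝ} (hτ : τ < d) {ρ : ℝ} (hρ : 0 < ρ) :
    ∫⁻ ξ in Metric.ball (0 : E d) ρ, ENNReal.ofReal (‖ξ‖ ^ (-τ)) =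
      ENNReal.ofReal (d * volume.real (Metric.ball (0 : E d) 1) / (d - τ) * ρ ^ (d - τ)) := by
  have : Nonempty (Fin d) := ⟨⟨0, hd⟩⟩
  have : Nontrivial (E d) := inferInstance
  have hpt : ∀ y ∈ Set.Ioi (0 : ℝ), y ^ (Module.finrank ℝ (E d) - 1) •
      (Set.Iio ρ).indicator (fun y => y ^ (-τ)) y =
        (Set.Iio ρ).indicator (fun y => y ^ ((d : ℝ) - 1 - τ)) y := by
    intro y hy
    by_cases h : y ∈ Set.Iio ρ
    · rw [Set.indicator_of_mem h, Set.indicator_of_mem h, finrank_euclideanSpace_fin, smul_eq_mul,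
        ← Real.rpow_natCast, ← Real.rpow_add hy]
      congr 1
      rw [Nat.cast_sub hd]; push_cast; ring
    · rw [Set.indicator_of_notMem h, Set.indicator_of_notMem h, smul_zero]
  have hint : IntegrableOn (fun y : ℝ => y ^ ((d : ℝ) - 1 - τ)) (Set.Ioo 0 ρ) :=
    (intervalIntegral.integrableOn_Ioo_rpow_iff hρ).2 (by linarith)
  have hval : ∫ y in Set.Ioi (0 : ℝ), (Set.Iio ρ).indicator (fun y => y ^ ((d : ℝ) - 1 - τ)) y =
      ρ ^ (d - τ) / (d - τ) := by
    rw [setIntegral_indicator measurableSet_Iio, Set.Ioi_inter_Iio, ← integral_Ioc_eq_integral_Ioo,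
      ← intervalIntegral.integral_of_le hρ.le, integral_rpow (Or.inl (by linarith))]
    rw [show (d : ℝ) - 1 - τ + 1 = d - τ by ring, Real.zero_rpow (by linarith), sub_zero]
  have hI : IntegrableOn (fun ξ : E d => ‖ξ‖ ^ (-τ)) (Metric.ball 0 ρ) := by
    rw [integrableOn_fun_norm_addHaar volume (f := fun y : ℝ => y ^ (-τ))]
    refine hint.congr_fun (fun y hy => ?_) measurableSet_Ioo
    have := hpt y hy.1
    rw [Set.indicator_of_mem (Set.mem_Iio.2 hy.2), Set.indicator_of_mem (Set.mem_Iio.2 hy.2)] at this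
    exact this.symm
  rw [← ofReal_integral_eq_lintegral_ofReal hI (Filter.Eventually.of_forall fun x => by positivity)]
  congr 1
  rw [← integral_indicator measurableSet_ball]
  have e1 : ∀ ξ : E d, (Metric.ball (0 : E d) ρ).indicator (fun ξ => ‖ξ‖ ^ (-τ)) ξ =
      (Set.Iio ρ).indicator (fun y => y ^ (-τ)) ‖ξ‖ := by
    intro ξ
    by_cases h : ‖ξ‖ < ρ
    · rw [Set.indicator_of_mem (by simpa using h), Set.indicator_of_mem (by simpa using h)]
    · rw [Set.indicator_of_notMem (by simpa using h), Set.indicator_of_notMem (by simpa using h)]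
  simp_rw [e1]
  rw [integral_fun_norm_addHaar volume ((Set.Iio ρ).indicator (fun y => y ^ (-τ))),
    setIntegral_congr_fun measurableSet_Ioi hpt, hval, finrank_euclideanSpace_fin, nsmul_eq_mul,
    smul_eq_mul]
  ring

end

/-! ### The Sobolev embedding, by splitting frequencies at each level -/

section

theorem lintegral_enorm_sq_eq {d : ℕ} (f : L2 d ℂ) : ∫⁻ x, ‖f x‖ₑ ^ 2 = ENNReal.ofReal (‖f‖ ^ 2) := by
  have h := eLpNorm_eq_lintegral_rpow_enorm_toReal (p := 2) (f := (f : E d → ℂ)) (μ := volume)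
    (by norm_num) (by norm_num)
  rw [ENNReal.ofReal_pow (norm_nonneg _), Lp.norm_def, ENNReal.ofReal_toReal (Lp.eLpNorm_ne_top f), h,
    ← ENNReal.rpow_natCast, ← ENNReal.rpow_mul]
  simp

theorem lintegral_enorm_sq_fourier {d : ℕ} (f : L2 d ℂ) :
    ∫⁻ ξ, ‖(𝓕 f : L2 d ℂ) ξ‖ₑ ^ 2 = ∫⁻ x, ‖f x‖ₑ ^ 2 := by
  rw [lintegral_enorm_sq_eq, lintegral_enorm_sq_eq, Lp.norm_fourier_eq]

theorem lintegral_enorm_sq_fourierInv {d : ℕ} (f : L2 d ℂ) :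
    ∫⁻ x, ‖(𝓕⁻ f : L2 d ℂ) x‖ₑ ^ 2 = ∫⁻ x, ‖f x‖ₑ ^ 2 := by
  rw [← lintegral_enorm_sq_fourier, FourierTransform.fourier_fourierInv_eq]

section Sobolev

variable {d : ℕ}

/-- The integral of `|ξ|^{-τ}` over the unit ball. -/
def ballConst (d : ℕ) (τ : ℝ) : ℝ := d * volume.real (Metric.ball (0 : E d) 1) / (d - τ)

theorem ballConst_pos (hd : 0 < d) {τ : ℝ} (hτ : τ < d) : 0 < ballConst d τ := by
  have h1 : (0 : ℝ) < d := by exact_mod_cast hd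
  have h2 : 0 < volume.real (Metric.ball (0 : E d) 1) :=
    ENNReal.toReal_pos (Metric.measure_ball_pos _ _ one_pos).ne' measure_ball_lt_top.ne
  have h3 : 0 < (d : ℝ) - τ := by linarith
  unfold ballConst
  positivity

/-- Cauchy–Schwarz with the weights |ξ|^{-τ/2} and |ξ|^{τ/2}; the first is square integrable on the
ball because τ < d. This gives an L^∞ bound for the low-frequency part of a function. -/
theorem lintegral_low_frequency_le (hd : 0 < d) {τ : ℝ} (hτ : τ < d) (U : L2 d ℂ) {a : ℝ}
    (ha : 0 < a) (hA : ∫⁻ ξ, ENNReal.ofReal (‖ξ‖ ^ τ) * ‖U ξ‖ₑ ^ 2 ≤ ENNReal.ofReal (a ^ 2))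
    {ρ : ℝ} (hρ : 0 < ρ) :
    ∫⁻ ξ in Metric.ball (0 : E d) ρ, ‖U ξ‖ₑ ≤
      ENNReal.ofReal (a * √(ballConst d τ * ρ ^ (d - τ))) := by
  have hUm : AEMeasurable (fun ξ => ‖U ξ‖ₑ) (volume.restrict (Metric.ball (0 : E d) ρ)) :=
    (Lp.stronglyMeasurable U).measurable.enorm.aemeasurable
  have hw : ∀ r : ℝ, Measurable fun ξ : E d => ENNReal.ofReal (‖ξ‖ ^ r) := fun r =>
    (measurable_norm.pow_const r).ennreal_ofReal
  have : Nonempty (Fin d) := ⟨⟨0, hd⟩⟩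
  have : Nontrivial (E d) := inferInstance
  have hne : ∀ᵐ ξ : E d, ξ ≠ 0 := by
    simp [ae_iff, measure_singleton]
  have hpow : ∀ (r : ℝ) (ξ : E d), (ENNReal.ofReal (‖ξ‖ ^ (r / 2))) ^ (2 : ℝ) = ENNReal.ofReal (‖ξ‖ ^ r) := by
    intro r ξ
    rw [ENNReal.ofReal_rpow_of_nonneg (by positivity) (by norm_num), ← Real.rpow_mul (norm_nonneg _)]
    congr 2; ring
  calc ∫⁻ ξ in Metric.ball (0 : E d) ρ, ‖U ξ‖ₑ
      = ∫⁻ ξ in Metric.ball (0 : E d) ρ, ((fun ξ : E d => ENNReal.ofReal (‖ξ‖ ^ (-τ / 2)) : E d → ℝ≥0∞) *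
          (fun ξ : E d => ENNReal.ofReal (‖ξ‖ ^ (τ / 2)) * ‖U ξ‖ₑ : E d → ℝ≥0∞)) ξ := by
        refine lintegral_congr_ae (ae_restrict_of_ae ?_)
        filter_upwards [hne] with ξ hξ
        have h0 : 0 < ‖ξ‖ := norm_pos_iff.2 hξ
        simp only [Pi.mul_apply]
        rw [← mul_assoc, ← ENNReal.ofReal_mul (by positivity), ← Real.rpow_add h0]
        simp [neg_div]
    _ ≤ (∫⁻ ξ in Metric.ball (0 : E d) ρ, ENNReal.ofReal (‖ξ‖ ^ (-τ / 2)) ^ (2 : ℝ)) ^ (1 / (2 : ℝ)) *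
        (∫⁻ ξ in Metric.ball (0 : E d) ρ, (ENNReal.ofReal (‖ξ‖ ^ (τ / 2)) * ‖U ξ‖ₑ) ^ (2 : ℝ)) ^ (1 / (2 : ℝ)) :=
        ENNReal.lintegral_mul_le_Lp_mul_Lq _ Real.HolderConjugate.two_two (hw _).aemeasurable
          ((hw _).aemeasurable.mul hUm)
    _ ≤ (ENNReal.ofReal (ballConst d τ * ρ ^ (d - τ))) ^ (1 / (2 : ℝ)) *
        (ENNReal.ofReal (a ^ 2)) ^ (1 / (2 : ℝ)) := by
        gcongr
        · simp_rw [hpow]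
          rw [lintegral_ball_rpow hd hτ hρ]; rfl
        · refine le_trans (setLIntegral_le_lintegral _ _) (le_trans (le_of_eq ?_) hA)
          refine lintegral_congr fun ξ => ?_
          rw [ENNReal.mul_rpow_of_nonneg _ _ (by norm_num), hpow]
          norm_num
    _ = _ := by
        have hc := (ballConst_pos hd hτ).le
        rw [ENNReal.ofReal_rpow_of_nonneg (by positivity) (by norm_num),
          ENNReal.ofReal_rpow_of_nonneg (by positivity) (by norm_num),
          ← ENNReal.ofReal_mul (by positivity), ← Real.sqrt_eq_rpow, ← Real.sqrt_eq_rpow,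
          Real.sqrt_sq ha.le, mul_comm]

/-- Distributional estimate: splitting frequencies at `|ξ| = ρ`. -/
theorem measure_lt_norm_le (hd : 0 < d) {τ : ℝ} (hτ : τ < d) (G : L2 d ℂ) {a : ℝ}
    (ha : 0 < a) (hA : ∫⁻ ξ, ENNReal.ofReal (‖ξ‖ ^ τ) * ‖(𝓕 G : L2 d ℂ) ξ‖ₑ ^ 2 ≤ ENNReal.ofReal (a ^ 2))
    {ρ t : ℝ} (hρ : 0 < ρ) (ht : 0 < t) (hρt : a * √(ballConst d τ * ρ ^ (d - τ)) ≤ t / 2) :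
    volume {x | t < ‖G x‖} * ENNReal.ofReal (t ^ 2) ≤
      4 * ∫⁻ ξ in (Metric.ball (0 : E d) ρ)ᶜ, ‖(𝓕 G : L2 d ℂ) ξ‖ₑ ^ 2 := by
  set U : L2 d ℂ := 𝓕 G with hU
  have hlow := lintegral_low_frequency_le hd hτ U ha hA hρ
  set B := Metric.ball (0 : E d) ρ
  have hB : MeasurableSet B := measurableSet_ball
  have hL2 : MemLp (B.indicator U) 2 volume := (Lp.memLp U).indicator hB
  have hH2 : MemLp (Bᶜ.indicator U) 2 volume := (Lp.memLp U).indicator hB.compl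
  have hL1 : Integrable (B.indicator U) := by
    refine ⟨hL2.1, ?_⟩
    rw [hasFiniteIntegral_iff_enorm]
    simp_rw [enorm_indicator_eq_indicator_enorm]
    rw [lintegral_indicator hB]
    exact hlow.trans_lt ENNReal.ofReal_lt_top
  set g₁ : L2 d ℂ := 𝓕⁻ (hL2.toLp _)
  set g₂ : L2 d ℂ := 𝓕⁻ (hH2.toLp _) with hg₂
  have hsum : G = g₁ + g₂ := by
    have h1 : U = hL2.toLp _ + hH2.toLp _ := by
      apply Lp.ext
      filter_upwards [hL2.coeFn_toLp, hH2.coeFn_toLp, Lp.coeFn_add (hL2.toLp _) (hH2.toLp _)] with x h1 h2 h3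
      rw [h3, Pi.add_apply, h1, h2, ← Pi.add_apply, Set.indicator_self_add_compl]
    have h2 : G = 𝓕⁻ U := by rw [hU, FourierTransform.fourierInv_fourier_eq]
    rw [h2, h1, FourierTransform.fourierInv_add]
  -- The low-frequency piece is at most the L¹ norm of its transform. Hence |g₂| > t/2 wherever |G|
  -- > t, and Chebyshev's inequality with Plancherel applies to g₂.
  have hg1 : ∀ᵐ x, ‖g₁ x‖ ≤ t / 2 := by
    filter_upwards [fourierInv_toLp_ae hL1 hL2] with x hx
    rw [hx]
    refine (norm_fourierInv_le _ x).trans (le_trans ?_ hρt)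
    rw [← ENNReal.ofReal_le_ofReal_iff (by positivity), ofReal_integral_norm_eq_lintegral_enorm hL1]
    simp_rw [enorm_indicator_eq_indicator_enorm]
    rwa [lintegral_indicator hB]
  have hg2 : ∫⁻ x, ‖g₂ x‖ₑ ^ 2 = ∫⁻ ξ in Bᶜ, ‖U ξ‖ₑ ^ 2 := by
    rw [hg₂, lintegral_enorm_sq_fourierInv, ← lintegral_indicator hB.compl]
    refine lintegral_congr_ae ?_
    filter_upwards [hH2.coeFn_toLp] with x hx
    rw [hx]
    by_cases h : x ∈ Bᶜ
    · rw [Set.indicator_of_mem h, Set.indicator_of_mem h]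
    · rw [Set.indicator_of_notMem h, Set.indicator_of_notMem h]; simp
  have hsub : volume {x | t < ‖G x‖} ≤ volume {x | ENNReal.ofReal ((t / 2) ^ 2) ≤ ‖g₂ x‖ₑ ^ 2} := by
    refine measure_mono_ae ?_
    filter_upwards [hg1, Lp.coeFn_add g₁ g₂] with x h1 h2 h3
    have h3' : t < ‖G x‖ := h3
    rw [hsum, h2, Pi.add_apply] at h3'
    have := norm_add_le (g₁ x) (g₂ x)
    change ENNReal.ofReal ((t / 2) ^ 2) ≤ ‖g₂ x‖ₑ ^ 2
    rw [← ofReal_norm, ← ENNReal.ofReal_pow (norm_nonneg _)]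
    refine ENNReal.ofReal_le_ofReal ?_
    exact pow_le_pow_left₀ (by positivity) (by linarith) 2
  have hcheb := mul_meas_ge_le_lintegral₀ (μ := (volume : Measure (E d))) (f := fun x => ‖g₂ x‖ₑ ^ 2)
    (((Lp.stronglyMeasurable g₂).measurable.enorm.pow_const 2).aemeasurable) (ENNReal.ofReal ((t / 2) ^ 2))
  rw [hg2] at hcheb
  calc volume {x | t < ‖G x‖} * ENNReal.ofReal (t ^ 2)
      ≤ volume {x | ENNReal.ofReal ((t / 2) ^ 2) ≤ ‖g₂ x‖ₑ ^ 2} * ENNReal.ofReal (t ^ 2) := by gcongr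
    _ = 4 * (ENNReal.ofReal ((t / 2) ^ 2) * volume {x | ENNReal.ofReal ((t / 2) ^ 2) ≤ ‖g₂ x‖ₑ ^ 2}) := by
        rw [← mul_assoc, mul_comm]
        congr 1
        rw [show t ^ 2 = 4 * (t / 2) ^ 2 by ring, ENNReal.ofReal_mul (by norm_num)]
        congr 1
        norm_num
    _ ≤ _ := by gcongr

theorem lintegral_Ioc_rpow {r b : ℝ} (hr : -1 < r) (hb : 0 ≤ b) :
    ∫⁻ t in Set.Ioc 0 b, ENNReal.ofReal (t ^ r) = ENNReal.ofReal (b ^ (r + 1) / (r + 1)) := by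
  have hI : IntegrableOn (fun t : ℝ => t ^ r) (Set.Ioc 0 b) :=
    (intervalIntegrable_iff_integrableOn_Ioc_of_le hb).1 (intervalIntegral.intervalIntegrable_rpow' hr)
  rw [← ofReal_integral_eq_lintegral_ofReal hI, ← intervalIntegral.integral_of_le hb,
    integral_rpow (Or.inl hr), Real.zero_rpow (by linarith), sub_zero]
  filter_upwards [ae_restrict_mem measurableSet_Ioc] with t ht
  exact Real.rpow_nonneg ht.1.le _

/-- The Sobolev embedding of `Ḣ^{τ/2}` into `L^{2d/(d-τ)}`, with an explicit constant. -/
theorem eLpNorm_le_of_lintegral_rpow_fourier_le (hd : 0 < d) {τ : ℝ} (hτ0 : 0 < τ) (hτ : τ < d)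
    (G : L2 d ℂ) {a : ℝ} (ha : 0 < a)
    (hA : ∫⁻ ξ, ENNReal.ofReal (‖ξ‖ ^ τ) * ‖(𝓕 G : L2 d ℂ) ξ‖ₑ ^ 2 ≤ ENNReal.ofReal (a ^ 2)) :
    eLpNorm G (.ofReal (2 * d / (d - τ))) volume ≤
      ENNReal.ofReal (4 * d / τ * (1 + 2 * √(ballConst d τ)) * a) := by
  have hd' : (0 : ℝ) < d := by exact_mod_cast hd
  have hdτ : 0 < (d : ℝ) - τ := by linarith
  set c := ballConst d τ with hc
  have hc0 : 0 < c := ballConst_pos hd hτ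
  set q : ℝ := 2 * d / (d - τ) with hq
  have hq2 : q - 2 = 2 * τ / (d - τ) := by rw [hq]; field_simp; ring
  have hq2pos : 0 < q - 2 := by rw [hq2]; positivity
  have hq0 : 0 < q := by linarith
  set U : L2 d ℂ := 𝓕 G with hU
  set b : ℝ := 2 * a * √c with hb
  have hb0 : 0 < b := by positivity
  -- The cut-off frequency depends on the level: ρ(t) = (t/b)^{2/(d-τ)} makes the low-frequency
  -- bound exactly t/2, and |ξ| ≥ ρ(t) then says t ≤ Λ(ξ).
  set Λ : E d → ℝ := fun ξ => b * ‖ξ‖ ^ ((d - τ) / 2) with hΛ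
  have hΛm : Measurable Λ := measurable_const.mul (measurable_norm.pow_const _)
  have hUm : Measurable fun ξ => ‖U ξ‖ₑ ^ 2 := (Lp.stronglyMeasurable U).measurable.enorm.pow_const 2
  set Φ : ℝ × E d → ℝ≥0∞ := {p : ℝ × E d | p.1 ≤ Λ p.2}.indicator
    (fun p => 4 * ‖U p.2‖ₑ ^ 2 * ENNReal.ofReal (p.1 ^ (q - 3))) with hΦ
  have hdist : ∀ t ∈ Set.Ioi (0 : ℝ), volume {x | t < ‖G x‖} * ENNReal.ofReal (t ^ (q - 1)) ≤
      ∫⁻ ξ, Φ (t, ξ) := by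
    intro t ht
    have ht0 : 0 < t := ht
    set ρ : ℝ := (t / b) ^ (2 / ((d : ℝ) - τ)) with hρ
    have hρ0 : 0 < ρ := by positivity
    have hρd : ρ ^ ((d : ℝ) - τ) = (t / b) ^ (2 : ℝ) := by
      rw [hρ, ← Real.rpow_mul (by positivity)]; congr 1; field_simp
    have h1 := measure_lt_norm_le hd hτ G ha hA hρ0 ht0 (by
      rw [hρd, Real.rpow_two, Real.sqrt_mul hc0.le, Real.sqrt_sq (by positivity), hb]
      apply le_of_eq
      have : √c ≠ 0 := by positivity
      field_simp)
    have hmem : ∀ ξ : E d, ξ ∈ (Metric.ball (0 : E d) ρ)ᶜ → t ≤ Λ ξ := by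
      intro ξ hξ
      have h2 : ρ ≤ ‖ξ‖ := by simpa using hξ
      have h3 : ρ ^ (((d : ℝ) - τ) / 2) ≤ ‖ξ‖ ^ (((d : ℝ) - τ) / 2) :=
        Real.rpow_le_rpow hρ0.le h2 (by positivity)
      have h4 : ρ ^ (((d : ℝ) - τ) / 2) = t / b := by
        rw [hρ, ← Real.rpow_mul (by positivity)]
        rw [show 2 / ((d : ℝ) - τ) * ((d - τ) / 2) = 1 by field_simp, Real.rpow_one]
      rw [h4, div_le_iff₀ hb0] at h3
      rw [hΛ]; linarith
    have h5 : ENNReal.ofReal (t ^ (q - 1)) = ENNReal.ofReal (t ^ 2) * ENNReal.ofReal (t ^ (q - 3)) := by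
      rw [← ENNReal.ofReal_mul (by positivity), ← Real.rpow_natCast t 2, ← Real.rpow_add ht0]
      congr 2; push_cast; ring
    rw [h5, ← mul_assoc]
    calc _ ≤ (4 * ∫⁻ ξ in (Metric.ball (0 : E d) ρ)ᶜ, ‖U ξ‖ₑ ^ 2) * ENNReal.ofReal (t ^ (q - 3)) := by
          gcongr
      _ = ∫⁻ ξ in (Metric.ball (0 : E d) ρ)ᶜ, 4 * ‖U ξ‖ₑ ^ 2 * ENNReal.ofReal (t ^ (q - 3)) := by
          rw [lintegral_mul_const _ (hUm.const_mul 4), lintegral_const_mul _ hUm]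
      _ ≤ _ := by
          rw [← lintegral_indicator measurableSet_ball.compl]
          refine lintegral_mono fun ξ => ?_
          by_cases h : ξ ∈ (Metric.ball (0 : E d) ρ)ᶜ
          · rw [Set.indicator_of_mem h, hΦ, Set.indicator_of_mem (show (t, ξ) ∈ {p : ℝ × E d | p.1 ≤ Λ p.2} from hmem ξ h)]
          · rw [Set.indicator_of_notMem h]; exact zero_le
  have hmeas : MeasurableSet {p : ℝ × E d | p.1 ≤ Λ p.2} :=
    measurableSet_le measurable_fst (hΛm.comp measurable_snd)
  have hFm : Measurable Φ :=
    (((hUm.comp measurable_snd).const_mul 4).mul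
      ((measurable_fst.pow_const _).ennreal_ofReal)).indicator hmeas
  -- With the order of integration exchanged, t runs over (0, Λ(ξ)] and the result is a multiple of
  -- Λ(ξ)^{q-2}. Since q - 2 = 2τ/(d-τ), this is the weight |ξ|^τ.
  have hinner : ∀ ξ, ∫⁻ t in Set.Ioi (0 : ℝ), Φ (t, ξ) =
      ENNReal.ofReal (4 * b ^ (q - 2) / (q - 2)) * (ENNReal.ofReal (‖ξ‖ ^ τ) * ‖U ξ‖ₑ ^ 2) := by
    intro ξ
    have hΛ0 : 0 ≤ Λ ξ := by simp only [hΛ]; positivity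
    have e1 : ∀ t, Φ (t, ξ) =
        (Set.Iic (Λ ξ)).indicator (fun t => 4 * ‖U ξ‖ₑ ^ 2 * ENNReal.ofReal (t ^ (q - 3))) t := by
      intro t
      by_cases h : t ≤ Λ ξ
      · rw [hΦ, Set.indicator_of_mem (show (t, ξ) ∈ {p : ℝ × E d | p.1 ≤ Λ p.2} from h),
          Set.indicator_of_mem (Set.mem_Iic.2 h)]
      · rw [hΦ, Set.indicator_of_notMem (show (t, ξ) ∉ {p : ℝ × E d | p.1 ≤ Λ p.2} from h),
          Set.indicator_of_notMem (by simpa using h)]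
    simp_rw [e1]
    rw [setLIntegral_indicator measurableSet_Iic, Set.inter_comm, Set.Ioi_inter_Iic,
      lintegral_const_mul _ (show Measurable fun t : ℝ => ENNReal.ofReal (t ^ (q - 3)) from
        (measurable_id.pow_const _).ennreal_ofReal),
      lintegral_Ioc_rpow (by linarith) hΛ0, show q - 3 + 1 = q - 2 by ring]
    have e2 : Λ ξ ^ (q - 2) = b ^ (q - 2) * ‖ξ‖ ^ τ := by
      simp only [hΛ]
      rw [Real.mul_rpow hb0.le (by positivity), ← Real.rpow_mul (norm_nonneg _), hq2]
      congr 2; field_simp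
    rw [e2, show 4 * b ^ (q - 2) / (q - 2) = 4 * (b ^ (q - 2) / (q - 2)) by ring,
      show b ^ (q - 2) * ‖ξ‖ ^ τ / (q - 2) = b ^ (q - 2) / (q - 2) * ‖ξ‖ ^ τ by ring,
      ENNReal.ofReal_mul (by positivity), ENNReal.ofReal_mul (by norm_num)]
    norm_num
    ring
  have hlayer : ∫⁻ x, ENNReal.ofReal (‖G x‖ ^ q) ≤ ENNReal.ofReal (q * (4 * b ^ (q - 2) / (q - 2)) * a ^ 2) := by
    rw [lintegral_rpow_eq_lintegral_meas_lt_mul volume (Filter.Eventually.of_forall fun x => norm_nonneg _)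
      (Lp.stronglyMeasurable G).measurable.norm.aemeasurable hq0]
    calc _ ≤ ENNReal.ofReal q * ∫⁻ t in Set.Ioi (0 : ℝ), ∫⁻ ξ, Φ (t, ξ) := by
          gcongr ENNReal.ofReal q * ?_
          exact setLIntegral_mono' measurableSet_Ioi hdist
      _ = ENNReal.ofReal q * ∫⁻ ξ, ENNReal.ofReal (4 * b ^ (q - 2) / (q - 2)) * (ENNReal.ofReal (‖ξ‖ ^ τ) * ‖U ξ‖ₑ ^ 2) := by
          rw [lintegral_lintegral_swap (f := fun t ξ => Φ (t, ξ)) hFm.aemeasurable]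
          simp_rw [hinner]
      _ ≤ ENNReal.ofReal q * (ENNReal.ofReal (4 * b ^ (q - 2) / (q - 2)) * ENNReal.ofReal (a ^ 2)) := by
          rw [lintegral_const_mul _ (show Measurable fun ξ : E d => ENNReal.ofReal (‖ξ‖ ^ τ) * ‖U ξ‖ₑ ^ 2
            from ((measurable_norm.pow_const _).ennreal_ofReal).mul hUm)]
          gcongr
      _ = _ := by
          rw [← ENNReal.ofReal_mul (by positivity), ← ENNReal.ofReal_mul (by positivity)]
          congr 1; ring
  have hval : q * (4 * b ^ (q - 2) / (q - 2)) * a ^ 2 = (4 * d / τ) * (2 * √c) ^ (q - 2) * a ^ q := by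
    have e1 : b ^ (q - 2) = (2 * √c) ^ (q - 2) * a ^ (q - 2) := by
      rw [hb, show 2 * a * √c = (2 * √c) * a by ring, Real.mul_rpow (by positivity) ha.le]
    have e2 : a ^ q = a ^ (q - 2) * a ^ 2 := by
      rw [← Real.rpow_natCast a 2, ← Real.rpow_add ha]; congr 1; push_cast; ring
    have e3 : q / (q - 2) = d / τ := by rw [hq2, hq]; field_simp
    rw [e1, e2]
    calc _ = 4 * (q / (q - 2)) * (2 * √c) ^ (q - 2) * (a ^ (q - 2) * a ^ 2) := by ring
      _ = _ := by rw [e3]; ring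
  rw [eLpNorm_eq_lintegral_rpow_enorm_toReal (by simpa using hq0) (by simp), ENNReal.toReal_ofReal hq0.le]
  have hconv : ∫⁻ x, ‖G x‖ₑ ^ q = ∫⁻ x, ENNReal.ofReal (‖G x‖ ^ q) := by
    refine lintegral_congr fun x => ?_
    rw [← ofReal_norm, ENNReal.ofReal_rpow_of_nonneg (norm_nonneg _) hq0.le]
  rw [hconv]
  refine (ENNReal.rpow_le_rpow hlayer (by positivity)).trans ?_
  rw [hval, ENNReal.ofReal_rpow_of_nonneg (by positivity) (by positivity)]
  refine ENNReal.ofReal_le_ofReal ?_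
  -- The remaining powers have exponents in [0, 1]; enlarging the bases to be at least 1 allows
  -- replacing them by first powers, so that q disappears from the constant.
  have hdτ1 : 1 ≤ 4 * d / τ := by rw [le_div_iff₀ hτ0]; linarith
  have hq1 : 1 / q ≤ 1 := by rw [div_le_one hq0]; linarith
  rw [Real.mul_rpow (by positivity) (by positivity), Real.mul_rpow (by positivity) (by positivity),
    ← Real.rpow_mul ha.le, mul_one_div_cancel hq0.ne', Real.rpow_one]
  gcongr
  · calc (4 * d / τ) ^ (1 / q) ≤ (4 * d / τ) ^ (1 : ℝ) := Real.rpow_le_rpow_of_exponent_le hdτ1 hq1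
      _ = _ := Real.rpow_one _
  · rw [← Real.rpow_mul (by positivity)]
    have he : (q - 2) * (1 / q) ≤ 1 := by
      rw [mul_one_div, div_le_one hq0]; linarith
    calc (2 * √c) ^ ((q - 2) * (1 / q)) ≤ (1 + 2 * √c) ^ ((q - 2) * (1 / q)) :=
          Real.rpow_le_rpow (by positivity) (by linarith) (by positivity)
      _ ≤ (1 + 2 * √c) ^ (1 : ℝ) := Real.rpow_le_rpow_of_exponent_le (by
          have : 0 ≤ √c := Real.sqrt_nonneg c
          linarith) he
      _ = _ := Real.rpow_one _

end Sobolev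

end

/-! ### Dual Sobolev inequality and multipliers of size |ξ|^{-τ} -/

section

section Sobolev

variable {d : ℕ}

/-- The constant of the Sobolev embedding of `Ḣ^{τ/2}`. -/
def sobolevConst (d : ℕ) (τ : ℝ) : ℝ := 4 * d / τ * (1 + 2 * √(ballConst d τ))

theorem sobolevConst_nonneg (d : ℕ) {τ : ℝ} (hτ : 0 < τ) : 0 ≤ sobolevConst d τ := by
  unfold sobolevConst; positivity

/-- Uniformity in τ on compact subintervals of (0, d) is what makes the final constant independent
of p. -/
theorem sobolevConst_le (hd : 0 < d) {τ τ₀ τ₁ : ℝ} (h0 : 0 < τ₀) (h1 : τ₀ ≤ τ) (h2 : τ ≤ τ₁) (h3 : τ₁ < d) :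
    sobolevConst d τ ≤ 4 * d / τ₀ * (1 + 2 * √(ballConst d τ₁)) := by
  unfold sobolevConst ballConst
  have h4 : (0 : ℝ) < d - τ₁ := by linarith
  have h5 : (d : ℝ) - τ₁ ≤ d - τ := by linarith
  gcongr

/-- The degenerate case a = 0 follows by letting a + ε tend to a; duality needs it because the
energy J there may vanish. -/
theorem eLpNorm_le_of_lintegral_rpow_fourier_le' (hd : 0 < d) {τ : ℝ} (hτ0 : 0 < τ) (hτ : τ < d)
    (G : L2 d ℂ) {a : ℝ} (ha : 0 ≤ a)
    (hA : ∫⁻ ξ, ENNReal.ofReal (‖ξ‖ ^ τ) * ‖(𝓕 G : L2 d ℂ) ξ‖ₑ ^ 2 ≤ ENNReal.ofReal (a ^ 2)) :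
    eLpNorm G (.ofReal (2 * d / (d - τ))) volume ≤ ENNReal.ofReal (sobolevConst d τ * a) := by
  have hcont : Filter.Tendsto (fun ε : ℝ => ENNReal.ofReal (sobolevConst d τ * (a + ε)))
      (nhdsWithin 0 (Set.Ioi 0)) (nhds (ENNReal.ofReal (sobolevConst d τ * (a + 0)))) := by
    apply Filter.Tendsto.mono_left _ nhdsWithin_le_nhds
    have : Continuous fun ε : ℝ => ENNReal.ofReal (sobolevConst d τ * (a + ε)) :=
      ENNReal.continuous_ofReal.comp (by fun_prop)
    exact this.tendsto 0
  rw [add_zero] at hcont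
  refine ge_of_tendsto hcont ?_
  filter_upwards [self_mem_nhdsWithin] with ε hε
  have hε' : 0 < ε := hε
  refine eLpNorm_le_of_lintegral_rpow_fourier_le hd hτ0 hτ G (by linarith) (hA.trans ?_)
  exact ENNReal.ofReal_le_ofReal (pow_le_pow_left₀ ha (by linarith) 2)

theorem holderConjugate_sobolev (hd : 0 < d) {τ : ℝ} (hτ0 : 0 < τ) (hτ : τ < d) :
    (2 * d / (d + τ)).HolderConjugate (2 * d / (d - τ)) := by
  have hd' : (0 : ℝ) < d := by exact_mod_cast hd
  have : 0 < (d : ℝ) - τ := by linarith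
  rw [Real.holderConjugate_iff]
  constructor
  · rw [lt_div_iff₀ (by positivity)]; linarith
  · field_simp; ring

/-- Pairing of two `L²` functions in dual Lebesgue spaces. -/
theorem norm_inner_le_of_holderConjugate {p q : ℝ} (hpq : p.HolderConjugate q) (f u : L2 d ℂ)
    (hf : eLpNorm f (.ofReal p) volume ≠ ∞) {b : ℝ} (hb : 0 ≤ b)
    (hu : eLpNorm u (.ofReal q) volume ≤ ENNReal.ofReal b) :
    ‖inner ℂ u f‖ ≤ b * (eLpNorm f (.ofReal p) volume).toReal := by
  have hmf : AEMeasurable (fun x => ‖f x‖ₑ) (volume : Measure (E d)) :=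
    (Lp.stronglyMeasurable f).measurable.enorm.aemeasurable
  have hmu : AEMeasurable (fun x => ‖u x‖ₑ) (volume : Measure (E d)) :=
    (Lp.stronglyMeasurable u).measurable.enorm.aemeasurable
  have e : ∀ (g : L2 d ℂ) (r : ℝ), 0 < r → eLpNorm g (.ofReal r) volume = (∫⁻ x, ‖g x‖ₑ ^ r) ^ (1 / r) := by
    intro g r hr
    rw [eLpNorm_eq_lintegral_rpow_enorm_toReal (by simpa using hr) (by simp), ENNReal.toReal_ofReal hr.le]
  rw [L2.inner_def, ← ENNReal.ofReal_le_ofReal_iff (by positivity), ofReal_norm]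
  calc ‖∫ a, inner ℂ (u a) (f a)‖ₑ ≤ ∫⁻ a, ‖inner ℂ (u a) (f a)‖ₑ := enorm_integral_le_lintegral_enorm _
    _ = ∫⁻ a, ((fun a => ‖u a‖ₑ : E d → ℝ≥0∞) * (fun a => ‖f a‖ₑ : E d → ℝ≥0∞)) a := by
        refine lintegral_congr fun a => ?_
        rw [Pi.mul_apply, ← ofReal_norm, ← ofReal_norm, ← ofReal_norm, ← ENNReal.ofReal_mul (norm_nonneg _)]
        congr 1
        simp [mul_comm]
    _ ≤ _ := ENNReal.lintegral_mul_le_Lp_mul_Lq _ hpq.symm hmu hmf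
    _ = eLpNorm u (.ofReal q) volume * eLpNorm f (.ofReal p) volume := by
        rw [e u q hpq.symm.pos, e f p hpq.pos]
    _ ≤ _ := by
        rw [ENNReal.ofReal_mul hb, ENNReal.ofReal_toReal hf]
        gcongr

/-- The dual Sobolev inequality `L^{2d/(d+τ)} → Ḣ^{-τ/2}`. -/
theorem lintegral_rpow_neg_fourier_le (hd : 0 < d) {τ : ℝ} (hτ0 : 0 < τ) (hτ : τ < d)
    (f : L2 d ℂ) (hf : eLpNorm f (.ofReal (2 * d / (d + τ))) volume ≠ ∞) :
    ∫⁻ ξ, ENNReal.ofReal (‖ξ‖ ^ (-τ)) * ‖(𝓕 f : L2 d ℂ) ξ‖ₑ ^ 2 ≤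
      ENNReal.ofReal ((sobolevConst d τ * (eLpNorm f (.ofReal (2 * d / (d + τ))) volume).toReal) ^ 2) := by
  set U : L2 d ℂ := 𝓕 f with hU
  set A := (eLpNorm f (.ofReal (2 * d / (d + τ))) volume).toReal with hA
  have hA0 : 0 ≤ A := ENNReal.toReal_nonneg
  have hC0 := sobolevConst_nonneg d hτ0
  have hUm : Measurable fun ξ => U ξ := (Lp.stronglyMeasurable U).measurable
  have hWm : Measurable fun ξ : E d => ‖ξ‖ ^ (-τ) := measurable_norm.pow_const _
  have key : ∀ n : ℕ, ∫⁻ ξ in (Metric.ball (0 : E d) (1 / ((n : ℝ) + 1)))ᶜ,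
      ENNReal.ofReal (‖ξ‖ ^ (-τ)) * ‖U ξ‖ₑ ^ 2 ≤ ENNReal.ofReal ((sobolevConst d τ * A) ^ 2) := by
    intro n
    set r : ℝ := 1 / ((n : ℝ) + 1) with hr
    have hr0 : 0 < r := by positivity
    set S := (Metric.ball (0 : E d) r)ᶜ with hSd
    have hS : MeasurableSet S := measurableSet_ball.compl
    have hbd : ∀ ξ ∈ S, ‖ξ‖ ^ (-τ) ≤ r ^ (-τ) := by
      intro ξ hξ
      have : r ≤ ‖ξ‖ := by simpa [hSd] using hξ
      exact Real.rpow_le_rpow_of_nonpos hr0 this (by linarith)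
    -- The dual extremizer has transform |ξ|^{-τ} f̂. Cutting to |ξ| ≥ r bounds the weight, so u is
    -- in L² and J is finite. Both the pairing ⟨u, f⟩ and the squared Sobolev norm of u equal J, so
    -- duality gives J ≤ C √J A.
    set v : E d → ℂ := S.indicator fun ξ => ((‖ξ‖ ^ (-τ) : ℝ) : ℂ) * U ξ with hv
    have hvm : Measurable v := ((Complex.measurable_ofReal.comp hWm).mul hUm).indicator hS
    have hv2 : MemLp v 2 volume := by
      refine MemLp.of_le_mul (c := r ^ (-τ)) (Lp.memLp U) hvm.aestronglyMeasurable
        (Filter.Eventually.of_forall fun ξ => ?_)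
      by_cases h : ξ ∈ S
      · rw [hv, Set.indicator_of_mem h, norm_mul, Complex.norm_real, Real.norm_of_nonneg (by positivity)]
        exact mul_le_mul_of_nonneg_right (hbd ξ h) (norm_nonneg _)
      · rw [hv, Set.indicator_of_notMem h, norm_zero]; positivity
    set u : L2 d ℂ := 𝓕⁻ (hv2.toLp v) with hu
    have hu' : (𝓕 u : L2 d ℂ) = hv2.toLp v := FourierTransform.fourier_fourierInv_eq _
    have hIU : Integrable (fun ξ => ‖U ξ‖ ^ 2) := (Lp.memLp U).integrable_norm_pow (by norm_num)
    have hJI : IntegrableOn (fun ξ => ‖ξ‖ ^ (-τ) * ‖U ξ‖ ^ 2) S := by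
      refine Integrable.mono' ((hIU.const_mul (r ^ (-τ))).integrableOn (s := S))
        (hWm.mul (hUm.norm.pow_const 2)).aestronglyMeasurable ?_
      filter_upwards [ae_restrict_mem hS] with ξ hξ
      rw [Real.norm_of_nonneg (by positivity)]
      exact mul_le_mul_of_nonneg_right (hbd ξ hξ) (by positivity)
    set J : ℝ := ∫ ξ in S, ‖ξ‖ ^ (-τ) * ‖U ξ‖ ^ 2 with hJ
    have hJ0 : 0 ≤ J := integral_nonneg fun ξ => by positivity
    have hJl : ∫⁻ ξ in S, ENNReal.ofReal (‖ξ‖ ^ (-τ)) * ‖U ξ‖ₑ ^ 2 = ENNReal.ofReal J := by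
      rw [hJ, ofReal_integral_eq_lintegral_ofReal hJI (Filter.Eventually.of_forall fun x => by positivity)]
      refine lintegral_congr fun ξ => ?_
      rw [ENNReal.ofReal_mul (by positivity), ENNReal.ofReal_pow (norm_nonneg _), ofReal_norm]
    have hpair : inner ℂ u f = (J : ℂ) := by
      rw [← Lp.inner_fourier_eq, hu', L2.inner_def, hJ, ← integral_indicator hS, ← integral_complex_ofReal]
      refine integral_congr_ae ?_
      filter_upwards [hv2.coeFn_toLp] with ξ hξ
      rw [hξ]
      by_cases h : ξ ∈ S
      · simp only [hv, Set.indicator_of_mem h, RCLike.inner_apply, map_mul, Complex.conj_ofReal]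
        rw [← hU, mul_left_comm, Complex.mul_conj, Complex.normSq_eq_norm_sq]
        push_cast; rfl
      · simp [hv, h]
    have hsob := eLpNorm_le_of_lintegral_rpow_fourier_le' hd hτ0 hτ u (Real.sqrt_nonneg J) (by
      rw [hu', Real.sq_sqrt hJ0, ← hJl, ← lintegral_indicator hS]
      refine le_of_eq (lintegral_congr_ae ?_)
      have hne : ∀ᵐ ξ : E d, ξ ≠ 0 := by
        have : Nonempty (Fin d) := ⟨⟨0, hd⟩⟩
        simp [ae_iff, measure_singleton]
      filter_upwards [hv2.coeFn_toLp, hne] with ξ hξ hξ0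
      have hpos : 0 < ‖ξ‖ := norm_pos_iff.2 hξ0
      rw [hξ]
      by_cases h : ξ ∈ S
      · rw [hv, Set.indicator_of_mem h, Set.indicator_of_mem h, enorm_mul, mul_pow, ← mul_assoc]
        congr 1
        rw [← ofReal_norm, Complex.norm_real, Real.norm_of_nonneg (by positivity),
          ← ENNReal.ofReal_pow (by positivity), ← ENNReal.ofReal_mul (by positivity),
          ← Real.rpow_natCast, ← Real.rpow_mul hpos.le, ← Real.rpow_add hpos]
        congr 2; push_cast; ring
      · rw [hv, Set.indicator_of_notMem h, Set.indicator_of_notMem h]; simp)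
    have hH := norm_inner_le_of_holderConjugate (holderConjugate_sobolev hd hτ0 hτ) f u hf
      (by positivity) hsob
    rw [hpair, Complex.norm_real, Real.norm_of_nonneg hJ0, ← hA] at hH
    rw [hJl]
    refine ENNReal.ofReal_le_ofReal ?_
    have h1 : √J * √J = J := Real.mul_self_sqrt hJ0
    rcases (Real.sqrt_nonneg J).eq_or_lt with h0 | h0
    · rw [← h1, ← h0]; simp; positivity
    · have h2 : √J ≤ sobolevConst d τ * A := by
        refine le_of_mul_le_mul_right ?_ h0
        nlinarith
      calc J = √J ^ 2 := by rw [sq, h1]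
        _ ≤ _ := pow_le_pow_left₀ h0.le h2 2
  have hun : ⋃ n : ℕ, (Metric.ball (0 : E d) (1 / ((n : ℝ) + 1)))ᶜ = {0}ᶜ := by
    ext ξ
    simp only [Set.mem_iUnion, Set.mem_compl_iff, Set.mem_singleton_iff, mem_ball_zero_iff, not_lt]
    constructor
    · rintro ⟨n, hn⟩ rfl
      have : (0 : ℝ) < 1 / ((n : ℝ) + 1) := by positivity
      rw [norm_zero] at hn; linarith
    · intro h
      obtain ⟨n, hn⟩ := exists_nat_one_div_lt (norm_pos_iff.2 h)
      exact ⟨n, hn.le⟩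
  have hmono : Monotone fun n : ℕ => (Metric.ball (0 : E d) (1 / ((n : ℝ) + 1)))ᶜ := by
    intro m n hmn
    apply Set.compl_subset_compl.2
    exact Metric.ball_subset_ball (one_div_le_one_div_of_le (by positivity) (by
      have : (m : ℝ) ≤ n := by exact_mod_cast hmn
      linarith))
  have : Nonempty (Fin d) := ⟨⟨0, hd⟩⟩
  have hnt : Nontrivial (E d) := inferInstance
  have he : ∫⁻ ξ, ENNReal.ofReal (‖ξ‖ ^ (-τ)) * ‖U ξ‖ₑ ^ 2 =
      ∫⁻ ξ in ⋃ n : ℕ, (Metric.ball (0 : E d) (1 / ((n : ℝ) + 1)))ᶜ,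
        ENNReal.ofReal (‖ξ‖ ^ (-τ)) * ‖U ξ‖ₑ ^ 2 := by
    rw [hun, restrict_compl_singleton]
  rw [he, setLIntegral_iUnion_of_directed _ hmono.directed_le]
  exact iSup_le key

/-- A Fourier multiplier (possibly vector-valued) of size `|ξ|^{-τ}` maps `L^{2d/(d+τ)}` to the dual
space `L^{2d/(d-τ)}`. -/
theorem eLpNorm_le_of_norm_fourier_le {ι : Type*} [Fintype ι] (hd : 0 < d) {τ : ℝ} (hτ0 : 0 < τ)
    (hτ : τ < d) (f : ι → L2 d ℂ) (G : L2 d ℂ) {K : ℝ} (hK : 0 ≤ K)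
    (h : ∀ᵐ ξ, ‖(𝓕 G : L2 d ℂ) ξ‖ ≤ K * ‖ξ‖ ^ (-τ) * ∑ j, ‖(𝓕 (f j) : L2 d ℂ) ξ‖)
    (hf : ∀ j, eLpNorm (f j) (.ofReal (2 * d / (d + τ))) volume ≠ ∞) :
    eLpNorm G (.ofReal (2 * d / (d - τ))) volume ≤
      ENNReal.ofReal (sobolevConst d τ ^ 2 * (K * (Fintype.card ι + 1))) *
        ∑ j, eLpNorm (f j) (.ofReal (2 * d / (d + τ))) volume := by
  set C := sobolevConst d τ with hC
  have hC0 : 0 ≤ C := sobolevConst_nonneg d hτ0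
  set A : ι → ℝ := fun j => (eLpNorm (f j) (.ofReal (2 * d / (d + τ))) volume).toReal with hA
  have hA0 : ∀ j, 0 ≤ A j := fun j => ENNReal.toReal_nonneg
  have hS0 : 0 ≤ ∑ j, A j := Finset.sum_nonneg fun j _ => hA0 j
  set N : ℝ := (Fintype.card ι : ℝ) with hN
  have hN0 : 0 ≤ N := by positivity
  have hUm : ∀ j, Measurable fun ξ => (𝓕 (f j) : L2 d ℂ) ξ := fun j =>
    (Lp.stronglyMeasurable _).measurable
  have hsum : ∑ j, eLpNorm (f j) (.ofReal (2 * d / (d + τ))) volume = ENNReal.ofReal (∑ j, A j) := by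
    rw [ENNReal.ofReal_sum_of_nonneg fun j _ => hA0 j]
    exact Finset.sum_congr rfl fun j _ => (ENNReal.ofReal_toReal (hf j)).symm
  have hnt : ∀ᵐ ξ : E d, ξ ≠ 0 := by
    have : Nonempty (Fin d) := ⟨⟨0, hd⟩⟩
    simp [ae_iff, measure_singleton]
  -- Half of the decay |ξ|^{-τ} is spent on the dual inequality for the inputs and half on the
  -- Sobolev embedding for the output.
  have hmain : ∫⁻ ξ, ENNReal.ofReal (‖ξ‖ ^ τ) * ‖(𝓕 G : L2 d ℂ) ξ‖ₑ ^ 2 ≤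
      ENNReal.ofReal ((C * (K * (N + 1)) * ∑ j, A j) ^ 2) := by
    calc _ ≤ ∫⁻ ξ, ∑ j, ENNReal.ofReal (K ^ 2 * N) *
          (ENNReal.ofReal (‖ξ‖ ^ (-τ)) * ‖(𝓕 (f j) : L2 d ℂ) ξ‖ₑ ^ 2) := by
          refine lintegral_mono_ae ?_
          filter_upwards [h, hnt] with ξ hξ hξ0
          have hpos : 0 < ‖ξ‖ := norm_pos_iff.2 hξ0
          have e1 : ∀ j, ENNReal.ofReal (K ^ 2 * N) * (ENNReal.ofReal (‖ξ‖ ^ (-τ)) * ‖(𝓕 (f j) : L2 d ℂ) ξ‖ₑ ^ 2)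
              = ENNReal.ofReal (K ^ 2 * N * (‖ξ‖ ^ (-τ) * ‖(𝓕 (f j) : L2 d ℂ) ξ‖ ^ 2)) := by
            intro j
            rw [ENNReal.ofReal_mul (p := K ^ 2 * N) (by positivity),
              ENNReal.ofReal_mul (p := ‖ξ‖ ^ (-τ)) (by positivity),
              ENNReal.ofReal_pow (norm_nonneg _), ofReal_norm]
          simp_rw [e1]
          rw [← ENNReal.ofReal_sum_of_nonneg fun j _ => by positivity, ← ofReal_norm,
            ← ENNReal.ofReal_pow (norm_nonneg _), ← ENNReal.ofReal_mul (by positivity)]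
          refine ENNReal.ofReal_le_ofReal ?_
          have hcs : (∑ j, ‖(𝓕 (f j) : L2 d ℂ) ξ‖) ^ 2 ≤ N * ∑ j, ‖(𝓕 (f j) : L2 d ℂ) ξ‖ ^ 2 :=
            sq_sum_le_card_mul_sum_sq
          calc ‖ξ‖ ^ τ * ‖(𝓕 G : L2 d ℂ) ξ‖ ^ 2
              ≤ ‖ξ‖ ^ τ * (K * ‖ξ‖ ^ (-τ) * ∑ j, ‖(𝓕 (f j) : L2 d ℂ) ξ‖) ^ 2 := by gcongr
            _ = (‖ξ‖ ^ τ * ‖ξ‖ ^ (-τ)) * K ^ 2 * ‖ξ‖ ^ (-τ) * (∑ j, ‖(𝓕 (f j) : L2 d ℂ) ξ‖) ^ 2 := by ring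
            _ = K ^ 2 * ‖ξ‖ ^ (-τ) * (∑ j, ‖(𝓕 (f j) : L2 d ℂ) ξ‖) ^ 2 := by
                rw [← Real.rpow_add hpos, add_neg_cancel, Real.rpow_zero, one_mul]
            _ ≤ K ^ 2 * ‖ξ‖ ^ (-τ) * (N * ∑ j, ‖(𝓕 (f j) : L2 d ℂ) ξ‖ ^ 2) := by gcongr
            _ = _ := by
                rw [Finset.mul_sum, Finset.mul_sum]
                refine Finset.sum_congr rfl fun j _ => ?_
                ring
      _ = ∑ j, ENNReal.ofReal (K ^ 2 * N) *
          ∫⁻ ξ, (ENNReal.ofReal (‖ξ‖ ^ (-τ)) * ‖(𝓕 (f j) : L2 d ℂ) ξ‖ₑ ^ 2) := by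
          have hm : ∀ j, Measurable fun ξ : E d => ENNReal.ofReal (‖ξ‖ ^ (-τ)) * ‖(𝓕 (f j) : L2 d ℂ) ξ‖ₑ ^ 2 :=
            fun j => (measurable_norm.pow_const _).ennreal_ofReal.mul ((hUm j).enorm.pow_const 2)
          rw [lintegral_finsetSum _ fun j _ => (hm j).const_mul _]
          refine Finset.sum_congr rfl fun j _ => ?_
          rw [lintegral_const_mul _ (hm j)]
      _ ≤ ∑ j, ENNReal.ofReal (K ^ 2 * N) * ENNReal.ofReal ((C * A j) ^ 2) := by
          gcongr with j
          exact lintegral_rpow_neg_fourier_le hd hτ0 hτ (f j) (hf j)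
      _ = ENNReal.ofReal (∑ j, K ^ 2 * N * (C * A j) ^ 2) := by
          rw [ENNReal.ofReal_sum_of_nonneg fun j _ => by positivity]
          refine Finset.sum_congr rfl fun j _ => ?_
          rw [ENNReal.ofReal_mul (p := K ^ 2 * N) (by positivity)]
      _ ≤ _ := by
          refine ENNReal.ofReal_le_ofReal ?_
          have h1 : ∑ j, A j ^ 2 ≤ (∑ j, A j) ^ 2 :=
            Finset.sum_sq_le_sq_sum_of_nonneg fun j _ => hA0 j
          calc ∑ j, K ^ 2 * N * (C * A j) ^ 2 = (K * C) ^ 2 * N * ∑ j, A j ^ 2 := by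
                rw [Finset.mul_sum]
                exact Finset.sum_congr rfl fun j _ => by ring
            _ ≤ (K * C) ^ 2 * (N + 1) ^ 2 * (∑ j, A j) ^ 2 := by
                gcongr
                nlinarith
            _ = _ := by ring
  refine (eLpNorm_le_of_lintegral_rpow_fourier_le' hd hτ0 hτ G (by positivity) hmain).trans_eq ?_
  rw [hsum, ← ENNReal.ofReal_mul (by positivity)]
  congr 1
  rw [← hC]; ring

end Sobolev

end

/-! ### Van der Corput estimates and amplitudes of bounded variation -/

section

section Oscillatory

open Complex (I)

/-- Van der Corput's first derivative test, for an increasing positive derivative. -/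
theorem norm_integral_exp_le_of_deriv_ge {φ φ' φ'' : ℝ → ℝ} {a b ρ : ℝ} (hab : a ≤ b) (hρ : 0 < ρ)
    (h1 : ∀ t ∈ Set.Icc a b, HasDerivAt φ (φ' t) t) (h2 : ∀ t ∈ Set.Icc a b, HasDerivAt φ' (φ'' t) t)
    (hc : ContinuousOn φ'' (Set.Icc a b)) (hpos : ∀ t ∈ Set.Icc a b, 0 ≤ φ'' t)
    (hge : ∀ t ∈ Set.Icc a b, ρ ≤ φ' t) :
    ‖∫ t in a..b, Complex.exp (I * φ t)‖ ≤ 3 / ρ := by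
  have hu : Set.uIcc a b = Set.Icc a b := Set.uIcc_of_le hab
  have hne : ∀ t ∈ Set.Icc a b, φ' t ≠ 0 := fun t ht => (hρ.trans_le (hge t ht)).ne'
  have hφ'c : ContinuousOn φ' (Set.Icc a b) := fun t ht => (h2 t ht).continuousAt.continuousWithinAt
  have hφc : ContinuousOn φ (Set.Icc a b) := fun t ht => (h1 t ht).continuousAt.continuousWithinAt
  have hE : ∀ t ∈ Set.uIcc a b, HasDerivAt (fun t => Complex.exp (I * φ t))
      (Complex.exp (I * φ t) * (I * φ' t)) t := by
    intro t ht
    rw [hu] at ht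
    exact ((h1 t ht).ofReal_comp.const_mul I).cexp
  have hR : ∀ t ∈ Set.Icc a b, HasDerivAt (fun t => (φ' t)⁻¹) (-φ'' t / φ' t ^ 2) t := fun t ht =>
    (h2 t ht).inv (hne t ht)
  have hV : ∀ t ∈ Set.uIcc a b, HasDerivAt (fun t => (((φ' t)⁻¹ : ℝ) : ℂ))
      ((-φ'' t / φ' t ^ 2 : ℝ) : ℂ) t := by
    intro t ht
    rw [hu] at ht
    exact (hR t ht).ofReal_comp
  have hRc : ContinuousOn (fun t => -φ'' t / φ' t ^ 2) (Set.Icc a b) :=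
    hc.neg.div (hφ'c.pow 2) fun t ht => pow_ne_zero 2 (hne t ht)
  have hparts := intervalIntegral.integral_mul_deriv_eq_deriv_mul hV hE
    (ContinuousOn.intervalIntegrable (by rw [hu]; exact Complex.continuous_ofReal.comp_continuousOn hRc))
    (ContinuousOn.intervalIntegrable (by
      rw [hu]
      exact (Complex.continuous_exp.comp_continuousOn (continuousOn_const.mul
        (Complex.continuous_ofReal.comp_continuousOn hφc))).mul (continuousOn_const.mul
        (Complex.continuous_ofReal.comp_continuousOn hφ'c))))
  have hlhs : ∫ t in a..b, (((φ' t)⁻¹ : ℝ) : ℂ) * (Complex.exp (I * φ t) * (I * φ' t)) =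
      I * ∫ t in a..b, Complex.exp (I * φ t) := by
    rw [← intervalIntegral.integral_const_mul]
    refine intervalIntegral.integral_congr fun t ht => ?_
    rw [hu] at ht
    have : (φ' t : ℂ) ≠ 0 := by exact_mod_cast hne t ht
    push_cast
    field_simp
  have hnE : ∀ t, ‖Complex.exp (I * φ t)‖ = 1 := fun t => by
    rw [mul_comm]; exact Complex.norm_exp_ofReal_mul_I _
  have hinv : ∀ t ∈ Set.Icc a b, ‖(((φ' t)⁻¹ : ℝ) : ℂ)‖ ≤ 1 / ρ := by
    intro t ht
    rw [Complex.norm_real, Real.norm_of_nonneg (inv_nonneg.2 (hρ.le.trans (hge t ht))), ← one_div]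
    exact one_div_le_one_div_of_le hρ (hge t ht)
  -- Since φ'' ≥ 0, the function 1/φ' is monotone, so the integral of the modulus of its derivative
  -- telescopes.
  have hint : ‖∫ t in a..b, ((-φ'' t / φ' t ^ 2 : ℝ) : ℂ) * Complex.exp (I * φ t)‖ ≤ 1 / ρ := by
    calc _ ≤ ∫ t in a..b, ‖((-φ'' t / φ' t ^ 2 : ℝ) : ℂ) * Complex.exp (I * φ t)‖ :=
          intervalIntegral.norm_integral_le_integral_norm hab
      _ = ∫ t in a..b, -(-φ'' t / φ' t ^ 2) := by
          refine intervalIntegral.integral_congr fun t ht => ?_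
          rw [hu] at ht
          simp only [norm_mul, hnE, mul_one, Complex.norm_real]
          rw [Real.norm_of_nonpos]
          rw [neg_div]
          exact neg_nonpos.2 (div_nonneg (hpos t ht) (by positivity))
      _ = -((φ' b)⁻¹ - (φ' a)⁻¹) := by
          rw [intervalIntegral.integral_neg, intervalIntegral.integral_eq_sub_of_hasDerivAt
            (fun t ht => hR t (by rwa [hu] at ht)) (ContinuousOn.intervalIntegrable (by rwa [hu]))]
      _ ≤ 1 / ρ := by
          have h3 := hinv a ⟨le_rfl, hab⟩
          rw [Complex.norm_real, Real.norm_eq_abs] at h3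
          have h4 : 0 ≤ (φ' b)⁻¹ := inv_nonneg.2 (hρ.le.trans (hge b ⟨hab, le_rfl⟩))
          linarith [le_abs_self (φ' a)⁻¹]
  have hfin : ‖I * ∫ t in a..b, Complex.exp (I * φ t)‖ ≤ 3 / ρ := by
    rw [← hlhs, hparts]
    have hb := hinv b ⟨hab, le_rfl⟩
    have ha := hinv a ⟨le_rfl, hab⟩
    calc _ ≤ ‖(((φ' b)⁻¹ : ℝ) : ℂ) * Complex.exp (I * φ b)‖ +
          ‖(((φ' a)⁻¹ : ℝ) : ℂ) * Complex.exp (I * φ a)‖ + 1 / ρ :=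
          (norm_sub_le _ _).trans (add_le_add (norm_sub_le _ _) hint)
      _ ≤ 1 / ρ + 1 / ρ + 1 / ρ := by
          rw [norm_mul, norm_mul, hnE, hnE, mul_one, mul_one]
          gcongr
      _ = 3 / ρ := by ring
  rwa [norm_mul, Complex.norm_I, one_mul] at hfin

theorem norm_integral_exp_le_length {φ : ℝ → ℝ} {a b : ℝ} (hab : a ≤ b) :
    ‖∫ t in a..b, Complex.exp (I * φ t)‖ ≤ b - a := by
  have := intervalIntegral.norm_integral_le_of_norm_le_const (a := a) (b := b) (C := 1)
    (f := fun t => Complex.exp (I * φ t)) (fun t _ => by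
      rw [mul_comm]; exact (Complex.norm_exp_ofReal_mul_I _).le)
  rwa [one_mul, abs_of_nonneg (by linarith)] at this

/-- Past an initial interval of length 1/√μ the derivative has grown to at least √μ and the first
derivative test applies; the initial interval is estimated by its length. -/
theorem norm_integral_exp_le_of_deriv2_ge_right {φ φ' φ'' : ℝ → ℝ} {a b μ : ℝ} (hab : a ≤ b) (hμ : 0 < μ)
    (h1 : ∀ t ∈ Set.Icc a b, HasDerivAt φ (φ' t) t) (h2 : ∀ t ∈ Set.Icc a b, HasDerivAt φ' (φ'' t) t)
    (hc : ContinuousOn φ'' (Set.Icc a b)) (hge : ∀ t ∈ Set.Icc a b, μ ≤ φ'' t) (ha : 0 ≤ φ' a) :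
    ‖∫ t in a..b, Complex.exp (I * φ t)‖ ≤ 4 / √μ := by
  have hs : 0 < √μ := Real.sqrt_pos.2 hμ
  have hss : √μ * √μ = μ := Real.mul_self_sqrt hμ.le
  set δ := 1 / √μ with hδ
  have hδ0 : 0 < δ := by positivity
  rcases le_total (b - a) δ with h | h
  · refine (norm_integral_exp_le_length hab).trans (h.trans ?_)
    rw [hδ]; gcongr; norm_num
  · have hac : a ≤ a + δ := by linarith
    have hcb : a + δ ≤ b := by linarith
    have hsub : Set.Icc (a + δ) b ⊆ Set.Icc a b := Set.Icc_subset_Icc_left hac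
    have hφc : ContinuousOn φ (Set.Icc a b) := fun t ht => (h1 t ht).continuousAt.continuousWithinAt
    have hEc : ContinuousOn (fun t => Complex.exp (I * φ t)) (Set.Icc a b) :=
      Complex.continuous_exp.comp_continuousOn (continuousOn_const.mul
        (Complex.continuous_ofReal.comp_continuousOn hφc))
    have hφ' : ∀ t ∈ Set.Icc (a + δ) b, √μ ≤ φ' t := by
      intro t ht
      have hφ'c : ContinuousOn φ' (Set.Icc a b) := fun t ht => (h2 t ht).continuousAt.continuousWithinAt
      have := (convex_Icc a b).mul_sub_le_image_sub_of_le_deriv hφ'c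
        (fun x hx => (h2 x (interior_subset hx)).differentiableAt.differentiableWithinAt)
        (fun x hx => by rw [(h2 x (interior_subset hx)).deriv]; exact hge x (interior_subset hx))
        a ⟨le_rfl, hab⟩ t (hsub ht) (by linarith [ht.1])
      have h3 : μ * δ = √μ := by rw [hδ]; field_simp; nlinarith
      have h4 : μ * δ ≤ μ * (t - a) := by
        apply mul_le_mul_of_nonneg_left _ hμ.le
        linarith [ht.1]
      linarith
    rw [← intervalIntegral.integral_add_adjacent_intervals (b := a + δ)
      (ContinuousOn.intervalIntegrable (by
        rw [Set.uIcc_of_le hac]; exact hEc.mono (Set.Icc_subset_Icc_right hcb)))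
      (ContinuousOn.intervalIntegrable (by rw [Set.uIcc_of_le hcb]; exact hEc.mono hsub))]
    refine (norm_add_le _ _).trans ?_
    have e1 := norm_integral_exp_le_length (φ := φ) hac
    have e2 := norm_integral_exp_le_of_deriv_ge hcb hs (fun t ht => h1 t (hsub ht))
      (fun t ht => h2 t (hsub ht)) (hc.mono hsub) (fun t ht => hμ.le.trans (hge t (hsub ht))) hφ'
    calc _ ≤ δ + 3 / √μ := add_le_add (by linarith) e2
      _ = 4 / √μ := by rw [hδ]; ring

/-- Van der Corput's second derivative test. -/
theorem norm_integral_exp_le_of_deriv2_ge {φ φ' φ'' : ℝ → ℝ} {a b μ : ℝ} (hab : a ≤ b) (hμ : 0 < μ)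
    (h1 : ∀ t ∈ Set.Icc a b, HasDerivAt φ (φ' t) t) (h2 : ∀ t ∈ Set.Icc a b, HasDerivAt φ' (φ'' t) t)
    (hc : ContinuousOn φ'' (Set.Icc a b)) (hge : ∀ t ∈ Set.Icc a b, μ ≤ φ'' t) :
    ‖∫ t in a..b, Complex.exp (I * φ t)‖ ≤ 8 / √μ := by
  have hs : 0 < √μ := Real.sqrt_pos.2 hμ
  -- Where φ' ≤ 0 the reflection t ↦ -t reduces to the one-sided case. If φ' changes sign, the
  -- interval is cut at a zero of φ'.
  have left : ∀ c ∈ Set.Icc a b, φ' c ≤ 0 → ‖∫ t in a..c, Complex.exp (I * φ t)‖ ≤ 4 / √μ := by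
    intro c hcm hc0
    have hmem : ∀ t ∈ Set.Icc (-c) (-a), -t ∈ Set.Icc a b := fun t ht =>
      ⟨by linarith [ht.2], by linarith [ht.1, hcm.2]⟩
    have := norm_integral_exp_le_of_deriv2_ge_right (φ := fun t => φ (-t)) (φ' := fun t => -φ' (-t))
      (φ'' := fun t => φ'' (-t)) (a := -c) (b := -a) (by linarith [hcm.1]) hμ
      (fun t ht => by
        have := (h1 (-t) (hmem t ht)).comp t (hasDerivAt_neg t)
        simpa [Function.comp_def] using this)
      (fun t ht => by
        have := ((h2 (-t) (hmem t ht)).comp t (hasDerivAt_neg t)).neg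
        rw [show -(φ'' (-t) * -1) = φ'' (-t) by ring] at this
        exact this)
      (hc.comp continuous_neg.continuousOn fun t ht => hmem t ht)
      (fun t ht => hge _ (hmem t ht)) (by simpa using hc0)
    rwa [intervalIntegral.integral_comp_neg (f := fun t => Complex.exp (I * φ t)), neg_neg, neg_neg] at this
  have right : ∀ c ∈ Set.Icc a b, 0 ≤ φ' c → ‖∫ t in c..b, Complex.exp (I * φ t)‖ ≤ 4 / √μ := by
    intro c hcm hc0
    have hsub : Set.Icc c b ⊆ Set.Icc a b := Set.Icc_subset_Icc_left hcm.1
    exact norm_integral_exp_le_of_deriv2_ge_right hcm.2 hμ (fun t ht => h1 t (hsub ht))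
      (fun t ht => h2 t (hsub ht)) (hc.mono hsub) (fun t ht => hge t (hsub ht)) hc0
  have h48 : 4 / √μ ≤ 8 / √μ := by gcongr; norm_num
  rcases le_total 0 (φ' a) with ha | ha
  · exact (right a ⟨le_rfl, hab⟩ ha).trans h48
  rcases le_total (φ' b) 0 with hb | hb
  · exact (left b ⟨hab, le_rfl⟩ hb).trans h48
  have hφ'c : ContinuousOn φ' (Set.Icc a b) := fun t ht => (h2 t ht).continuousAt.continuousWithinAt
  obtain ⟨c, hcm, hc0⟩ := intermediate_value_Icc hab hφ'c ⟨ha, hb⟩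
  have hφc : ContinuousOn φ (Set.Icc a b) := fun t ht => (h1 t ht).continuousAt.continuousWithinAt
  have hEc : ContinuousOn (fun t => Complex.exp (I * φ t)) (Set.Icc a b) :=
    Complex.continuous_exp.comp_continuousOn (continuousOn_const.mul
      (Complex.continuous_ofReal.comp_continuousOn hφc))
  rw [← intervalIntegral.integral_add_adjacent_intervals (b := c)
    (ContinuousOn.intervalIntegrable (by
      rw [Set.uIcc_of_le hcm.1]; exact hEc.mono (Set.Icc_subset_Icc_right hcm.2)))
    (ContinuousOn.intervalIntegrable (by
      rw [Set.uIcc_of_le hcm.2]; exact hEc.mono (Set.Icc_subset_Icc_left hcm.1)))]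
  calc _ ≤ 4 / √μ + 4 / √μ := (norm_add_le _ _).trans (add_le_add (left c hcm hc0.le) (right c hcm hc0.ge))
    _ = 8 / √μ := by ring

/-- Inserting an amplitude of bounded variation into an oscillatory integral. -/
theorem norm_integral_mul_le_of_variation {f m m' : ℝ → ℂ} {a b M V : ℝ} (hab : a ≤ b)
    (hf : ContinuousOn f (Set.Icc a b)) (hm : ∀ t ∈ Set.Icc a b, HasDerivAt m (m' t) t)
    (hm' : ContinuousOn m' (Set.Icc a b)) (hM : ∀ T ∈ Set.Icc a b, ‖∫ t in a..T, f t‖ ≤ M)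
    (hmb : ‖m b‖ ≤ 1) (hV : ∫ t in a..b, ‖m' t‖ ≤ V) :
    ‖∫ t in a..b, f t * m t‖ ≤ M * (1 + V) := by
  have hM0 : 0 ≤ M := (norm_nonneg _).trans (hM b ⟨hab, le_rfl⟩)
  have hu : Set.uIcc a b = Set.Icc a b := Set.uIcc_of_le hab
  have hfi : IntervalIntegrable f volume a b := ContinuousOn.intervalIntegrable (by rwa [hu])
  have hm'i : IntervalIntegrable m' volume a b := ContinuousOn.intervalIntegrable (by rwa [hu])
  have hmin : min a b = a := min_eq_left hab
  have hmax : max a b = b := max_eq_right hab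
  have hF : ContinuousOn (fun T => ∫ t in a..T, f t) (Set.uIcc a b) :=
    intervalIntegral.continuousOn_primitive_interval (by
      rw [hu]; exact hf.integrableOn_Icc)
  have hmc : ContinuousOn m (Set.uIcc a b) := by
    rw [hu]; exact fun t ht => (hm t ht).continuousAt.continuousWithinAt
  -- Summation by parts: the primitive of f is bounded by M, so only the end value and the total
  -- variation of the amplitude enter.
  have hparts := intervalIntegral.integral_deriv_mul_eq_sub_of_hasDeriv_right
    (u := fun T => ∫ t in a..T, f t) (v := m) (u' := f) (v' := m') (a := a) (b := b) hF hmc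
    (fun x hx => by
      rw [hmin, hmax] at hx
      have hxm : x ∈ Set.Icc a b := Set.Ioo_subset_Icc_self hx
      have hnh : Set.Icc a b ∈ nhds x := Icc_mem_nhds hx.1 hx.2
      exact (intervalIntegral.integral_hasDerivAt_right
        (hfi.mono_set (by rw [hu, Set.uIcc_of_le hxm.1]; exact Set.Icc_subset_Icc_right hxm.2))
        (hf.stronglyMeasurableAtFilter_nhdsWithin measurableSet_Icc x |>.filter_mono
          (by rw [nhdsWithin_eq_nhds.2 hnh]))
        (hf.continuousAt hnh)).hasDerivWithinAt)
    (fun x hx => by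
      rw [hmin, hmax] at hx
      exact (hm x (Set.Ioo_subset_Icc_self hx)).hasDerivWithinAt) hfi hm'i
  have hsplit : ∫ t in a..b, f t * m t = (∫ t in a..b, f t) * m b -
      ∫ t in a..b, (∫ s in a..t, f s) * m' t := by
    rw [intervalIntegral.integral_add] at hparts
    · rw [intervalIntegral.integral_same, zero_mul, sub_zero] at hparts
      rw [← hparts]; ring
    · exact hfi.mul_continuousOn hmc
    · exact hm'i.continuousOn_mul hF
  rw [hsplit]
  calc _ ≤ ‖∫ t in a..b, f t‖ * ‖m b‖ + ‖∫ t in a..b, (∫ s in a..t, f s) * m' t‖ := by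
        rw [← norm_mul]; exact norm_sub_le _ _
    _ ≤ M * 1 + ∫ t in a..b, M * ‖m' t‖ := by
        gcongr
        · exact hM b ⟨hab, le_rfl⟩
        · refine (intervalIntegral.norm_integral_le_integral_norm hab).trans ?_
          refine intervalIntegral.integral_mono_on hab ?_ ?_ fun t ht => ?_
          · exact (hm'i.continuousOn_mul hF).norm
          · exact hm'i.norm.const_mul M
          · rw [norm_mul]
            exact mul_le_mul_of_nonneg_right (hM t ht) (norm_nonneg _)
    _ ≤ M * (1 + V) := by
        rw [intervalIntegral.integral_const_mul, mul_add]
        gcongr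

/-- Inserting a monotone amplitude with values in `[0, 1]`. -/
theorem norm_integral_mul_le_of_monotone {f : ℝ → ℂ} {m m' : ℝ → ℝ} {a b M : ℝ} (hab : a ≤ b)
    (hf : ContinuousOn f (Set.Icc a b)) (hm : ∀ t ∈ Set.Icc a b, HasDerivAt m (m' t) t)
    (hm' : ContinuousOn m' (Set.Icc a b)) (hM : ∀ T ∈ Set.Icc a b, ‖∫ t in a..T, f t‖ ≤ M)
    (h0 : ∀ t ∈ Set.Icc a b, 0 ≤ m t) (h1 : ∀ t ∈ Set.Icc a b, m t ≤ 1)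
    (hs : (∀ t ∈ Set.Icc a b, 0 ≤ m' t) ∨ (∀ t ∈ Set.Icc a b, m' t ≤ 0)) :
    ∀ T ∈ Set.Icc a b, ‖∫ t in a..T, f t * (m t : ℂ)‖ ≤ M * 2 := by
  intro T hT
  have hsub : Set.Icc a T ⊆ Set.Icc a b := Set.Icc_subset_Icc_right hT.2
  have hu : Set.uIcc a T = Set.Icc a T := Set.uIcc_of_le hT.1
  have hmT := h0 T hT
  have hmT1 := h1 T hT
  have hma := h0 a ⟨le_rfl, hab⟩
  have hma1 := h1 a ⟨le_rfl, hab⟩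
  have hint : ∫ t in a..T, m' t = m T - m a :=
    intervalIntegral.integral_eq_sub_of_hasDerivAt (fun t ht => hm t (hsub (by rwa [hu] at ht)))
      (ContinuousOn.intervalIntegrable (by rw [hu]; exact hm'.mono hsub))
  have := norm_integral_mul_le_of_variation (f := f) (m := fun t => (m t : ℂ))
    (m' := fun t => (m' t : ℂ)) (M := M) (V := 1) hT.1 (hf.mono hsub)
    (fun t ht => (hm t (hsub ht)).ofReal_comp)
    (Complex.continuous_ofReal.comp_continuousOn (hm'.mono hsub))
    (fun S hS => hM S (hsub hS)) (by
      rw [Complex.norm_real, Real.norm_of_nonneg hmT]; exact hmT1) (by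
      -- The sign of m' is constant, so the variation is |m T - m a| ≤ 1; hence the factor 1 + 1 =
      -- 2.
      rcases hs with hs | hs
      · rw [intervalIntegral.integral_congr (g := m') fun t ht => by
          rw [hu] at ht
          simp only [Complex.norm_real, Real.norm_of_nonneg (hs t (hsub ht))], hint]
        linarith
      · rw [intervalIntegral.integral_congr (g := fun t => -m' t) fun t ht => by
          rw [hu] at ht
          simp only [Complex.norm_real, Real.norm_of_nonpos (hs t (hsub ht))],
          intervalIntegral.integral_neg, hint]
        linarith)
  linarith

end Oscillatory

end

/-! ### The kernel bound at the L¹ endpoint -/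

section

section Kernel

open Complex (I)

/-- The basic oscillatory integral with amplitude `t^{-1/2}`. -/
theorem norm_integral_rpow_neg_half_exp_le {u₀ u b y : ℝ} (hu₀ : 0 < u₀) (hu : u₀ ≤ u) (hb : 0 ≤ b)
    {T : ℝ} (hT : 2 ≤ T) :
    ‖∫ t in (2 : ℝ)..T, ((t ^ (-(1 / 2) : ℝ) : ℝ) : ℂ) *
      Complex.exp (I * ((u * t + b * (t / (1 + t ^ 2)) - y * Real.log t : ℝ) : ℂ))‖ ≤
      2 * ((1 + 2 * |y| / u₀) + 8 / √u₀) := by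
  -- Substituting t = σ² turns t^{-1/2} dt into 2 dσ and the linear phase ut into uσ², whose second
  -- derivative is bounded below.
  set φ : ℝ → ℝ := fun σ => u * σ ^ 2 + b * (σ ^ 2 / (1 + σ ^ 4)) - 2 * y * Real.log σ with hφ
  have h2T : √2 ≤ √T := Real.sqrt_le_sqrt hT
  have hs2 : 0 < √2 := by positivity
  have hs22 : √2 ^ 2 = 2 := Real.sq_sqrt (by norm_num)
  have hsTT : √T ^ 2 = T := Real.sq_sqrt (by linarith)
  have hden : ∀ σ : ℝ, 0 < 1 + σ ^ 4 := fun σ => by positivity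
  have hsub : ∫ t in (2 : ℝ)..T, ((t ^ (-(1 / 2) : ℝ) : ℝ) : ℂ) *
      Complex.exp (I * ((u * t + b * (t / (1 + t ^ 2)) - y * Real.log t : ℝ) : ℂ)) =
      2 * ∫ σ in √2..√T, Complex.exp (I * φ σ) := by
    set g : ℝ → ℂ := fun t => ((t ^ (-(1 / 2) : ℝ) : ℝ) : ℂ) *
      Complex.exp (I * ((u * t + b * (t / (1 + t ^ 2)) - y * Real.log t : ℝ) : ℂ)) with hg
    have hgc : ∀ t : ℝ, 0 < t → ContinuousAt g t := by
      intro t ht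
      have h1 : ContinuousAt (fun t : ℝ => t ^ (-(1 / 2) : ℝ)) t :=
        Real.continuousAt_rpow_const _ _ (Or.inl ht.ne')
      have h2 : ContinuousAt (fun t : ℝ => u * t + b * (t / (1 + t ^ 2)) - y * Real.log t) t := by
        have h3 : 1 + t ^ 2 ≠ 0 := by positivity
        have h4 : t ≠ 0 := ht.ne'
        fun_prop (disch := assumption)
      exact (Complex.continuous_ofReal.continuousAt.comp h1).mul
        (Complex.continuous_exp.continuousAt.comp (continuousAt_const.mul
          (Complex.continuous_ofReal.continuousAt.comp h2)))
    have hcs := intervalIntegral.integral_deriv_smul_comp' (a := √2) (b := √T) (f := fun σ : ℝ => σ ^ 2)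
      (f' := fun σ : ℝ => 2 * σ) (g := g) (fun x _ => by simpa using hasDerivAt_pow 2 x)
      (by fun_prop) (by
        rintro _ ⟨σ, hσ, rfl⟩
        rw [Set.uIcc_of_le h2T] at hσ
        have : 0 < σ := hs2.trans_le hσ.1
        exact (hgc _ (by positivity)).continuousWithinAt)
    simp only [hs22, hsTT] at hcs
    rw [← hcs, ← intervalIntegral.integral_const_mul]
    refine intervalIntegral.integral_congr fun σ hσ => ?_
    rw [Set.uIcc_of_le h2T] at hσ
    have hσ0 : 0 < σ := hs2.trans_le hσ.1
    simp only [Function.comp_apply, hg, hφ]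
    have e1 : (σ ^ 2) ^ (-(1 / 2) : ℝ) = σ⁻¹ := by
      rw [← Real.rpow_natCast, ← Real.rpow_mul hσ0.le]
      norm_num
      rw [Real.rpow_neg_one]
    have e2 : Real.log (σ ^ 2) = 2 * Real.log σ := by rw [Real.log_pow]; norm_num
    rw [e1, e2, Complex.real_smul, ← mul_assoc, ← Complex.ofReal_mul,
      show 2 * σ * σ⁻¹ = 2 by field_simp]
    congr 3
    push_cast
    ring_nf
  rw [hsub, norm_mul, Complex.norm_ofNat]
  refine mul_le_mul_of_nonneg_left ?_ (by norm_num)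
  -- Beyond √2 + σ₁ the logarithmic phase lowers the second derivative by at most u₀, leaving 2u -
  -- u₀ ≥ u₀. The part before is estimated by its length σ₁, which is linear in |y|.
  set σ₁ : ℝ := 1 + 2 * |y| / u₀ with hσ₁
  have hσ₁0 : 0 < σ₁ := by positivity
  have h8 : 0 ≤ 8 / √u₀ := by positivity
  rcases le_total (√T) (√2 + σ₁) with h | h
  · have := norm_integral_exp_le_length (φ := φ) h2T
    linarith
  · have hφd : ∀ σ ∈ Set.Icc (√2 + σ₁) (√T), HasDerivAt φ
        (2 * u * σ + b * ((2 * σ - 2 * σ ^ 5) / (1 + σ ^ 4) ^ 2) - 2 * y / σ) σ := by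
      intro σ hσ
      have hσ0 : σ ≠ 0 := by linarith [hσ.1]
      have h1 := ((hasDerivAt_pow 2 σ).const_mul u)
      have h2 := (((hasDerivAt_pow 2 σ).div ((hasDerivAt_pow 4 σ).const_add 1) (hden σ).ne').const_mul b)
      have h3 := (Real.hasDerivAt_log hσ0).const_mul (2 * y)
      refine ((h1.add h2).sub h3).congr_deriv ?_
      have := (hden σ).ne'
      push_cast
      field_simp
      ring
    have hφd2 : ∀ σ ∈ Set.Icc (√2 + σ₁) (√T), HasDerivAt
        (fun σ => 2 * u * σ + b * ((2 * σ - 2 * σ ^ 5) / (1 + σ ^ 4) ^ 2) - 2 * y / σ)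
        (2 * u + b * ((2 - 24 * σ ^ 4 + 6 * σ ^ 8) / (1 + σ ^ 4) ^ 3) + 2 * y / σ ^ 2) σ := by
      intro σ hσ
      have hσ0 : σ ≠ 0 := by linarith [hσ.1]
      have h1 := ((hasDerivAt_id σ).const_mul (2 * u))
      have h2 := ((((hasDerivAt_id σ).const_mul 2).fun_sub ((hasDerivAt_pow 5 σ).const_mul 2)).fun_div
        (((hasDerivAt_pow 4 σ).const_add 1).fun_pow 2) (pow_ne_zero 2 (hden σ).ne')).const_mul b
      have h3 := (hasDerivAt_inv hσ0).const_mul (2 * y)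
      refine ((h1.add h2).sub h3).congr_deriv ?_
      have := (hden σ).ne'
      simp only [id]
      push_cast
      field_simp
      ring
    have hcont : ContinuousOn (fun σ : ℝ => 2 * u + b * ((2 - 24 * σ ^ 4 + 6 * σ ^ 8) / (1 + σ ^ 4) ^ 3) +
        2 * y / σ ^ 2) (Set.Icc (√2 + σ₁) (√T)) := by
      intro σ hσ
      have hσ0 : σ ^ 2 ≠ 0 := pow_ne_zero 2 (by linarith [hσ.1])
      have h3 : (1 + σ ^ 4) ^ 3 ≠ 0 := pow_ne_zero 3 (hden σ).ne'
      have : ContinuousAt (fun σ : ℝ => 2 * u + b * ((2 - 24 * σ ^ 4 + 6 * σ ^ 8) / (1 + σ ^ 4) ^ 3) +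
        2 * y / σ ^ 2) σ := by fun_prop (disch := assumption)
      exact this.continuousWithinAt
    have hge : ∀ σ ∈ Set.Icc (√2 + σ₁) (√T), u₀ ≤
        2 * u + b * ((2 - 24 * σ ^ 4 + 6 * σ ^ 8) / (1 + σ ^ 4) ^ 3) + 2 * y / σ ^ 2 := by
      intro σ hσ
      have hσ2 : √2 ≤ σ := by linarith [hσ.1]
      have hσ0 : 0 < σ := by linarith
      -- The lower limit t = 2 is used here: X = σ⁴ ≥ 4 implies 2 - 24X + 6X² ≥ 0, so the b-term is
      -- convex and arbitrarily large b costs nothing.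
      have hσ4 : 4 ≤ σ ^ 4 := by
        have h5 : (2 : ℝ) ≤ σ ^ 2 := by rw [← hs22]; exact pow_le_pow_left₀ hs2.le hσ2 2
        nlinarith
      have h6 : 0 ≤ b * ((2 - 24 * σ ^ 4 + 6 * σ ^ 8) / (1 + σ ^ 4) ^ 3) := by
        refine mul_nonneg hb (div_nonneg ?_ (by positivity))
        nlinarith
      have h7 : 2 * |y| / σ ^ 2 ≤ u₀ := by
        have h8 : σ₁ ≤ σ := by linarith [hσ.1]
        have h9 : 2 * |y| / u₀ ≤ σ ^ 2 := by
          have h10 : 0 ≤ 2 * |y| / u₀ := by positivity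
          nlinarith
        rw [div_le_iff₀ (by positivity)]
        rw [div_le_iff₀ hu₀] at h9
        linarith
      have h10 : -(2 * |y| / σ ^ 2) ≤ 2 * y / σ ^ 2 := by
        rw [← neg_div]
        gcongr
        linarith [neg_abs_le y]
      linarith
    have hφc : ContinuousOn φ (Set.Icc (√2) (√T)) := by
      intro σ hσ
      have hσ0 : σ ≠ 0 := by linarith [hσ.1]
      have h3 : 1 + σ ^ 4 ≠ 0 := (hden σ).ne'
      have : ContinuousAt φ σ := by simp only [hφ]; fun_prop (disch := assumption)
      exact this.continuousWithinAt
    have hEc : ContinuousOn (fun t => Complex.exp (I * φ t)) (Set.Icc (√2) (√T)) :=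
      Complex.continuous_exp.comp_continuousOn (continuousOn_const.mul
        (Complex.continuous_ofReal.comp_continuousOn hφc))
    rw [← intervalIntegral.integral_add_adjacent_intervals (b := √2 + σ₁)
      (ContinuousOn.intervalIntegrable (by
        rw [Set.uIcc_of_le (by linarith)]; exact hEc.mono (Set.Icc_subset_Icc_right h)))
      (ContinuousOn.intervalIntegrable (by
        rw [Set.uIcc_of_le h]; exact hEc.mono (Set.Icc_subset_Icc_left (by linarith))))]
    refine (norm_add_le _ _).trans (add_le_add ?_ ?_)
    · refine (norm_integral_exp_le_length (by linarith)).trans_eq (by ring)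
    · exact norm_integral_exp_le_of_deriv2_ge h hu₀ hφd hφd2 hcont hge

/-- The kernel factor `(t / (1 + i t)) ^ (d / 2)` has bounded variation on `[2, ∞)`. -/
theorem hasDerivAt_ratio_cpow (d : ℕ) {t : ℝ} (ht : 0 < t) :
    HasDerivAt (fun t : ℝ => ((t : ℂ) * (1 + t * I)⁻¹) ^ ((d : ℂ) / 2))
      ((d : ℂ) / 2 * ((t : ℂ) * (1 + t * I)⁻¹) ^ ((d : ℂ) / 2 - 1) * ((1 + t * I)⁻¹) ^ 2) t := by
  have hne : (1 + t * I : ℂ) ≠ 0 := by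
    intro h
    have := congrArg Complex.re h
    simp at this
  have h1 : HasDerivAt (fun t : ℝ => (t : ℂ)) 1 t := Complex.ofRealCLM.hasDerivAt
  have h2 : HasDerivAt (fun t : ℝ => (1 + t * I : ℂ)) I t := by
    simpa using (h1.mul_const I).const_add 1
  have h3 := h1.fun_mul (h2.fun_inv hne)
  have hslit : (t : ℂ) * (1 + t * I)⁻¹ ∈ Complex.slitPlane := by
    left
    rw [Complex.inv_def, Complex.re_ofReal_mul]
    have : 0 < Complex.normSq (1 + t * I) := Complex.normSq_pos.2 hne
    simp
    positivity
  refine (((hasDerivAt_id ((t : ℂ) * (1 + t * I)⁻¹)).cpow_const (c := (d : ℂ) / 2) hslit).comp t h3).congr_deriv ?_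
  have e : 1 * (1 + ↑t * I)⁻¹ + ↑t * (-I / (1 + ↑t * I) ^ 2) = ((1 + t * I : ℂ)⁻¹) ^ 2 := by
    field_simp
    ring
  rw [e]
  simp

theorem norm_one_add_mul_I (t : ℝ) : ‖(1 + t * I : ℂ)‖ = √(1 + t ^ 2) := by
  rw [Complex.norm_def, Complex.normSq_apply]
  congr 1
  simp
  ring

/-- For t ≥ 2 the ratio has modulus between 1/2 and 1, so its power d/2 - 1 ≥ -1 is at most 2. The
remaining factor decays like t^{-2}, which is integrable. -/
theorem norm_ratio_cpow_deriv_le (d : ℕ) {t : ℝ} (ht : 2 ≤ t) :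
    ‖(d : ℂ) / 2 * ((t : ℂ) * (1 + t * I)⁻¹) ^ ((d : ℂ) / 2 - 1) * ((1 + t * I)⁻¹) ^ 2‖ ≤ d / t ^ 2 := by
  have h0 : 0 < t := by linarith
  set z : ℂ := (t : ℂ) * (1 + t * I)⁻¹ with hz
  have hn : ‖z‖ = t / √(1 + t ^ 2) := by
    rw [hz, norm_mul, norm_inv, norm_one_add_mul_I, Complex.norm_real, Real.norm_of_nonneg h0.le]; rfl
  have hs : t ≤ √(1 + t ^ 2) := Real.le_sqrt_of_sq_le (by linarith)
  have hs0 : 0 < √(1 + t ^ 2) := by positivity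
  have hs2 : √(1 + t ^ 2) ≤ 2 * t := by
    rw [Real.sqrt_le_left (by positivity)]; nlinarith
  have hz0 : z ≠ 0 := by
    intro h; rw [h, norm_zero] at hn
    have : 0 < t / √(1 + t ^ 2) := by positivity
    linarith
  have hz1 : ‖z‖ ≤ 1 := by rw [hn, div_le_one hs0]; exact hs
  have hz2 : 1 / 2 ≤ ‖z‖ := by rw [hn, div_le_div_iff₀ (by norm_num) hs0]; linarith
  have hpow : ‖z ^ ((d : ℂ) / 2 - 1)‖ ≤ 2 := by
    have e : ((d : ℂ) / 2 - 1) = (((d : ℝ) / 2 - 1 : ℝ) : ℂ) := by push_cast; ring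
    have hzp : 0 < ‖z‖ := norm_pos_iff.2 hz0
    rw [e, Complex.norm_cpow_real]
    calc ‖z‖ ^ ((d : ℝ) / 2 - 1) ≤ ‖z‖ ^ (-1 : ℝ) := by
          apply Real.rpow_le_rpow_of_exponent_ge hzp hz1
          have : (0 : ℝ) ≤ d := by positivity
          linarith
      _ = 1 / ‖z‖ := by rw [Real.rpow_neg_one, one_div]
      _ ≤ 2 := by rw [div_le_iff₀ hzp]; linarith
  have hden : ‖((1 + t * I : ℂ)⁻¹) ^ 2‖ ≤ 1 / t ^ 2 := by
    rw [norm_pow, norm_inv, norm_one_add_mul_I, inv_pow, Real.sq_sqrt (by positivity), ← one_div]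
    exact one_div_le_one_div_of_le (by positivity) (by linarith)
  have hd2 : ‖(d : ℂ) / 2‖ = d / 2 := by simp
  rw [norm_mul, norm_mul, hd2]
  calc (d : ℝ) / 2 * ‖z ^ ((d : ℂ) / 2 - 1)‖ * ‖((1 + t * I : ℂ)⁻¹) ^ 2‖ ≤ (d : ℝ) / 2 * 2 * (1 / t ^ 2) := by
        gcongr
    _ = d / t ^ 2 := by ring

theorem integral_div_sq_le {c T : ℝ} (hc : 0 ≤ c) (hT : 2 ≤ T) : ∫ t in (2 : ℝ)..T, c / t ^ 2 ≤ c := by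
  have hu : Set.uIcc 2 T = Set.Icc 2 T := Set.uIcc_of_le hT
  have h := intervalIntegral.integral_eq_sub_of_hasDerivAt (a := 2) (b := T) (f := fun t : ℝ => -c * t⁻¹)
    (f' := fun t => c / t ^ 2) (fun t ht => by
      rw [hu] at ht
      have h0 : t ≠ 0 := by linarith [ht.1]
      refine ((hasDerivAt_inv h0).const_mul (-c)).congr_deriv (by ring))
    (ContinuousOn.intervalIntegrable (by
      rw [hu]
      intro t ht
      have h0 : t ^ 2 ≠ 0 := pow_ne_zero 2 (by linarith [ht.1])
      have : ContinuousAt (fun t : ℝ => c / t ^ 2) t := by fun_prop (disch := assumption)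
      exact this.continuousWithinAt))
  rw [h]
  have : 0 ≤ c * T⁻¹ := by positivity
  linarith

theorem ofReal_mul_cpow {r : ℝ} (hr : 0 < r) {x : ℂ} (hx : x ≠ 0) (c : ℂ) :
    ((r : ℂ) * x) ^ c = Complex.exp (c * Real.log r) * x ^ c := by
  have hr' : (r : ℂ) ≠ 0 := by exact_mod_cast hr.ne'
  rw [Complex.cpow_def_of_ne_zero (mul_ne_zero hr' hx), Complex.cpow_def_of_ne_zero hx,
    Complex.log_ofReal_mul hr hx, ← Complex.exp_add]
  congr 1
  ring

/-- The uniform pointwise bound for the kernel of the analytic family of truncated resolvents. -/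
theorem norm_integral_kernel_le (d : ℕ) {u₀ u₁ : ℝ} (hu₀ : 0 < u₀) {w : ℂ} (hw0 : u₀ ≤ w.re)
    (hw1 : w.re ≤ u₁) (hwi : 0 ≤ w.im) {b : ℝ} (hb : 0 ≤ b) {μ : ℂ} (hμ : μ.re ≤ ((d : ℝ) - 1) / 2)
    {N : ℝ} (hN : 2 ≤ N) :
    ‖∫ t in (2 : ℝ)..N, Complex.exp (μ * Real.log t) * ((1 + t * I)⁻¹) ^ ((d : ℂ) / 2) *
      Complex.exp ((1 + t * I) * w) * Complex.exp (-b / (1 + t * I))‖ ≤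
      Real.exp u₁ * (8 * ((1 + 2 * |μ.im| / u₀) + 8 / √u₀) * (1 + d)) := by
  set M := 2 * ((1 + 2 * |μ.im| / u₀) + 8 / √u₀) with hM
  -- The integrand is e^w f₀ m₁ m₂ B. The factor f₀ carries t^{-1/2} and all the oscillation, using
  -- -b/(1 + it) = -b/(1 + t²) + i b t/(1 + t²). The increasing m₁ and the decreasing m₂ have values
  -- in [0, 1], and m₂ contains the surplus decay t^{-δ}. Finally B = (t/(1 + it))^{d/2} has
  -- variation at most d. The three insertions cost 2, 2 and 1 + d.
  set δ := ((d : ℝ) - 1) / 2 - μ.re with hδ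
  have hδ0 : 0 ≤ δ := by linarith
  set f₀ : ℝ → ℂ := fun t => ((t ^ (-(1 / 2) : ℝ) : ℝ) : ℂ) *
      Complex.exp (I * ((w.re * t + b * (t / (1 + t ^ 2)) - (-μ.im) * Real.log t : ℝ) : ℂ)) with hf₀
  set m₁ : ℝ → ℝ := fun t => Real.exp (-(b / (1 + t ^ 2))) with hm₁
  set m₂ : ℝ → ℝ := fun t => Real.exp (-(δ * Real.log t + w.im * t)) with hm₂
  set B : ℝ → ℂ := fun t => ((t : ℂ) * (1 + t * I)⁻¹) ^ ((d : ℂ) / 2) with hB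
  have hpos : ∀ t ∈ Set.Icc 2 N, 0 < t := fun t ht => by linarith [ht.1]
  have hf₀c : ContinuousOn f₀ (Set.Icc 2 N) := by
    intro t ht
    have ht0 := hpos t ht
    have h1 : ContinuousAt (fun t : ℝ => t ^ (-(1 / 2) : ℝ)) t :=
      Real.continuousAt_rpow_const _ _ (Or.inl ht0.ne')
    have h2 : ContinuousAt (fun t : ℝ => w.re * t + b * (t / (1 + t ^ 2)) - (-μ.im) * Real.log t) t := by
      have h3 : 1 + t ^ 2 ≠ 0 := by positivity
      have h4 : t ≠ 0 := ht0.ne'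
      fun_prop (disch := assumption)
    exact ((Complex.continuous_ofReal.continuousAt.comp h1).mul
      (Complex.continuous_exp.continuousAt.comp (continuousAt_const.mul
        (Complex.continuous_ofReal.continuousAt.comp h2)))).continuousWithinAt
  have hf₀b : ∀ T ∈ Set.Icc 2 N, ‖∫ t in (2 : ℝ)..T, f₀ t‖ ≤ M := by
    intro T hT
    have := norm_integral_rpow_neg_half_exp_le (y := -μ.im) hu₀ hw0 hb hT.1
    rwa [abs_neg] at this
  have hm₁d : ∀ t ∈ Set.Icc 2 N, HasDerivAt m₁ (m₁ t * (b * (2 * t) / (1 + t ^ 2) ^ 2)) t := by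
    intro t _
    have h3 : 1 + t ^ 2 ≠ 0 := by positivity
    have := (((hasDerivAt_const t b).div ((hasDerivAt_pow 2 t).const_add 1) h3).neg).exp
    refine this.congr_deriv ?_
    simp only [hm₁, Pi.neg_apply, Pi.div_apply]
    push_cast
    congr 1
    ring
  have hm₁c : ContinuousOn (fun t => m₁ t * (b * (2 * t) / (1 + t ^ 2) ^ 2)) (Set.Icc 2 N) := by
    intro t _
    have h3 : 1 + t ^ 2 ≠ 0 := by positivity
    have h4 : (1 + t ^ 2) ^ 2 ≠ 0 := by positivity
    have : ContinuousAt (fun t => m₁ t * (b * (2 * t) / (1 + t ^ 2) ^ 2)) t := by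
      simp only [hm₁]; fun_prop (disch := assumption)
    exact this.continuousWithinAt
  have hstep₁ := norm_integral_mul_le_of_monotone hN hf₀c hm₁d hm₁c hf₀b
    (fun t _ => (Real.exp_pos _).le) (fun t _ => Real.exp_le_one_iff.2 (by
      have : 0 ≤ b / (1 + t ^ 2) := by positivity
      linarith))
    (Or.inl fun t ht => by
      have := hpos t ht
      have : 0 ≤ m₁ t := (Real.exp_pos _).le
      positivity)
  have hf₁c : ContinuousOn (fun t => f₀ t * (m₁ t : ℂ)) (Set.Icc 2 N) :=
    hf₀c.mul (Complex.continuous_ofReal.comp_continuousOn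
      fun t ht => (hm₁d t ht).continuousAt.continuousWithinAt)
  have hm₂d : ∀ t ∈ Set.Icc 2 N, HasDerivAt m₂ (m₂ t * (-(δ * t⁻¹ + w.im))) t := by
    intro t ht
    have h0 := (hpos t ht).ne'
    have := ((((Real.hasDerivAt_log h0).const_mul δ).add ((hasDerivAt_id t).const_mul w.im)).neg).exp
    refine this.congr_deriv ?_
    simp only [hm₂, mul_one]
    rfl
  have hm₂c : ContinuousOn (fun t => m₂ t * (-(δ * t⁻¹ + w.im))) (Set.Icc 2 N) := by
    intro t ht
    have h0 := (hpos t ht).ne'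
    have : ContinuousAt (fun t => m₂ t * (-(δ * t⁻¹ + w.im))) t := by
      simp only [hm₂]; fun_prop (disch := assumption)
    exact this.continuousWithinAt
  have hstep₂ := norm_integral_mul_le_of_monotone hN hf₁c hm₂d hm₂c hstep₁
    (fun t _ => (Real.exp_pos _).le) (fun t ht => Real.exp_le_one_iff.2 (by
      have h1 : 0 ≤ Real.log t := Real.log_nonneg (by linarith [ht.1])
      have h2 := (hpos t ht).le
      have : 0 ≤ δ * Real.log t + w.im * t := by positivity
      linarith))
    (Or.inr fun t ht => by
      have h2 := hpos t ht
      have h1 : 0 ≤ δ * t⁻¹ + w.im := by positivity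
      have : 0 ≤ m₂ t := (Real.exp_pos _).le
      nlinarith)
  have hf₂c : ContinuousOn (fun t => f₀ t * (m₁ t : ℂ) * (m₂ t : ℂ)) (Set.Icc 2 N) :=
    hf₁c.mul (Complex.continuous_ofReal.comp_continuousOn
      fun t ht => (hm₂d t ht).continuousAt.continuousWithinAt)
  have hne : ∀ t : ℝ, (1 + t * I : ℂ) ≠ 0 := by
    intro t h
    have := congrArg Complex.re h
    simp at this
  have hslit : ∀ t : ℝ, 0 < t → (t : ℂ) * (1 + t * I)⁻¹ ∈ Complex.slitPlane := by
    intro t ht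
    left
    rw [Complex.inv_def, Complex.re_ofReal_mul]
    have : 0 < Complex.normSq (1 + t * I) := Complex.normSq_pos.2 (hne t)
    simp
    positivity
  have hB'c : ContinuousOn (fun t : ℝ => (d : ℂ) / 2 * ((t : ℂ) * (1 + t * I)⁻¹) ^ ((d : ℂ) / 2 - 1) *
      ((1 + t * I)⁻¹) ^ 2) (Set.Icc 2 N) := by
    have hinv : Continuous fun t : ℝ => (1 + t * I : ℂ)⁻¹ :=
      Continuous.inv₀ (by fun_prop) hne
    have hr : Continuous fun t : ℝ => (t : ℂ) * (1 + t * I)⁻¹ := Complex.continuous_ofReal.mul hinv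
    exact (continuousOn_const.mul (hr.continuousOn.cpow_const fun t ht => hslit t (hpos t ht))).mul
      (hinv.pow 2).continuousOn
  have hBN : ‖B N‖ ≤ 1 := by
    have h0 : 0 < N := by linarith
    have e : ((d : ℂ) / 2) = (((d : ℝ) / 2 : ℝ) : ℂ) := by push_cast; ring
    simp only [hB]
    rw [e, Complex.norm_cpow_real]
    refine Real.rpow_le_one (norm_nonneg _) ?_ (by positivity)
    rw [norm_mul, norm_inv, norm_one_add_mul_I, Complex.norm_real, Real.norm_of_nonneg h0.le,
      ← div_eq_mul_inv, div_le_one (by positivity)]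
    exact Real.le_sqrt_of_sq_le (by linarith)
  have hBV : ∫ t in (2 : ℝ)..N, ‖(d : ℂ) / 2 * ((t : ℂ) * (1 + t * I)⁻¹) ^ ((d : ℂ) / 2 - 1) *
      ((1 + t * I)⁻¹) ^ 2‖ ≤ d := by
    refine le_trans (intervalIntegral.integral_mono_on hN ?_ ?_
      fun t ht => norm_ratio_cpow_deriv_le d ht.1) (integral_div_sq_le (by positivity) hN)
    · exact (ContinuousOn.intervalIntegrable (by rw [Set.uIcc_of_le hN]; exact hB'c)).norm
    · refine ContinuousOn.intervalIntegrable ?_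
      rw [Set.uIcc_of_le hN]
      intro t ht
      have h0 : t ^ 2 ≠ 0 := pow_ne_zero 2 (hpos t ht).ne'
      have : ContinuousAt (fun t : ℝ => (d : ℝ) / t ^ 2) t := by fun_prop (disch := assumption)
      exact this.continuousWithinAt
  have hstep₃ := norm_integral_mul_le_of_variation (m := B) hN hf₂c
    (fun t ht => hasDerivAt_ratio_cpow d (hpos t ht)) hB'c hstep₂ hBN hBV
  have heq : ∫ t in (2 : ℝ)..N, Complex.exp (μ * Real.log t) * ((1 + t * I)⁻¹) ^ ((d : ℂ) / 2) *
      Complex.exp ((1 + t * I) * w) * Complex.exp (-b / (1 + t * I)) =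
      Complex.exp w * ∫ t in (2 : ℝ)..N, f₀ t * (m₁ t : ℂ) * (m₂ t : ℂ) * B t := by
    rw [← intervalIntegral.integral_const_mul]
    refine intervalIntegral.integral_congr fun t ht => ?_
    rw [Set.uIcc_of_le hN] at ht
    have ht0 := hpos t ht
    have hBt : B t = Complex.exp ((d : ℂ) / 2 * Real.log t) * ((1 + t * I)⁻¹) ^ ((d : ℂ) / 2) := by
      simp only [hB]
      exact ofReal_mul_cpow ht0 (inv_ne_zero (hne t)) _
    have hrt : ((t ^ (-(1 / 2) : ℝ) : ℝ) : ℂ) = Complex.exp (-(1 / 2) * Real.log t) := by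
      rw [Real.rpow_def_of_pos ht0, Complex.ofReal_exp]
      congr 1
      push_cast
      ring
    have hfrac : -(b : ℂ) / (1 + t * I) = -(b / (1 + t ^ 2) : ℝ) + I * (b * (t / (1 + t ^ 2)) : ℝ) := by
      have h1 : (1 + (t : ℂ) ^ 2) ≠ 0 := by
        have : (1 + t ^ 2 : ℝ) ≠ 0 := by positivity
        exact_mod_cast this
      have h2 := hne t
      push_cast
      field_simp
      linear_combination (-(t : ℂ) ^ 2) * b * Complex.I_sq
    have hμ' : μ = μ.re + μ.im * I := (Complex.re_add_im μ).symm
    have hw' : w = w.re + w.im * I := (Complex.re_add_im w).symm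
    rw [hBt, hfrac]
    simp only [hf₀, hm₁, hm₂, hrt, Complex.ofReal_exp]
    have key : μ * Real.log t + (1 + t * I) * w +
        (-(b / (1 + t ^ 2) : ℝ) + I * (b * (t / (1 + t ^ 2)) : ℝ)) =
        w + (-(1 / 2) * Real.log t + I * ((w.re * t + b * (t / (1 + t ^ 2)) - (-μ.im) * Real.log t : ℝ) : ℂ) +
          ((-(b / (1 + t ^ 2)) : ℝ) : ℂ) + ((-(δ * Real.log t + w.im * t) : ℝ) : ℂ) +
          (d : ℂ) / 2 * Real.log t) := by
      rw [hδ]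
      push_cast
      have h1 : μ * Real.log t = (μ.re + μ.im * I) * Real.log t := by rw [← hμ']
      have h2 : (1 + t * I) * w = w + t * I * (w.re + w.im * I) := by rw [← hw']; ring
      rw [h1, h2]
      linear_combination (t * w.im : ℂ) * Complex.I_sq
    calc _ = Complex.exp (μ * Real.log t + (1 + t * I) * w +
        (-(b / (1 + t ^ 2) : ℝ) + I * (b * (t / (1 + t ^ 2)) : ℝ))) * ((1 + t * I)⁻¹) ^ ((d : ℂ) / 2) := by
          rw [Complex.exp_add (μ * _ + _), Complex.exp_add (μ * _)]; ring
      _ = _ := by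
          rw [key, Complex.exp_add, Complex.exp_add, Complex.exp_add, Complex.exp_add, Complex.exp_add]
          ring
  rw [heq, norm_mul, Complex.norm_exp]
  have hM0 : 0 ≤ M := by rw [hM]; positivity
  calc Real.exp w.re * ‖∫ t in (2 : ℝ)..N, f₀ t * (m₁ t : ℂ) * (m₂ t : ℂ) * B t‖
      ≤ Real.exp u₁ * (M * 2 * 2 * (1 + d)) := by gcongr
    _ = _ := by rw [hM]; ring

end Kernel

end

/-! ### The symbol bound at the L² endpoint -/

section

section Symbol

open Complex (I)

theorem norm_exp_mul_log {μ : ℂ} {t : ℝ} (ht : 0 < t) : ‖Complex.exp (μ * Real.log t)‖ = t ^ μ.re := by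
  rw [Complex.norm_exp, Real.rpow_def_of_pos ht]
  congr 1
  simp [mul_comm]

theorem norm_exp_mul_I_mul_le_one {a : ℂ} (ha : 0 ≤ a.im) {t : ℝ} (ht : 0 ≤ t) :
    ‖Complex.exp (t * I * a)‖ ≤ 1 := by
  rw [Complex.norm_exp, Real.exp_le_one_iff]
  simp
  positivity

theorem norm_exp_sub_one_le_of_re_nonpos {z : ℂ} (hz : z.re ≤ 0) : ‖Complex.exp z - 1‖ ≤ ‖z‖ := by
  have h : ∀ x ∈ (Set.Iic (0 : ℝ) : Set ℝ), True := fun _ _ => trivial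
  have := (convex_halfSpace_re_le (0 : ℝ)).norm_image_sub_le_of_norm_hasDerivWithin_le (𝕜 := ℂ)
    (f := Complex.exp) (f' := Complex.exp) (C := 1)
    (fun x _ => (Complex.hasDerivAt_exp x).hasDerivWithinAt)
    (fun x hx => by rw [Complex.norm_exp, Real.exp_le_one_iff]; exact hx)
    (x := 0) (y := z) (by simp) hz
  simpa using this

theorem continuousOn_exp_mul_log (μ : ℂ) {s : Set ℝ} (hs : ∀ t ∈ s, 0 < t) :
    ContinuousOn (fun t : ℝ => Complex.exp (μ * Real.log t)) s := by
  intro t ht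
  have h0 := (hs t ht).ne'
  have : ContinuousAt (fun t : ℝ => Real.log t) t := Real.continuousAt_log h0
  exact (Complex.continuous_exp.continuousAt.comp (continuousAt_const.mul
    (Complex.continuous_ofReal.continuousAt.comp this))).continuousWithinAt

theorem hasDerivAt_exp_mul_log (μ : ℂ) {t : ℝ} (ht : 0 < t) :
    HasDerivAt (fun t : ℝ => Complex.exp (μ * Real.log t)) (μ * Complex.exp ((μ - 1) * Real.log t)) t := by
  refine (((Real.hasDerivAt_log ht.ne').ofReal_comp).const_mul μ).cexp.congr_deriv ?_
  have h1 : ((t⁻¹ : ℝ) : ℂ) = Complex.exp (-Real.log t) := by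
    rw [← Complex.ofReal_neg, ← Complex.ofReal_exp, Real.exp_neg, Real.exp_log ht]
  rw [h1, show (μ - 1) * (Real.log t : ℂ) = μ * Real.log t + -Real.log t by ring, Complex.exp_add]
  ring

/-- As long as t|a| ≤ 1 the exponential is 1 + O(t|a|). The integral of t^{-1+iη} is explicit and at
most 2/|η| however large T is: the imaginary power removes the logarithmic divergence. -/
theorem norm_integral_low_le {a : ℂ} (ha : 0 ≤ a.im) {η : ℝ} (hη : η ≠ 0) {T : ℝ} (hT : 2 ≤ T)
    (hTa : T * ‖a‖ ≤ 1) :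
    ‖∫ t in (2 : ℝ)..T, Complex.exp ((-1 + η * I) * Real.log t) * Complex.exp (t * I * a)‖ ≤
      2 / |η| + 1 := by
  have hu : Set.uIcc 2 T = Set.Icc 2 T := Set.uIcc_of_le hT
  have hpos : ∀ t ∈ Set.Icc 2 T, 0 < t := fun t ht => by linarith [ht.1]
  have hc := continuousOn_exp_mul_log (-1 + η * I) hpos
  have hηI : (η : ℂ) * I ≠ 0 := mul_ne_zero (by exact_mod_cast hη) Complex.I_ne_zero
  have hE : Continuous fun t : ℝ => Complex.exp (t * I * a) := by fun_prop
  have hsplit : ∫ t in (2 : ℝ)..T, Complex.exp ((-1 + η * I) * Real.log t) * Complex.exp (t * I * a) =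
      (∫ t in (2 : ℝ)..T, Complex.exp ((-1 + η * I) * Real.log t)) +
      ∫ t in (2 : ℝ)..T, Complex.exp ((-1 + η * I) * Real.log t) * (Complex.exp (t * I * a) - 1) := by
    rw [← intervalIntegral.integral_add (ContinuousOn.intervalIntegrable (by rwa [hu]))
      (ContinuousOn.intervalIntegrable (by rw [hu]; exact hc.mul (hE.sub continuous_const).continuousOn))]
    refine intervalIntegral.integral_congr fun t _ => ?_
    ring
  have h1 : ∫ t in (2 : ℝ)..T, Complex.exp ((-1 + η * I) * Real.log t) =
      Complex.exp (η * I * Real.log T) / (η * I) - Complex.exp (η * I * Real.log 2) / (η * I) := by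
    refine intervalIntegral.integral_eq_sub_of_hasDerivAt
      (f := fun t : ℝ => Complex.exp (η * I * Real.log t) / (η * I)) (fun t ht => ?_)
      (ContinuousOn.intervalIntegrable (by rwa [hu]))
    rw [hu] at ht
    refine ((hasDerivAt_exp_mul_log (η * I) (hpos t ht)).div_const (η * I)).congr_deriv ?_
    rw [mul_div_cancel_left₀ _ hηI]
    congr 1
    ring
  have hn : ∀ x : ℝ, 0 < x → ‖Complex.exp (η * I * Real.log x) / (η * I)‖ = 1 / |η| := by
    intro x hx
    rw [norm_div, norm_exp_mul_log hx]
    simp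
  have h2 : ‖∫ t in (2 : ℝ)..T, Complex.exp ((-1 + η * I) * Real.log t) * (Complex.exp (t * I * a) - 1)‖ ≤
      ‖a‖ * |T - 2| := by
    refine intervalIntegral.norm_integral_le_of_norm_le_const fun t ht => ?_
    rw [Set.uIoc_of_le hT] at ht
    have ht0 : 0 < t := by linarith [ht.1]
    rw [norm_mul, norm_exp_mul_log ht0]
    have h3 : ‖Complex.exp (t * I * a) - 1‖ ≤ t * ‖a‖ := by
      refine (norm_exp_sub_one_le_of_re_nonpos ?_).trans_eq ?_
      · simp; positivity
      · simp [abs_of_pos ht0]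
    have h4 : (-1 + η * I : ℂ).re = -1 := by simp
    rw [h4, Real.rpow_neg_one]
    calc t⁻¹ * ‖Complex.exp (t * I * a) - 1‖ ≤ t⁻¹ * (t * ‖a‖) := by gcongr
      _ = ‖a‖ := by field_simp
  rw [hsplit, h1]
  have h5 : ‖a‖ * |T - 2| ≤ 1 := by
    rw [abs_of_nonneg (by linarith)]
    nlinarith [norm_nonneg a]
  calc _ ≤ (1 / |η| + 1 / |η|) + ‖a‖ * |T - 2| := by
        refine (norm_add_le _ _).trans (add_le_add ((norm_sub_le _ _).trans ?_) h2)
        rw [hn T (by linarith), hn 2 (by norm_num)]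
    _ ≤ 2 / |η| + 1 := by
        have : 1 / |η| + 1 / |η| = 2 / |η| := by ring
        linarith

/-- Once t|a| ≥ 1, integration by parts in e^{ita} gains 1/|a|, which the decay t^{-1} at T
compensates. The exponential stays bounded because Im a ≥ 0. -/
theorem norm_integral_high_le {a : ℂ} (ha : 0 ≤ a.im) (η : ℝ) {T N : ℝ} (hT : 0 < T) (hTN : T ≤ N)
    (hTa : 1 ≤ T * ‖a‖) :
    ‖∫ t in T..N, Complex.exp ((-1 + η * I) * Real.log t) * Complex.exp (t * I * a)‖ ≤ 3 + |η| := by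
  have hu : Set.uIcc T N = Set.Icc T N := Set.uIcc_of_le hTN
  have hpos : ∀ t ∈ Set.Icc T N, 0 < t := fun t ht => by linarith [ht.1]
  have ha0 : 0 < ‖a‖ := by
    by_contra h
    have : ‖a‖ = 0 := le_antisymm (not_lt.1 h) (norm_nonneg _)
    rw [this] at hTa; linarith
  have haI : I * a ≠ 0 := mul_ne_zero Complex.I_ne_zero (norm_pos_iff.1 ha0)
  have hE : Continuous fun t : ℝ => Complex.exp (t * I * a) := by fun_prop
  have hdE : ∀ t : ℝ, HasDerivAt (fun t : ℝ => Complex.exp (t * I * a) / (I * a)) (Complex.exp (t * I * a)) t := by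
    intro t
    have h1 : HasDerivAt (fun t : ℝ => (t : ℂ)) 1 t := Complex.ofRealCLM.hasDerivAt
    refine ((((h1.mul_const I).mul_const a).cexp).div_const (I * a)).congr_deriv ?_
    rw [one_mul, mul_div_cancel_right₀ _ haI]
  have hc1 := continuousOn_exp_mul_log (-1 + η * I - 1) hpos
  have hparts := intervalIntegral.integral_mul_deriv_eq_deriv_mul
    (u := fun t : ℝ => Complex.exp ((-1 + η * I) * Real.log t))
    (v := fun t : ℝ => Complex.exp (t * I * a) / (I * a))
    (a := T) (b := N)
    (fun t ht => hasDerivAt_exp_mul_log (-1 + η * I) (hpos t (by rwa [hu] at ht)))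
    (fun t _ => hdE t)
    (ContinuousOn.intervalIntegrable (by rw [hu]; exact continuousOn_const.mul hc1))
    (hE.intervalIntegrable _ _)
  rw [hparts]
  have hre : (-1 + η * I : ℂ).re = -1 := by simp
  have hv : ∀ t : ℝ, 0 < t → ‖Complex.exp (t * I * a) / (I * a)‖ ≤ 1 / ‖a‖ := by
    intro t ht
    rw [norm_div, norm_mul, Complex.norm_I, one_mul]
    gcongr
    exact norm_exp_mul_I_mul_le_one ha ht.le
  have hbd : ∀ t : ℝ, T ≤ t → ‖Complex.exp ((-1 + η * I) * Real.log t) *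
      (Complex.exp (t * I * a) / (I * a))‖ ≤ 1 := by
    intro t ht
    have ht0 : 0 < t := hT.trans_le ht
    rw [norm_mul, norm_exp_mul_log ht0, hre, Real.rpow_neg_one]
    calc t⁻¹ * _ ≤ T⁻¹ * (1 / ‖a‖) := by
          gcongr
          exact hv t ht0
      _ = 1 / (T * ‖a‖) := by field_simp
      _ ≤ 1 := by rw [div_le_one (by positivity)]; exact hTa
  have hη1 : ‖(-1 + η * I : ℂ)‖ ≤ 1 + |η| := by
    refine (norm_add_le _ _).trans_eq ?_
    simp
  have hint : ‖∫ t in T..N, (-1 + η * I) * Complex.exp ((-1 + η * I - 1) * Real.log t) *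
      (Complex.exp (t * I * a) / (I * a))‖ ≤ 1 + |η| := by
    have hcc : ContinuousOn (fun t : ℝ => (1 + |η|) * (1 / ‖a‖) * (1 / t ^ 2)) (Set.Icc T N) := by
      intro t ht
      have h0 : t ^ 2 ≠ 0 := pow_ne_zero 2 (hpos t ht).ne'
      have : ContinuousAt (fun t : ℝ => (1 + |η|) * (1 / ‖a‖) * (1 / t ^ 2)) t := by
        fun_prop (disch := assumption)
      exact this.continuousWithinAt
    calc _ ≤ ∫ t in T..N, (1 + |η|) * (1 / ‖a‖) * (1 / t ^ 2) := by
          refine intervalIntegral.norm_integral_le_of_norm_le hTN ?_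
            (ContinuousOn.intervalIntegrable (by rwa [hu]))
          refine Filter.Eventually.of_forall fun t ht => ?_
          have ht0 : 0 < t := hT.trans ht.1
          rw [norm_mul, norm_mul, norm_exp_mul_log ht0]
          have h2 : (-1 + η * I - 1 : ℂ).re = -2 := by simp; norm_num
          rw [h2, show t ^ (-2 : ℝ) = 1 / t ^ 2 by
            rw [Real.rpow_neg ht0.le, one_div]; norm_num]
          calc _ ≤ (1 + |η|) * (1 / t ^ 2) * (1 / ‖a‖) := by
                gcongr
                exact hv t ht0
            _ = _ := by ring
      _ = (1 + |η|) * (1 / ‖a‖) * (T⁻¹ - N⁻¹) := by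
          rw [intervalIntegral.integral_const_mul]
          congr 1
          rw [intervalIntegral.integral_eq_sub_of_hasDerivAt (f := fun t : ℝ => -t⁻¹)
            (fun t ht => by
              have h0 := (hpos t (by rwa [hu] at ht)).ne'
              exact (hasDerivAt_inv h0).neg.congr_deriv (by simp))
            (ContinuousOn.intervalIntegrable (by
              rw [hu]
              intro t ht
              have h0 : t ^ 2 ≠ 0 := pow_ne_zero 2 (hpos t ht).ne'
              have : ContinuousAt (fun t : ℝ => 1 / t ^ 2) t := by fun_prop (disch := assumption)
              exact this.continuousWithinAt))]
          ring
      _ ≤ (1 + |η|) * (1 / ‖a‖) * T⁻¹ := by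
          have : 0 ≤ N⁻¹ := inv_nonneg.2 (hT.le.trans hTN)
          gcongr
          linarith
      _ = (1 + |η|) * (1 / (T * ‖a‖)) := by field_simp
      _ ≤ (1 + |η|) * 1 := by
          gcongr
          rw [div_le_one (by positivity)]; exact hTa
      _ = 1 + |η| := mul_one _
  calc _ ≤ 1 + 1 + (1 + |η|) :=
        (norm_sub_le _ _).trans (add_le_add ((norm_sub_le _ _).trans
          (add_le_add (hbd N hTN) (hbd T le_rfl))) hint)
    _ = 3 + |η| := by ring

/-- The uniform bound for the symbol of the analytic family on the `L²` side. -/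
theorem norm_integral_symbol_le {a : ℂ} (ha : 0 ≤ a.im) {u₁ : ℝ} (hau : a.re ≤ u₁) {η : ℝ} (hη : η ≠ 0)
    {N : ℝ} (hN : 2 ≤ N) :
    ‖∫ t in (2 : ℝ)..N, Complex.exp ((-1 + η * I) * Real.log t) * Complex.exp ((1 + t * I) * a)‖ ≤
      Real.exp u₁ * (2 / |η| + 4 + |η|) := by
  have hη0 : 0 < |η| := abs_pos.2 hη
  have hfac : ∫ t in (2 : ℝ)..N, Complex.exp ((-1 + η * I) * Real.log t) * Complex.exp ((1 + t * I) * a) =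
      Complex.exp a * ∫ t in (2 : ℝ)..N, Complex.exp ((-1 + η * I) * Real.log t) * Complex.exp (t * I * a) := by
    rw [← intervalIntegral.integral_const_mul]
    refine intervalIntegral.integral_congr fun t _ => ?_
    rw [show (1 + t * I) * a = a + t * I * a by ring, Complex.exp_add]
    ring
  rw [hfac, norm_mul, Complex.norm_exp]
  gcongr
  rcases le_total (N * ‖a‖) 1 with h | h
  · exact (norm_integral_low_le ha hη hN h).trans (by linarith)
  rcases le_total 1 (2 * ‖a‖) with h2 | h2
  · have : 0 < 2 / |η| := by positivity
    exact (norm_integral_high_le ha η (by norm_num) hN h2).trans (by linarith)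
  have ha0 : 0 < ‖a‖ := by
    by_contra h'
    have : ‖a‖ = 0 := le_antisymm (not_lt.1 h') (norm_nonneg _)
    rw [this] at h; linarith
  -- The two regimes meet at t = 1/|a|, so neither N nor the size of a survives in the bound.
  set T := 1 / ‖a‖ with hT
  have hTa : T * ‖a‖ = 1 := by rw [hT]; field_simp
  have h2T : 2 ≤ T := by rw [hT, le_div_iff₀ ha0]; exact h2
  have hTN : T ≤ N := by rw [hT, div_le_iff₀ ha0]; exact h
  have hc : ∀ x y : ℝ, 0 < x → x ≤ y → IntervalIntegrable (fun t : ℝ =>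
      Complex.exp ((-1 + η * I) * Real.log t) * Complex.exp (t * I * a)) volume x y := by
    intro x y hx hxy
    refine ContinuousOn.intervalIntegrable ?_
    rw [Set.uIcc_of_le hxy]
    exact (continuousOn_exp_mul_log _ fun t ht => hx.trans_le ht.1).mul
      (Continuous.continuousOn (by fun_prop))
  rw [← intervalIntegral.integral_add_adjacent_intervals (hc 2 T (by norm_num) h2T)
    (hc T N (by linarith) hTN)]
  calc _ ≤ (2 / |η| + 1) + (3 + |η|) := (norm_add_le _ _).trans
        (add_le_add (norm_integral_low_le ha hη h2T hTa.le)
          (norm_integral_high_le ha η (by linarith) hTN hTa.ge))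
    _ = 2 / |η| + 4 + |η| := by ring

end Symbol

end

/-! ### One bilinear form, evaluated in frequency and in space -/

section

open Complex (I)
open scoped ComplexConjugate RealInnerProductSpace

/-- The symbol `exp ((1 + i t) (w - κ² |ξ|²))` of the damped propagator at time `t`. -/
def waveSymbol {d : ℕ} (κ : ℝ) (w : ℂ) (t : ℝ) (ξ : E d) : ℂ :=
  Complex.exp ((1 + t * I) * (w - (κ ^ 2 * ‖ξ‖ ^ 2 : ℝ)))

/-- The superposition of the damped propagators at times `2 ≤ t ≤ N` with density `t ^ μ`. -/
def truncSymbol {d : ℕ} (κ : ℝ) (w μ : ℂ) (N : ℝ) (ξ : E d) : ℂ :=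
  ∫ t in (2 : ℝ)..N, Complex.exp (μ * Real.log t) * waveSymbol κ w t ξ

/-- The integrand, over times, frequencies and pairs of points, of the bilinear form of
`truncSymbol`. -/
def waveIntegrand {d : ℕ} (κ : ℝ) (w μ : ℂ) (a b : E d → ℂ) (ω : (ℝ × E d) × (E d × E d)) : ℂ :=
  (Complex.exp (μ * Real.log ω.1.1) * waveSymbol κ w ω.1.1 ω.1.2) *
    (((Real.fourierChar (-⟪ω.2.1, ω.1.2⟫) : ℂ) * a ω.2.1) *
      conj ((Real.fourierChar (-⟪ω.2.2, ω.1.2⟫) : ℂ) * b ω.2.2))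

/-- The measure on times `2 < t ≤ N`, frequencies and pairs of points. -/
def waveMeasure (d : ℕ) (N : ℝ) : Measure ((ℝ × E d) × (E d × E d)) :=
  (((volume : Measure ℝ).restrict (Set.Ioc 2 N)).prod volume).prod (volume.prod volume)

theorem continuous_waveSymbol {d : ℕ} (κ : ℝ) (w : ℂ) :
    Continuous fun p : ℝ × E d => waveSymbol κ w p.1 p.2 := by
  unfold waveSymbol; fun_prop

theorem norm_waveSymbol_le {d : ℕ} (κ : ℝ) {w : ℂ} {u₁ : ℝ} (hw1 : w.re ≤ u₁) (hwi : 0 ≤ w.im) {t : ℝ}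
    (ht : 0 ≤ t) (ξ : E d) :
    ‖waveSymbol κ w t ξ‖ ≤ Real.exp u₁ * Real.exp (-κ ^ 2 * ‖ξ‖ ^ 2) := by
  rw [waveSymbol, Complex.norm_exp, ← Real.exp_add]
  apply Real.exp_le_exp.2
  have e : ((1 + t * I) * (w - (κ ^ 2 * ‖ξ‖ ^ 2 : ℝ))).re = w.re - κ ^ 2 * ‖ξ‖ ^ 2 - t * w.im := by
    rw [Complex.mul_re, Complex.sub_re, Complex.sub_im, Complex.ofReal_re, Complex.ofReal_im]
    simp
  rw [e]
  nlinarith [mul_nonneg ht hwi]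

theorem integrable_gaussian {d : ℕ} {κ : ℝ} (hκ : 0 < κ) :
    Integrable fun ξ : E d => Real.exp (-κ ^ 2 * ‖ξ‖ ^ 2) := by
  have h := (GaussianFourier.integrable_cexp_neg_mul_sq_norm_add (V := E d) (b := ((κ ^ 2 : ℝ) : ℂ))
    (by rw [Complex.ofReal_re]; positivity) 0 0).norm
  refine h.congr (Filter.Eventually.of_forall fun ξ => ?_)
  simp only [Complex.norm_exp]
  congr 1
  rw [zero_mul, add_zero, ← Complex.ofReal_pow, ← Complex.ofReal_neg, ← Complex.ofReal_mul,
    Complex.ofReal_re]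

theorem measurable_exp_mul_log (μ : ℂ) : Measurable fun t : ℝ => Complex.exp (μ * Real.log t) := by
  fun_prop

theorem norm_exp_mul_log_le {μ : ℂ} {t N : ℝ} (ht : t ∈ Set.Ioc 2 N) :
    ‖Complex.exp (μ * Real.log t)‖ ≤ Real.exp (|μ.re| * Real.log N) := by
  rw [Complex.norm_exp]
  apply Real.exp_le_exp.2
  have h0 : 0 ≤ Real.log t := Real.log_nonneg (by linarith [ht.1])
  have h1 : Real.log t ≤ Real.log N := Real.log_le_log (by linarith [ht.1]) ht.2
  simp only [Complex.mul_re, Complex.ofReal_re, Complex.ofReal_im, mul_zero, sub_zero]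
  calc μ.re * Real.log t ≤ |μ.re| * Real.log t := by gcongr; exact le_abs_self _
    _ ≤ _ := by gcongr

theorem integrable_waveSymbol_prod {d : ℕ} {κ : ℝ} (hκ : 0 < κ) {w : ℂ} (hwi : 0 ≤ w.im) (μ : ℂ) (N : ℝ) :
    Integrable (fun p : ℝ × E d => Complex.exp (μ * Real.log p.1) * waveSymbol κ w p.1 p.2)
      (((volume : Measure ℝ).restrict (Set.Ioc 2 N)).prod volume) := by
  have h1 : Integrable (fun _ : ℝ => Real.exp (|μ.re| * Real.log N) * Real.exp w.re)
      ((volume : Measure ℝ).restrict (Set.Ioc 2 N)) := integrable_const _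
  have h2 := h1.mul_prod (integrable_gaussian (d := d) hκ)
  refine h2.mono' ?_ ?_
  · exact (((measurable_exp_mul_log μ).comp measurable_fst).mul
      (continuous_waveSymbol κ w).measurable).aestronglyMeasurable
  · rw [show (((volume : Measure ℝ).restrict (Set.Ioc 2 N)).prod (volume : Measure (E d))) =
      ((volume : Measure ℝ).prod volume).restrict (Set.Ioc 2 N ×ˢ Set.univ) by
        rw [← Measure.prod_restrict, Measure.restrict_univ]]
    filter_upwards [ae_restrict_mem (measurableSet_Ioc.prod MeasurableSet.univ)] with p hp
    rw [norm_mul, mul_assoc]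
    exact mul_le_mul (norm_exp_mul_log_le hp.1)
      (norm_waveSymbol_le κ le_rfl hwi (by linarith [hp.1.1]) _) (norm_nonneg _) (Real.exp_pos _).le

theorem integrable_waveIntegrand {d : ℕ} {κ : ℝ} (hκ : 0 < κ) {w : ℂ} (hwi : 0 ≤ w.im) (μ : ℂ) (N : ℝ)
    {a b : E d → ℂ} (ha : Integrable a) (hb : Integrable b) :
    Integrable (waveIntegrand κ w μ a b) (waveMeasure d N) := by
  have hb' : Integrable fun x => conj (b x) :=
    hb.congr' (Complex.continuous_conj.comp_aestronglyMeasurable hb.1)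
      (Filter.Eventually.of_forall fun x => (RCLike.norm_conj (b x)).symm)
  have h := (integrable_waveSymbol_prod (d := d) hκ hwi μ N).mul_prod (ha.mul_prod hb')
  have h' := h.bdd_mul (c := 1) (f := fun ω : (ℝ × E d) × (E d × E d) =>
    (Real.fourierChar (-⟪ω.2.1, ω.1.2⟫) : ℂ) * conj (Real.fourierChar (-⟪ω.2.2, ω.1.2⟫) : ℂ)) ?_ ?_
  · refine h'.congr (Filter.Eventually.of_forall fun ω => ?_)
    simp only [waveIntegrand, map_mul]
    ring
  · refine Continuous.aestronglyMeasurable ?_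
    have := Real.continuous_fourierChar
    fun_prop
  · refine Filter.Eventually.of_forall fun ω => ?_
    rw [norm_mul, RCLike.norm_conj, Circle.norm_coe, Circle.norm_coe, mul_one]

/-- Fubini with the two points integrated first: they produce the transforms of a and b, and the
time integral produces the multiplier. -/
theorem integral_waveIntegrand_eq_fourier {d : ℕ} {κ : ℝ} (hκ : 0 < κ) {w : ℂ} (hwi : 0 ≤ w.im) (μ : ℂ)
    {N : ℝ} (hN : 2 ≤ N) {a b : E d → ℂ} (ha : Integrable a) (hb : Integrable b) :
    ∫ ω, waveIntegrand κ w μ a b ω ∂waveMeasure d N =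
      ∫ ξ, truncSymbol κ w μ N ξ * (𝓕 a ξ * conj (𝓕 b ξ)) := by
  have hint := integrable_waveIntegrand hκ hwi μ N ha hb
  have hin : ∀ q : ℝ × E d, ∫ y, waveIntegrand κ w μ a b (q, y) ∂(volume.prod volume) =
      (Complex.exp (μ * Real.log q.1) * waveSymbol κ w q.1 q.2) * (𝓕 a q.2 * conj (𝓕 b q.2)) := by
    intro q
    simp only [waveIntegrand]
    rw [integral_const_mul]
    congr 1
    rw [integral_prod_mul (fun x => (Real.fourierChar (-⟪x, q.2⟫) : ℂ) * a x)
      (fun x => conj ((Real.fourierChar (-⟪x, q.2⟫) : ℂ) * b x)), integral_conj,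
      Real.fourier_eq, Real.fourier_eq]
    rfl
  rw [waveMeasure, integral_prod _ hint]
  simp only [hin]
  rw [integral_prod_symm _ (by simpa only [hin] using hint.integral_prod_left)]
  refine integral_congr_ae (Filter.Eventually.of_forall fun ξ => ?_)
  simp only
  rw [integral_mul_const, truncSymbol, intervalIntegral.integral_of_le hN]

/-- Fubini with frequency integrated first: it produces the convolution kernel at q.1 - q.2, so that
a pointwise kernel bound becomes an L¹ estimate. -/
theorem integral_waveIntegrand_eq_kernel {d : ℕ} {κ : ℝ} (hκ : 0 < κ) {w : ℂ} (hwi : 0 ≤ w.im) (μ : ℂ)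
    {N : ℝ} (hN : 2 ≤ N) {a b : E d → ℂ} (ha : Integrable a) (hb : Integrable b) :
    ∫ ω, waveIntegrand κ w μ a b ω ∂waveMeasure d N =
      ∫ q : E d × E d, (∫ t in (2 : ℝ)..N, Complex.exp (μ * Real.log t) *
        𝓕 (waveSymbol κ w t) (q.1 - q.2)) * (a q.1 * conj (b q.2)) := by
  have hint := integrable_waveIntegrand hκ hwi μ N ha hb
  rw [waveMeasure, integral_prod_symm _ hint]
  refine integral_congr_ae (Filter.Eventually.of_forall fun q => ?_)
  simp only
  have h1 : ∀ p : ℝ × E d, waveIntegrand κ w μ a b (p, q) =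
      ((Complex.exp (μ * Real.log p.1) * waveSymbol κ w p.1 p.2) *
        (Real.fourierChar (-⟪p.2, q.1 - q.2⟫) : ℂ)) * (a q.1 * conj (b q.2)) := by
    intro p
    simp only [waveIntegrand, map_mul]
    have : (Real.fourierChar (-⟪p.2, q.1 - q.2⟫) : ℂ) = (Real.fourierChar (-⟪q.1, p.2⟫) : ℂ) *
        conj (Real.fourierChar (-⟪q.2, p.2⟫) : ℂ) := by
      simp only [Real.fourierChar_apply]
      rw [← Complex.exp_conj, ← Complex.exp_add]
      congr 1
      rw [map_mul, Complex.conj_I, Complex.conj_ofReal, inner_sub_right, real_inner_comm p.2,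
        real_inner_comm p.2]
      push_cast
      ring
    rw [this]; ring
  simp only [h1]
  rw [integral_mul_const]
  congr 1
  rw [integral_prod, intervalIntegral.integral_of_le hN]
  · refine integral_congr_ae (Filter.Eventually.of_forall fun t => ?_)
    simp only
    simp only [mul_assoc]
    rw [integral_const_mul, Real.fourier_eq]
    congr 1
    refine integral_congr_ae (Filter.Eventually.of_forall fun ξ => ?_)
    simp only [Circle.smul_def, smul_eq_mul]
    ring
  · refine (integrable_waveSymbol_prod hκ hwi μ N).mul_bdd (c := 1) ?_ ?_
    · refine Continuous.aestronglyMeasurable ?_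
      have := Real.continuous_fourierChar
      fun_prop
    · exact Filter.Eventually.of_forall fun ω => (Circle.norm_coe _).le

/-- The symbol is a Gaussian with complex width κ²(1 + it). The positive factor π/κ² is separated
from the complex power, leaving the dispersive factor (1 + it)^{-d/2}. -/
theorem fourier_waveSymbol {d : ℕ} {κ : ℝ} (hκ : 0 < κ) (w : ℂ) (t : ℝ) (x : E d) :
    𝓕 (waveSymbol κ w t) x = Complex.exp ((d : ℂ) / 2 * Real.log (Real.pi / κ ^ 2)) *
      (((1 + t * I)⁻¹) ^ ((d : ℂ) / 2) * Complex.exp ((1 + t * I) * w) *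
        Complex.exp (-(Real.pi ^ 2 * ‖x‖ ^ 2 / κ ^ 2 : ℝ) / (1 + t * I))) := by
  have hb : 0 < ((κ ^ 2 : ℝ) * (1 + t * I) : ℂ).re := by
    simp only [Complex.mul_re, Complex.ofReal_re, Complex.ofReal_im]
    simp; positivity
  have h1 : (1 + t * I : ℂ) ≠ 0 := by
    intro h; have := congrArg Complex.re h; simp at this
  have hκ' : (κ : ℂ) ≠ 0 := by exact_mod_cast hκ.ne'
  have e : waveSymbol κ w t = fun ξ : E d => Complex.exp ((1 + t * I) * w) •
      Complex.exp (-((κ ^ 2 : ℝ) * (1 + t * I) : ℂ) * ‖ξ‖ ^ 2) := by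
    funext ξ
    rw [waveSymbol, smul_eq_mul, ← Complex.exp_add]
    congr 1
    push_cast; ring
  have e2 : 𝓕 (waveSymbol κ w t) x = Complex.exp ((1 + t * I) * w) •
      𝓕 (fun ξ : E d => Complex.exp (-((κ ^ 2 : ℝ) * (1 + t * I) : ℂ) * ‖ξ‖ ^ 2)) x := by
    rw [e, Real.fourier_eq, Real.fourier_eq, ← integral_smul]
    refine integral_congr_ae (Filter.Eventually.of_forall fun ξ => ?_)
    exact smul_comm _ _ _
  rw [e2, fourier_gaussian_innerProductSpace hb, finrank_euclideanSpace_fin,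
    show (Real.pi / ((κ ^ 2 : ℝ) * (1 + t * I)) : ℂ) = (Real.pi / κ ^ 2 : ℝ) * (1 + t * I)⁻¹ by
      push_cast; field_simp,
    ofReal_mul_cpow (by positivity) (inv_ne_zero h1),
    show (-Real.pi ^ 2 * ‖x‖ ^ 2 / ((κ ^ 2 : ℝ) * (1 + t * I)) : ℂ) =
      -(Real.pi ^ 2 * ‖x‖ ^ 2 / κ ^ 2 : ℝ) / (1 + t * I) by push_cast; field_simp, smul_eq_mul]
  ring

/-- The `L¹` endpoint: the pairing is controlled by the supremum of the kernel. -/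
theorem norm_integral_waveIntegrand_le_of_re_one {d : ℕ} {κ : ℝ} (hκ : 0 < κ) {u₀ u₁ : ℝ} (hu₀ : 0 < u₀)
    {w : ℂ} (hw0 : u₀ ≤ w.re) (hw1 : w.re ≤ u₁) (hwi : 0 ≤ w.im) {μ : ℂ} (hμ : μ.re ≤ ((d : ℝ) - 1) / 2)
    {N : ℝ} (hN : 2 ≤ N) {a b : E d → ℂ} (ha : Integrable a) (hb : Integrable b) :
    ‖∫ ω, waveIntegrand κ w μ a b ω ∂waveMeasure d N‖ ≤
      (Real.pi / κ ^ 2) ^ ((d : ℝ) / 2) *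
        (Real.exp u₁ * (8 * ((1 + 2 * |μ.im| / u₀) + 8 / √u₀) * (1 + d))) *
          ((∫ x, ‖a x‖) * ∫ x, ‖b x‖) := by
  rw [integral_waveIntegrand_eq_kernel hκ hwi μ hN ha hb]
  have hab : Integrable (fun q : E d × E d => ‖a q.1‖ * ‖b q.2‖) (volume.prod volume) :=
    ha.norm.mul_prod hb.norm
  rw [← integral_prod_mul, ← integral_const_mul]
  refine norm_integral_le_of_norm_le (hab.const_mul _) (Filter.Eventually.of_forall fun q => ?_)
  rw [norm_mul, norm_mul, RCLike.norm_conj]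
  gcongr
  have h : ∫ t in (2 : ℝ)..N, Complex.exp (μ * Real.log t) * 𝓕 (waveSymbol κ w t) (q.1 - q.2) =
      Complex.exp ((d : ℂ) / 2 * Real.log (Real.pi / κ ^ 2)) * ∫ t in (2 : ℝ)..N,
        Complex.exp (μ * Real.log t) * ((1 + t * I)⁻¹) ^ ((d : ℂ) / 2) *
      Complex.exp ((1 + t * I) * w) *
        Complex.exp (-(Real.pi ^ 2 * ‖q.1 - q.2‖ ^ 2 / κ ^ 2 : ℝ) / (1 + t * I)) := by
    rw [← intervalIntegral.integral_const_mul]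
    refine intervalIntegral.integral_congr fun t _ => ?_
    simp only [fourier_waveSymbol hκ]
    ring
  rw [h, norm_mul]
  -- The separation of the points enters only through b = π²|q.1 - q.2|²/κ², and the kernel bound is
  -- uniform in b ≥ 0.
  refine mul_le_mul (le_of_eq ?_) (norm_integral_kernel_le d hu₀ hw0 hw1 hwi (by positivity) hμ hN)
    (norm_nonneg _) (by positivity)
  have hp : 0 < Real.pi / κ ^ 2 := by positivity
  rw [Complex.norm_exp, Real.rpow_def_of_pos hp,
    show ((d : ℂ) / 2 * Real.log (Real.pi / κ ^ 2)) =
      ((Real.log (Real.pi / κ ^ 2) * ((d : ℝ) / 2) : ℝ) : ℂ) by push_cast; ring, Complex.ofReal_re]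

/-- Plancherel for the bilinear pairing of two transforms. -/
theorem integral_norm_fourier_mul_le {d : ℕ} {a b : E d → ℂ} (ha : Integrable a) (ha2 : MemLp a 2 volume)
    (hb : Integrable b) (hb2 : MemLp b 2 volume) :
    Integrable (fun ξ => ‖𝓕 a ξ‖ * ‖𝓕 b ξ‖) ∧
    ∫ ξ, ‖𝓕 a ξ‖ * ‖𝓕 b ξ‖ ≤ √(∫ x, ‖a x‖ ^ 2) * √(∫ x, ‖b x‖ ^ 2) := by
  have key : ∀ {c : E d → ℂ}, Integrable c → MemLp c 2 volume →
      MemLp (𝓕 c) 2 volume ∧ ∫ ξ, ‖𝓕 c ξ‖ ^ 2 = ∫ x, ‖c x‖ ^ 2 := by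
    intro c h1 h2
    have hae := fourier_toLp_ae h1 h2
    have hm : MemLp (𝓕 c) 2 volume := (memLp_congr_ae hae).1 (Lp.memLp _)
    refine ⟨hm, ?_⟩
    have hn : ‖(𝓕 (h2.toLp c) : L2 d ℂ)‖ = ‖h2.toLp c‖ := Lp.norm_fourier_eq _
    have e : ∀ g : L2 d ℂ, ∫ x, ‖g x‖ ^ 2 = ‖g‖ ^ 2 := by
      intro g
      have := (L2.inner_def (𝕜 := ℂ) g g)
      rw [inner_self_eq_norm_sq_to_K] at this
      have h3 : ((∫ x, ‖g x‖ ^ 2 : ℝ) : ℂ) = ((‖g‖ ^ 2 : ℝ) : ℂ) := by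
        push_cast
        rw [show ((‖g‖ : ℂ) ^ 2) = _ from this, ← integral_complex_ofReal]
        refine integral_congr_ae (Filter.Eventually.of_forall fun x => ?_)
        simp only [inner_self_eq_norm_sq_to_K]
        push_cast; rfl
      exact_mod_cast h3
    calc ∫ ξ, ‖𝓕 c ξ‖ ^ 2 = ∫ ξ, ‖(𝓕 (h2.toLp c) : L2 d ℂ) ξ‖ ^ 2 := by
          refine integral_congr_ae ?_
          filter_upwards [hae] with x hx
          rw [hx]
      _ = ∫ x, ‖(h2.toLp c) x‖ ^ 2 := by rw [e, e, hn]
      _ = _ := by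
          refine integral_congr_ae ?_
          filter_upwards [h2.coeFn_toLp] with x hx
          rw [hx]
  obtain ⟨ma, ea⟩ := key ha ha2
  obtain ⟨mb, eb⟩ := key hb hb2
  refine ⟨ma.norm.integrable_mul mb.norm, ?_⟩
  have := integral_mul_le_Lp_mul_Lq_of_nonneg (μ := volume) Real.HolderConjugate.two_two
    (Filter.Eventually.of_forall fun ξ => norm_nonneg (𝓕 a ξ))
    (Filter.Eventually.of_forall fun ξ => norm_nonneg (𝓕 b ξ)) (by simpa using ma.norm) (by simpa using mb.norm)
  rw [← ea, ← eb, Real.sqrt_eq_rpow, Real.sqrt_eq_rpow]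
  simpa using this

/-- The `L²` endpoint: the pairing is controlled by the supremum of the symbol. -/
theorem norm_integral_waveIntegrand_le_of_re_zero {d : ℕ} {κ : ℝ} (hκ : 0 < κ) {u₁ : ℝ}
    {w : ℂ} (hw1 : w.re ≤ u₁) (hwi : 0 ≤ w.im) {η : ℝ} (hη : η ≠ 0)
    {N : ℝ} (hN : 2 ≤ N) {a b : E d → ℂ} (ha : Integrable a) (ha2 : MemLp a 2 volume)
    (hb : Integrable b) (hb2 : MemLp b 2 volume) :
    ‖∫ ω, waveIntegrand κ w (-1 + η * I) a b ω ∂waveMeasure d N‖ ≤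
      Real.exp u₁ * (2 / |η| + 4 + |η|) * (√(∫ x, ‖a x‖ ^ 2) * √(∫ x, ‖b x‖ ^ 2)) := by
  rw [integral_waveIntegrand_eq_fourier hκ hwi _ hN ha hb]
  obtain ⟨hi, hle⟩ := integral_norm_fourier_mul_le ha ha2 hb hb2
  have : 0 ≤ Real.exp u₁ * (2 / |η| + 4 + |η|) := by positivity
  calc _ ≤ ∫ ξ, Real.exp u₁ * (2 / |η| + 4 + |η|) * (‖𝓕 a ξ‖ * ‖𝓕 b ξ‖) := by
        refine norm_integral_le_of_norm_le (hi.const_mul _) (Filter.Eventually.of_forall fun ξ => ?_)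
        rw [norm_mul, norm_mul, RCLike.norm_conj]
        gcongr
        -- Subtracting κ²|ξ|² keeps the imaginary part and lowers the real part, so one symbol bound
        -- serves all frequencies.
        have hre : (w - (κ ^ 2 * ‖ξ‖ ^ 2 : ℝ)).re ≤ u₁ := by
          simp only [Complex.sub_re, Complex.ofReal_re]
          have : 0 ≤ κ ^ 2 * ‖ξ‖ ^ 2 := by positivity
          linarith
        exact norm_integral_symbol_le (by simpa only [Complex.sub_im, Complex.ofReal_im, sub_zero] using hwi)
          hre hη hN
    _ ≤ _ := by
        rw [integral_const_mul]
        gcongr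

end

/-! ### Stein interpolation -/

section

open Complex (I)
open scoped ComplexConjugate RealInnerProductSpace

section ExponentialFamily

variable {Ω : Type*} [MeasurableSpace Ω] {ν : Measure Ω} {u : Ω → ℝ} {v : Ω → ℂ} {M : ℝ}

theorem norm_cexp_mul_ofReal_le {ζ : ℂ} {r : ℝ} (hr : |r| ≤ M) :
    ‖Complex.exp (ζ * r)‖ ≤ Real.exp (|ζ.re| * M) := by
  rw [Complex.norm_exp]
  apply Real.exp_le_exp.2
  simp only [Complex.mul_re, Complex.ofReal_re, Complex.ofReal_im, mul_zero, sub_zero]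
  calc ζ.re * r ≤ |ζ.re * r| := le_abs_self _
    _ = |ζ.re| * |r| := abs_mul _ _
    _ ≤ _ := by gcongr

/-- With u bounded and v integrable, differentiation under the integral is dominated locally in ζ.
The analytic family is brought to this form so that holomorphy needs no further argument. -/
theorem differentiable_integral_cexp_mul (hu : Measurable u) (hM : ∀ᵐ ω ∂ν, |u ω| ≤ M)
    (hv : Integrable v ν) : Differentiable ℂ fun ζ : ℂ => ∫ ω, Complex.exp (ζ * u ω) * v ω ∂ν := by
  intro ζ₀
  have hmeas : ∀ ζ : ℂ, AEStronglyMeasurable (fun ω => Complex.exp (ζ * u ω) * v ω) ν := fun ζ =>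
    AEStronglyMeasurable.mul (by fun_prop) hv.1
  refine (hasDerivAt_integral_of_dominated_loc_of_deriv_le (μ := ν)
    (F := fun ζ ω => Complex.exp (ζ * u ω) * v ω) (F' := fun ζ ω => Complex.exp (ζ * u ω) * u ω * v ω)
    (bound := fun ω => Real.exp ((|ζ₀.re| + 1) * M) * M * ‖v ω‖) (Metric.ball_mem_nhds ζ₀ one_pos)
    (Filter.Eventually.of_forall hmeas) ?_ ?_ ?_ (hv.norm.const_mul _) ?_).2.differentiableAt
  · exact hv.bdd_mul (c := Real.exp (|ζ₀.re| * M)) (by fun_prop)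
      (hM.mono fun ω h => norm_cexp_mul_ofReal_le h)
  · exact AEStronglyMeasurable.mul (by fun_prop) hv.1
  · filter_upwards [hM] with ω h ζ hζ
    have hM0 : 0 ≤ M := (abs_nonneg _).trans h
    rw [norm_mul, norm_mul, Complex.norm_real, Real.norm_eq_abs]
    gcongr
    refine (norm_cexp_mul_ofReal_le h).trans ?_
    gcongr
    have h1 : |(ζ - ζ₀).re| ≤ ‖ζ - ζ₀‖ := Complex.abs_re_le_norm _
    have h2 : ‖ζ - ζ₀‖ < 1 := by simpa [dist_eq_norm] using hζ
    have h3 : |ζ.re| ≤ |ζ₀.re| + |(ζ - ζ₀).re| := by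
      have := abs_add_le ζ₀.re (ζ - ζ₀).re
      simpa using this
    linarith
  · filter_upwards with ω ζ _
    have h := (((hasDerivAt_id ζ).mul_const (u ω : ℂ)).cexp).mul_const (v ω)
    simpa using h

theorem norm_integral_cexp_mul_le (hM : ∀ᵐ ω ∂ν, |u ω| ≤ M) (hv : Integrable v ν) (ζ : ℂ) :
    ‖∫ ω, Complex.exp (ζ * u ω) * v ω ∂ν‖ ≤ Real.exp (|ζ.re| * M) * ∫ ω, ‖v ω‖ ∂ν := by
  rw [← integral_const_mul]
  refine norm_integral_le_of_norm_le (hv.norm.const_mul _) (hM.mono fun ω h => ?_)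
  rw [norm_mul]
  gcongr
  exact norm_cexp_mul_ofReal_le h

end ExponentialFamily

/-- The analytic family `sgn f |f|^{p (1 + ζ) / 2}`. -/
def amplitude {d : ℕ} (p : ℝ) (ζ : ℂ) (f : E d → ℂ) (x : E d) : ℂ :=
  f x / ‖f x‖ * Complex.exp (p * (1 + ζ) / 2 * Real.log ‖f x‖)

section Amplitude

variable {d : ℕ} {p : ℝ} {f : E d → ℂ}

theorem norm_amplitude {ζ : ℂ} (h : 0 < p * (1 + ζ.re) / 2) (x : E d) :
    ‖amplitude p ζ f x‖ = ‖f x‖ ^ (p * (1 + ζ.re) / 2) := by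
  rcases eq_or_ne (f x) 0 with h0 | h0
  · rw [amplitude, h0]; simp [Real.zero_rpow h.ne']
  · have hx : 0 < ‖f x‖ := norm_pos_iff.2 h0
    have e : ((p : ℂ) * (1 + ζ) / 2).re = p * (1 + ζ.re) / 2 := by
      rw [show ((p : ℂ) * (1 + ζ) / 2) = ((p / 2 : ℝ) : ℂ) * (1 + ζ) by push_cast; ring,
        Complex.re_ofReal_mul, Complex.add_re, Complex.one_re]
      ring
    rw [amplitude, norm_mul, norm_div, Complex.norm_real, norm_norm, div_self hx.ne', one_mul,
      Complex.norm_exp, Complex.re_mul_ofReal, e, Real.rpow_def_of_pos hx, mul_comm]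

theorem amplitude_eq_self {ζ : ℂ} (h : (p : ℂ) * (1 + ζ) = 2) : amplitude p ζ f = f := by
  funext x
  rcases eq_or_ne (f x) 0 with h0 | h0
  · simp [amplitude, h0]
  · have hx : 0 < ‖f x‖ := norm_pos_iff.2 h0
    have hx' : (‖f x‖ : ℂ) ≠ 0 := by exact_mod_cast hx.ne'
    rw [amplitude, h, div_self two_ne_zero, one_mul, ← Complex.ofReal_exp, Real.exp_log hx]
    field_simp

theorem amplitude_eq_mul (ζ : ℂ) (x : E d) : amplitude p ζ f x =
    Complex.exp (ζ * (p / 2 * Real.log ‖f x‖ : ℝ)) * amplitude p 0 f x := by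
  rw [amplitude, amplitude, mul_left_comm, ← Complex.exp_add]
  congr 2
  push_cast; ring

theorem memLp_amplitude {S : Set (E d)} (hS : MeasurableSet S) (hS' : volume S < ∞) (hf : Measurable f)
    (h0 : ∀ x ∉ S, f x = 0) {L : ℝ} (hL : ∀ x, |Real.log ‖f x‖| ≤ L) (p : ℝ) (ζ : ℂ) (q : ℝ≥0∞) :
    MemLp (amplitude p ζ f) q volume := by
  refine memLp_of_bound_of_support hS hS' (C := Real.exp (|(p * (1 + ζ) / 2 : ℂ).re| * L)) ?_ ?_ ?_ q
  · unfold amplitude; fun_prop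
  · intro x _
    rw [amplitude, norm_mul, norm_div, Complex.norm_real, norm_norm]
    refine (mul_le_of_le_one_left (norm_nonneg _) (div_self_le_one _)).trans ?_
    exact norm_cexp_mul_ofReal_le (hL x)
  · intro x hx
    simp [amplitude, h0 x hx]

end Amplitude

theorem abs_mul_exp_neg_sq_le (y : ℝ) : |y| * Real.exp (-y ^ 2) ≤ 1 := by
  rw [Real.exp_neg, ← div_eq_mul_inv, div_le_one (Real.exp_pos _)]
  have := Real.add_one_le_exp (y ^ 2)
  nlinarith [sq_nonneg (|y| - 1), sq_abs y]

theorem sq_mul_exp_neg_sq_le (y : ℝ) : y ^ 2 * Real.exp (-y ^ 2) ≤ 1 := by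
  rw [Real.exp_neg, ← div_eq_mul_inv, div_le_one (Real.exp_pos _)]
  have := Real.add_one_le_exp (y ^ 2)
  linarith

/-- The constant on the `L²` line. -/
def lineConstZero (d : ℕ) (u₁ : ℝ) : ℝ := Real.exp u₁ * (7 + d)

/-- The constant on the `L¹` line. -/
def lineConstOne (d : ℕ) (u₀ u₁ : ℝ) : ℝ :=
  Real.exp 1 * (Real.pi ^ ((d : ℝ) / 2) *
    (Real.exp u₁ * (8 * (2 * (1 + 2 * (d + 1) / u₀ + 8 / √u₀)) * (1 + d))))

/-- The constant in the interpolated bound for the truncated resolvent symbols. -/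
def steinConst (d : ℕ) (u₀ u₁ : ℝ) : ℝ :=
  (d + 1) * (max 1 (lineConstZero d u₁) * max 1 (lineConstOne d u₀ u₁))

theorem norm_cexp_sq (x y : ℝ) : ‖Complex.exp ((x + y * I) ^ 2)‖ = Real.exp (x ^ 2) * Real.exp (-y ^ 2) := by
  rw [Complex.norm_exp, ← Real.exp_add]
  congr 1
  rw [show ((x + y * I : ℂ)) ^ 2 = ((x ^ 2 + -y ^ 2 : ℝ) : ℂ) + (2 * x * y : ℝ) * I by
    push_cast; ring_nf; rw [Complex.I_sq]; ring]
  simp only [Complex.add_re, Complex.ofReal_re, Complex.re_ofReal_mul, Complex.I_re, mul_zero, add_zero]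

section Stein

variable {d : ℕ} {κ : ℝ} {u₀ u₁ : ℝ} {w : ℂ} {N θ p : ℝ} {f h : E d → ℂ} {S S' : Set (E d)} {L : ℝ}

/-- All dependence on ζ sits in exp(ζu) with u real. The second amplitude carries the conjugate of ζ
because the pairing conjugates it back. -/
theorem waveIntegrand_amplitude_eq (p θ : ℝ) (ζ : ℂ) (ω : (ℝ × E d) × (E d × E d)) :
    waveIntegrand κ w (-1 + ζ / θ) (amplitude p ζ f) (amplitude p (conj ζ) h) ω =
      Complex.exp (ζ * (Real.log ω.1.1 / θ + p / 2 * Real.log ‖f ω.2.1‖ +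
        p / 2 * Real.log ‖h ω.2.2‖ : ℝ)) *
        waveIntegrand κ w (-1) (amplitude p 0 f) (amplitude p 0 h) ω := by
  have e1 : Complex.exp (ζ * (Real.log ω.1.1 / θ + p / 2 * Real.log ‖f ω.2.1‖ +
        p / 2 * Real.log ‖h ω.2.2‖ : ℝ)) = Complex.exp (ζ / θ * Real.log ω.1.1) *
          Complex.exp (ζ * (p / 2 * Real.log ‖f ω.2.1‖ : ℝ)) *
          Complex.exp (ζ * (p / 2 * Real.log ‖h ω.2.2‖ : ℝ)) := by
    rw [← Complex.exp_add, ← Complex.exp_add]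
    congr 1
    push_cast; ring
  have e2 : conj (Complex.exp (conj ζ * (p / 2 * Real.log ‖h ω.2.2‖ : ℝ))) =
      Complex.exp (ζ * (p / 2 * Real.log ‖h ω.2.2‖ : ℝ)) := by
    rw [← Complex.exp_conj, map_mul, Complex.conj_conj, Complex.conj_ofReal]
  have e3 : Complex.exp ((-1 + ζ / θ) * Real.log ω.1.1) =
      Complex.exp (-1 * Real.log ω.1.1) * Complex.exp (ζ / θ * Real.log ω.1.1) := by
    rw [← Complex.exp_add, add_mul]
  simp only [waveIntegrand]
  rw [amplitude_eq_mul ζ, amplitude_eq_mul (conj ζ), map_mul, map_mul, map_mul, e2, e1, e3]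
  ring

set_option maxHeartbeats 1600000 in
/-- Stein interpolation for functions with bounded logarithm supported on sets of finite measure. -/
theorem norm_integral_truncSymbol_le_of_log_le (hκ : 0 < κ) (hu₀ : 0 < u₀) (hw0 : u₀ ≤ w.re)
    (hw1 : w.re ≤ u₁) (hwi : 0 ≤ w.im) (hN : 2 ≤ N) (hθ0 : 2 / ((d : ℝ) + 1) ≤ θ) (hθ1 : θ ≤ 1)
    (hp : p * (1 + θ) = 2)
    (hS : MeasurableSet S) (hS' : volume S < ∞) (hf : Measurable f) (hf0 : ∀ x ∉ S, f x = 0)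
    (hfL : ∀ x, |Real.log ‖f x‖| ≤ L)
    (hT : MeasurableSet S') (hT' : volume S' < ∞) (hh : Measurable h) (hh0 : ∀ x ∉ S', h x = 0)
    (hhL : ∀ x, |Real.log ‖h x‖| ≤ L) :
    ‖∫ ξ, truncSymbol κ w 0 N ξ * (𝓕 f ξ * conj (𝓕 h ξ))‖ ≤
      steinConst d u₀ u₁ * κ ^ (-(d * θ)) *
        (∫ x, ‖f x‖ ^ p) ^ (1 / p) * (∫ x, ‖h x‖ ^ p) ^ (1 / p) := by
  have hd1 : (0 : ℝ) < (d : ℝ) + 1 := by positivity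
  have hθ : 0 < θ := lt_of_lt_of_le (by positivity) hθ0
  have hθinv : 1 / θ ≤ ((d : ℝ) + 1) / 2 := by
    rw [div_le_iff₀ hθ]; rw [div_le_iff₀ hd1] at hθ0; linarith
  have hp0 : 0 < p := by
    by_contra hc
    have : p * (1 + θ) ≤ 0 := mul_nonpos_of_nonpos_of_nonneg (not_lt.1 hc) (by linarith)
    linarith
  set A := ∫ x, ‖f x‖ ^ p with hA
  set B := ∫ x, ‖h x‖ ^ p with hB
  have hA0 : 0 ≤ A := integral_nonneg fun x => by positivity
  have hB0 : 0 ≤ B := integral_nonneg fun x => by positivity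
  have mf := fun ζ q => memLp_amplitude hS hS' hf hf0 hfL p ζ q
  have mh := fun ζ q => memLp_amplitude hT hT' hh hh0 hhL p ζ q
  have jf := fun ζ => memLp_one_iff_integrable.1 (mf ζ 1)
  have jh := fun ζ => memLp_one_iff_integrable.1 (mh ζ 1)
  -- The density exponent is μ = -1 + ζ/θ: real part -1 on the L² line, 1/θ - 1 ≤ (d-1)/2 on the L¹
  -- line since θ ≥ 2/(d+1), and μ = 0 at ζ = θ. Correspondingly the amplitudes are of size
  -- |f|^{p/2}, of size |f|^p, and equal to f.
  set Φ : ℂ → ℂ := fun ζ => ∫ ω, waveIntegrand κ w (-1 + ζ / θ) (amplitude p ζ f)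
    (amplitude p (conj ζ) h) ω ∂waveMeasure d N with hΦ
  set u : (ℝ × E d) × (E d × E d) → ℝ := fun ω => Real.log ω.1.1 / θ + p / 2 * Real.log ‖f ω.2.1‖ +
    p / 2 * Real.log ‖h ω.2.2‖ with hu
  set v := waveIntegrand κ w (-1) (amplitude p 0 f) (amplitude p 0 h) with hv
  have hΦ' : Φ = fun ζ => ∫ ω, Complex.exp (ζ * u ω) * v ω ∂waveMeasure d N := by
    funext ζ
    exact integral_congr_ae (Filter.Eventually.of_forall fun ω => waveIntegrand_amplitude_eq p θ ζ ω)
  have hvi : Integrable v (waveMeasure d N) := integrable_waveIntegrand hκ hwi _ N (jf 0) (jh 0)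
  have hum : Measurable u := by rw [hu]; fun_prop
  set M := Real.log N / θ + p / 2 * L + p / 2 * L with hM
  have huM : ∀ᵐ ω ∂waveMeasure d N, |u ω| ≤ M := by
    have h1 : ∀ᵐ t ∂((volume : Measure ℝ).restrict (Set.Ioc 2 N)), |Real.log t / θ| ≤ Real.log N / θ := by
      filter_upwards [ae_restrict_mem measurableSet_Ioc] with t ht
      rw [abs_div, abs_of_pos hθ, abs_of_nonneg (Real.log_nonneg (by linarith [ht.1]))]
      gcongr
      · linarith [ht.1]
      · exact ht.2
    have h2 : ∀ᵐ ω ∂waveMeasure d N, |Real.log ω.1.1 / θ| ≤ Real.log N / θ :=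
      Measure.quasiMeasurePreserving_fst.ae (Measure.quasiMeasurePreserving_fst.ae h1)
    filter_upwards [h2] with ω hω
    rw [hu, hM]
    refine (abs_add_le _ _).trans (add_le_add ((abs_add_le _ _).trans (add_le_add hω ?_)) ?_)
    · rw [abs_mul, abs_of_pos (by positivity : 0 < p / 2)]; gcongr; exact hfL _
    · rw [abs_mul, abs_of_pos (by positivity : 0 < p / 2)]; gcongr; exact hhL _
  have hΦd : Differentiable ℂ Φ := by
    rw [hΦ']; exact differentiable_integral_cexp_mul hum huM hvi
  -- The factor ζ cancels the singularity 2/|η| of the L² bound at ζ = 0, and exp(ζ²) absorbs the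
  -- linear growth in Im ζ on both lines.
  set F : ℂ → ℂ := fun ζ => ζ * Complex.exp (ζ ^ 2) * Φ ζ with hF
  have hFd : Differentiable ℂ F := by
    rw [hF]; fun_prop
  have hM0 : 0 ≤ M := by
    have : 0 ≤ L := (abs_nonneg _).trans (hfL 0)
    have : 0 ≤ Real.log N := Real.log_nonneg (by linarith)
    positivity
  have hdecomp : ∀ ζ : ℂ, ζ = ζ.re + ζ.im * I := fun ζ => (Complex.re_add_im ζ).symm
  have hFb : BddAbove ((norm ∘ F) '' Complex.HadamardThreeLines.verticalClosedStrip 0 1) := by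
    refine ⟨2 * Real.exp 1 * (Real.exp M * ∫ ω, ‖v ω‖ ∂waveMeasure d N), ?_⟩
    rintro _ ⟨ζ, hζ, rfl⟩
    have hx0 : 0 ≤ ζ.re := hζ.1
    have hx1 : ζ.re ≤ 1 := hζ.2
    have h1 : ‖ζ * Complex.exp (ζ ^ 2)‖ ≤ 2 * Real.exp 1 := by
      have h2 : ‖Complex.exp (ζ ^ 2)‖ = Real.exp (ζ.re ^ 2) * Real.exp (-ζ.im ^ 2) := by
        conv_lhs => rw [hdecomp ζ]
        exact norm_cexp_sq _ _
      have h3 : ‖ζ‖ ≤ 1 + |ζ.im| := by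
        refine (Complex.norm_le_abs_re_add_abs_im ζ).trans ?_
        rw [abs_of_nonneg hx0]; linarith
      have h4 : Real.exp (ζ.re ^ 2) ≤ Real.exp 1 := Real.exp_le_exp.2 (by nlinarith)
      have h5 : Real.exp (-ζ.im ^ 2) ≤ 1 := Real.exp_le_one_iff.2 (by nlinarith)
      rw [norm_mul, h2]
      calc ‖ζ‖ * (Real.exp (ζ.re ^ 2) * Real.exp (-ζ.im ^ 2))
          ≤ (1 + |ζ.im|) * (Real.exp 1 * Real.exp (-ζ.im ^ 2)) := by gcongr
        _ = Real.exp 1 * (Real.exp (-ζ.im ^ 2) + |ζ.im| * Real.exp (-ζ.im ^ 2)) := by ring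
        _ ≤ Real.exp 1 * (1 + 1) := by
          gcongr
          exact abs_mul_exp_neg_sq_le _
        _ = _ := by ring
    have h6 : ‖Φ ζ‖ ≤ Real.exp M * ∫ ω, ‖v ω‖ ∂waveMeasure d N := by
      rw [hΦ']
      refine (norm_integral_cexp_mul_le huM hvi ζ).trans ?_
      have : 0 ≤ ∫ ω, ‖v ω‖ ∂waveMeasure d N := integral_nonneg fun _ => norm_nonneg _
      gcongr
      rw [abs_of_nonneg hx0]
      exact mul_le_of_le_one_left hM0 hx1
    simp only [Function.comp_apply, hF]
    rw [norm_mul]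
    exact mul_le_mul h1 h6 (norm_nonneg _) (by positivity)
  have hline0 : ∀ ζ ∈ Complex.re ⁻¹' {(0 : ℝ)}, ‖F ζ‖ ≤ lineConstZero d u₁ * (√A * √B) := by
    intro ζ hζ
    have hre : ζ.re = 0 := hζ
    rcases eq_or_ne ζ.im 0 with hi | hi
    · have : ζ = 0 := Complex.ext hre hi
      rw [this, hF]
      simp only [zero_mul, norm_zero]
      unfold lineConstZero; positivity
    set y := ζ.im with hy
    have hζ' : ζ = y * I := by rw [hdecomp ζ, hre]; simp [hy]
    have hη : y / θ ≠ 0 := div_ne_zero hi hθ.ne'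
    have hb := norm_integral_waveIntegrand_le_of_re_zero hκ hw1 hwi hη hN (jf ζ) (mf ζ 2)
      (jh (conj ζ)) (mh (conj ζ) 2)
    have hsq : ∀ {g : E d → ℂ} {ζ' : ℂ}, ζ'.re = 0 → ∫ x, ‖amplitude p ζ' g x‖ ^ 2 = ∫ x, ‖g x‖ ^ p := by
      intro g ζ' h'
      refine integral_congr_ae (Filter.Eventually.of_forall fun x => ?_)
      simp only
      rw [norm_amplitude (by rw [h']; linarith), ← Real.rpow_natCast, ← Real.rpow_mul (norm_nonneg _), h']
      congr 1
      push_cast; ring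
    rw [hsq hre, hsq (by simpa using hre)] at hb
    have hΦb : ‖Φ ζ‖ ≤ Real.exp u₁ * (2 / |y / θ| + 4 + |y / θ|) * (√A * √B) := by
      rw [hΦ]
      simp only
      rw [show (-1 + ζ / θ : ℂ) = -1 + (y / θ : ℝ) * I by rw [hζ']; push_cast; ring]
      exact hb
    have h2 : ‖Complex.exp (ζ ^ 2)‖ = Real.exp (-y ^ 2) := by
      have := norm_cexp_sq 0 y
      rw [hζ']
      simpa using this
    have hny : ‖ζ‖ = |y| := by rw [hζ']; simp
    have hy0 : 0 < |y| := abs_pos.2 hi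
    rw [hF]
    simp only
    rw [norm_mul, norm_mul, h2, hny]
    calc |y| * Real.exp (-y ^ 2) * ‖Φ ζ‖
        ≤ |y| * Real.exp (-y ^ 2) * (Real.exp u₁ * (2 / |y / θ| + 4 + |y / θ|) * (√A * √B)) := by gcongr
      _ = Real.exp u₁ * (2 * θ * Real.exp (-y ^ 2) + 4 * (|y| * Real.exp (-y ^ 2)) +
          1 / θ * (y ^ 2 * Real.exp (-y ^ 2))) * (√A * √B) := by
          rw [abs_div, abs_of_pos hθ, ← sq_abs y]; field_simp
      _ ≤ Real.exp u₁ * (2 * 1 * 1 + 4 * 1 + ((d : ℝ) + 1) / 2 * 1) * (√A * √B) := by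
          gcongr
          · exact Real.exp_le_one_iff.2 (by nlinarith)
          · exact abs_mul_exp_neg_sq_le _
          · exact sq_mul_exp_neg_sq_le _
      _ ≤ _ := by
          have hd0 : (0 : ℝ) ≤ d := by positivity
          rw [lineConstZero]
          refine mul_le_mul_of_nonneg_right (mul_le_mul_of_nonneg_left ?_ (Real.exp_pos _).le) (by positivity)
          linarith
  -- The scale enters only through the L¹ endpoint, as κ^{-d}; interpolation raises it to the power
  -- θ.
  have hpid : (Real.pi / κ ^ 2) ^ ((d : ℝ) / 2) = Real.pi ^ ((d : ℝ) / 2) * κ ^ (-(d : ℝ)) := by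
    rw [Real.div_rpow Real.pi_pos.le (by positivity), ← Real.rpow_natCast κ 2, ← Real.rpow_mul hκ.le,
      Real.rpow_neg hκ.le, div_eq_mul_inv]
    congr 3
    push_cast; ring
  have hline1 : ∀ ζ ∈ Complex.re ⁻¹' {(1 : ℝ)}, ‖F ζ‖ ≤
      lineConstOne d u₀ u₁ * κ ^ (-(d : ℝ)) * (A * B) := by
    intro ζ hζ
    have hre : ζ.re = 1 := hζ
    set y := ζ.im with hy
    have hζ' : ζ = 1 + y * I := by rw [hdecomp ζ, hre]; simp [hy]
    have hμ : (-1 + ζ / θ : ℂ) = ((-1 + 1 / θ : ℝ) : ℂ) + (y / θ : ℝ) * I := by rw [hζ']; push_cast; ring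
    have hμre : (-1 + ζ / θ : ℂ).re = -1 + 1 / θ := by rw [hμ]; simp [-Complex.ofReal_div]
    have hμim : (-1 + ζ / θ : ℂ).im = y / θ := by rw [hμ]; simp [-Complex.ofReal_div, -Complex.ofReal_add]
    have hb := norm_integral_waveIntegrand_le_of_re_one hκ hu₀ hw0 hw1 hwi (μ := -1 + ζ / θ)
      (by rw [hμre]; linarith) hN (jf ζ) (jh (conj ζ))
    have hsq : ∀ {g : E d → ℂ} {ζ' : ℂ}, ζ'.re = 1 → ∫ x, ‖amplitude p ζ' g x‖ = ∫ x, ‖g x‖ ^ p := by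
      intro g ζ' h'
      refine integral_congr_ae (Filter.Eventually.of_forall fun x => ?_)
      simp only
      rw [norm_amplitude (by rw [h']; linarith), h']
      congr 1
      ring
    rw [hsq hre, hsq (by simpa using hre), hμim, hpid] at hb
    have h2 : ‖Complex.exp (ζ ^ 2)‖ = Real.exp 1 * Real.exp (-y ^ 2) := by
      have := norm_cexp_sq 1 y
      rw [hζ']
      simpa using this
    have hny : ‖ζ‖ ≤ 1 + |y| := by
      refine (Complex.norm_le_abs_re_add_abs_im ζ).trans ?_
      rw [hre, abs_one]
    have hyθ : |y / θ| ≤ (d + 1) * |y| := by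
      rw [abs_div, abs_of_pos hθ, div_eq_mul_one_div, mul_comm]
      gcongr
      linarith
    have he1 : Real.exp (-y ^ 2) ≤ 1 := Real.exp_le_one_iff.2 (by nlinarith)
    have he2 := abs_mul_exp_neg_sq_le y
    have he3 := sq_mul_exp_neg_sq_le y
    have hpow : 0 < κ ^ (-(d : ℝ)) := by positivity
    rw [hF]
    simp only
    rw [norm_mul, norm_mul, h2]
    set c := 2 * ((d : ℝ) + 1) / u₀ with hc
    have hc0 : 0 ≤ c := by positivity
    calc ‖ζ‖ * (Real.exp 1 * Real.exp (-y ^ 2)) * ‖Φ ζ‖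
        ≤ (1 + |y|) * (Real.exp 1 * Real.exp (-y ^ 2)) * (Real.pi ^ ((d : ℝ) / 2) * κ ^ (-(d : ℝ)) *
        (Real.exp u₁ * (8 * ((1 + 2 * ((d + 1) * |y|) / u₀) + 8 / √u₀) * (1 + d))) * (A * B)) := by
          gcongr
          refine hb.trans ?_
          gcongr
      _ = Real.exp 1 * (Real.pi ^ ((d : ℝ) / 2) * (Real.exp u₁ * (8 *
          ((1 + 8 / √u₀) * (Real.exp (-y ^ 2) + |y| * Real.exp (-y ^ 2)) +
            c * (|y| * Real.exp (-y ^ 2) + y ^ 2 * Real.exp (-y ^ 2)))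
          * (1 + d)))) * κ ^ (-(d : ℝ)) * (A * B) := by rw [← sq_abs y, hc]; ring
      _ ≤ Real.exp 1 * (Real.pi ^ ((d : ℝ) / 2) * (Real.exp u₁ * (8 *
          ((1 + 8 / √u₀) * (1 + 1) + c * (1 + 1))
          * (1 + d)))) * κ ^ (-(d : ℝ)) * (A * B) := by gcongr
      _ = _ := by rw [lineConstOne, ← hc]; ring
  have hthree := Complex.HadamardThreeLines.norm_le_interp_of_mem_verticalClosedStrip₀₁' F (z := (θ : ℂ))
    ⟨by simpa using hθ.le, by simpa using hθ1⟩ hFd.diffContOnCl hFb hline0 hline1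
  rw [Complex.ofReal_re] at hthree
  have hΦθ : Φ θ = ∫ ξ, truncSymbol κ w 0 N ξ * (𝓕 f ξ * conj (𝓕 h ξ)) := by
    have hpθ : (p : ℂ) * (1 + (θ : ℂ)) = 2 := by exact_mod_cast congrArg (fun r : ℝ => (r : ℂ)) hp
    have hθ' : (θ : ℂ) ≠ 0 := by exact_mod_cast hθ.ne'
    rw [hΦ]
    simp only
    rw [Complex.conj_ofReal, amplitude_eq_self hpθ, amplitude_eq_self hpθ, div_self hθ', neg_add_cancel]
    have j1 := jf θ
    have j2 := jh θ
    rw [amplitude_eq_self hpθ] at j1 j2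
    exact integral_waveIntegrand_eq_fourier hκ hwi 0 hN j1 j2
  rw [← hΦθ]
  -- Undoing the auxiliary factor costs at most 1/θ, and (d + 1)θ ≥ 2.
  have hFθ : ‖Φ θ‖ ≤ (d + 1) * ‖F θ‖ := by
    rw [hF]
    simp only
    rw [norm_mul, norm_mul, Complex.norm_real, Real.norm_eq_abs, abs_of_pos hθ]
    have h1 : 1 ≤ ‖Complex.exp ((θ : ℂ) ^ 2)‖ := by
      rw [Complex.norm_exp, ← Complex.ofReal_pow, Complex.ofReal_re]
      exact Real.one_le_exp (by positivity)
    have h2 : 1 ≤ ((d : ℝ) + 1) * θ := by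
      rw [div_le_iff₀ hd1] at hθ0; linarith
    calc ‖Φ θ‖ = 1 * 1 * ‖Φ θ‖ := by ring
      _ ≤ ((d + 1) * θ) * ‖Complex.exp ((θ : ℂ) ^ 2)‖ * ‖Φ θ‖ := by gcongr
      _ = _ := by ring
  refine hFθ.trans ((mul_le_mul_of_nonneg_left hthree hd1.le).trans ?_)
  have hC0 : 0 ≤ lineConstZero d u₁ := by unfold lineConstZero; positivity
  have hC1 : 0 ≤ lineConstOne d u₀ u₁ := by unfold lineConstOne; positivity
  -- This removes θ from the constants, so the bound is uniform in p.
  have hmax : ∀ {c r : ℝ}, 0 ≤ c → 0 ≤ r → r ≤ 1 → c ^ r ≤ max 1 c := by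
    intro c r hc hr hr1
    calc c ^ r ≤ (max 1 c) ^ r := Real.rpow_le_rpow hc (le_max_right _ _) hr
      _ ≤ (max 1 c) ^ (1 : ℝ) := Real.rpow_le_rpow_of_exponent_le (le_max_left _ _) hr1
      _ = _ := Real.rpow_one _
  -- The exponents add up to (1 - θ)/2 + θ = (1 + θ)/2 = 1/p.
  have hAB : ∀ {X : ℝ}, 0 ≤ X → (√X) ^ (1 - θ) * X ^ θ = X ^ (1 / p) := by
    intro X hX
    have hexp : 1 / p = 1 / 2 * (1 - θ) + θ := by
      rw [div_eq_iff hp0.ne']; linarith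
    rw [Real.sqrt_eq_rpow, ← Real.rpow_mul hX, hexp,
      Real.rpow_add_of_nonneg hX (by nlinarith) hθ.le]
  calc ((d : ℝ) + 1) * ((lineConstZero d u₁ * (√A * √B)) ^ (1 - θ) *
        (lineConstOne d u₀ u₁ * κ ^ (-(d : ℝ)) * (A * B)) ^ θ)
      = (d + 1) * (lineConstZero d u₁ ^ (1 - θ) * lineConstOne d u₀ u₁ ^ θ) * κ ^ (-(d * θ)) *
        ((√A) ^ (1 - θ) * A ^ θ) * ((√B) ^ (1 - θ) * B ^ θ) := by
        rw [Real.mul_rpow hC0 (by positivity), Real.mul_rpow (Real.sqrt_nonneg _) (Real.sqrt_nonneg _),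
          Real.mul_rpow (by positivity) (by positivity), Real.mul_rpow hC1 (by positivity),
          Real.mul_rpow hA0 hB0, ← Real.rpow_mul hκ.le, neg_mul]
        ring
    _ ≤ (d + 1) * (max 1 (lineConstZero d u₁) * max 1 (lineConstOne d u₀ u₁)) * κ ^ (-(d * θ)) *
        ((√A) ^ (1 - θ) * A ^ θ) * ((√B) ^ (1 - θ) * B ^ θ) := by
        gcongr
        · exact hmax hC0 (by linarith) (by linarith)
        · exact hmax hC1 hθ.le hθ1
    _ = _ := by rw [hAB hA0, hAB hB0, steinConst]

end Stein

end

/-! ### Bilinear bounds: density, translations and limits -/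

section

open Complex (I)
open scoped ComplexConjugate RealInnerProductSpace Topology

/-- The multiplier `m` defines a bilinear form on `L¹ ∩ L²` bounded by `C ‖f‖_p ‖h‖_p`. -/
def BilinearBound {d : ℕ} (m : E d → ℂ) (p C : ℝ) : Prop :=
  ∀ f h : E d → ℂ, MemLp f 1 volume → MemLp f 2 volume → MemLp h 1 volume → MemLp h 2 volume →
    ‖∫ ξ, m ξ * (𝓕 f ξ * conj (𝓕 h ξ))‖ ≤
      C * ((eLpNorm f (.ofReal p) volume).toReal * (eLpNorm h (.ofReal p) volume).toReal)

section Basic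

variable {d : ℕ}

theorem fourier_congr_ae {f g : E d → ℂ} (h : f =ᵐ[volume] g) : 𝓕 f = 𝓕 g := by
  funext ξ
  rw [Real.fourier_eq, Real.fourier_eq]
  refine integral_congr_ae ?_
  filter_upwards [h] with x hx
  rw [hx]

theorem continuous_fourier {f : E d → ℂ} (hf : Integrable f) : Continuous (𝓕 f) :=
  VectorFourier.fourierIntegral_continuous Real.continuous_fourierChar continuous_inner hf

theorem tendsto_fourier_indicator_band {f : E d → ℂ} (hfm : Measurable f) (hf : Integrable f) (ξ : E d) :
    Filter.Tendsto (fun n => 𝓕 ((band f n).indicator f) ξ) Filter.atTop (𝓝 (𝓕 f ξ)) := by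
  simp only [Real.fourier_eq]
  refine tendsto_integral_of_dominated_convergence (fun x => ‖f x‖) (fun n => ?_) hf.norm (fun n => ?_) ?_
  · simp only [Circle.smul_def, smul_eq_mul]
    have h1 : Continuous fun v : E d => (Real.fourierChar (-⟪v, ξ⟫) : ℂ) := by
      have := Real.continuous_fourierChar
      fun_prop
    exact (h1.measurable.mul (hfm.indicator (measurableSet_band hfm n))).aestronglyMeasurable
  · filter_upwards with x
    rw [Circle.norm_smul]
    exact norm_indicator_le_norm_self _ _
  · filter_upwards with x
    refine Filter.Tendsto.const_smul ?_ _
    rcases eq_or_ne (f x) 0 with h0 | h0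
    · simp [Set.indicator, h0]
    · have hx : x ∈ ⋃ n, band f n := by rw [iUnion_band]; exact h0
      obtain ⟨n, hn⟩ := Set.mem_iUnion.1 hx
      refine tendsto_const_nhds.congr' ?_
      filter_upwards [Filter.eventually_ge_atTop n] with m hm
      rw [Set.indicator_of_mem (band_mono f hm hn)]

theorem integrable_norm_rpow {f : E d → ℂ} (h1 : MemLp f 1 volume) (h2 : MemLp f 2 volume) {p : ℝ}
    (hp1 : 1 ≤ p) (hp2 : p ≤ 2) : Integrable fun x => ‖f x‖ ^ p := by
  have i1 := (memLp_one_iff_integrable.1 h1).norm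
  have i2 : Integrable fun x => ‖f x‖ ^ 2 := h2.integrable_norm_pow (by norm_num)
  refine (i1.add i2).mono' (h1.1.norm.aemeasurable.pow_const p).aestronglyMeasurable
    (Filter.Eventually.of_forall fun x => ?_)
  have hx := norm_nonneg (f x)
  rw [Real.norm_of_nonneg (by positivity)]
  simp only [Pi.add_apply]
  rcases le_total ‖f x‖ 1 with h | h
  · have : ‖f x‖ ^ p ≤ ‖f x‖ ^ (1 : ℝ) := Real.rpow_le_rpow_of_exponent_ge' hx h (by norm_num) hp1
    rw [Real.rpow_one] at this
    linarith [sq_nonneg ‖f x‖]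
  · have : ‖f x‖ ^ p ≤ ‖f x‖ ^ (2 : ℝ) := Real.rpow_le_rpow_of_exponent_le h hp2
    rw [Real.rpow_two] at this
    linarith

/-- Off the band the value is `Real.log 0 = 0`, so the bound holds at every point, as the
interpolation of bounded logarithms requires. -/
theorem abs_log_norm_indicator_band_le (f : E d → ℂ) (n : ℕ) (x : E d) :
    |Real.log ‖(band f n).indicator f x‖| ≤ Real.log (n + 1) := by
  have hn : (0 : ℝ) < (n : ℝ) + 1 := by positivity
  have h0 : 0 ≤ Real.log ((n : ℝ) + 1) := Real.log_nonneg (by linarith [n.cast_nonneg (α := ℝ)])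
  by_cases hx : x ∈ band f n
  · rw [Set.indicator_of_mem hx, abs_le]
    have hpos : 0 < ‖f x‖ := lt_of_lt_of_le (by positivity) hx.1
    constructor
    · rw [← Real.log_inv, ← one_div]
      exact Real.log_le_log (by positivity) hx.1
    · exact Real.log_le_log hpos hx.2
  · simpa [Set.indicator_of_notMem hx] using h0

end Basic

theorem integrable_truncSymbol {d : ℕ} {κ : ℝ} (hκ : 0 < κ) {w : ℂ} (hwi : 0 ≤ w.im) (μ : ℂ) {N : ℝ}
    (hN : 2 ≤ N) : Integrable (truncSymbol (d := d) κ w μ N) := by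
  have h := (integrable_waveSymbol_prod (d := d) hκ hwi μ N).integral_prod_right
  refine h.congr (Filter.Eventually.of_forall fun ξ => ?_)
  rw [truncSymbol, intervalIntegral.integral_of_le hN]

/-- The truncated resolvent symbols define uniformly bounded bilinear forms. -/
theorem bilinearBound_truncSymbol {d : ℕ} {κ : ℝ} {u₀ u₁ : ℝ} {w : ℂ} {N θ p : ℝ}
    (hκ : 0 < κ) (hu₀ : 0 < u₀) (hw0 : u₀ ≤ w.re)
    (hw1 : w.re ≤ u₁) (hwi : 0 ≤ w.im) (hN : 2 ≤ N) (hθ0 : 2 / ((d : ℝ) + 1) ≤ θ) (hθ1 : θ ≤ 1)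
    (hp : p * (1 + θ) = 2) :
    BilinearBound (truncSymbol (d := d) κ w 0 N) p (steinConst d u₀ u₁ * κ ^ (-(d * θ))) := by
  have hθ : 0 < θ := lt_of_lt_of_le (by positivity) hθ0
  have hp1 : 1 ≤ p := by nlinarith
  have hp2 : p ≤ 2 := by nlinarith
  have hp0 : 0 < p := by linarith
  have main : ∀ f h : E d → ℂ, Measurable f → Measurable h → MemLp f 1 volume → MemLp f 2 volume →
      MemLp h 1 volume → MemLp h 2 volume →
      ‖∫ ξ, truncSymbol κ w 0 N ξ * (𝓕 f ξ * conj (𝓕 h ξ))‖ ≤ steinConst d u₀ u₁ * κ ^ (-(d * θ)) *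
      ((eLpNorm f (.ofReal p) volume).toReal * (eLpNorm h (.ofReal p) volume).toReal) := by
    intro f h fm hm f1 f2 h1 h2
    have jf := memLp_one_iff_integrable.1 f1
    have jh := memLp_one_iff_integrable.1 h1
    have pf := integrable_norm_rpow f1 f2 hp1 hp2
    have ph := integrable_norm_rpow h1 h2 hp1 hp2
    rw [toReal_eLpNorm_eq hp0 pf, toReal_eLpNorm_eq hp0 ph]
    have hb : ∀ {g : E d → ℂ} (n : ℕ) (ξ : E d), Integrable g →
        ‖𝓕 ((band g n).indicator g) ξ‖ ≤ ∫ x, ‖g x‖ := by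
      intro g n ξ hg
      refine (norm_fourier_le _ _).trans ?_
      refine integral_mono_of_nonneg (Filter.Eventually.of_forall fun x => norm_nonneg _) hg.norm
        (Filter.Eventually.of_forall fun x => norm_indicator_le_norm_self _ _)
    -- The truncated symbol is integrable in ξ and the transforms of the truncations are bounded by
    -- the L¹ norms of f and h, so dominated convergence removes the bands.
    have hlim : Filter.Tendsto (fun n => ∫ ξ, truncSymbol κ w 0 N ξ *
        (𝓕 ((band f n).indicator f) ξ * conj (𝓕 ((band h n).indicator h) ξ))) Filter.atTop
        (𝓝 (∫ ξ, truncSymbol κ w 0 N ξ * (𝓕 f ξ * conj (𝓕 h ξ)))) := by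
      have hT := integrable_truncSymbol (d := d) hκ hwi 0 hN
      refine tendsto_integral_of_dominated_convergence
        (fun ξ => ‖truncSymbol κ w 0 N ξ‖ * ((∫ x, ‖f x‖) * ∫ x, ‖h x‖)) (fun n => ?_)
        (hT.norm.mul_const _) (fun n => ?_) ?_
      · have c1 := continuous_fourier (jf.indicator (measurableSet_band fm n))
        have c2 := continuous_fourier (jh.indicator (measurableSet_band hm n))
        exact hT.1.mul (c1.mul (Complex.continuous_conj.comp c2)).aestronglyMeasurable
      · filter_upwards with ξ
        rw [norm_mul, norm_mul, RCLike.norm_conj]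
        gcongr
        · exact hb n ξ jf
        · exact hb n ξ jh
      · filter_upwards with ξ
        refine ((tendsto_fourier_indicator_band fm jf ξ).mul ?_).const_mul _
        exact (Complex.continuous_conj.tendsto _).comp (tendsto_fourier_indicator_band hm jh ξ)
    refine le_of_tendsto hlim.norm (Filter.Eventually.of_forall fun n => ?_)
    refine (norm_integral_truncSymbol_le_of_log_le hκ hu₀ hw0 hw1 hwi hN hθ0 hθ1 hp
      (measurableSet_band fm n) (volume_band_lt_top f2 n) (fm.indicator (measurableSet_band fm n))
      (fun x hx => Set.indicator_of_notMem hx _) (abs_log_norm_indicator_band_le f n)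
      (measurableSet_band hm n) (volume_band_lt_top h2 n) (hm.indicator (measurableSet_band hm n))
      (fun x hx => Set.indicator_of_notMem hx _) (abs_log_norm_indicator_band_le h n)).trans ?_
    have hmono : ∀ {g : E d → ℂ}, Integrable (fun x => ‖g x‖ ^ p) →
        (∫ x, ‖(band g n).indicator g x‖ ^ p) ^ (1 / p) ≤ (∫ x, ‖g x‖ ^ p) ^ (1 / p) := by
      intro g hg
      refine Real.rpow_le_rpow (integral_nonneg fun x => by positivity) ?_ (by positivity)
      refine integral_mono_of_nonneg (Filter.Eventually.of_forall fun x => by positivity) hg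
        (Filter.Eventually.of_forall fun x => ?_)
      exact Real.rpow_le_rpow (norm_nonneg _) (norm_indicator_le_norm_self _ _) hp0.le
    have hC : 0 ≤ steinConst d u₀ u₁ := by
      unfold steinConst; positivity
    rw [mul_assoc]
    have i0 : ∀ g : E d → ℂ, 0 ≤ (∫ x, ‖g x‖ ^ p) ^ (1 / p) := fun g =>
      Real.rpow_nonneg (integral_nonneg fun x => by positivity) _
    exact mul_le_mul_of_nonneg_left (mul_le_mul (hmono pf) (hmono ph) (i0 _) (i0 _)) (by positivity)
  intro f h f1 f2 h1 h2
  obtain ⟨f', f'm, hf'⟩ := f1.1.aemeasurable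
  obtain ⟨h', h'm, hh'⟩ := h1.1.aemeasurable
  rw [fourier_congr_ae hf', fourier_congr_ae hh', eLpNorm_congr_ae hf', eLpNorm_congr_ae hh']
  exact main f' h' f'm h'm ((memLp_congr_ae hf').1 f1) ((memLp_congr_ae hf').1 f2)
    ((memLp_congr_ae hh').1 h1) ((memLp_congr_ae hh').1 h2)

section BilinearBound

variable {d : ℕ} {m : E d → ℂ} {p C : ℝ}

/-- Conjugating the multiplier amounts to exchanging the two functions. This transfers the estimates
from Im w ≥ 0 to Im w < 0. -/
theorem BilinearBound.conj (h : BilinearBound m p C) : BilinearBound (fun ξ => conj (m ξ)) p C := by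
  intro f g f1 f2 g1 g2
  have e : ∫ ξ, conj (m ξ) * (𝓕 f ξ * conj (𝓕 g ξ)) = conj (∫ ξ, m ξ * (𝓕 g ξ * conj (𝓕 f ξ))) := by
    rw [← integral_conj]
    refine integral_congr_ae (Filter.Eventually.of_forall fun ξ => ?_)
    simp only [map_mul, Complex.conj_conj]
    ring
  rw [e, RCLike.norm_conj, mul_comm (eLpNorm f _ _).toReal]
  exact h g f g1 g2 f1 f2

theorem fourier_comp_sub (f : E d → ℂ) (y ξ : E d) :
    𝓕 (fun x => f (x - y)) ξ = (Real.fourierChar (-⟪y, ξ⟫) : ℂ) * 𝓕 f ξ := by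
  rw [Real.fourier_eq, Real.fourier_eq, ← integral_const_mul]
  rw [← integral_sub_right_eq_self (fun x => (Real.fourierChar (-⟪y, ξ⟫) : ℂ) *
    (Real.fourierChar (-⟪x, ξ⟫) • f x)) y]
  refine integral_congr_ae (Filter.Eventually.of_forall fun x => ?_)
  simp only [Circle.smul_def, smul_eq_mul, ← mul_assoc, ← Circle.coe_mul]
  congr 2
  rw [← AddChar.map_add_eq_mul, inner_sub_left]
  congr 1
  ring

/-- Multiplying by the Fourier transform of an integrable function preserves bilinear bounds. -/
theorem BilinearBound.fourier_mul (h : BilinearBound m p C) (hm : Integrable m) {k : E d → ℂ}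
    (hk : Integrable k) : BilinearBound (fun ξ => 𝓕 k ξ * m ξ) p ((∫ x, ‖k x‖) * C) := by
  intro f g f1 f2 g1 g2
  have cf := continuous_fourier (memLp_one_iff_integrable.1 f1)
  have cg := continuous_fourier (memLp_one_iff_integrable.1 g1)
  have hq : Integrable fun ξ => m ξ * (𝓕 f ξ * conj (𝓕 g ξ)) := by
    refine hm.mul_bdd (c := (∫ x, ‖f x‖) * ∫ x, ‖g x‖) ?_ (Filter.Eventually.of_forall fun ξ => ?_)
    · exact (cf.mul (Complex.continuous_conj.comp cg)).aestronglyMeasurable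
    · rw [norm_mul, RCLike.norm_conj]
      exact mul_le_mul (norm_fourier_le _ _) (norm_fourier_le _ _) (norm_nonneg _)
        (integral_nonneg fun _ => norm_nonneg _)
  have hprod : Integrable (Function.uncurry fun (ξ x : E d) => (Real.fourierChar (-⟪x, ξ⟫) : ℂ) *
      (m ξ * (𝓕 f ξ * conj (𝓕 g ξ)) * k x)) (volume.prod volume) := by
    refine (hq.mul_prod hk).bdd_mul (c := 1)
      (f := fun q : E d × E d => (Real.fourierChar (-⟪q.2, q.1⟫) : ℂ)) ?_ ?_
    · refine Continuous.aestronglyMeasurable ?_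
      have := Real.continuous_fourierChar
      fun_prop
    · exact Filter.Eventually.of_forall fun ω => (Circle.norm_coe _).le
  -- The transform of k is a superposition of characters, that is, of translations of f, and these
  -- preserve the L^p norm.
  have e : ∫ ξ, 𝓕 k ξ * m ξ * (𝓕 f ξ * conj (𝓕 g ξ)) =
      ∫ x, k x * ∫ ξ, m ξ * (𝓕 (fun z => f (z - x)) ξ * conj (𝓕 g ξ)) := by
    calc _ = ∫ ξ, ∫ x, (Real.fourierChar (-⟪x, ξ⟫) : ℂ) * (m ξ * (𝓕 f ξ * conj (𝓕 g ξ)) * k x) := by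
          refine integral_congr_ae (Filter.Eventually.of_forall fun ξ => ?_)
          simp only
          rw [mul_assoc, Real.fourier_eq, ← integral_mul_const]
          refine integral_congr_ae (Filter.Eventually.of_forall fun x => ?_)
          simp only [Circle.smul_def, smul_eq_mul]
          ring
      _ = _ := by
          rw [integral_integral_swap hprod]
          refine integral_congr_ae (Filter.Eventually.of_forall fun x => ?_)
          simp only
          rw [← integral_const_mul]
          refine integral_congr_ae (Filter.Eventually.of_forall fun ξ => ?_)
          simp only
          rw [fourier_comp_sub]
          ring
  rw [e, mul_assoc, ← integral_mul_const]
  refine norm_integral_le_of_norm_le (hk.norm.mul_const _) (Filter.Eventually.of_forall fun x => ?_)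
  rw [norm_mul]
  gcongr
  have hmp : MeasurePreserving (fun z : E d => z - x) volume volume := measurePreserving_sub_right _ x
  have := h (fun z => f (z - x)) g (f1.comp_measurePreserving hmp) (f2.comp_measurePreserving hmp) g1 g2
  rwa [show eLpNorm (fun z => f (z - x)) (.ofReal p) volume = eLpNorm f (.ofReal p) volume from
    eLpNorm_comp_measurePreserving f1.1 hmp] at this

/-- A bilinear bound for a bounded multiplier extends to `L² ∩ L^p` in the first variable. -/
theorem BilinearBound.norm_integral_le (h : BilinearBound m p C) (hC : 0 ≤ C) (hm : AEStronglyMeasurable m volume)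
    {B : ℝ} (hB : ∀ᵐ ξ, ‖m ξ‖ ≤ B) (f : L2 d ℂ) (hf : eLpNorm f (.ofReal p) volume ≠ ∞)
    {u : E d → ℂ} (u1 : MemLp u 1 volume) (u2 : MemLp u 2 volume) :
    ‖∫ ξ, m ξ * ((𝓕 f : L2 d ℂ) ξ * conj ((𝓕 (u2.toLp u) : L2 d ℂ) ξ))‖ ≤
      C * ((eLpNorm f (.ofReal p) volume).toReal * (eLpNorm u (.ofReal p) volume).toReal) := by
  have hu := fourier_toLp_ae (memLp_one_iff_integrable.1 u1) u2
  have hfm : Measurable (f : E d → ℂ) := (Lp.stronglyMeasurable f).measurable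
  -- Since m is bounded it can be moved onto the transform of u. The form is then an L² inner
  -- product of f with a fixed Q, and the band truncations of f converge in it.
  have hQ : MemLp (fun ξ => starRingEnd ℂ (m ξ) * (𝓕 (u2.toLp u) : L2 d ℂ) ξ) 2 volume := by
    refine MemLp.of_le_mul (c := B) (Lp.memLp (𝓕 (u2.toLp u) : L2 d ℂ)) ?_ ?_
    · exact (Complex.continuous_conj.comp_aestronglyMeasurable hm).mul (Lp.aestronglyMeasurable _)
    · filter_upwards [hB] with ξ hξ
      rw [norm_mul, RCLike.norm_conj]
      gcongr
  have hinner : ∀ g : L2 d ℂ, ∫ ξ, m ξ * ((𝓕 g : L2 d ℂ) ξ * conj ((𝓕 (u2.toLp u) : L2 d ℂ) ξ)) =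
      inner ℂ (𝓕⁻ (hQ.toLp _) : L2 d ℂ) g := by
    intro g
    rw [← Lp.inner_fourier_eq, FourierTransform.fourier_fourierInv_eq, L2.inner_def]
    refine integral_congr_ae ?_
    filter_upwards [hQ.coeFn_toLp] with ξ hξ
    rw [hξ, RCLike.inner_apply, map_mul, Complex.conj_conj]
    ring
  set Q : L2 d ℂ := 𝓕⁻ (hQ.toLp _) with hQdef
  have hint : Integrable fun x => f x * starRingEnd ℂ (Q x) := by
    have := L2.integrable_inner (𝕜 := ℂ) Q f
    simpa only [RCLike.inner_apply] using this
  have hind : ∀ n, MemLp ((band f n).indicator f) 2 volume := fun n =>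
    (Lp.memLp f).indicator (measurableSet_band hfm n)
  have hind1 : ∀ n, MemLp ((band f n).indicator f) 1 volume := fun n =>
    memLp_of_bound_of_support (measurableSet_band hfm n) (volume_band_lt_top (Lp.memLp f) n)
      (hfm.indicator (measurableSet_band hfm n)) (C := n + 1)
      (fun x hx => by rw [Set.indicator_of_mem hx]; exact hx.2)
      (fun x hx => Set.indicator_of_notMem hx _) 1
  have hlim : Filter.Tendsto (fun n => inner ℂ Q ((hind n).toLp _)) Filter.atTop (𝓝 (inner ℂ Q f)) := by
    have h1 := tendsto_setIntegral_of_monotone (fun n => measurableSet_band hfm n) (band_mono f)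
      (hint.integrableOn (s := ⋃ n, band f n))
    have h2 : ∫ x in ⋃ n, band f n, f x * starRingEnd ℂ (Q x) = inner ℂ Q f := by
      rw [L2.inner_def, ← integral_indicator (MeasurableSet.iUnion fun n => measurableSet_band hfm n)]
      refine integral_congr_ae (Filter.Eventually.of_forall fun x => ?_)
      simp only [RCLike.inner_apply]
      by_cases hx : x ∈ ⋃ n, band f n
      · rw [Set.indicator_of_mem hx]
      · rw [Set.indicator_of_notMem hx]
        rw [iUnion_band] at hx
        have : f x = 0 := by simpa using hx
        rw [this, zero_mul]
    rw [h2] at h1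
    refine h1.congr fun n => ?_
    rw [L2.inner_def, ← integral_indicator (measurableSet_band hfm n)]
    refine integral_congr_ae ?_
    filter_upwards [(hind n).coeFn_toLp] with x hx
    rw [hx, RCLike.inner_apply]
    by_cases hx : x ∈ band f n
    · rw [Set.indicator_of_mem hx, Set.indicator_of_mem hx]
    · rw [Set.indicator_of_notMem hx, Set.indicator_of_notMem hx, zero_mul]
  rw [hinner f]
  refine le_of_tendsto hlim.norm (Filter.Eventually.of_forall fun n => ?_)
  rw [← hinner]
  have hn := fourier_toLp_ae (memLp_one_iff_integrable.1 (hind1 n)) (hind n)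
  have e : ∫ ξ, m ξ * ((𝓕 ((hind n).toLp _) : L2 d ℂ) ξ * starRingEnd ℂ ((𝓕 (u2.toLp u) : L2 d ℂ) ξ)) =
      ∫ ξ, m ξ * (𝓕 ((band f n).indicator f) ξ * starRingEnd ℂ (𝓕 u ξ)) := by
    refine integral_congr_ae ?_
    filter_upwards [hn, hu] with ξ h1 h2
    rw [h1, h2]
  rw [e]
  refine (h _ u (hind1 n) (hind n) u1 u2).trans ?_
  gcongr
  exact eLpNorm_indicator_le _

end BilinearBound

/-- The pair `(p, q)` consists of conjugate exponents, with `p = 1` and `q = ∞` allowed. -/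
def IsDualPair (p : ℝ) (q : ℝ≥0∞) : Prop :=
  (∃ p' : ℝ, p.HolderConjugate p' ∧ q = .ofReal p') ∨ p = 1 ∧ q = ∞

theorem eLpNorm_le_of_forall_pairing' {d : ℕ} {p : ℝ} {q : ℝ≥0∞} (hpq : IsDualPair p q) (G : L2 d ℂ)
    {M : ℝ} (hM : 0 ≤ M)
    (h : ∀ u : E d → ℂ, MemLp u 1 volume → MemLp u 2 volume →
      ‖∫ x, G x * (starRingEnd ℂ) (u x)‖ ≤ M * (eLpNorm u (.ofReal p) volume).toReal) :
    eLpNorm G q volume ≤ ENNReal.ofReal M := by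
  have hGm : Measurable (G : E d → ℂ) := (Lp.stronglyMeasurable G).measurable
  rcases hpq with ⟨p', hp, rfl⟩ | ⟨rfl, rfl⟩
  · exact eLpNorm_le_of_forall_pairing hp hGm (Lp.memLp G) hM h
  · rw [ENNReal.ofReal_one] at h
    exact eLpNorm_top_le_of_forall_pairing hGm (Lp.memLp G) hM h

/-- Bilinear bounds pass to almost everywhere limits of multipliers. -/
theorem eLpNorm_le_of_bilinearBound {d : ℕ} {ι : Type*} [Fintype ι] {p C : ℝ} {q : ℝ≥0∞}
    (hpq : IsDualPair p q) (hC : 0 ≤ C) (n : ι → E d → ℂ) {A : ℕ → E d → ℂ} {a : E d → ℂ} {D : ℝ}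
    (hm : ∀ k j, AEStronglyMeasurable (fun ξ => n j ξ * A k ξ) volume)
    (hbd : ∀ k j, ∃ B : ℝ, ∀ ξ, ‖n j ξ * A k ξ‖ ≤ B)
    (hA : ∀ k j, BilinearBound (fun ξ => n j ξ * A k ξ) p C)
    (hlim : ∀ᵐ ξ, Filter.Tendsto (fun k => A k ξ) Filter.atTop (𝓝 (a ξ)))
    (hdom : ∀ k, ∀ᵐ ξ, ‖A k ξ‖ ≤ D * ‖a ξ‖)
    (f : ι → L2 d ℂ) (G : L2 d ℂ) (hf : ∀ j, eLpNorm (f j) (.ofReal p) volume ≠ ∞)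
    (hG : ∀ᵐ ξ, (𝓕 G : L2 d ℂ) ξ = a ξ * ∑ j, n j ξ * (𝓕 (f j) : L2 d ℂ) ξ) :
    eLpNorm G q volume ≤ ENNReal.ofReal C * ∑ j, eLpNorm (f j) (.ofReal p) volume := by
  have hsum : ENNReal.ofReal C * ∑ j, eLpNorm (f j) (.ofReal p) volume =
      ENNReal.ofReal (C * ∑ j, (eLpNorm (f j) (.ofReal p) volume).toReal) := by
    rw [ENNReal.ofReal_mul hC, ENNReal.ofReal_sum_of_nonneg fun j _ => ENNReal.toReal_nonneg]
    simp only [ENNReal.ofReal_toReal (hf _)]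
  rw [hsum]
  refine eLpNorm_le_of_forall_pairing' hpq G
    (mul_nonneg hC (Finset.sum_nonneg fun j _ => ENNReal.toReal_nonneg)) fun u u1 u2 => ?_
  set U : L2 d ℂ := 𝓕 (u2.toLp u) with hU
  have e : ∫ x, G x * (starRingEnd ℂ) (u x) = ∫ ξ, (𝓕 G : L2 d ℂ) ξ * conj (U ξ) := by
    have h1 : ∫ x, G x * (starRingEnd ℂ) (u x) = inner ℂ (u2.toLp u) G := by
      rw [L2.inner_def]
      refine integral_congr_ae ?_
      filter_upwards [u2.coeFn_toLp] with x hx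
      rw [hx, RCLike.inner_apply]
    rw [h1, ← Lp.inner_fourier_eq, L2.inner_def]
    simp only [RCLike.inner_apply, hU]
  have hint : Integrable fun ξ => ‖(𝓕 G : L2 d ℂ) ξ‖ * ‖U ξ‖ :=
    (Lp.memLp _).norm.integrable_mul (Lp.memLp U).norm
  have hterm : ∀ k j, Integrable fun ξ => n j ξ * A k ξ * ((𝓕 (f j) : L2 d ℂ) ξ * conj (U ξ)) := by
    intro k j
    obtain ⟨B, hB⟩ := hbd k j
    have h1 : Integrable fun ξ => (𝓕 (f j) : L2 d ℂ) ξ * conj (U ξ) := by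
      simpa only [RCLike.inner_apply] using L2.integrable_inner (𝕜 := ℂ) U (𝓕 (f j) : L2 d ℂ)
    exact h1.bdd_mul (hm k j) (Filter.Eventually.of_forall hB)
  -- The limit a may be unbounded, but A k is dominated by a multiple of it, and a times the sum is
  -- the transform of G, already known to be in L². So D |Ĝ| |U| dominates.
  have hconv : Filter.Tendsto (fun k => ∫ ξ, ∑ j, n j ξ * A k ξ * ((𝓕 (f j) : L2 d ℂ) ξ * conj (U ξ)))
      Filter.atTop (𝓝 (∫ ξ, (𝓕 G : L2 d ℂ) ξ * conj (U ξ))) := by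
    refine tendsto_integral_of_dominated_convergence (fun ξ => D * (‖(𝓕 G : L2 d ℂ) ξ‖ * ‖U ξ‖))
      (fun k => (integrable_finsetSum _ fun j _ => hterm k j).1) (hint.const_mul D) (fun k => ?_) ?_
    · filter_upwards [hG, hdom k] with ξ h1 h2
      have : ∑ j, n j ξ * A k ξ * ((𝓕 (f j) : L2 d ℂ) ξ * conj (U ξ)) =
          A k ξ * (∑ j, n j ξ * (𝓕 (f j) : L2 d ℂ) ξ) * conj (U ξ) := by
        rw [Finset.mul_sum, Finset.sum_mul]
        exact Finset.sum_congr rfl fun j _ => by ring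
      rw [this, h1, norm_mul, norm_mul, norm_mul, RCLike.norm_conj]
      calc _ ≤ D * ‖a ξ‖ * ‖∑ j, n j ξ * (𝓕 (f j) : L2 d ℂ) ξ‖ * ‖U ξ‖ := by gcongr
        _ = _ := by ring
    · filter_upwards [hG, hlim] with ξ h1 h2
      rw [h1, Finset.mul_sum, Finset.sum_mul]
      refine tendsto_finsetSum _ fun j _ => ?_
      have := (h2.const_mul (n j ξ)).mul_const ((𝓕 (f j) : L2 d ℂ) ξ * conj (U ξ))
      refine this.trans (le_of_eq ?_)
      congr 1
      ring
  rw [e]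
  refine le_of_tendsto hconv.norm (Filter.Eventually.of_forall fun k => ?_)
  rw [integral_finsetSum _ fun j _ => hterm k j, mul_assoc, Finset.sum_mul, Finset.mul_sum]
  refine (norm_sum_le _ _).trans (Finset.sum_le_sum fun j _ => ?_)
  obtain ⟨B, hB⟩ := hbd k j
  exact (hA k j).norm_integral_le hC (hm k j) (Filter.Eventually.of_forall hB) (f j) (hf j) u1 u2

end

/-! ### Limiting absorption for the model singularity; Gaussian multipliers -/

section

open Complex (I)
open scoped ComplexConjugate RealInnerProductSpace Topology

/-- The dominant singular part of the resolvent symbol, for `Im w ≥ 0`. -/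
def upperSymbol {d : ℕ} (κ : ℝ) (w : ℂ) (ξ : E d) : ℂ :=
  I * Complex.exp ((1 + 2 * I) * (w - (κ ^ 2 * ‖ξ‖ ^ 2 : ℝ))) / (w - (κ ^ 2 * ‖ξ‖ ^ 2 : ℝ))

theorem integral_cexp_mul {a : ℂ} (ha : a ≠ 0) (N : ℝ) :
    ∫ t in (2 : ℝ)..N, Complex.exp ((1 + t * I) * a) =
      I * (Complex.exp ((1 + 2 * I) * a) - Complex.exp ((1 + N * I) * a)) / a := by
  have hc : I * a ≠ 0 := mul_ne_zero Complex.I_ne_zero ha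
  have h := integral_exp_mul_complex (a := (2 : ℝ)) (b := N) hc
  have e : ∀ t : ℝ, Complex.exp ((1 + t * I) * a) = Complex.exp a * Complex.exp (I * a * t) := by
    intro t
    rw [← Complex.exp_add]
    congr 1; ring
  rw [show (1 + 2 * I) = (1 + (2 : ℝ) * I) by push_cast; rfl]
  simp only [e]
  rw [intervalIntegral.integral_const_mul, h]
  field_simp
  rw [Complex.I_sq]
  ring

theorem truncSymbol_zero_eq {d : ℕ} {κ : ℝ} {w : ℂ} {N : ℝ} {ξ : E d}
    (ha : w - (κ ^ 2 * ‖ξ‖ ^ 2 : ℝ) ≠ 0) :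
    truncSymbol κ w 0 N ξ = I * (Complex.exp ((1 + 2 * I) * (w - (κ ^ 2 * ‖ξ‖ ^ 2 : ℝ))) -
      Complex.exp ((1 + N * I) * (w - (κ ^ 2 * ‖ξ‖ ^ 2 : ℝ)))) / (w - (κ ^ 2 * ‖ξ‖ ^ 2 : ℝ)) := by
  rw [← integral_cexp_mul ha]
  simp only [truncSymbol, zero_mul, Complex.exp_zero, one_mul, waveSymbol]

/-- The singular set lies in the sphere of positive radius √(Re w)/κ, which is null. -/
theorem ae_sub_ne_zero {d : ℕ} {κ : ℝ} (hκ : 0 < κ) {w : ℂ} (hw : 0 < w.re) :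
    ∀ᵐ ξ : E d, w - (κ ^ 2 * ‖ξ‖ ^ 2 : ℝ) ≠ 0 := by
  have hr : √w.re / κ ≠ 0 := by positivity
  have h := Measure.addHaar_sphere_of_ne_zero (volume : Measure (E d)) 0 hr
  have h' : ∀ᵐ ξ : E d, ξ ∉ Metric.sphere (0 : E d) (√w.re / κ) := measure_eq_zero_iff_ae_notMem.1 h
  filter_upwards [h'] with ξ hξ h0
  apply hξ
  have hre := congrArg Complex.re h0
  simp only [Complex.sub_re, Complex.ofReal_re, Complex.zero_re] at hre
  rw [mem_sphere_zero_iff_norm, eq_div_iff hκ.ne']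
  rw [← Real.sqrt_sq (by positivity : 0 ≤ ‖ξ‖ * κ)]
  congr 1
  linarith

theorem norm_exp_one_add_mul_I (a : ℂ) (t : ℝ) :
    ‖Complex.exp ((1 + t * I) * a)‖ = Real.exp a.re * Real.exp (-t * a.im) := by
  rw [Complex.norm_exp, ← Real.exp_add]
  congr 1
  simp
  ring

/-- The damping and the truncation time used to approximate a boundary value of the resolvent. -/
def approxSymbol {d : ℕ} (κ : ℝ) (w : ℂ) (k : ℕ) (ξ : E d) : ℂ :=
  truncSymbol κ (w + (1 / ((k : ℝ) + 1) : ℝ) * I) 0 (2 + ((k : ℝ) + 1) ^ 2) ξ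

section Approx

variable {d : ℕ} {κ : ℝ} {w : ℂ} {ξ : E d}

theorem approxSymbol_eq (hwi : 0 ≤ w.im) (k : ℕ) :
    approxSymbol κ w k ξ = I * (Complex.exp ((1 + (2 : ℝ) * I) * (w - (κ ^ 2 * ‖ξ‖ ^ 2 : ℝ) +
      (1 / ((k : ℝ) + 1) : ℝ) * I)) - Complex.exp ((1 + (2 + ((k : ℝ) + 1) ^ 2 : ℝ) * I) *
        (w - (κ ^ 2 * ‖ξ‖ ^ 2 : ℝ) + (1 / ((k : ℝ) + 1) : ℝ) * I))) /
          (w - (κ ^ 2 * ‖ξ‖ ^ 2 : ℝ) + (1 / ((k : ℝ) + 1) : ℝ) * I) := by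
  have e : w + (1 / ((k : ℝ) + 1) : ℝ) * I - (κ ^ 2 * ‖ξ‖ ^ 2 : ℝ) =
    w - (κ ^ 2 * ‖ξ‖ ^ 2 : ℝ) + (1 / ((k : ℝ) + 1) : ℝ) * I := by ring
  have hne : w + (1 / ((k : ℝ) + 1) : ℝ) * I - (κ ^ 2 * ‖ξ‖ ^ 2 : ℝ) ≠ 0 := by
    intro h
    have := congrArg Complex.im h
    simp only [Complex.sub_im, Complex.add_im, Complex.ofReal_im, Complex.mul_im, Complex.ofReal_re,
      Complex.I_im, Complex.I_re, Complex.zero_im] at this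
    have hk : 0 < 1 / ((k : ℝ) + 1) := by positivity
    linarith
  rw [approxSymbol, truncSymbol_zero_eq hne, e]
  push_cast; rfl

/-- Raising Im w ≥ 0 only enlarges the denominator, and the numerator is at most 2e^{Re a}. The
factor e^{2 Im w} undoes the damping contained in the limit symbol. -/
theorem norm_approxSymbol_le (hwi : 0 ≤ w.im) (hne : w - (κ ^ 2 * ‖ξ‖ ^ 2 : ℝ) ≠ 0) (k : ℕ) :
    ‖approxSymbol κ w k ξ‖ ≤ 2 * Real.exp (2 * w.im) * ‖upperSymbol κ w ξ‖ := by
  rw [approxSymbol_eq hwi, upperSymbol]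
  set a := w - (κ ^ 2 * ‖ξ‖ ^ 2 : ℝ) with ha
  set ε := 1 / ((k : ℝ) + 1) with hε
  have hε0 : 0 < ε := by positivity
  have hai : a.im = w.im := by rw [ha]; simp only [Complex.sub_im, Complex.ofReal_im, sub_zero]
  have hbi : (a + ε * I).im = w.im + ε := by simp [hai]
  have hbr : (a + ε * I).re = a.re := by simp
  have ha0 : 0 < ‖a‖ := norm_pos_iff.2 hne
  have hab : ‖a‖ ≤ ‖a + ε * I‖ := by
    rw [Complex.norm_def, Complex.norm_def]
    apply Real.sqrt_le_sqrt
    rw [Complex.normSq_apply, Complex.normSq_apply, hbi, hbr, hai]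
    nlinarith
  have e1 : ∀ t : ℝ, 0 ≤ t → ‖Complex.exp ((1 + t * I) * (a + ε * I))‖ ≤ Real.exp a.re := by
    intro t ht
    rw [norm_exp_one_add_mul_I, hbr, hbi]
    refine mul_le_of_le_one_right (Real.exp_pos _).le (Real.exp_le_one_iff.2 ?_)
    nlinarith
  rw [norm_div, norm_div, norm_mul, norm_mul, Complex.norm_I, one_mul, one_mul]
  have e2 := norm_exp_one_add_mul_I a 2
  rw [Complex.ofReal_ofNat] at e2
  rw [e2, hai]
  have e3 : Real.exp (2 * w.im) * Real.exp (-2 * w.im) = 1 := by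
    rw [← Real.exp_add]; simp
  calc _ ≤ (Real.exp a.re + Real.exp a.re) / ‖a‖ := by
        gcongr
        exact (norm_sub_le _ _).trans (add_le_add (e1 _ (by norm_num)) (e1 _ (by positivity)))
    _ = 2 * (Real.exp (2 * w.im) * Real.exp (-2 * w.im)) * Real.exp a.re / ‖a‖ := by rw [e3]; ring
    _ = _ := by ring

/-- The damping 1/(k+1) tends to 0, but multiplied by the truncation time, which exceeds (k+1)², it
still diverges. So the upper endpoint of the time integral disappears even when w is real. -/
theorem tendsto_approxSymbol (hwi : 0 ≤ w.im) (hne : w - (κ ^ 2 * ‖ξ‖ ^ 2 : ℝ) ≠ 0) :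
    Filter.Tendsto (fun k => approxSymbol κ w k ξ) Filter.atTop (𝓝 (upperSymbol κ w ξ)) := by
  simp only [approxSymbol_eq hwi, upperSymbol]
  set a := w - (κ ^ 2 * ‖ξ‖ ^ 2 : ℝ) with ha
  have hai : a.im = w.im := by rw [ha]; simp only [Complex.sub_im, Complex.ofReal_im, sub_zero]
  have hε : Filter.Tendsto (fun k : ℕ => 1 / ((k : ℝ) + 1)) Filter.atTop (𝓝 0) :=
    tendsto_one_div_add_atTop_nhds_zero_nat
  have hb : Filter.Tendsto (fun k : ℕ => a + (1 / ((k : ℝ) + 1) : ℝ) * I) Filter.atTop (𝓝 a) := by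
    have := ((Complex.continuous_ofReal.tendsto 0).comp hε).mul_const I |>.const_add a
    simpa using this
  have h1 : Filter.Tendsto (fun k : ℕ => Complex.exp ((1 + (2 : ℝ) * I) *
      (a + (1 / ((k : ℝ) + 1) : ℝ) * I))) Filter.atTop (𝓝 (Complex.exp ((1 + (2 : ℝ) * I) * a))) :=
    (Complex.continuous_exp.tendsto _).comp (hb.const_mul _)
  have h2 : Filter.Tendsto (fun k : ℕ => Complex.exp ((1 + (2 + ((k : ℝ) + 1) ^ 2 : ℝ) * I) *
      (a + (1 / ((k : ℝ) + 1) : ℝ) * I))) Filter.atTop (𝓝 0) := by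
    have h3 : Filter.Tendsto (fun k : ℕ => Real.exp a.re * Real.exp (-((k : ℝ) + 1))) Filter.atTop (𝓝 0) := by
      have : Filter.Tendsto (fun k : ℕ => (k : ℝ) + 1) Filter.atTop Filter.atTop :=
        Filter.tendsto_atTop_add_const_right _ _ tendsto_natCast_atTop_atTop
      have := (Real.tendsto_exp_neg_atTop_nhds_zero.comp this).const_mul (Real.exp a.re)
      simpa using this
    refine squeeze_zero_norm (fun k => ?_) h3
    rw [norm_exp_one_add_mul_I]
    have hbr : (a + (1 / ((k : ℝ) + 1) : ℝ) * I).re = a.re := by simp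
    have hbi : (a + (1 / ((k : ℝ) + 1) : ℝ) * I).im = w.im + 1 / ((k : ℝ) + 1) := by
      rw [Complex.add_im, Complex.im_ofReal_mul, Complex.I_im, mul_one, hai]
    rw [hbr, hbi]
    have hk : 0 < 1 / ((k : ℝ) + 1) := by positivity
    have hkk : ((k : ℝ) + 1) ^ 2 * (1 / ((k : ℝ) + 1)) = (k : ℝ) + 1 := by field_simp
    gcongr
    nlinarith [mul_nonneg (by positivity : (0 : ℝ) ≤ 2 + ((k : ℝ) + 1) ^ 2) hwi]
  have h4 := (((h1.sub h2).const_mul I).div hb hne)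
  rw [sub_zero] at h4
  push_cast at h4 ⊢
  exact h4

end Approx

/-- A bounded multiplier that multiplies the constants in bilinear bounds by at most `L`. -/
structure BilinearMultiplier {d : ℕ} (n : E d → ℂ) (L : ℝ) : Prop where
  aestronglyMeasurable : AEStronglyMeasurable n volume
  bounded : ∃ B : ℝ, ∀ ξ, ‖n ξ‖ ≤ B
  bound : ∀ (m : E d → ℂ) (p C : ℝ), Integrable m → 0 ≤ C → BilinearBound m p C →
    BilinearBound (fun ξ => n ξ * m ξ) p (L * C)

theorem BilinearBound.mono {d : ℕ} {m : E d → ℂ} {p C C' : ℝ} (h : BilinearBound m p C) (hC : C ≤ C') :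
    BilinearBound m p C' := fun f g f1 f2 g1 g2 =>
  (h f g f1 f2 g1 g2).trans (mul_le_mul_of_nonneg_right hC (by positivity))

theorem BilinearMultiplier.mono {d : ℕ} {n : E d → ℂ} {L L' : ℝ} (h : BilinearMultiplier n L) (hL : L ≤ L') :
    BilinearMultiplier n L' :=
  ⟨h.1, h.2, fun m p C hm hC hb => (h.3 m p C hm hC hb).mono (mul_le_mul_of_nonneg_right hL hC)⟩

theorem fourier_dilation {d : ℕ} {κ : ℝ} (hκ : 0 < κ) (k : E d → ℂ) (ξ : E d) :
    𝓕 (fun x => (((κ⁻¹) ^ d : ℝ) : ℂ) * k (κ⁻¹ • x)) ξ = 𝓕 k (κ • ξ) := by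
  have h := Measure.integral_comp_smul (volume : Measure (E d))
    (fun x => Real.fourierChar (-⟪x, κ • ξ⟫) • k x) κ⁻¹
  rw [Real.fourier_eq, Real.fourier_eq]
  rw [finrank_euclideanSpace_fin, abs_of_pos (by positivity)] at h
  have hc : (((κ⁻¹) ^ d : ℝ) : ℂ) ≠ 0 := by
    have : (0 : ℝ) < (κ⁻¹) ^ d := by positivity
    exact_mod_cast this.ne'
  calc _ = (((κ⁻¹) ^ d : ℝ) : ℂ) * ∫ x, Real.fourierChar (-⟪κ⁻¹ • x, κ • ξ⟫) • k (κ⁻¹ • x) := by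
        rw [← integral_const_mul]
        refine integral_congr_ae (Filter.Eventually.of_forall fun x => ?_)
        simp only [Circle.smul_def, smul_eq_mul, inner_smul_left, inner_smul_right, RCLike.conj_to_real]
        rw [show κ * (κ⁻¹ * ⟪x, ξ⟫) = ⟪x, ξ⟫ by field_simp]
        ring
    _ = _ := by
        rw [h, Complex.real_smul, ← mul_assoc, ← Complex.ofReal_mul, mul_inv_cancel₀ (by positivity),
          Complex.ofReal_one, one_mul]

/-- Dilating the kernel preserves its L¹ norm, so the bound does not see κ. -/
theorem bilinearMultiplier_fourier {d : ℕ} {κ : ℝ} (hκ : 0 < κ) {k : E d → ℂ} (hk : Integrable k) :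
    BilinearMultiplier (fun ξ => 𝓕 k (κ • ξ)) (∫ x, ‖k x‖) := by
  refine ⟨((continuous_fourier hk).comp (continuous_const_smul κ)).aestronglyMeasurable,
    ⟨_, fun ξ => norm_fourier_le k _⟩, fun m p C hm hC hb => ?_⟩
  have hk' : Integrable fun x => (((κ⁻¹) ^ d : ℝ) : ℂ) * k (κ⁻¹ • x) :=
    (hk.comp_smul (inv_ne_zero hκ.ne')).const_mul _
  have h := hb.fourier_mul hm hk'
  simp only [fourier_dilation hκ] at h
  have e : ∫ x, ‖(((κ⁻¹) ^ d : ℝ) : ℂ) * k (κ⁻¹ • x)‖ = ∫ x, ‖k x‖ := by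
    have h2 := Measure.integral_comp_smul (volume : Measure (E d)) (fun x => ‖k x‖) κ⁻¹
    rw [finrank_euclideanSpace_fin, abs_of_pos (by positivity)] at h2
    simp only [norm_mul, Complex.norm_real]
    rw [integral_const_mul, h2, Real.norm_of_nonneg (by positivity), smul_eq_mul, ← mul_assoc,
      mul_inv_cancel₀ (by positivity), one_mul]
  rwa [e] at h

/-- The approximating symbols satisfy the interpolated bound with one constant for all k, and
bilinear bounds pass to almost everywhere limits. The multipliers n j accommodate matrix numerators,
and the two alternatives cover both signs of Im w. -/
theorem upperSymbol_estimate {d : ℕ} {ι : Type*} [Fintype ι] {κ : ℝ} {u₀ u₁ : ℝ} {w : ℂ} {θ p : ℝ}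
    {q : ℝ≥0∞} (hκ : 0 < κ) (hu₀ : 0 < u₀) (hw0 : u₀ ≤ w.re)
    (hw1 : w.re ≤ u₁) (hwi : 0 ≤ w.im) (hθ0 : 2 / ((d : ℝ) + 1) ≤ θ) (hθ1 : θ ≤ 1)
    (hp : p * (1 + θ) = 2) (hpq : IsDualPair p q) {L : ℝ} (hL : 0 ≤ L) (n : ι → E d → ℂ)
    (hn : ∀ j, BilinearMultiplier (n j) L) (f : ι → L2 d ℂ) (G : L2 d ℂ)
    (hf : ∀ j, eLpNorm (f j) (.ofReal p) volume ≠ ∞)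
    (hG : (∀ᵐ ξ, (𝓕 G : L2 d ℂ) ξ = upperSymbol κ w ξ * ∑ j, n j ξ * (𝓕 (f j) : L2 d ℂ) ξ) ∨
      ∀ᵐ ξ, (𝓕 G : L2 d ℂ) ξ = conj (upperSymbol κ w ξ) * ∑ j, n j ξ * (𝓕 (f j) : L2 d ℂ) ξ) :
    eLpNorm G q volume ≤ ENNReal.ofReal (L * (steinConst d u₀ u₁ * κ ^ (-(d * θ)))) *
      ∑ j, eLpNorm (f j) (.ofReal p) volume := by
  have hC : 0 ≤ steinConst d u₀ u₁ * κ ^ (-(d * θ)) := by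
    unfold steinConst; positivity
  have hre : ∀ k : ℕ, (w + (1 / ((k : ℝ) + 1) : ℝ) * I).re = w.re := fun k => by simp
  have him : ∀ k : ℕ, 0 ≤ (w + (1 / ((k : ℝ) + 1) : ℝ) * I).im := fun k => by
    have : 0 < 1 / ((k : ℝ) + 1) := by positivity
    simp only [Complex.add_im, Complex.mul_im, Complex.ofReal_re, Complex.ofReal_im, Complex.I_im,
      Complex.I_re]
    linarith
  have hN : ∀ k : ℕ, (2 : ℝ) ≤ 2 + ((k : ℝ) + 1) ^ 2 := fun k => by nlinarith
  have hb : ∀ k, BilinearBound (approxSymbol (d := d) κ w k) p (steinConst d u₀ u₁ * κ ^ (-(d * θ))) :=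
    fun k => bilinearBound_truncSymbol hκ hu₀ (by rw [hre]; exact hw0) (by rw [hre]; exact hw1) (him k)
      (hN k) hθ0 hθ1 hp
  have hi : ∀ k, Integrable (approxSymbol (d := d) κ w k) := fun k =>
    integrable_truncSymbol hκ (him k) 0 (hN k)
  have hbdd : ∀ k : ℕ, ∃ B : ℝ, ∀ ξ : E d, ‖approxSymbol κ w k ξ‖ ≤ B := by
    intro k
    refine ⟨Real.exp u₁ * |2 + ((k : ℝ) + 1) ^ 2 - 2|, fun ξ => ?_⟩
    refine intervalIntegral.norm_integral_le_of_norm_le_const fun t ht => ?_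
    rw [Set.uIoc_of_le (hN k)] at ht
    rw [zero_mul, Complex.exp_zero, one_mul]
    refine (norm_waveSymbol_le κ ((hre k).trans_le hw1) (him k) (by linarith [ht.1]) ξ).trans ?_
    refine mul_le_of_le_one_right (Real.exp_pos _).le (Real.exp_le_one_iff.2 ?_)
    have : 0 ≤ κ ^ 2 * ‖ξ‖ ^ 2 := by positivity
    linarith
  have hne := ae_sub_ne_zero (d := d) hκ (hu₀.trans_le hw0)
  have hbdn : ∀ (A : E d → ℂ) (j : ι), (∃ B : ℝ, ∀ ξ, ‖A ξ‖ ≤ B) → ∃ B : ℝ, ∀ ξ, ‖n j ξ * A ξ‖ ≤ B := by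
    rintro A j ⟨B, hB⟩
    obtain ⟨B', hB'⟩ := (hn j).bounded
    refine ⟨B' * B, fun ξ => ?_⟩
    rw [norm_mul]
    exact mul_le_mul (hB' ξ) (hB ξ) (norm_nonneg _) ((norm_nonneg _).trans (hB' ξ))
  rcases hG with hG | hG
  · exact eLpNorm_le_of_bilinearBound hpq (mul_nonneg hL hC) n (A := approxSymbol κ w)
      (D := 2 * Real.exp (2 * w.im)) (fun k j => (hn j).1.mul (hi k).1) (fun k j => hbdn _ j (hbdd k))
      (fun k j => (hn j).bound _ _ _ (hi k) hC (hb k))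
      (hne.mono fun ξ h => tendsto_approxSymbol hwi h)
      (fun k => hne.mono fun ξ h => norm_approxSymbol_le hwi h k) f G hf hG
  · have hi' : ∀ k, Integrable fun ξ : E d => starRingEnd ℂ (approxSymbol κ w k ξ) := fun k =>
      (hi k).congr' (Complex.continuous_conj.comp_aestronglyMeasurable (hi k).1)
        (Filter.Eventually.of_forall fun x => (RCLike.norm_conj _).symm)
    refine eLpNorm_le_of_bilinearBound hpq (mul_nonneg hL hC) n
      (A := fun k ξ => starRingEnd ℂ (approxSymbol κ w k ξ)) (D := 2 * Real.exp (2 * w.im))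
      (fun k j => (hn j).1.mul (hi' k).1) (fun k j => hbdn _ j ?_)
      (fun k j => (hn j).bound _ _ _ (hi' k) hC (hb k).conj)
      (hne.mono fun ξ h => (Complex.continuous_conj.tendsto _).comp (tendsto_approxSymbol hwi h))
      (fun k => hne.mono fun ξ h => ?_) f G hf hG
    · obtain ⟨B, hB⟩ := hbdd k
      exact ⟨B, fun ξ => (RCLike.norm_conj (approxSymbol κ w k ξ)).trans_le (hB ξ)⟩
    · rw [RCLike.norm_conj, RCLike.norm_conj]
      exact norm_approxSymbol_le hwi h k

section Gaussian

variable {d : ℕ}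

/-- The Gaussian whose Fourier transform is a multiple of `exp (-|ξ|²)`. -/
def piGaussian (x : E d) : ℂ := ((Real.exp (-Real.pi ^ 2 * ‖x‖ ^ 2) : ℝ) : ℂ)

theorem fourier_piGaussian (ξ : E d) :
    𝓕 (piGaussian (d := d)) ξ = ((Real.pi / Real.pi ^ 2 : ℂ) ^ ((d : ℂ) / 2)) * Real.exp (-‖ξ‖ ^ 2) := by
  have hpi : (Real.pi : ℂ) ≠ 0 := by exact_mod_cast Real.pi_ne_zero
  have hb : 0 < ((Real.pi : ℂ) ^ 2).re := by
    rw [← Complex.ofReal_pow, Complex.ofReal_re]; positivity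
  have h := fourier_gaussian_innerProductSpace (V := E d) hb ξ
  rw [finrank_euclideanSpace_fin] at h
  have e : (piGaussian (d := d)) = fun v : E d => Complex.exp (-(Real.pi : ℂ) ^ 2 * ‖v‖ ^ 2) := by
    funext v; rw [piGaussian]; push_cast; rfl
  rw [e, h]
  congr 1
  push_cast
  congr 1
  field_simp

theorem hasFDerivAt_piGaussian (x : E d) : HasFDerivAt (piGaussian (d := d))
    (Complex.ofRealCLM.comp (Real.exp (-Real.pi ^ 2 * ‖x‖ ^ 2) • (-Real.pi ^ 2) • (2 • innerSL ℝ x))) x := by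
  have h := ((hasStrictFDerivAt_norm_sq x).hasFDerivAt.const_mul (-Real.pi ^ 2)).exp
  exact Complex.ofRealCLM.hasFDerivAt.comp x h

theorem integrable_piGaussian : Integrable (piGaussian (d := d)) :=
  (integrable_gaussian (d := d) Real.pi_pos).ofReal

theorem fderiv_piGaussian : fderiv ℝ (piGaussian (d := d)) = fun x =>
    Complex.ofRealCLM.comp (Real.exp (-Real.pi ^ 2 * ‖x‖ ^ 2) • (-Real.pi ^ 2) • (2 • innerSL ℝ x)) :=
  funext fun x => (hasFDerivAt_piGaussian x).fderiv

theorem integrable_fderiv_piGaussian : Integrable (fderiv ℝ (piGaussian (d := d))) := by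
  have hcont : Continuous (fderiv ℝ (piGaussian (d := d))) := by
    rw [fderiv_piGaussian]
    fun_prop
  refine ((integrable_gaussian (d := d) one_pos).const_mul (2 * Real.pi ^ 2)).mono'
    hcont.aestronglyMeasurable (Filter.Eventually.of_forall fun x => ?_)
  rw [fderiv_piGaussian]
  simp only
  refine (ContinuousLinearMap.opNorm_comp_le _ _).trans ?_
  rw [Complex.ofRealCLM_norm, one_mul, norm_smul, norm_smul, two_nsmul, ← two_smul ℝ (innerSL ℝ x),
    norm_smul, innerSL_apply_norm, Real.norm_of_nonneg (Real.exp_pos _).le, norm_neg, Real.norm_of_nonneg (by positivity)]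
  have h1 : ‖x‖ ≤ Real.exp (‖x‖ ^ 2) := by
    have := Real.add_one_le_exp (‖x‖ ^ 2)
    nlinarith [sq_nonneg (‖x‖ - 1)]
  have hpi : (2 : ℝ) ≤ Real.pi ^ 2 := by nlinarith [Real.pi_gt_three]
  have h2 : Real.exp (-Real.pi ^ 2 * ‖x‖ ^ 2) ≤ Real.exp (-2 * ‖x‖ ^ 2) := by
    apply Real.exp_le_exp.2; nlinarith [sq_nonneg ‖x‖]
  have h3 : Real.exp (-2 * ‖x‖ ^ 2) * Real.exp (‖x‖ ^ 2) = Real.exp (-1 ^ 2 * ‖x‖ ^ 2) := by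
    rw [← Real.exp_add]; congr 1; ring
  rw [Real.norm_ofNat]
  calc _ = 2 * Real.pi ^ 2 * (Real.exp (-Real.pi ^ 2 * ‖x‖ ^ 2) * ‖x‖) := by ring
    _ ≤ 2 * Real.pi ^ 2 * (Real.exp (-2 * ‖x‖ ^ 2) * Real.exp (‖x‖ ^ 2)) := by gcongr
    _ = _ := by rw [h3]

theorem fourier_fderiv_piGaussian (j : Fin d) (ξ : E d) :
    𝓕 (fun x => fderiv ℝ (piGaussian (d := d)) x (EuclideanSpace.single j 1)) ξ =
      2 * Real.pi * I * ξ j * 𝓕 (piGaussian (d := d)) ξ := by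
  have h := Real.fourier_fderiv (integrable_piGaussian (d := d))
    (fun x => (hasFDerivAt_piGaussian x).differentiableAt) integrable_fderiv_piGaussian
  have h1 := congrFun h ξ
  have e : 𝓕 (fun x => fderiv ℝ (piGaussian (d := d)) x (EuclideanSpace.single j 1)) ξ =
      (𝓕 (fderiv ℝ (piGaussian (d := d))) ξ) (EuclideanSpace.single j 1) := by
    rw [Real.fourier_eq, Real.fourier_eq, ContinuousLinearMap.integral_apply]
    · rfl
    · exact (Real.fourierIntegral_convergent_iff ξ).2 integrable_fderiv_piGaussian
  rw [e, h1, VectorFourier.fourierSMulRight_apply]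
  have e2 : (innerSL ℝ ξ) (EuclideanSpace.single j (1 : ℝ)) = ξ j := by
    rw [innerSL_apply_apply, EuclideanSpace.inner_single_right]; simp
  simp [e2]
  ring

end Gaussian

/-- The Gaussian and its product with κξ_j are the transforms of a Gaussian and of its derivatives,
up to constants, evaluated at κξ. Thus the factor e^{-x} makes a Dirac numerator harmless, uniformly
in the scale. -/
theorem exists_bilinearMultiplier_gaussian (d : ℕ) : ∃ L : ℝ, 1 ≤ L ∧ ∀ κ : ℝ, 0 < κ →
    BilinearMultiplier (fun ξ : E d => ((Real.exp (-(κ ^ 2 * ‖ξ‖ ^ 2)) : ℝ) : ℂ)) L ∧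
    ∀ j : Fin d, BilinearMultiplier
      (fun ξ : E d => ((κ * ξ j : ℝ) : ℂ) * (Real.exp (-(κ ^ 2 * ‖ξ‖ ^ 2)) : ℝ)) L := by
  set c : ℂ := (Real.pi / Real.pi ^ 2 : ℂ) ^ ((d : ℂ) / 2) with hc
  have hpi : (Real.pi : ℂ) ≠ 0 := by exact_mod_cast Real.pi_ne_zero
  have hc0 : c ≠ 0 := by
    rw [hc]
    have : (Real.pi / Real.pi ^ 2 : ℂ) ≠ 0 := div_ne_zero hpi (pow_ne_zero _ hpi)
    simp [Complex.cpow_eq_zero_iff, this]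
  set k₀ : E d → ℂ := fun x => c⁻¹ * piGaussian x with hk₀
  set k : Fin d → E d → ℂ := fun j x => (c * (2 * Real.pi * I))⁻¹ *
    fderiv ℝ (piGaussian (d := d)) x (EuclideanSpace.single j 1) with hk
  have i0 : Integrable k₀ := integrable_piGaussian.const_mul _
  have ij : ∀ j, Integrable (k j) := fun j =>
    (integrable_fderiv_piGaussian.apply_continuousLinearMap _).const_mul _
  have hmul : ∀ (a : ℂ) (g : E d → ℂ) (ξ : E d), 𝓕 (fun x => a * g x) ξ = a * 𝓕 g ξ := by
    intro a g ξ
    rw [Real.fourier_eq, Real.fourier_eq, ← integral_const_mul]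
    refine integral_congr_ae (Filter.Eventually.of_forall fun x => ?_)
    simp only [Circle.smul_def, smul_eq_mul]
    ring
  have nn : ∀ g : E d → ℂ, 0 ≤ ∫ x, ‖g x‖ := fun g => integral_nonneg fun _ => norm_nonneg _
  have hnorm : ∀ {κ : ℝ}, 0 < κ → ∀ ξ : E d, -‖κ • ξ‖ ^ 2 = -(κ ^ 2 * ‖ξ‖ ^ 2) := by
    intro κ hκ ξ
    rw [norm_smul, Real.norm_of_nonneg hκ.le, mul_pow]
  refine ⟨1 + (∫ x, ‖k₀ x‖) + ∑ j, ∫ x, ‖k j x‖, ?_, fun κ hκ => ⟨?_, fun j => ?_⟩⟩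
  · have := nn k₀
    have := Finset.sum_nonneg fun (j : Fin d) (_ : j ∈ Finset.univ) => nn (k j)
    linarith
  · have h := (bilinearMultiplier_fourier hκ i0).mono (L' := 1 + (∫ x, ‖k₀ x‖) + ∑ j, ∫ x, ‖k j x‖) (by
      have := Finset.sum_nonneg fun (j : Fin d) (_ : j ∈ Finset.univ) => nn (k j)
      linarith)
    convert h using 2 with ξ
    rw [hk₀, hmul, fourier_piGaussian, ← hc, hnorm hκ, ← mul_assoc, inv_mul_cancel₀ hc0, one_mul]
  · have h := (bilinearMultiplier_fourier hκ (ij j)).mono (L' := 1 + (∫ x, ‖k₀ x‖) + ∑ j, ∫ x, ‖k j x‖) (by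
      have := nn k₀
      have := Finset.single_le_sum (fun (j : Fin d) _ => nn (k j)) (Finset.mem_univ j)
      linarith)
    convert h using 2 with ξ
    rw [hk, hmul, fourier_fderiv_piGaussian, fourier_piGaussian, ← hc, hnorm hκ]
    have e : (κ • ξ) j = κ * ξ j := by simp
    rw [e]
    have hI := Complex.I_ne_zero
    field_simp

end

/-! ### Model poles and uniform expansion of the resolvent symbol -/

section

open Complex (I)
open scoped Topology

/-- The sign of the imaginary part, equal to `1` on the real axis. -/
def imSign (w : ℂ) : ℝ := if 0 ≤ w.im then 1 else -1

/-- The model singularity at `w`, damped on the side of the imaginary part of `w`. -/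
def singularPart (w : ℂ) (x : ℝ) : ℂ :=
  imSign w * I * Complex.exp ((1 + 2 * imSign w * I) * (w - x)) / (w - x)

theorem imSign_sq (w : ℂ) : imSign w * imSign w = 1 := by
  unfold imSign; split_ifs <;> norm_num

theorem abs_imSign (w : ℂ) : |imSign w| = 1 := by
  unfold imSign; split_ifs <;> norm_num

theorem imSign_mul_im_nonneg (w : ℂ) : 0 ≤ imSign w * w.im := by
  unfold imSign; split_ifs with h
  · simpa using h
  · linarith

theorem norm_singularPart_le (w : ℂ) (x : ℝ) :
    ‖singularPart w x‖ ≤ Real.exp (w.re - x) / ‖w - x‖ := by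
  have h := imSign_mul_im_nonneg w
  rw [singularPart, norm_div, norm_mul, norm_mul, Complex.norm_real, Complex.norm_I, Real.norm_eq_abs,
    abs_imSign, one_mul, one_mul, Complex.norm_exp]
  gcongr
  have e : ((1 + 2 * imSign w * I) * (w - x)).re = w.re - x - 2 * (imSign w * w.im) := by
    rw [show (1 + 2 * imSign w * I) * (w - x) = (w - x) + ((2 * imSign w : ℝ) : ℂ) * (I * (w - x)) by
      push_cast; ring, Complex.add_re, Complex.re_ofReal_mul]
    simp
    ring
  rw [e]
  linarith

/-- With a = w - x the difference is -(e^{(2 ± 2i)a} - 1)/a, where the pole has cancelled. From |2 ±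
2i| ≤ 4 and |a| ≤ 1/4 the inequality |e^y - 1| ≤ 2|y| applies and gives 8. -/
theorem norm_singularPart_sub_le {w : ℂ} {x : ℝ} (hne : (x : ℂ) ≠ w) (h : ‖(x : ℂ) - w‖ ≤ 1 / 4) :
    ‖imSign w * I * Complex.exp w * (Complex.exp (-x) * singularPart w x) - ((x : ℂ) - w)⁻¹‖ ≤ 8 := by
  set a := w - x with ha
  have ha0 : a ≠ 0 := sub_ne_zero.2 hne.symm
  have hna : ‖a‖ = ‖(x : ℂ) - w‖ := by rw [ha, norm_sub_rev]
  have hs : (imSign w : ℂ) * imSign w = 1 := by exact_mod_cast imSign_sq w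
  have e : imSign w * I * Complex.exp w * (Complex.exp (-x) * singularPart w x) - ((x : ℂ) - w)⁻¹ =
      -(Complex.exp ((2 + 2 * imSign w * I) * a) - 1) / a := by
    rw [show (x : ℂ) - w = -a by rw [ha]; ring, inv_neg, singularPart, ← ha]
    have e1 : Complex.exp ((2 + 2 * imSign w * I) * a) =
        Complex.exp w * Complex.exp (-x) * Complex.exp ((1 + 2 * imSign w * I) * a) := by
      rw [← Complex.exp_add, ← Complex.exp_add]
      congr 1
      rw [ha]; ring
    rw [e1]
    field_simp
    rw [pow_two, hs, Complex.I_sq]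
    ring
  have hc : ‖(2 + 2 * imSign w * I : ℂ)‖ ≤ 4 := by
    refine (norm_add_le _ _).trans ?_
    rw [norm_mul, norm_mul, Complex.norm_real, Complex.norm_I, Real.norm_eq_abs, abs_imSign]
    norm_num
  have hb : ‖(2 + 2 * imSign w * I) * a‖ ≤ 4 * ‖a‖ := by
    rw [norm_mul]; gcongr
  have h1 := Complex.norm_exp_sub_one_le (x := (2 + 2 * imSign w * I) * a) (by linarith)
  rw [e, norm_div, norm_neg, div_le_iff₀ (norm_pos_iff.2 ha0)]
  linarith

/-- The resolvent symbol `(φ - z)⁻¹` is a multiple of a model singularity up to an error of order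
`(1 + x) ^ (-σ)`. -/
def ResolventExpansion (φ : ℝ → ℝ) (σ : ℝ) (z : ℂ) (C u₀ u₁ : ℝ) : Prop :=
  ∃ w c : ℂ, u₀ ≤ w.re ∧ w.re ≤ u₁ ∧ ‖c‖ ≤ C ∧ ∀ x : ℝ, 0 ≤ x → (x : ℂ) ≠ w → (φ x : ℂ) ≠ z ∧
    ‖((φ x : ℂ) - z)⁻¹ - c * (Complex.exp (-x) * singularPart w x)‖ ≤ C * (1 + x) ^ (-σ)

theorem ResolventExpansion.mono {φ : ℝ → ℝ} {σ : ℝ} {z : ℂ} {C u₀ u₁ C' u₀' u₁' : ℝ}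
    (h : ResolventExpansion φ σ z C u₀ u₁) (hC : C ≤ C') (h0 : u₀' ≤ u₀) (h1 : u₁ ≤ u₁') :
    ResolventExpansion φ σ z C' u₀' u₁' := by
  obtain ⟨w, c, hw0, hw1, hc, h⟩ := h
  refine ⟨w, c, h0.trans hw0, hw1.trans h1, hc.trans hC, fun x hx hxw => ⟨(h x hx hxw).1, ?_⟩⟩
  refine (h x hx hxw).2.trans ?_
  gcongr

/-- Used far from the pole: there the factor e^{-x} makes the model smaller than the permitted error
(1 + x)^{-σ}. -/
theorem one_add_rpow_le_exp (σ : ℝ) : ∃ C : ℝ, 0 < C ∧ ∀ x : ℝ, 0 ≤ x → (1 + x) ^ σ ≤ C * Real.exp x := by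
  obtain ⟨n, hn⟩ := exists_nat_ge (max σ 1)
  have hn1 : (1 : ℝ) ≤ n := (le_max_right _ _).trans hn
  have hn0 : (0 : ℝ) < n := by linarith
  refine ⟨(n : ℝ) ^ n, by positivity, fun x hx => ?_⟩
  calc (1 + x) ^ σ ≤ (1 + x) ^ (n : ℝ) :=
        Real.rpow_le_rpow_of_exponent_le (by linarith) ((le_max_left _ _).trans hn)
    _ = (1 + x) ^ n := Real.rpow_natCast _ _
    _ ≤ (n * (x / n + 1)) ^ n := by
        gcongr
        rw [mul_add, mul_div_cancel₀ _ hn0.ne']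
        linarith
    _ ≤ (n * Real.exp (x / n)) ^ n := by
        gcongr
        exact Real.add_one_le_exp _
    _ = _ := by
        rw [mul_pow, ← Real.exp_nat_mul, mul_div_cancel₀ _ hn0.ne']

/-- A lower bound for `|φ - z|`, locally uniform in `z`, off the level set of `φ`. -/
theorem exists_lower_bound {φ : ℝ → ℝ} {σ : ℝ} (hσ : 0 < σ) (hφ : ContinuousOn φ (Set.Ici 0)) {c₀ B : ℝ}
    (hc₀ : 0 < c₀) (hgrow : ∀ x, 0 ≤ x → c₀ * (1 + x) ^ σ ≤ |φ x| + B) {S : Set ℝ} (hS : IsClosed S)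
    (hS0 : S ⊆ Set.Ici 0) {z₀ : ℂ} (hne : ∀ x ∈ S, (φ x : ℂ) ≠ z₀) :
    ∃ m : ℝ, 0 < m ∧ ∀ z : ℂ, ‖z - z₀‖ < m → ∀ x ∈ S, m * (1 + x) ^ σ ≤ ‖(φ x : ℂ) - z‖ := by
  have hB : ∃ Y : ℝ, 0 ≤ Y ∧ 2 * (B + ‖z₀‖) / c₀ ≤ Y := ⟨max 0 _, le_max_left _ _, le_max_right _ _⟩
  obtain ⟨Y, hY0, hY⟩ := hB
  -- Beyond X the growth of φ alone separates it from z₀; on the compact remainder a positive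
  -- minimum exists.
  set X := Y ^ (1 / σ) with hX
  have hcomp : IsCompact (S ∩ Set.Icc 0 X) := isCompact_Icc.inter_left hS
  have hcont : ContinuousOn (fun x : ℝ => ‖(φ x : ℂ) - z₀‖ * (1 + x) ^ (-σ)) (S ∩ Set.Icc 0 X) := by
    refine ContinuousOn.mul ?_ ?_
    · refine ContinuousOn.norm (ContinuousOn.sub ?_ continuousOn_const)
      exact Complex.continuous_ofReal.comp_continuousOn (hφ.mono fun x hx => hx.2.1)
    · refine ContinuousOn.rpow_const (by fun_prop) fun x hx => Or.inl ?_
      have := hx.2.1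
      positivity
  have hpos : ∀ x ∈ S ∩ Set.Icc 0 X, 0 < ‖(φ x : ℂ) - z₀‖ * (1 + x) ^ (-σ) := by
    intro x hx
    have h0 := hx.2.1
    exact mul_pos (norm_pos_iff.2 (sub_ne_zero.2 (hne x hx.1))) (by positivity)
  obtain ⟨m₁, hm₁, hm₁'⟩ := hcomp.exists_forall_le' hcont hpos
  have key : ∀ x ∈ S, min m₁ (c₀ / 2) * (1 + x) ^ σ ≤ ‖(φ x : ℂ) - z₀‖ := by
    intro x hx
    have hx0 : 0 ≤ x := hS0 hx
    have hp : 0 < (1 + x) ^ σ := by positivity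
    rcases le_total x X with h | h
    · have h1 := hm₁' x ⟨hx, hx0, h⟩
      rw [Real.rpow_neg (by linarith), ← div_eq_mul_inv, le_div_iff₀ hp] at h1
      exact (mul_le_mul_of_nonneg_right (min_le_left _ _) hp.le).trans h1
    · have h1 : Y ≤ (1 + x) ^ σ := by
        calc Y = X ^ σ := by rw [hX, ← Real.rpow_mul hY0, one_div_mul_cancel hσ.ne', Real.rpow_one]
          _ ≤ _ := Real.rpow_le_rpow (by positivity) (by linarith) hσ.le
      have h2 : 2 * (B + ‖z₀‖) ≤ c₀ * (1 + x) ^ σ := by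
        have := hY.trans h1
        rw [div_le_iff₀ hc₀] at this
        linarith
      have h3 := hgrow x hx0
      have h4 : |φ x| ≤ ‖(φ x : ℂ) - z₀‖ + ‖z₀‖ := by
        have := norm_add_le ((φ x : ℂ) - z₀) z₀
        rwa [sub_add_cancel, Complex.norm_real, Real.norm_eq_abs] at this
      have h5 := mul_le_mul_of_nonneg_right (min_le_right m₁ (c₀ / 2)) hp.le
      linarith
  refine ⟨min m₁ (c₀ / 2) / 2, by positivity, fun z hz x hx => ?_⟩
  have hx0 : 0 ≤ x := hS0 hx
  have h1 := key x hx
  have h2 : 1 ≤ (1 + x) ^ σ := Real.one_le_rpow (by linarith) hσ.le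
  have h3 : ‖(φ x : ℂ) - z₀‖ ≤ ‖(φ x : ℂ) - z‖ + ‖z - z₀‖ := norm_sub_le_norm_sub_add_norm_sub _ _ _
  have h4 : 0 < min m₁ (c₀ / 2) := by positivity
  nlinarith

/-- Expansion of the resolvent symbol near a regular real value or off the range of `φ`. -/
theorem exists_resolventExpansion_nhds {φ : ℝ → ℝ} {σ : ℝ} (hσ : 0 < σ) (hφ : ContinuousOn φ (Set.Ici 0))
    {c₀ B : ℝ} (hc₀ : 0 < c₀) (hgrow : ∀ x, 0 ≤ x → c₀ * (1 + x) ^ σ ≤ |φ x| + B) {z₀ : ℂ}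
    (h : (∀ x, 0 ≤ x → (φ x : ℂ) ≠ z₀) ∨ ∃ x₀ : ℝ, 0 < x₀ ∧ (φ x₀ : ℂ) = z₀ ∧
      (∀ x, 0 ≤ x → x ≠ x₀ → (φ x : ℂ) ≠ z₀) ∧ ∃ Φ : ℂ → ℂ, AnalyticAt ℂ Φ x₀ ∧ deriv Φ x₀ ≠ 0 ∧
        ∀ x : ℝ, 0 < x → Φ x = φ x) :
    ∃ V ∈ 𝓝 z₀, ∃ C u₀ u₁ : ℝ, 0 < u₀ ∧ 0 ≤ C ∧ ∀ z ∈ V, ResolventExpansion φ σ z C u₀ u₁ := by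
  rcases h with h | ⟨x₀, hx₀, hz₀, hinj, Φ, hΦ, hD, hΦφ⟩
  · obtain ⟨m, hm, hlow⟩ := exists_lower_bound hσ hφ hc₀ hgrow isClosed_Ici subset_rfl (fun x hx => h x hx)
    refine ⟨Metric.ball z₀ m, Metric.ball_mem_nhds _ hm, m⁻¹, 1, 1, one_pos, by positivity, fun z hz => ?_⟩
    -- Off the range there is no pole: the coefficient c is 0 and w = 1 is a dummy.
    refine ⟨1, 0, by simp, by simp, by simpa using hm.le, fun x hx _ => ?_⟩
    have h1 := hlow z (by simpa [dist_eq_norm] using hz) x hx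
    have hp : 0 < (1 + x) ^ σ := by positivity
    have h2 : 0 < ‖(φ x : ℂ) - z‖ := lt_of_lt_of_le (by positivity) h1
    refine ⟨sub_ne_zero.1 (norm_pos_iff.1 h2), ?_⟩
    rw [zero_mul, sub_zero, norm_inv, Real.rpow_neg (by linarith), ← mul_inv]
    exact inv_anti₀ (by positivity) h1
  set g := deriv Φ with hg
  have hga : AnalyticAt ℂ g x₀ := hΦ.deriv
  obtain ⟨K, t, ht, hK⟩ := (hga.contDiffAt (n := 1)).exists_lipschitzOnWith
  set m₁ := ‖g x₀‖ / 2 with hm₁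
  have hm₁0 : 0 < m₁ := by have := norm_pos_iff.2 hD; positivity
  have hgn : ∀ᶠ y in 𝓝 (x₀ : ℂ), m₁ < ‖g y‖ :=
    hga.continuousAt.norm.eventually_const_lt (by rw [hm₁]; linarith [norm_pos_iff.2 hD])
  obtain ⟨R, hR, hball⟩ := Metric.eventually_nhds_iff_ball.1
    ((hgn.and hΦ.eventually_analyticAt).and ht)
  -- The radius keeps Φ analytic with derivative above m₁ and Lipschitz, keeps the real points
  -- positive, meets the condition 1/4 of the model pole, and lets the linear term absorb the
  -- quadratic error.
  obtain ⟨r, hr, hrR, hrx, hr4, hrK⟩ : ∃ r : ℝ, 0 < r ∧ r ≤ R ∧ r ≤ x₀ ∧ 2 * r ≤ 1 / 4 ∧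
      K * (2 * r) ≤ m₁ / 2 := by
    have hK0 : (0 : ℝ) ≤ K := K.2
    refine ⟨min (min R x₀) (min (1 / 8) (m₁ / (4 * (K + 1)))), by positivity,
      (min_le_left _ _).trans (min_le_left _ _), (min_le_left _ _).trans (min_le_right _ _), ?_, ?_⟩
    · have := (min_le_right (min R x₀) _).trans (min_le_left (1 / 8) (m₁ / (4 * (K + 1))))
      linarith
    · have h1 := (min_le_right (min R x₀) _).trans (min_le_right (1 / 8) (m₁ / (4 * ((K : ℝ) + 1))))
      rw [le_div_iff₀ (by positivity)] at h1
      have h2 : 0 < min (min R x₀) (min (1 / 8) (m₁ / (4 * ((K : ℝ) + 1)))) := by positivity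
      nlinarith
  have hsub : Metric.ball (x₀ : ℂ) r ⊆ Metric.ball (x₀ : ℂ) R := Metric.ball_subset_ball hrR
  have hquad : ∀ w ∈ Metric.ball (x₀ : ℂ) r, ∀ x ∈ Metric.ball (x₀ : ℂ) r,
      ‖Φ x - Φ w - g w * (x - w)‖ ≤ K * ‖x - w‖ * ‖x - w‖ := by
    intro w hw x hx
    have hseg : segment ℝ w x ⊆ Metric.ball (x₀ : ℂ) r := (convex_ball _ _).segment_subset hw hx
    have h1 := Convex.norm_image_sub_le_of_norm_hasDerivWithin_le (𝕜 := ℂ)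
      (f := fun y => Φ y - g w * y) (f' := fun y => g y - g w * 1) (s := segment ℝ w x)
      (C := K * ‖x - w‖) (x := w) (y := x)
      (fun y hy => (((hball y (hsub (hseg hy))).1.2.differentiableAt.hasDerivAt).sub
        ((hasDerivAt_id y).const_mul (g w))).hasDerivWithinAt)
      (fun y hy => by
        rw [mul_one]
        have h2 := hK.norm_sub_le (hball y (hsub (hseg hy))).2 (hball w (hsub hw)).2
        refine h2.trans ?_
        gcongr
        have h3 := norm_sub_le_of_mem_segment hy
        exact h3)
      (convex_segment w x) (left_mem_segment ℝ w x) (right_mem_segment ℝ w x)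
    refine le_trans (le_of_eq ?_) h1
    congr 1
    ring
  set S : Set ℝ := Set.Ici 0 ∩ {x | r ≤ |x - x₀|} with hS
  have hSc : IsClosed S := isClosed_Ici.inter (isClosed_le continuous_const (by fun_prop))
  obtain ⟨m, hm, hlow⟩ := exists_lower_bound hσ hφ hc₀ hgrow hSc Set.inter_subset_left (z₀ := z₀)
    (fun x hx => hinj x hx.1 (fun h => by
      have h2 : r ≤ |x - x₀| := hx.2
      rw [h, sub_self, abs_zero] at h2
      linarith))
  -- Nonvanishing derivative makes Φ open at x₀, so every z near z₀, real or not, is Φ(w) with w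
  -- near x₀.
  have hV : Φ '' Metric.ball (x₀ : ℂ) (r / 2) ∈ 𝓝 z₀ := by
    have h1 := hΦ.hasStrictDerivAt.map_nhds_eq hD
    rw [← hz₀, ← hΦφ x₀ hx₀, ← h1]
    exact Filter.image_mem_map (Metric.ball_mem_nhds _ (by positivity))
  obtain ⟨Cσ, hCσ, hexp⟩ := one_add_rpow_le_exp σ
  set u₁ := 2 * x₀ with hu₁
  set cB := Real.exp u₁ / m₁ with hcB
  set Cn := (2 * K / m₁ ^ 2 + 8 / m₁) * (1 + u₁) ^ σ with hCn
  set Cf := m⁻¹ + cB * (Real.exp u₁ / (r / 2) * Cσ) with hCf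
  have hCn0 : 0 ≤ Cn := by have : (0 : ℝ) ≤ K := K.2; positivity
  have hCf0 : 0 ≤ Cf := by positivity
  have hcB0 : 0 ≤ cB := by positivity
  refine ⟨Φ '' Metric.ball (x₀ : ℂ) (r / 2) ∩ Metric.ball z₀ m,
    Filter.inter_mem hV (Metric.ball_mem_nhds _ hm), cB + Cn + Cf, x₀ / 2, u₁, by positivity, by positivity, ?_⟩
  rintro z ⟨⟨w, hw, rfl⟩, hz⟩
  have hwn : ‖w - x₀‖ < r / 2 := by simpa [dist_eq_norm] using hw
  have hwre : |w.re - x₀| < r / 2 := by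
    have := Complex.abs_re_le_norm (w - x₀)
    rw [Complex.sub_re, Complex.ofReal_re] at this
    linarith
  rw [abs_lt] at hwre
  have hwr : w ∈ Metric.ball (x₀ : ℂ) r := Metric.ball_subset_ball (by linarith) hw
  have hgw : m₁ < ‖g w‖ := (hball w (hsub hwr)).1.1
  have hgw0 : g w ≠ 0 := norm_pos_iff.1 (hm₁0.trans hgw)
  have hwu : w.re ≤ u₁ := by rw [hu₁]; linarith
  have hcn : ‖(imSign w * I * Complex.exp w / g w : ℂ)‖ ≤ cB := by
    rw [norm_div, norm_mul, norm_mul, Complex.norm_real, Complex.norm_I, Real.norm_eq_abs, abs_imSign,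
      one_mul, one_mul, Complex.norm_exp, hcB]
    gcongr
  refine ⟨w, imSign w * I * Complex.exp w / g w, by linarith, hwu, by linarith, ?_⟩
  intro x hx hxw
  have hp : 0 < (1 + x) ^ σ := by positivity
  rw [Real.rpow_neg (by linarith), ← div_eq_mul_inv, le_div_iff₀ hp]
  have hxw0 : 0 < ‖(x : ℂ) - w‖ := norm_pos_iff.2 (sub_ne_zero.2 hxw)
  rcases lt_or_ge |x - x₀| r with hnear | hfar
  · have hxr : (x : ℂ) ∈ Metric.ball (x₀ : ℂ) r := by
      rw [mem_ball_iff_norm, ← Complex.ofReal_sub, Complex.norm_real]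
      exact hnear
    have hnear' := abs_lt.1 hnear
    have hx0 : 0 < x := by linarith
    have hq := hquad w hwr x hxr
    rw [hΦφ x hx0] at hq
    have hdist : ‖(x : ℂ) - w‖ ≤ 2 * r := by
      have h1 : ‖(x : ℂ) - x₀‖ < r := by simpa [dist_eq_norm] using hxr
      have h2 := norm_sub_le_norm_sub_add_norm_sub (x : ℂ) x₀ w
      rw [norm_sub_rev (x₀ : ℂ) w] at h2
      linarith
    set A := (φ x : ℂ) - Φ w with hA
    set δ := (x : ℂ) - w with hδ
    have hK0 : (0 : ℝ) ≤ K := K.2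
    have hAlow : m₁ / 2 * ‖δ‖ ≤ ‖A‖ := by
      have h1 : ‖g w * δ‖ ≤ ‖A‖ + ‖A - g w * δ‖ := by
        have := norm_sub_le A (A - g w * δ)
        rwa [sub_sub_cancel] at this
      rw [norm_mul] at h1
      have h2 : K * ‖δ‖ * ‖δ‖ ≤ m₁ / 2 * ‖δ‖ := by
        gcongr
        exact (mul_le_mul_of_nonneg_left hdist hK0).trans hrK
      nlinarith
    have hA0 : A ≠ 0 := by
      intro h0
      rw [h0, norm_zero] at hAlow
      have : 0 < m₁ / 2 * ‖δ‖ := by positivity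
      linarith
    have hδ0 : δ ≠ 0 := norm_pos_iff.1 hxw0
    refine ⟨sub_ne_zero.1 hA0, ?_⟩
    -- The error splits into 1/A - 1/(g δ), bounded because A - gδ is quadratic in δ, and 1/g times
    -- the difference between 1/δ and the model pole.
    have e : A⁻¹ - imSign w * I * Complex.exp w / g w * (Complex.exp (-x) * singularPart w x) =
        -(A - g w * δ) / (A * (g w * δ)) -
          (imSign w * I * Complex.exp w * (Complex.exp (-x) * singularPart w x) - δ⁻¹) / g w := by
      field_simp
      ring
    have b1 : ‖-(A - g w * δ) / (A * (g w * δ))‖ ≤ 2 * K / m₁ ^ 2 := by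
      rw [norm_div, norm_neg, norm_mul, norm_mul, div_le_div_iff₀ (by positivity) (by positivity)]
      calc ‖A - g w * δ‖ * m₁ ^ 2 ≤ K * ‖δ‖ * ‖δ‖ * m₁ ^ 2 := by gcongr
        _ = 2 * K * ((m₁ / 2 * ‖δ‖) * (m₁ * ‖δ‖)) := by ring
        _ ≤ 2 * K * (‖A‖ * (‖g w‖ * ‖δ‖)) := by gcongr
    have b2 : ‖(imSign w * I * Complex.exp w * (Complex.exp (-x) * singularPart w x) - δ⁻¹) / g w‖ ≤
        8 / m₁ := by
      rw [norm_div]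
      gcongr
      exact norm_singularPart_sub_le hxw (hdist.trans hr4)
    have b3 : (1 + x) ^ σ ≤ (1 + u₁) ^ σ := by
      refine Real.rpow_le_rpow (by linarith) ?_ hσ.le
      rw [hu₁]; linarith
    rw [e]
    calc _ ≤ (2 * K / m₁ ^ 2 + 8 / m₁) * (1 + u₁) ^ σ := by
          gcongr
          exact (norm_sub_le _ _).trans (add_le_add b1 b2)
      _ ≤ _ := by linarith
  · have h1 := hlow (Φ w) (by simpa [dist_eq_norm] using hz) x ⟨hx, hfar⟩
    have h2 : 0 < ‖(φ x : ℂ) - Φ w‖ := lt_of_lt_of_le (by positivity) h1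
    refine ⟨sub_ne_zero.1 (norm_pos_iff.1 h2), ?_⟩
    have hdist : r / 2 ≤ ‖w - x‖ := by
      have h3 : r ≤ ‖(x : ℂ) - x₀‖ := by
        rw [← Complex.ofReal_sub, Complex.norm_real]; exact hfar
      have h4 := norm_sub_le_norm_sub_add_norm_sub (x : ℂ) w x₀
      rw [norm_sub_rev (x : ℂ) w] at h4
      linarith
    have b1 : ‖((φ x : ℂ) - Φ w)⁻¹‖ * (1 + x) ^ σ ≤ m⁻¹ := by
      rw [norm_inv, inv_mul_eq_div, div_le_iff₀ h2, inv_mul_eq_div, le_div_iff₀ hm]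
      linarith
    have b2 : ‖imSign w * I * Complex.exp w / g w * (Complex.exp (-x) * singularPart w x)‖ * (1 + x) ^ σ ≤
        cB * (Real.exp u₁ / (r / 2) * Cσ) := by
      rw [norm_mul, norm_mul, ← Complex.ofReal_neg, ← Complex.ofReal_exp, Complex.norm_real,
        Real.norm_of_nonneg (Real.exp_pos _).le]
      have h5 : ‖singularPart w x‖ ≤ Real.exp u₁ / (r / 2) := by
        refine (norm_singularPart_le w x).trans ?_
        gcongr
        linarith
      calc _ ≤ cB * (Real.exp (-x) * (Real.exp u₁ / (r / 2))) * (Cσ * Real.exp x) := by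
            gcongr
            exact hexp x hx
        _ = cB * (Real.exp u₁ / (r / 2) * Cσ) * (Real.exp (-x) * Real.exp x) := by ring
        _ = _ := by rw [← Real.exp_add, neg_add_cancel, Real.exp_zero, mul_one]
    calc _ ≤ (‖((φ x : ℂ) - Φ w)⁻¹‖ +
          ‖imSign w * I * Complex.exp w / g w * (Complex.exp (-x) * singularPart w x)‖) * (1 + x) ^ σ := by
          gcongr
          exact norm_sub_le _ _
      _ ≤ Cf := by rw [add_mul]; linarith
      _ ≤ _ := by linarith

/-- Uniform expansion of the resolvent symbol over a compact set of regular values. -/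
theorem exists_resolventExpansion {φ : ℝ → ℝ} {σ : ℝ} (hσ : 0 < σ) (hφ : ContinuousOn φ (Set.Ici 0))
    {c₀ B : ℝ} (hc₀ : 0 < c₀) (hgrow : ∀ x, 0 ≤ x → c₀ * (1 + x) ^ σ ≤ |φ x| + B) {K : Set ℂ}
    (hK : IsCompact K)
    (h : ∀ z₀ ∈ K, (∀ x, 0 ≤ x → (φ x : ℂ) ≠ z₀) ∨ ∃ x₀ : ℝ, 0 < x₀ ∧ (φ x₀ : ℂ) = z₀ ∧
      (∀ x, 0 ≤ x → x ≠ x₀ → (φ x : ℂ) ≠ z₀) ∧ ∃ Φ : ℂ → ℂ, AnalyticAt ℂ Φ x₀ ∧ deriv Φ x₀ ≠ 0 ∧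
        ∀ x : ℝ, 0 < x → Φ x = φ x) :
    ∃ C u₀ u₁ : ℝ, 0 < u₀ ∧ 0 ≤ C ∧ ∀ z ∈ K, ResolventExpansion φ σ z C u₀ u₁ := by
  refine hK.induction_on (p := fun S => ∃ C u₀ u₁ : ℝ, 0 < u₀ ∧ 0 ≤ C ∧
    ∀ z ∈ S, ResolventExpansion φ σ z C u₀ u₁) ⟨0, 1, 1, one_pos, le_rfl, by simp⟩ ?_ ?_ ?_
  · rintro S T hST ⟨C, u₀, u₁, hu, hC, h⟩
    exact ⟨C, u₀, u₁, hu, hC, fun z hz => h z (hST hz)⟩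
  · rintro S T ⟨C, u₀, u₁, hu, hC, h⟩ ⟨C', u₀', u₁', hu', hC', h'⟩
    refine ⟨max C C', min u₀ u₀', max u₁ u₁', lt_min hu hu', hC.trans (le_max_left _ _), fun z hz => ?_⟩
    rcases hz with hz | hz
    · exact (h z hz).mono (le_max_left _ _) (min_le_left _ _) (le_max_left _ _)
    · exact (h' z hz).mono (le_max_right _ _) (min_le_right _ _) (le_max_right _ _)
  · intro z₀ hz₀
    obtain ⟨V, hV, hV'⟩ := exists_resolventExpansion_nhds hσ hφ hc₀ hgrow (h z₀ hz₀)
    exact ⟨V, mem_nhdsWithin_of_mem_nhds hV, hV'⟩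

end

/-! ### Combining singular and regular parts at scale R -/

section

open Complex (I)
open scoped ComplexConjugate

theorem BilinearMultiplier.const_mul {d : ℕ} {n : E d → ℂ} {L : ℝ} (h : BilinearMultiplier n L) (a : ℂ) :
    BilinearMultiplier (fun ξ => a * n ξ) (‖a‖ * L) := by
  refine ⟨h.1.const_mul a, ?_, fun m p C hm hC hb f g f1 f2 g1 g2 => ?_⟩
  · obtain ⟨B, hB⟩ := h.bounded
    exact ⟨‖a‖ * B, fun ξ => by rw [norm_mul]; gcongr; exact hB ξ⟩
  · have := h.bound m p C hm hC hb f g f1 f2 g1 g2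
    simp only [mul_assoc] at this ⊢
    rw [integral_const_mul, norm_mul]
    gcongr

theorem singularPart_eq {d : ℕ} (κ : ℝ) (w : ℂ) (ξ : E d) : singularPart w (κ ^ 2 * ‖ξ‖ ^ 2) =
    if 0 ≤ w.im then upperSymbol κ w ξ else conj (upperSymbol κ (conj w) ξ) := by
  unfold singularPart upperSymbol imSign
  split_ifs with h
  · push_cast; simp only [one_mul, mul_one]
  · simp only [map_div₀, map_mul, map_sub, ← Complex.exp_conj, Complex.conj_conj, Complex.conj_ofReal,
      map_add, map_one, Complex.conj_I, Complex.conj_ofNat]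
    push_cast
    ring_nf

theorem measurable_singularPart {d : ℕ} (κ : ℝ) (w : ℂ) :
    Measurable fun ξ : E d => singularPart w (κ ^ 2 * ‖ξ‖ ^ 2) := by
  unfold singularPart
  refine Measurable.div ?_ ?_
  · exact Continuous.measurable (by fun_prop)
  · exact Continuous.measurable (by fun_prop)

/-- The estimate for the singular part of the resolvent. -/
theorem singularPart_estimate {d : ℕ} {ι : Type*} [Fintype ι] {κ : ℝ} {u₀ u₁ : ℝ} {w : ℂ} {θ p : ℝ}
    {q : ℝ≥0∞} (hκ : 0 < κ) (hu₀ : 0 < u₀) (hw0 : u₀ ≤ w.re)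
    (hw1 : w.re ≤ u₁) (hθ0 : 2 / ((d : ℝ) + 1) ≤ θ) (hθ1 : θ ≤ 1)
    (hp : p * (1 + θ) = 2) (hpq : IsDualPair p q) {L : ℝ} (hL : 0 ≤ L) (n : ι → E d → ℂ)
    (hn : ∀ j, BilinearMultiplier (n j) L) (f : ι → L2 d ℂ) (G : L2 d ℂ)
    (hf : ∀ j, eLpNorm (f j) (.ofReal p) volume ≠ ∞)
    (hG : ∀ᵐ ξ, (𝓕 G : L2 d ℂ) ξ =
      singularPart w (κ ^ 2 * ‖ξ‖ ^ 2) * ∑ j, n j ξ * (𝓕 (f j) : L2 d ℂ) ξ) :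
    eLpNorm G q volume ≤ ENNReal.ofReal (L * (steinConst d u₀ u₁ * κ ^ (-(d * θ)))) *
      ∑ j, eLpNorm (f j) (.ofReal p) volume := by
  simp only [singularPart_eq] at hG
  by_cases h : 0 ≤ w.im
  · simp only [if_pos h] at hG
    exact upperSymbol_estimate hκ hu₀ hw0 hw1 h hθ0 hθ1 hp hpq hL n hn f G hf (Or.inl hG)
  · simp only [if_neg h] at hG
    exact upperSymbol_estimate (w := conj w) hκ hu₀ (by rwa [Complex.conj_re]) (by rwa [Complex.conj_re])
      (by rw [Complex.conj_im]; linarith) hθ0 hθ1 hp hpq hL n hn f G hf (Or.inr hG)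

/-- The exponents for which the resolvent maps `L^p` to `L^{p'}`. -/
def IsAdmissible (d : ℕ) (s p : ℝ) : Prop :=
  2 * d / (d + 1) ≤ s ∧ 2 * d / (d + s) ≤ p ∧ p ≤ 2 * (d + 1) / (d + 3)

/-- `G` is the sum of two functions satisfying the estimates for the singular part and for the
regular part of the resolvent, respectively. -/
def SplitBound {d : ℕ} {ι : Type*} [Fintype ι] (s C : ℝ) (f : ι → L2 d ℂ) (G : L2 d ℂ) : Prop :=
  ∃ G₁ G₂ : L2 d ℂ, G = G₁ + G₂ ∧
    (∀ (p : ℝ) (q : ℝ≥0∞), IsDualPair p q → p = 2 * (d + 1) / (d + 3) ∨ IsAdmissible d s p →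
      (∀ j, eLpNorm (f j) (.ofReal p) volume ≠ ∞) →
      eLpNorm G₁ q volume ≤ ENNReal.ofReal C * ∑ j, eLpNorm (f j) (.ofReal p) volume) ∧
    (∀ p p' : ℝ, p.HolderConjugate p' → p = 2 * d / (d + s) ∨ IsAdmissible d s p →
      (∀ j, eLpNorm (f j) (.ofReal p) volume ≠ ∞) →
      eLpNorm G₂ (.ofReal p') volume ≤ ENNReal.ofReal C * ∑ j, eLpNorm (f j) (.ofReal p) volume)

section Exponents

variable {d : ℕ} {s p : ℝ}

theorem eq_of_gap (hd : 0 < d) (hp : 0 < p) : p = 2 * d / (d + d * (2 / p - 1)) := by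
  have : (0 : ℝ) < d := by exact_mod_cast hd
  field_simp
  ring

theorem gap_eq_of_eq (hd : 0 < d) (hp : p = 2 * d / (d + s)) : d * (2 / p - 1) = s := by
  have : (0 : ℝ) < d := by exact_mod_cast hd
  rw [hp]
  field_simp
  ring

theorem gap_eq_of_eq_stein (hp : p = 2 * (d + 1) / (d + 3)) : 2 / p - 1 = 2 / ((d : ℝ) + 1) := by
  rw [hp]
  have : (0 : ℝ) < (d : ℝ) + 1 := by positivity
  have : (0 : ℝ) < (d : ℝ) + 3 := by positivity
  field_simp
  ring

theorem IsAdmissible.pos (h : IsAdmissible d s p) (hd : 0 < d) (hs : 0 < s) : 0 < p := by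
  have : (0 : ℝ) < d := by exact_mod_cast hd
  exact lt_of_lt_of_le (by positivity) h.2.1

theorem IsAdmissible.gap (h : IsAdmissible d s p) (hd : 0 < d) (hs : 0 < s) :
    2 / ((d : ℝ) + 1) ≤ 2 / p - 1 ∧ d * (2 / p - 1) ≤ s := by
  have hd' : (0 : ℝ) < d := by exact_mod_cast hd
  have hp := h.pos hd hs
  obtain ⟨-, h1, h2⟩ := h
  constructor
  · rw [← gap_eq_of_eq_stein rfl]
    gcongr
  · rw [← gap_eq_of_eq (s := s) hd rfl]
    gcongr

end Exponents

/-- The lower bound on R is asked only for negative exponents, so for nonnegative ones the scale may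
tend to 0. -/
theorem rpow_le_of_bounds {R R₀ R₁ x D : ℝ} (hR₀ : 0 < R₀) (hR₀' : R₀ ≤ 1) (hR₁ : 1 ≤ R₁) (hR : 0 < R)
    (hRR : R ≤ R₁) (hx : |x| ≤ D) (h : x < 0 → R₀ ≤ R) : R ^ x ≤ R₁ ^ D + R₀ ^ (-D) := by
  rw [abs_le] at hx
  rcases le_or_gt 0 x with h0 | h0
  · have : R ^ x ≤ R₁ ^ D := (Real.rpow_le_rpow hR.le hRR h0).trans
      (Real.rpow_le_rpow_of_exponent_le hR₁ hx.2)
    have : 0 < R₀ ^ (-D) := by positivity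
    linarith
  · have h1 : R ^ x ≤ R₀ ^ x := Real.rpow_le_rpow_of_nonpos hR₀ (h h0) h0.le
    have h2 : R₀ ^ x ≤ R₀ ^ (-D) := Real.rpow_le_rpow_of_exponent_ge hR₀ hR₀' hx.1
    have : 0 ≤ R₁ ^ D := by positivity
    linarith

/-- Functions whose transforms are given by a resolvent symbol at frequency scale `R` satisfy the
split bound, uniformly. -/
theorem exists_splitBound {d : ℕ} (hd : 0 < d) {s : ℝ} (hs : 0 < s) (hsd : s < d) (m : ℕ) {σ β : ℝ}
    (hβ : σ - β = s / 2) {C u₀ u₁ L R₀ R₁ CA : ℝ} (hC : 0 ≤ C) (hu₀ : 0 < u₀) (hL : 0 ≤ L)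
    (hR₀ : 0 < R₀) (hR₀' : R₀ ≤ 1) (hR₁ : 1 ≤ R₁) (hCA : 0 ≤ CA) :
    ∃ C' : ℝ, 0 ≤ C' ∧ ∀ (φ : ℝ → ℝ) (z A : ℂ) (R : ℝ) (ι : Type) [Fintype ι] (N : ι → E d → ℂ) (f : ι → L2 d ℂ)
      (G : L2 d ℂ), Fintype.card ι ≤ m → ResolventExpansion φ σ z C u₀ u₁ → 0 < R → R ≤ R₁ →
      (2 * d / (d + 1) ≤ s → R₀ ≤ R) → ‖A‖ ≤ CA * R ^ (-s) →
      (∀ j, BilinearMultiplier (fun ξ => N j ξ *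
        (Real.exp (-((2 * Real.pi / R) ^ 2 * ‖ξ‖ ^ 2)) : ℝ)) L) →
      (∀ j ξ, ‖N j ξ‖ ≤ L * (1 + (2 * Real.pi / R) ^ 2 * ‖ξ‖ ^ 2) ^ β) →
      (∀ᵐ ξ, (𝓕 G : L2 d ℂ) ξ = A * (((φ ((2 * Real.pi / R) ^ 2 * ‖ξ‖ ^ 2) : ℝ) : ℂ) - z)⁻¹ *
        ∑ j, N j ξ * (𝓕 (f j) : L2 d ℂ) ξ) → SplitBound s C' f G := by
  have hd' : (0 : ℝ) < d := by exact_mod_cast hd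
  have hd1 : (1 : ℝ) ≤ d := by exact_mod_cast hd
  -- As p varies, the order τ = d(2/p - 1) used for the remainder stays in [τ₀, s], a compact subset
  -- of (0, d); S₀ bounds the Sobolev constants there.
  set τ₀ := min s (2 * d / ((d : ℝ) + 1)) with hτ₀
  have hτ₀0 : 0 < τ₀ := lt_min hs (by positivity)
  set S₀ := 4 * d / τ₀ * (1 + 2 * √(ballConst d s)) with hS₀
  set M := R₁ ^ (d : ℝ) + R₀ ^ (-(d : ℝ)) with hM
  have hM0 : 0 ≤ M := by positivity
  have hS₀0 : 0 ≤ S₀ := by positivity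
  have hst : 0 ≤ steinConst d u₀ u₁ := by unfold steinConst; positivity
  refine ⟨CA * M * (C * L) * (steinConst d u₀ u₁ + S₀ ^ 2 * (m + 1)), by positivity, ?_⟩
  intro φ z A R ι _ N f G hm hexp hR hRR hRa hA hN1 hN2 hG
  obtain ⟨w, c, hw0, hw1, hc, hrem⟩ := hexp
  set κ := 2 * Real.pi / R with hκdef
  have hκ : 0 < κ := by positivity
  have hw : 0 < w.re := hu₀.trans_le hw0
  -- The prefactor A contributes R^{-s}, and an estimate gaining x derivatives contributes κ^{-x} ≤
  -- R^x. Only the net power R^{x-s} matters.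
  have hgap : ∀ x : ℝ, 0 ≤ x → x ≤ d → (x - s < 0 → R₀ ≤ R) → ‖A‖ * κ ^ (-x) ≤ CA * M := by
    intro x hx hxd hx'
    have h1 : κ ^ (-x) ≤ R ^ x := by
      rw [hκdef, Real.rpow_neg (by positivity), Real.div_rpow (by positivity) hR.le, inv_div]
      refine div_le_self (by positivity) (Real.one_le_rpow ?_ hx)
      linarith [Real.pi_gt_three]
    have h2 : R ^ (x - s) ≤ M := rpow_le_of_bounds hR₀ hR₀' hR₁ hR hRR
      (by rw [abs_le]; constructor <;> linarith) hx'
    calc ‖A‖ * κ ^ (-x) ≤ CA * R ^ (-s) * R ^ x := by gcongr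
      _ = CA * R ^ (x - s) := by
        rw [mul_assoc, ← Real.rpow_add hR]; congr 2; ring
      _ ≤ _ := by gcongr
  -- The factor e^{-x} of the expansion is attached to the numerator, which turns it into an
  -- admissible multiplier.
  set n : ι → E d → ℂ := fun j ξ => (A * c) * (N j ξ * (Real.exp (-(κ ^ 2 * ‖ξ‖ ^ 2)) : ℝ)) with hn
  have hnm : ∀ j, BilinearMultiplier (n j) (‖A * c‖ * L) := fun j => (hN1 j).const_mul _
  set H₁ : E d → ℂ := fun ξ => singularPart w (κ ^ 2 * ‖ξ‖ ^ 2) * ∑ j, n j ξ * (𝓕 (f j) : L2 d ℂ) ξ with hH₁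
  have hH₁m : AEStronglyMeasurable H₁ volume := by
    refine (measurable_singularPart κ w).aestronglyMeasurable.mul ?_
    exact Finset.aestronglyMeasurable_fun_sum _ fun j _ => (hnm j).1.mul (Lp.aestronglyMeasurable _)
  have hρ0 : ∀ ξ : E d, 0 ≤ κ ^ 2 * ‖ξ‖ ^ 2 := fun ξ => by positivity
  have hH₂ : ∀ᵐ ξ, ‖(𝓕 G : L2 d ℂ) ξ - H₁ ξ‖ ≤
      ‖A‖ * (C * L) * (1 + κ ^ 2 * ‖ξ‖ ^ 2) ^ (-(s / 2)) * ∑ j, ‖(𝓕 (f j) : L2 d ℂ) ξ‖ := by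
    filter_upwards [hG, ae_sub_ne_zero (d := d) hκ hw] with ξ hξ hne
    have h1 := (hrem _ (hρ0 ξ) (fun h => hne (by rw [h, sub_self]))).2
    set ρ := κ ^ 2 * ‖ξ‖ ^ 2 with hρ
    have hρp : 0 ≤ ρ := hρ0 ξ
    have e : (𝓕 G : L2 d ℂ) ξ - H₁ ξ = A * (((φ ρ : ℝ) : ℂ) - z)⁻¹ * (∑ j, N j ξ * (𝓕 (f j) : L2 d ℂ) ξ) -
        A * (c * (Complex.exp (-ρ) * singularPart w ρ)) * ∑ j, N j ξ * (𝓕 (f j) : L2 d ℂ) ξ := by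
      rw [hξ]
      congr 1
      simp only [H₁, n]
      rw [Finset.mul_sum, Finset.mul_sum]
      refine Finset.sum_congr rfl fun j _ => ?_
      rw [show singularPart w (κ ^ 2 * ‖ξ‖ ^ 2) = singularPart w ρ from rfl,
        show -(κ ^ 2 * ‖ξ‖ ^ 2) = -ρ from rfl]
      push_cast
      ring
    rw [e, ← sub_mul, ← mul_sub, norm_mul, norm_mul]
    calc _ ≤ ‖A‖ * (C * (1 + ρ) ^ (-σ)) * ∑ j, (L * (1 + ρ) ^ β) * ‖(𝓕 (f j) : L2 d ℂ) ξ‖ := by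
          gcongr
          refine (norm_sum_le _ _).trans (Finset.sum_le_sum fun j _ => ?_)
          rw [norm_mul]
          gcongr
          exact hN2 j ξ
      _ = ‖A‖ * (C * L) * ((1 + ρ) ^ (-σ) * (1 + ρ) ^ β) * ∑ j, ‖(𝓕 (f j) : L2 d ℂ) ξ‖ := by
          rw [← Finset.mul_sum]; ring
      _ = _ := by
          rw [← Real.rpow_add (by linarith), show -σ + β = -(s / 2) by linarith]
  -- The remainder is a bounded multiplier, so its piece lies in L². The singular piece then lies in
  -- L² as a difference, although its symbol may be unbounded.
  have hH₂m : MemLp (fun ξ => (𝓕 G : L2 d ℂ) ξ - H₁ ξ) 2 volume := by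
    have hs2 : MemLp (fun ξ => ∑ j, ‖(𝓕 (f j) : L2 d ℂ) ξ‖) 2 volume :=
      memLp_finsetSum _ fun j _ => (Lp.memLp (𝓕 (f j) : L2 d ℂ)).norm
    refine hs2.of_le_mul (c := ‖A‖ * (C * L)) ((Lp.aestronglyMeasurable _).sub hH₁m) ?_
    filter_upwards [hH₂] with ξ hξ
    refine hξ.trans ?_
    rw [Real.norm_of_nonneg (Finset.sum_nonneg fun j _ => norm_nonneg _)]
    have h1 : 1 ≤ 1 + κ ^ 2 * ‖ξ‖ ^ 2 := by linarith [hρ0 ξ]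
    have h2 : (1 + κ ^ 2 * ‖ξ‖ ^ 2) ^ (-(s / 2)) ≤ 1 :=
      Real.rpow_le_one_of_one_le_of_nonpos h1 (by linarith)
    exact mul_le_mul_of_nonneg_right (mul_le_of_le_one_right (by positivity) h2)
      (Finset.sum_nonneg fun j _ => norm_nonneg _)
  set G₂ : L2 d ℂ := 𝓕⁻ (hH₂m.toLp _) with hG₂
  have hFG₂ : (𝓕 G₂ : L2 d ℂ) = hH₂m.toLp _ := FourierTransform.fourier_fourierInv_eq _
  have hFG₁ : ∀ᵐ ξ, (𝓕 (G - G₂) : L2 d ℂ) ξ = H₁ ξ := by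
    have e : (𝓕 (G - G₂) : L2 d ℂ) = 𝓕 G - 𝓕 G₂ := map_sub (Lp.fourierTransformₗᵢ (E d) ℂ) G G₂
    rw [e, hFG₂]
    filter_upwards [Lp.coeFn_sub (𝓕 G : L2 d ℂ) (hH₂m.toLp _), hH₂m.coeFn_toLp] with ξ h1 h2
    rw [h1, Pi.sub_apply, h2, sub_sub_cancel]
  refine ⟨G - G₂, G₂, (sub_add_cancel _ _).symm, fun p q hpq hp hf => ?_, fun p p' hpp hp hf => ?_⟩
  · have hp0 : 0 < p := by
      rcases hp with h | h
      · rw [h]; positivity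
      · exact h.pos hd hs
    have hp1 : 1 ≤ p := by
      rcases hpq with ⟨p', h, -⟩ | ⟨h, -⟩
      · exact h.lt.le
      · exact h.ge
    have hθ0 : 2 / ((d : ℝ) + 1) ≤ 2 / p - 1 := by
      rcases hp with h | h
      · exact (gap_eq_of_eq_stein h).ge
      · exact (h.gap hd hs).1
    have hθ1 : 2 / p - 1 ≤ 1 := by
      have : 2 / p ≤ 2 := div_le_self (by norm_num) hp1
      linarith
    -- At the endpoint exponent d(2/p - 1) = 2d/(d+1). A negative power of R thus occurs only for s
    -- above this value, where R ≥ R₀ is assumed.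
    have hθs : d * (2 / p - 1) - s < 0 → R₀ ≤ R := by
      intro hlt
      rcases hp with h | h
      · rw [gap_eq_of_eq_stein h] at hlt
        apply hRa
        rw [show (2 * d / ((d : ℝ) + 1)) = d * (2 / (d + 1)) by ring]
        linarith
      · exact hRa h.1
    have hθp : (0 : ℝ) ≤ 2 / p - 1 := le_trans (by positivity) hθ0
    refine (singularPart_estimate hκ hu₀ hw0 hw1 hθ0 hθ1 (by field_simp; ring) hpq (by positivity) n hnm f _
      hf hFG₁).trans (mul_le_mul_left (ENNReal.ofReal_le_ofReal ?_) _)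
    have h1 := hgap (d * (2 / p - 1)) (by positivity) (mul_le_of_le_one_right hd'.le hθ1) hθs
    rw [norm_mul]
    calc ‖A‖ * ‖c‖ * L * (steinConst d u₀ u₁ * κ ^ (-(d * (2 / p - 1))))
        ≤ ‖A‖ * C * L * (steinConst d u₀ u₁ * κ ^ (-(d * (2 / p - 1)))) := by gcongr
      _ = (‖A‖ * κ ^ (-(d * (2 / p - 1)))) * (C * L) * (steinConst d u₀ u₁) := by ring
      _ ≤ CA * M * (C * L) * (steinConst d u₀ u₁ + S₀ ^ 2 * (m + 1)) := by
          gcongr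
          have : 0 ≤ S₀ ^ 2 * ((m : ℝ) + 1) := by positivity
          linarith
  · have hp0 : 0 < p := hpp.pos
    set τ := d * (2 / p - 1) with hτ
    have hpτ : p = 2 * d / (d + τ) := eq_of_gap hd hp0
    have hττ : τ₀ ≤ τ ∧ τ ≤ s := by
      rcases hp with h | h
      · rw [hτ, gap_eq_of_eq hd h]; exact ⟨min_le_left _ _, le_rfl⟩
      · obtain ⟨h1, h2⟩ := h.gap hd hs
        refine ⟨(min_le_right _ _).trans ?_, h2⟩
        rw [hτ, show (2 * d / ((d : ℝ) + 1)) = d * (2 / (d + 1)) by ring]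
        gcongr
    have hτ0 : 0 < τ := hτ₀0.trans_le hττ.1
    have hτd : τ < d := hττ.2.trans_lt hsd
    have hτR : τ - s < 0 → R₀ ≤ R := by
      intro hlt
      rcases hp with h | h
      · rw [hτ, gap_eq_of_eq hd h] at hlt; linarith
      · exact hRa h.1
    have hp'τ : p' = 2 * d / (d - τ) := by
      have h1 := holderConjugate_sobolev hd hτ0 hτd
      rw [← hpτ] at h1
      exact hpp.conjugate_eq.trans h1.conjugate_eq.symm
    have hnz : ∀ᵐ ξ : E d, ξ ≠ 0 := by
      have : Nontrivial (E d) := by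
        have : Nonempty (Fin d) := ⟨⟨0, hd⟩⟩
        infer_instance
      exact measure_eq_zero_iff_ae_notMem.1 (measure_singleton (0 : E d))
    -- Because x ≥ 0, (1 + x)^{-s/2} is at most x^{-τ/2} for every τ in [0, s]; one remainder bound
    -- serves all exponents p.
    have hbound : ∀ᵐ ξ, ‖(𝓕 G₂ : L2 d ℂ) ξ‖ ≤ (‖A‖ * (C * L) * κ ^ (-τ)) * ‖ξ‖ ^ (-τ) *
        ∑ j, ‖(𝓕 (f j) : L2 d ℂ) ξ‖ := by
      rw [hFG₂]
      filter_upwards [hH₂m.coeFn_toLp, hH₂, hnz] with ξ h1 h2 h3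
      rw [h1]
      refine h2.trans ?_
      have hξ : 0 < ‖ξ‖ := norm_pos_iff.2 h3
      rw [mul_assoc (‖A‖ * (C * L)) (κ ^ (-τ)), ← Real.mul_rpow hκ.le hξ.le]
      gcongr
      have h4 : (κ * ‖ξ‖) ^ (-τ) = (κ ^ 2 * ‖ξ‖ ^ 2) ^ (-(τ / 2)) := by
        rw [← mul_pow, ← Real.rpow_natCast, ← Real.rpow_mul (by positivity)]
        congr 1
        push_cast; ring
      rw [h4]
      calc (1 + κ ^ 2 * ‖ξ‖ ^ 2) ^ (-(s / 2)) ≤ (1 + κ ^ 2 * ‖ξ‖ ^ 2) ^ (-(τ / 2)) :=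
            Real.rpow_le_rpow_of_exponent_le (by linarith [hρ0 ξ]) (by linarith [hττ.2])
        _ ≤ _ := Real.rpow_le_rpow_of_nonpos (by positivity) (by linarith) (by linarith)
    have hsob := eLpNorm_le_of_norm_fourier_le hd hτ0 hτd f G₂ (by positivity) hbound
      (by rw [← hpτ]; exact hf)
    rw [← hpτ, ← hp'τ] at hsob
    refine hsob.trans (mul_le_mul_left (ENNReal.ofReal_le_ofReal ?_) _)
    have h1 := hgap τ hτ0.le hτd.le hτR
    have h2 : sobolevConst d τ ≤ S₀ := sobolevConst_le hd hτ₀0 hττ.1 hττ.2 hsd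
    have h3 : 0 ≤ sobolevConst d τ := sobolevConst_nonneg d hτ0
    have h4 : (Fintype.card ι : ℝ) ≤ m := by exact_mod_cast hm
    calc sobolevConst d τ ^ 2 * (‖A‖ * (C * L) * κ ^ (-τ) * (Fintype.card ι + 1))
        = (‖A‖ * κ ^ (-τ)) * (C * L) * (sobolevConst d τ ^ 2 * (Fintype.card ι + 1)) := by ring
      _ ≤ CA * M * (C * L) * (S₀ ^ 2 * (m + 1)) := by gcongr
      _ ≤ _ := by
          gcongr
          linarith

end

/-! ### From resolvents to multipliers, and assembly from coordinates -/

section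

section Resolvent

variable {d : ℕ} {V : Type} [NormedAddCommGroup V] [InnerProductSpace ℂ V] [CompleteSpace V]

theorem fourier_ofSymbol_ae (T : E d → V →L[ℂ] V) (x : (ofSymbol T).domain) :
    ∀ᵐ ξ, (𝓕 (ofSymbol T x) : L2 d V) ξ = T ((2 * Real.pi) • ξ) ((𝓕 (x : L2 d V) : L2 d V) ξ) := by
  have hx : MemLp (fun ξ => T ((2 * Real.pi) • ξ) ((𝓕 (x : L2 d V) : L2 d V) ξ)) 2 volume := x.2
  have e : (𝓕 (ofSymbol T x) : L2 d V) = hx.toLp _ :=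
    (Lp.fourierTransformₗᵢ (E d) V).apply_symm_apply _
  rw [e]
  exact hx.coeFn_toLp

/-- The defining relation of the resolvent in Fourier space. -/
theorem fourier_resolvent_ae {T : E d → V →L[ℂ] V} {z : ℂ}
    (hT : ∀ᵐ ξ : E d, ∀ v : V, T ((2 * Real.pi) • ξ) v - z • v = 0 → v = 0)
    (f : (resolvent (ofSymbol T) z).domain) :
    ∀ᵐ ξ, (𝓕 (f : L2 d V) : L2 d V) ξ =
      T ((2 * Real.pi) • ξ) ((𝓕 (resolvent (ofSymbol T) z f) : L2 d V) ξ) -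
        z • (𝓕 (resolvent (ofSymbol T) z f) : L2 d V) ξ := by
  set A := ofSymbol T - (z • LinearMap.id : L2 d V →ₗ[ℂ] L2 d V).toPMap ⊤ with hA
  have hAx : ∀ x : A.domain, ∀ᵐ ξ, (𝓕 (A x) : L2 d V) ξ =
      T ((2 * Real.pi) • ξ) ((𝓕 (x : L2 d V) : L2 d V) ξ) - z • (𝓕 (x : L2 d V) : L2 d V) ξ := by
    intro x
    have e : A x = ofSymbol T ⟨x, x.2.1⟩ - z • (x : L2 d V) := rfl
    have e2 : (𝓕 (A x) : L2 d V) = 𝓕 (ofSymbol T ⟨x, x.2.1⟩) - z • 𝓕 (x : L2 d V) := by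
      rw [e]
      exact (map_sub (Lp.fourierTransformₗᵢ (E d) V) _ _).trans
        (congrArg _ (map_smul (Lp.fourierTransformₗᵢ (E d) V) z (x : L2 d V)))
    rw [e2]
    filter_upwards [Lp.coeFn_sub (𝓕 (ofSymbol T ⟨x, x.2.1⟩) : L2 d V) (z • 𝓕 (x : L2 d V)),
      Lp.coeFn_smul z (𝓕 (x : L2 d V) : L2 d V), fourier_ofSymbol_ae T ⟨x, x.2.1⟩] with ξ h1 h2 h3
    rw [h1, Pi.sub_apply, h2, Pi.smul_apply, h3]
  -- Injectivity makes `LinearPMap.inverse` a genuine inverse. It holds because the symbol minus z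
  -- is injective at almost every frequency, also for z in the spectrum.
  have hker : A.toFun.ker = ⊥ := by
    rw [LinearMap.ker_eq_bot']
    intro x hx
    have h0 : A x = 0 := hx
    have h1 := hAx x
    rw [h0] at h1
    have hz : (𝓕 (0 : L2 d V) : L2 d V) = 0 := map_zero (Lp.fourierTransformₗᵢ (E d) V)
    rw [hz] at h1
    have h2 : (𝓕 (x : L2 d V) : L2 d V) = 0 := by
      rw [Lp.eq_zero_iff_ae_eq_zero]
      filter_upwards [h1, hT, Lp.coeFn_zero V 2 (volume : Measure (E d))] with ξ k1 k2 k3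
      rw [k3] at k1
      exact k2 _ k1.symm
    have h3 : (x : L2 d V) = 0 := (Lp.fourierTransformₗᵢ (E d) V).map_eq_zero_iff.1 h2
    exact Subtype.ext h3
  have hf : (f : L2 d V) ∈ LinearMap.range A.toFun := by
    rw [← LinearPMap.inverse_domain]; exact f.2
  obtain ⟨x, hx⟩ := hf
  have hy : resolvent (ofSymbol T) z f = x := LinearPMap.inverse_apply_eq hker (y := f) (x := x) hx
  rw [hy, ← hx]
  exact hAx x

end Resolvent

theorem eLpSumNorm_le {d : ℕ} {V : Type} [NormedAddCommGroup V] {g g₁ g₂ : E d → V} (h₁ : AEStronglyMeasurable g₁ volume)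
    (h₂ : AEStronglyMeasurable g₂ volume) (h : g =ᵐ[volume] g₁ + g₂) (p q : ℝ≥0∞) :
    eLpSumNorm g p q ≤ eLpNorm g₁ p volume + eLpNorm g₂ q volume := by
  unfold eLpSumNorm
  exact iInf_le_of_le g₁ (iInf_le_of_le g₂ (iInf_le_of_le h₁ (iInf_le_of_le h₂ (iInf_le _ h))))

section Assembly

variable {d : ℕ} {V : Type} [NormedAddCommGroup V] [InnerProductSpace ℂ V]

/-- Coordinates on `V` that are contractions, together with the unit vectors dual to them. -/
structure ContractiveCoordinates (V : Type) [NormedAddCommGroup V] [InnerProductSpace ℂ V]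
    (ι : Type) [Fintype ι] where
  /-- The coordinate functionals. -/
  coord : ι → V →L[ℂ] ℂ
  /-- The dual vectors. -/
  vec : ι → V
  norm_coord_le : ∀ i v, ‖coord i v‖ ≤ ‖v‖
  norm_vec_le : ∀ i, ‖vec i‖ ≤ 1
  sum_eq : ∀ v, ∑ i, coord i v • vec i = v

/-- The coordinate of a complex number. -/
def ContractiveCoordinates.scalar : ContractiveCoordinates ℂ Unit where
  coord _ := ContinuousLinearMap.id ℂ ℂ
  vec _ := 1
  norm_coord_le _ _ := le_rfl
  norm_vec_le _ := by simp
  sum_eq v := by simp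

/-- The coordinates of `ℂⁿ`. -/
def ContractiveCoordinates.euclidean (n : ℕ) :
    ContractiveCoordinates (EuclideanSpace ℂ (Fin n)) (Fin n) where
  coord i := EuclideanSpace.proj i
  vec i := EuclideanSpace.single i 1
  norm_coord_le i v := PiLp.norm_apply_le v i
  norm_vec_le i := by simp
  sum_eq v := by
    ext j
    simp [Finset.sum_apply, Pi.single_apply]

variable {ι : Type} [Fintype ι]

theorem eLpNorm_coord_le (B : ContractiveCoordinates V ι) (i : ι) (f : L2 d V) (p : ℝ≥0∞) :
    eLpNorm ((B.coord i).compLp f) p volume ≤ eLpNorm f p volume := by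
  refine eLpNorm_mono_ae ?_
  filter_upwards [(B.coord i).coeFn_compLp f] with x hx
  rw [hx]
  exact B.norm_coord_le i _

theorem eLpNorm_sum_smul_vec_le (B : ContractiveCoordinates V ι) (G : ι → L2 d ℂ) {p : ℝ≥0∞} (hp : 1 ≤ p) :
    eLpNorm (∑ i, fun x => G i x • B.vec i) p volume ≤ ∑ i, eLpNorm (G i) p volume := by
  refine (eLpNorm_sum_le (fun i _ => (Lp.aestronglyMeasurable (G i)).smul_const _) hp).trans ?_
  refine Finset.sum_le_sum fun i _ => eLpNorm_mono fun x => ?_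
  rw [norm_smul]
  exact mul_le_of_le_one_right (norm_nonneg _) (B.norm_vec_le i)

theorem sum_coord_smul_vec_ae (B : ContractiveCoordinates V ι) (g : L2 d V) :
    g =ᵐ[volume] ∑ i, fun x => (B.coord i).compLp g x • B.vec i := by
  have h : ∀ᵐ x, ∀ i, (B.coord i).compLp g x = B.coord i (g x) :=
    ae_all_iff.2 fun i => (B.coord i).coeFn_compLp g
  filter_upwards [h] with x hx
  rw [Finset.sum_apply]
  simp only [hx]
  exact (B.sum_eq _).symm

/-- For d > 1 this is the Sobolev pair with τ = 2d/(d+1). For d = 1 the division by zero in `ℝ≥0∞`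
has the value ∞, paired with p = 1. -/
theorem isDualPair_stein (hd : 0 < d) :
    IsDualPair (2 * (d + 1) / (d + 3)) (2 * ((d : ℝ≥0∞) + 1) / ((d : ℝ≥0∞) - 1)) := by
  rcases Nat.lt_or_ge 1 d with h | h
  · left
    have hd1 : (1 : ℝ) < d := by exact_mod_cast h
    have h1 := holderConjugate_sobolev hd (τ := 2 * d / (d + 1)) (by positivity) (by
      rw [div_lt_iff₀ (by positivity)]; nlinarith)
    refine ⟨2 * (d + 1) / (d - 1), ?_, ?_⟩
    · convert h1 using 1
      · field_simp; ring
      · have : (d : ℝ) - 1 ≠ 0 := by linarith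
        have h3 : (d : ℝ) - 2 * d / (d + 1) ≠ 0 := by
          have : (d : ℝ) - 2 * d / (d + 1) = d * (d - 1) / (d + 1) := by field_simp; ring
          rw [this]; positivity
        rw [div_eq_div_iff this h3]
        field_simp
        ring
    · rw [ENNReal.ofReal_div_of_pos (by linarith), ENNReal.ofReal_mul (by norm_num),
        ENNReal.ofReal_add (by positivity) (by norm_num), ENNReal.ofReal_sub _ (by norm_num)]
      simp
  · right
    have : d = 1 := by omega
    subst this
    constructor
    · norm_num
    · simp [ENNReal.div_zero]

theorem SplitBound.mono {s C C' : ℝ} {f : ι → L2 d ℂ} {G : L2 d ℂ} (h : SplitBound s C f G) (hC : C ≤ C') :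
    SplitBound s C' f G := by
  obtain ⟨G₁, G₂, hG, h1, h2⟩ := h
  refine ⟨G₁, G₂, hG, fun p q hpq hp hf => (h1 p q hpq hp hf).trans ?_,
    fun p p' hpp hp hf => (h2 p p' hpp hp hf).trans ?_⟩ <;> gcongr

/-- Split bounds for the coordinates of the resolvent give the uniform Sobolev inequalities. -/
theorem uniformSobolev_of_splitBound [CompleteSpace V] (hd : 0 < d) {s : ℝ} (hs : 0 < s) (hsd : s < d)
    (B : ContractiveCoordinates V ι) {J : Type} [Fintype J] (k : J → ι) (H : L2 d V →ₗ.[ℂ] L2 d V) (K : Set ℂ)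
    (C : ℝ)
    (h : ∀ z ∈ K, ∀ f : (resolvent H z).domain, ∀ i, SplitBound s C
      (fun j : J => (B.coord (k j)).compLp (f : L2 d V)) ((B.coord i).compLp (resolvent H z f))) :
    UniformSobolev H s K := by
  set c : ℝ≥0 := C.toNNReal * Fintype.card J with hc
  have hsum : ∀ (f : L2 d V) (p : ℝ≥0∞),
      ENNReal.ofReal C * ∑ j, eLpNorm ((B.coord (k j)).compLp f) p volume ≤ c * eLpNorm f p volume := by
    intro f p
    rw [hc, ENNReal.coe_mul, mul_assoc]
    refine mul_le_mul_right ?_ _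
    refine (Finset.sum_le_sum fun j _ => eLpNorm_coord_le B (k j) f p).trans ?_
    simp
  refine ⟨2 * c * Fintype.card ι, fun hs2 p p' hpp hp1 hp2 z hz f hf => ?_, fun hs2 z hz f hf1 hf2 => ?_⟩
  · have hadm : IsAdmissible d s p := ⟨hs2, hp1, hp2⟩
    have hfin : ∀ j, eLpNorm ((B.coord (k j)).compLp (f : L2 d V)) (.ofReal p) volume ≠ ∞ := fun j =>
      ((eLpNorm_coord_le B (k j) _ _).trans_lt hf.2).ne
    have hp'1 : (1 : ℝ≥0∞) ≤ .ofReal p' := by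
      rw [← ENNReal.ofReal_one]; exact ENNReal.ofReal_le_ofReal hpp.symm.lt.le
    rw [eLpNorm_congr_ae (sum_coord_smul_vec_ae B (resolvent H z f))]
    refine (eLpNorm_sum_smul_vec_le B _ hp'1).trans ?_
    have hi : ∀ i, eLpNorm ((B.coord i).compLp (resolvent H z f)) (.ofReal p') volume ≤
        2 * c * eLpNorm (f : L2 d V) (.ofReal p) volume := by
      intro i
      obtain ⟨G₁, G₂, hG, h1, h2⟩ := h z hz f i
      rw [hG, eLpNorm_congr_ae (Lp.coeFn_add G₁ G₂)]
      refine (eLpNorm_add_le (Lp.aestronglyMeasurable _) (Lp.aestronglyMeasurable _) hp'1).trans ?_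
      have b1 := (h1 p _ (Or.inl ⟨p', hpp, rfl⟩) (Or.inr hadm) hfin).trans (hsum f _)
      have b2 := (h2 p p' hpp (Or.inr hadm) hfin).trans (hsum f _)
      calc _ ≤ c * eLpNorm (f : L2 d V) (.ofReal p) volume + c * eLpNorm (f : L2 d V) (.ofReal p) volume :=
            add_le_add b1 b2
        _ = _ := by ring
    refine (Finset.sum_le_sum fun i _ => hi i).trans (le_of_eq ?_)
    rw [Finset.sum_const, Finset.card_univ, nsmul_eq_mul]
    push_cast
    ring
  · have hfin1 : ∀ j, eLpNorm ((B.coord (k j)).compLp (f : L2 d V)) (.ofReal (2 * d / (d + s))) volume ≠ ∞ :=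
      fun j => ((eLpNorm_coord_le B (k j) _ _).trans_lt hf1.2).ne
    have hfin2 : ∀ j, eLpNorm ((B.coord (k j)).compLp (f : L2 d V))
        (.ofReal (2 * (d + 1) / (d + 3))) volume ≠ ∞ :=
      fun j => ((eLpNorm_coord_le B (k j) _ _).trans_lt hf2.2).ne
    choose G₁ G₂ hG h1 h2 using h z hz f
    have hconj := holderConjugate_sobolev hd hs hsd
    have hq1 : (1 : ℝ≥0∞) ≤ .ofReal (2 * d / (d - s)) := by
      rw [← ENNReal.ofReal_one]; exact ENNReal.ofReal_le_ofReal hconj.symm.lt.le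
    have hdual := isDualPair_stein hd
    have hq2 : (1 : ℝ≥0∞) ≤ 2 * ((d : ℝ≥0∞) + 1) / ((d : ℝ≥0∞) - 1) := by
      rcases hdual with ⟨p', hp', e⟩ | ⟨-, e⟩
      · rw [e, ← ENNReal.ofReal_one]; exact ENNReal.ofReal_le_ofReal hp'.symm.lt.le
      · rw [e]; exact le_top
    -- The order is reversed: the regular parts G₂ go to the Sobolev space L^{2d/(d-s)}, the
    -- singular parts G₁ to the space with exponent 2(d+1)/(d-1).
    refine (eLpSumNorm_le (g₁ := ∑ i, fun x => G₂ i x • B.vec i) (g₂ := ∑ i, fun x => G₁ i x • B.vec i)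
      ?_ ?_ ?_ _ _).trans ?_
    · exact Finset.aestronglyMeasurable_sum _ fun i _ => (Lp.aestronglyMeasurable (G₂ i)).smul_const _
    · exact Finset.aestronglyMeasurable_sum _ fun i _ => (Lp.aestronglyMeasurable (G₁ i)).smul_const _
    · have hadd : ∀ᵐ x, ∀ i, (G₁ i + G₂ i : L2 d ℂ) x = G₁ i x + G₂ i x :=
        ae_all_iff.2 fun i => Lp.coeFn_add (G₁ i) (G₂ i)
      filter_upwards [sum_coord_smul_vec_ae B (resolvent H z f), hadd] with x hx hx2
      rw [hx, Pi.add_apply, Finset.sum_apply, Finset.sum_apply, Finset.sum_apply, ← Finset.sum_add_distrib]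
      refine Finset.sum_congr rfl fun i _ => ?_
      rw [hG i, hx2, add_smul, add_comm]
    · set m := max (eLpNorm (f : L2 d V) (.ofReal (2 * d / (d + s))) volume)
        (eLpNorm (f : L2 d V) (.ofReal (2 * (d + 1) / (d + 3))) volume) with hm
      have b1 : ∀ i, eLpNorm (G₁ i) (2 * ((d : ℝ≥0∞) + 1) / ((d : ℝ≥0∞) - 1)) volume ≤ c * m := fun i =>
        ((h1 i _ _ hdual (Or.inl rfl) hfin2).trans (hsum f _)).trans (by gcongr; exact le_max_right _ _)
      have b2 : ∀ i, eLpNorm (G₂ i) (.ofReal (2 * d / (d - s))) volume ≤ c * m := fun i =>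
        ((h2 i _ _ hconj (Or.inl rfl) hfin1).trans (hsum f _)).trans (by gcongr; exact le_max_left _ _)
      refine (add_le_add ((eLpNorm_sum_smul_vec_le B _ hq1).trans (Finset.sum_le_sum fun i _ => b2 i))
        ((eLpNorm_sum_smul_vec_le B _ hq2).trans (Finset.sum_le_sum fun i _ => b1 i))).trans (le_of_eq ?_)
      rw [Finset.sum_const, Finset.card_univ, nsmul_eq_mul]
      push_cast
      ring

end Assembly

end

/-! ### Scalar operators -/

section

theorem ResolventExpansion.ae_ne {d : ℕ} {φ : ℝ → ℝ} {σ C u₀ u₁ κ : ℝ} {z : ℂ}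
    (h : ResolventExpansion φ σ z C u₀ u₁) (hu₀ : 0 < u₀) (hκ : 0 < κ) :
    ∀ᵐ ξ : E d, (φ (κ ^ 2 * ‖ξ‖ ^ 2) : ℂ) - z ≠ 0 := by
  obtain ⟨w, c, hw0, -, -, h⟩ := h
  filter_upwards [ae_sub_ne_zero (d := d) hκ (hu₀.trans_le hw0)] with ξ hξ
  exact sub_ne_zero.2 (h _ (by positivity) (fun e => hξ (by rw [e, sub_self]))).1

/-- A pointwise bound of the transform by `|ξ|^{-s}` gives a split bound without singular part. -/
theorem splitBound_of_norm_fourier_le {d : ℕ} (hd : 0 < d) {s : ℝ} (hs : 0 < s) (hsd : s < d)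
    (hs2 : ¬ 2 * d / (d + 1) ≤ s) {J : Type} [Fintype J] (f : J → L2 d ℂ) (G : L2 d ℂ) {K : ℝ} (hK : 0 ≤ K)
    (h : ∀ᵐ ξ, ‖(𝓕 G : L2 d ℂ) ξ‖ ≤ K * ‖ξ‖ ^ (-s) * ∑ j, ‖(𝓕 (f j) : L2 d ℂ) ξ‖) :
    SplitBound s (sobolevConst d s ^ 2 * (K * (Fintype.card J + 1))) f G := by
  refine ⟨0, G, (zero_add _).symm, fun p q _ _ _ => ?_, fun p p' hpp hp hf => ?_⟩
  · rw [eLpNorm_congr_ae (Lp.coeFn_zero ℂ 2 volume), eLpNorm_zero]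
    exact zero_le
  · have hp : p = 2 * d / (d + s) := hp.resolve_right fun h => hs2 h.1
    have hp' : p' = 2 * d / (d - s) := by
      have h1 := holderConjugate_sobolev hd hs hsd
      rw [← hp] at h1
      exact hpp.conjugate_eq.trans h1.conjugate_eq.symm
    rw [hp']
    rw [hp] at hf ⊢
    exact eLpNorm_le_of_norm_fourier_le hd hs hsd f G hK h hf

theorem fourier_coord_ae {d : ℕ} {V : Type} [NormedAddCommGroup V] [InnerProductSpace ℂ V] [CompleteSpace V]
    (L : V →L[ℂ] ℂ) (f : L2 d V) :
    ∀ᵐ ξ, (𝓕 (L.compLp f) : L2 d ℂ) ξ = L ((𝓕 f : L2 d V) ξ) := by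
  rw [fourier_compLp]
  exact L.coeFn_compLp _

/-- Uniform split bounds for the resolvents of a scalar operator, at frequency scale `R`. -/
theorem exists_splitBound_scalar {d : ℕ} (hd : 0 < d) {s : ℝ} (hs : 0 < s) (hsd : s < d) {C u₀ u₁ R₀ R₁ : ℝ}
    (hC : 0 ≤ C) (hu₀ : 0 < u₀) (hR₀ : 0 < R₀) (hR₀' : R₀ ≤ 1) (hR₁ : 1 ≤ R₁) :
    ∃ C' : ℝ, 0 ≤ C' ∧ ∀ (φ : ℝ → ℝ) (T : E d → ℝ) (z z' : ℂ) (R : ℝ), ResolventExpansion φ (s / 2) z' C u₀ u₁ →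
      0 < R → R ≤ R₁ → (2 * d / (d + 1) ≤ s → R₀ ≤ R) → z = (R ^ s : ℝ) * z' →
      (∀ ξ, T ((2 * Real.pi) • ξ) = R ^ s * φ ((2 * Real.pi / R) ^ 2 * ‖ξ‖ ^ 2)) →
      ∀ (f : (resolvent (ofSymbol (scalarSymbol T)) z).domain) (i : Unit), SplitBound s C'
        (fun j : Unit => (ContractiveCoordinates.scalar.coord j).compLp (f : L2 d ℂ))
        ((ContractiveCoordinates.scalar.coord i).compLp (resolvent (ofSymbol (scalarSymbol T)) z f)) := by
  obtain ⟨L, hL1, hL⟩ := exists_bilinearMultiplier_gaussian d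
  obtain ⟨C', hC', h⟩ := exists_splitBound hd hs hsd 1 (σ := s / 2) (β := 0) (by ring) (u₁ := u₁) hC hu₀
    (zero_le_one.trans hL1) hR₀ hR₀' hR₁ zero_le_one
  refine ⟨C', hC', fun φ T z z' R hexp hR hRR hRa hz hT f i => ?_⟩
  have hRs : 0 < R ^ s := by positivity
  have hRs' : ((R ^ s : ℝ) : ℂ) ≠ 0 := by exact_mod_cast hRs.ne'
  have hκ : 0 < 2 * Real.pi / R := by positivity
  have hne := hexp.ae_ne (d := d) hu₀ hκ
  -- Symbol and energy scale alike, so the resolvent is R^{-s} times a normalized one; this is the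
  -- prefactor A of the split bound.
  have hfac : ∀ ξ : E d, ((T ((2 * Real.pi) • ξ) : ℝ) : ℂ) - z =
      (R ^ s : ℝ) * (((φ ((2 * Real.pi / R) ^ 2 * ‖ξ‖ ^ 2) : ℝ) : ℂ) - z') := by
    intro ξ
    rw [hT, hz]
    push_cast; ring
  have hval : ∀ (ξ : E d) (v : ℂ), scalarSymbol T ((2 * Real.pi) • ξ) v - z • v =
      (R ^ s : ℝ) * (((φ ((2 * Real.pi / R) ^ 2 * ‖ξ‖ ^ 2) : ℝ) : ℂ) - z') * v := by
    intro ξ v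
    rw [← hfac, sub_mul]
    rfl
  have hres := fourier_resolvent_ae (T := scalarSymbol T) (z := z) (by
    filter_upwards [hne] with ξ hξ v hv
    rw [hval] at hv
    exact (mul_eq_zero.1 hv).resolve_left (mul_ne_zero hRs' hξ)) f
  refine h φ z' ((R ^ s : ℝ) : ℂ)⁻¹ R Unit (fun _ _ => 1) _ _ (by simp) hexp hR hRR hRa ?_ (fun _ => ?_) ?_ ?_
  · rw [norm_inv, Complex.norm_real, Real.norm_of_nonneg hRs.le, Real.rpow_neg hR.le, one_mul]
  · simpa only [one_mul] using (hL _ hκ).1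
  · intro _ ξ
    rw [norm_one, Real.rpow_zero, mul_one]
    exact hL1
  · filter_upwards [hres, hne, fourier_coord_ae (ContractiveCoordinates.scalar.coord ()) (f : L2 d ℂ),
      fourier_coord_ae (ContractiveCoordinates.scalar.coord i) (resolvent (ofSymbol (scalarSymbol T)) z f)]
      with ξ h1 h2 h3 h4
    rw [hval] at h1
    rw [h4, Finset.univ_unique, Finset.sum_singleton, PUnit.default_eq_unit, h3]
    simp only [ContractiveCoordinates.scalar, ContinuousLinearMap.id_apply]
    rw [h1]
    generalize ((φ ((2 * Real.pi / R) ^ 2 * ‖ξ‖ ^ 2) : ℝ) : ℂ) - z' = y at h2 ⊢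
    field_simp

theorem analyticAt_const_add_cpow {b x : ℝ} (h : 0 < b + x) (σ : ℂ) :
    AnalyticAt ℂ (fun ζ : ℂ => ((b : ℂ) + ζ) ^ σ) x ∧
      deriv (fun ζ : ℂ => ((b : ℂ) + ζ) ^ σ) x = σ * ((b + x : ℝ) : ℂ) ^ (σ - 1) := by
  have hs : (b : ℂ) + x ∈ Complex.slitPlane := by
    rw [← Complex.ofReal_add]; exact Complex.ofReal_mem_slitPlane.2 h
  constructor
  · exact (analyticAt_const.add analyticAt_id).cpow analyticAt_const hs
  · have h1 := ((hasDerivAt_id (x : ℂ)).const_add (b : ℂ)).cpow_const (c := σ) hs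
    simp only [id_eq] at h1
    rw [h1.deriv]
    push_cast
    ring

section Fractional

variable {d : ℕ} {s : ℝ}

/-- By homogeneity the unit circle represents all nonzero energies. On it the only value attained is
1, at x = 1, where the derivative s/2 does not vanish. -/
theorem exists_resolventExpansion_rpow (hs : 0 < s) :
    ∃ C u₀ u₁ : ℝ, 0 < u₀ ∧ 0 ≤ C ∧ ∀ z ∈ Metric.sphere (0 : ℂ) 1,
      ResolventExpansion (fun x => x ^ (s / 2)) (s / 2) z C u₀ u₁ := by
  have hσ : 0 < s / 2 := by positivity
  refine exists_resolventExpansion hσ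
    (ContinuousOn.rpow_const (f := fun x => x) continuousOn_id fun x _ => Or.inr hσ.le)
    (c₀ := (2 ^ (s / 2))⁻¹) (B := 1) (by positivity) (fun x hx => ?_) (isCompact_sphere _ _) (fun z₀ hz₀ => ?_)
  · have h2 : (0 : ℝ) < 2 ^ (s / 2) := by positivity
    rw [inv_mul_le_iff₀ h2, abs_of_nonneg (by positivity)]
    rcases le_total x 1 with h | h
    · calc (1 + x) ^ (s / 2) ≤ 2 ^ (s / 2) := Real.rpow_le_rpow (by linarith) (by linarith) hσ.le
        _ = 2 ^ (s / 2) * (0 + 1) := by ring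
        _ ≤ _ := by gcongr; positivity
    · calc (1 + x) ^ (s / 2) ≤ (2 * x) ^ (s / 2) := Real.rpow_le_rpow (by linarith) (by linarith) hσ.le
        _ = 2 ^ (s / 2) * x ^ (s / 2) := Real.mul_rpow (by norm_num) hx
        _ ≤ _ := by gcongr; linarith
  · have hz : ‖z₀‖ = 1 := by simpa using hz₀
    have key : ∀ x : ℝ, 0 ≤ x → ((x ^ (s / 2) : ℝ) : ℂ) = z₀ → x = 1 := by
      intro x hx h
      rw [← h, Complex.norm_real, Real.norm_of_nonneg (by positivity)] at hz
      exact (Real.rpow_left_inj hx zero_le_one hσ.ne').1 (by rw [Real.one_rpow]; exact hz)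
    by_cases h1 : z₀ = 1
    · right
      have ha := analyticAt_const_add_cpow (b := 0) (x := 1) (by norm_num) ((s / 2 : ℝ) : ℂ)
      refine ⟨1, one_pos, by rw [h1]; simp, fun x hx hne h => hne (key x hx h),
        fun ζ => (((0 : ℝ) : ℂ) + ζ) ^ ((s / 2 : ℝ) : ℂ), ha.1, ?_, fun x hx => ?_⟩
      · rw [ha.2]
        simpa using hs.ne'
      · simp only [Complex.ofReal_zero, zero_add]
        rw [Complex.ofReal_cpow hx.le]
    · left
      intro x hx h
      have := key x hx h
      rw [this] at h
      exact h1 (by rw [← h]; simp)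

/-- For s > 1 the power is differentiable at the origin. This keeps 0 out of K in the regime of L^p
→ L^{p'} bounds. -/
theorem zero_mem_criticalValues_fracSymbol (hs : 1 < s) : (0 : ℝ) ∈ criticalValues (fracSymbol d s) := by
  refine ⟨0, ?_, ?_⟩
  · have h := hasFDerivAt_norm_rpow (0 : E d) hs
    rw [map_zero, smul_zero] at h
    exact h
  · rw [fracSymbol, norm_zero, Real.zero_rpow (by linarith)]

/-- The scale is R = |z|^{1/s} and the normalized energy z/|z| lies on the unit circle, so
uniformity in z becomes uniformity in R. -/
theorem uniformSobolev_fracSymbol (hs : 0 < s) (hsd : s < d) {K : Set ℂ}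
    (hK : IsCompactAvoiding K (criticalValues (fracSymbol d s))) :
    UniformSobolev (ofSymbol (scalarSymbol (fracSymbol d s))) s K := by
  have hd : 0 < d := by
    rcases Nat.eq_zero_or_pos d with h | h
    · rw [h] at hsd; norm_num at hsd; linarith
    · exact h
  have hd1 : (1 : ℝ) ≤ d := by exact_mod_cast hd
  obtain ⟨C, u₀, u₁, hu₀, hC, hexp⟩ := exists_resolventExpansion_rpow hs
  obtain ⟨b, hb⟩ := hK.1.isBounded.exists_norm_le
  set R₁ := max 1 (b ^ (1 / s)) with hR₁
  -- If s ≥ 2d/(d+1), then s > 1, since equality 2d/(d+1) = 1 needs d = 1, excluded by s < d. So K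
  -- avoids 0 and the scales have a positive minimum. Otherwise no lower bound is needed and R₀ = 1
  -- is a dummy.
  obtain ⟨R₀, hR₀, hR₀', hR₀K⟩ : ∃ R₀ : ℝ, 0 < R₀ ∧ R₀ ≤ 1 ∧
      (2 * d / (d + 1) ≤ s → ∀ z ∈ K, R₀ ≤ ‖z‖ ^ (1 / s)) := by
    by_cases h : 2 * d / (d + 1) ≤ s
    · have hs1 : 1 < s := by
        rw [div_le_iff₀ (by positivity)] at h
        nlinarith
      have h0 : (0 : ℂ) ∉ K := by
        have := hK.2 0 (zero_mem_criticalValues_fracSymbol hs1)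
        simpa using this
      obtain ⟨δ, hδ, hδK⟩ := hK.1.exists_forall_le' (a := 0) (f := fun z : ℂ => ‖z‖) continuous_norm.continuousOn
        (fun z hz => norm_pos_iff.2 fun h => h0 (h ▸ hz))
      refine ⟨min 1 (δ ^ (1 / s)), by positivity, min_le_left _ _, fun _ z hz => (min_le_right _ _).trans ?_⟩
      exact Real.rpow_le_rpow hδ.le (hδK z hz) (by positivity)
    · exact ⟨1, one_pos, le_rfl, fun h' => absurd h' h⟩
  obtain ⟨C', hC', hsplit⟩ := exists_splitBound_scalar hd hs hsd (u₁ := u₁) hC hu₀ hR₀ hR₀' (le_max_left 1 _ : 1 ≤ R₁)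
  refine uniformSobolev_of_splitBound hd hs hsd ContractiveCoordinates.scalar (fun j : Unit => j) _ K
    (max C' (sobolevConst d s ^ 2 * (1 * (Fintype.card Unit + 1)))) fun z hz f i => ?_
  -- At z = 0 there is no scale; the inverse symbol |2πξ|^{-s} is covered by the Sobolev
  -- inequalities alone.
  rcases eq_or_ne z 0 with rfl | hz0
  · have hs2 : ¬ 2 * d / (d + 1) ≤ s := by
      intro h
      have := hR₀K h 0 hz
      rw [norm_zero, Real.zero_rpow (by positivity)] at this
      linarith
    refine (splitBound_of_norm_fourier_le hd hs hsd hs2 _ _ zero_le_one ?_).mono (le_max_right _ _)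
    have hnz : ∀ᵐ ξ : E d, ξ ≠ 0 := by
      have : Nontrivial (E d) := by
        have : Nonempty (Fin d) := ⟨⟨0, hd⟩⟩
        infer_instance
      exact measure_eq_zero_iff_ae_notMem.1 (measure_singleton (0 : E d))
    have hval : ∀ (ξ : E d) (v : ℂ), scalarSymbol (fracSymbol d s) ((2 * Real.pi) • ξ) v - (0 : ℂ) • v =
        (((2 * Real.pi * ‖ξ‖) ^ s : ℝ) : ℂ) * v := by
      intro ξ v
      rw [zero_smul, sub_zero]
      have : fracSymbol d s ((2 * Real.pi) • ξ) = (2 * Real.pi * ‖ξ‖) ^ s := by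
        rw [fracSymbol, norm_smul, Real.norm_of_nonneg (by positivity)]
      rw [← this]; rfl
    have hpos : ∀ ξ : E d, ξ ≠ 0 → 0 < (2 * Real.pi * ‖ξ‖) ^ s := fun ξ h => by
      have := norm_pos_iff.2 h
      positivity
    have hres := fourier_resolvent_ae (T := scalarSymbol (fracSymbol d s)) (z := 0) (by
      filter_upwards [hnz] with ξ hξ v hv
      rw [hval] at hv
      refine (mul_eq_zero.1 hv).resolve_left ?_
      exact_mod_cast (hpos ξ hξ).ne') f
    filter_upwards [hres, hnz, fourier_coord_ae (ContractiveCoordinates.scalar.coord ()) (f : L2 d ℂ),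
      fourier_coord_ae (ContractiveCoordinates.scalar.coord i)
        (resolvent (ofSymbol (scalarSymbol (fracSymbol d s))) 0 f)] with ξ h1 h2 h3 h4
    rw [hval] at h1
    have hξ : 0 < ‖ξ‖ := norm_pos_iff.2 h2
    rw [h4, Finset.univ_unique, Finset.sum_singleton, PUnit.default_eq_unit, h3]
    simp only [ContractiveCoordinates.scalar, ContinuousLinearMap.id_apply]
    rw [h1, norm_mul, Complex.norm_real, Real.norm_of_nonneg (hpos ξ h2).le, one_mul, ← mul_assoc]
    refine le_mul_of_one_le_left (norm_nonneg _) ?_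
    rw [Real.rpow_neg hξ.le, ← div_eq_inv_mul, le_div_iff₀ (by positivity), one_mul]
    refine Real.rpow_le_rpow hξ.le ?_ hs.le
    nlinarith [Real.pi_gt_three]
  · refine SplitBound.mono ?_ (le_max_left _ _)
    have hzn : 0 < ‖z‖ := norm_pos_iff.2 hz0
    have hR : 0 < ‖z‖ ^ (1 / s) := by positivity
    have hRs : (‖z‖ ^ (1 / s)) ^ s = ‖z‖ := by
      rw [← Real.rpow_mul hzn.le, one_div_mul_cancel hs.ne', Real.rpow_one]
    refine hsplit (fun x => x ^ (s / 2)) (fracSymbol d s) z (z / ‖z‖) (‖z‖ ^ (1 / s)) (hexp _ ?_) hR ?_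
      (fun h => hR₀K h z hz) ?_ (fun ξ => ?_) f i
    · rw [mem_sphere_zero_iff_norm, norm_div, Complex.norm_real, norm_norm, div_self hzn.ne']
    · exact (Real.rpow_le_rpow hzn.le (hb z hz) (by positivity)).trans (le_max_right _ _)
    · rw [hRs]
      have : (‖z‖ : ℂ) ≠ 0 := by exact_mod_cast hzn.ne'
      field_simp
    · rw [fracSymbol, norm_smul, Real.norm_of_nonneg (by positivity), ← mul_pow,
        ← Real.rpow_natCast (2 * Real.pi / ‖z‖ ^ (1 / s) * ‖ξ‖),
        ← Real.rpow_mul (x := 2 * Real.pi / ‖z‖ ^ (1 / s) * ‖ξ‖) (by positivity),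
        show ((2 : ℕ) : ℝ) * (s / 2) = s by push_cast; ring, ← Real.mul_rpow hR.le (by positivity)]
      congr 1
      field_simp

end Fractional

section Bessel

variable {d : ℕ} {s : ℝ}

theorem hasFDerivAt_one_add_norm_sq_rpow (s : ℝ) :
    HasFDerivAt (fun η : E d => (1 + ‖η‖ ^ 2) ^ s) (0 : E d →L[ℝ] ℝ) 0 := by
  have h := (((hasStrictFDerivAt_norm_sq (0 : E d)).hasFDerivAt).const_add 1).rpow_const (p := s)
    (Or.inl (by simp))
  simpa using h

theorem zero_mem_criticalValues_besselSymbol : (0 : ℝ) ∈ criticalValues (besselSymbol d s) := by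
  refine ⟨0, (hasFDerivAt_one_add_norm_sq_rpow (s / 2)).sub_const 1, ?_⟩
  simp [besselSymbol]

/-- The profile (1 + x)^{s/2} - 1 is strictly increasing with nonvanishing derivative, so every
value at x₀ > 0 is regular. Its value at x = 0 is the critical value 0, which K avoids. Hence
compactness suffices and R = 1. -/
theorem uniformSobolev_besselSymbol (hs : 0 < s) (hsd : s < d) {K : Set ℂ}
    (hK : IsCompactAvoiding K (criticalValues (besselSymbol d s))) :
    UniformSobolev (ofSymbol (scalarSymbol (besselSymbol d s))) s K := by
  have hd : 0 < d := by
    rcases Nat.eq_zero_or_pos d with h | h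
    · rw [h] at hsd; norm_num at hsd; linarith
    · exact h
  have hσ : 0 < s / 2 := by positivity
  have h0 : (0 : ℂ) ∉ K := by
    have := hK.2 0 zero_mem_criticalValues_besselSymbol
    simpa using this
  obtain ⟨C, u₀, u₁, hu₀, hC, hexp⟩ := exists_resolventExpansion (φ := fun x => (1 + x) ^ (s / 2) - 1) hσ
    ((ContinuousOn.rpow_const (by fun_prop) fun x _ => Or.inr hσ.le).sub continuousOn_const)
    (c₀ := 1) (B := 1) one_pos (fun x hx => by
      have := le_abs_self ((1 + x) ^ (s / 2) - 1)
      linarith) hK.1 (fun z₀ hz₀ => by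
    by_cases h : ∀ x : ℝ, 0 ≤ x → (((1 + x) ^ (s / 2) - 1 : ℝ) : ℂ) ≠ z₀
    · exact Or.inl h
    push Not at h
    obtain ⟨x₀, hx₀, hx₀z⟩ := h
    have hpos : 0 < x₀ := by
      refine lt_of_le_of_ne hx₀ fun h => h0 ?_
      rw [← h] at hx₀z
      have : z₀ = 0 := by rw [← hx₀z]; simp
      exact this ▸ hz₀
    have ha := analyticAt_const_add_cpow (b := 1) (x := x₀) (by linarith) ((s / 2 : ℝ) : ℂ)
    refine Or.inr ⟨x₀, hpos, hx₀z, fun x hx hne h => hne ?_,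
      fun ζ => (((1 : ℝ) : ℂ) + ζ) ^ ((s / 2 : ℝ) : ℂ) - 1, ha.1.sub analyticAt_const, ?_, fun x hx => ?_⟩
    · rw [← hx₀z] at h
      have h1 : (1 + x) ^ (s / 2) = (1 + x₀) ^ (s / 2) := by
        have := Complex.ofReal_injective h
        linarith
      have := (Real.rpow_left_inj (by linarith) (by linarith) hσ.ne').1 h1
      linarith
    · rw [deriv_sub_const, ha.2]
      refine mul_ne_zero (by exact_mod_cast hσ.ne') ?_
      rw [Complex.cpow_ne_zero_iff]
      left
      exact_mod_cast (by linarith : 1 + x₀ ≠ 0)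
    · simp only
      rw [← Complex.ofReal_add, ← Complex.ofReal_cpow (by linarith)]
      push_cast; rfl)
  obtain ⟨C', hC', hsplit⟩ := exists_splitBound_scalar hd hs hsd (u₁ := u₁) hC hu₀ one_pos le_rfl le_rfl
  refine uniformSobolev_of_splitBound hd hs hsd ContractiveCoordinates.scalar (fun j : Unit => j) _ K C'
    fun z hz f i => ?_
  refine hsplit _ (besselSymbol d s) z z 1 (hexp z hz) one_pos le_rfl (fun _ => le_rfl) ?_ (fun ξ => ?_) f i
  · simp
  · rw [besselSymbol, norm_smul, Real.norm_of_nonneg (by positivity), Real.one_rpow, one_mul, div_one, mul_pow]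

end Bessel

end

/-! ### Dirac operators -/

section

section Dirac

variable {d n : ℕ}

/-- Doubling the square and renaming indices in one copy produces a sum of anticommutators, to which
the Clifford relations apply term by term. -/
theorem IsClifford.sum_smul_mul_self {α : Fin d → Matrix (Fin n) (Fin n) ℂ} (hα : IsClifford α) (η : E d) :
    (∑ j, (η j : ℂ) • α j) * (∑ j, (η j : ℂ) • α j) = ((‖η‖ ^ 2 : ℝ) : ℂ) • 1 := by
  have key : ∀ i j, ((η i : ℂ) • α i) * ((η j : ℂ) • α j) + ((η j : ℂ) • α j) * ((η i : ℂ) • α i) =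
      if i = j then (2 * (η i : ℂ) ^ 2) • (1 : Matrix (Fin n) (Fin n) ℂ) else 0 := by
    intro i j
    have h : ((η i : ℂ) • α i) * ((η j : ℂ) • α j) + ((η j : ℂ) • α j) * ((η i : ℂ) • α i) =
        ((η i : ℂ) * η j) • (α i * α j + α j * α i) := by
      simp only [smul_mul_smul_comm, smul_add]
      rw [mul_comm (η j : ℂ)]
    rw [h, hα i j]
    split_ifs with hij
    · subst hij
      rw [show (2 : Matrix (Fin n) (Fin n) ℂ) = (2 : ℂ) • 1 by rw [two_smul, one_add_one_eq_two], smul_smul]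
      congr 1
      ring
    · rw [smul_zero]
  have h2 : (2 : ℂ) • ((∑ j, (η j : ℂ) • α j) * (∑ j, (η j : ℂ) • α j)) =
      (2 : ℂ) • (((‖η‖ ^ 2 : ℝ) : ℂ) • (1 : Matrix (Fin n) (Fin n) ℂ)) := by
    have hS : (∑ j, (η j : ℂ) • α j) * (∑ j, (η j : ℂ) • α j) =
        ∑ i, ∑ j, ((η i : ℂ) • α i) * ((η j : ℂ) • α j) := Finset.sum_mul_sum _ _ _ _
    rw [two_smul]
    nth_rewrite 2 [hS]
    rw [Finset.sum_comm, hS, ← Finset.sum_add_distrib]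
    simp only [← Finset.sum_add_distrib, key]
    simp only [Finset.sum_ite_eq, Finset.mem_univ, if_true, ← Finset.sum_smul, ← Finset.mul_sum, smul_smul]
    rw [EuclideanSpace.real_norm_sq_eq]
    push_cast
    rfl
  exact smul_right_injective _ (two_ne_zero' ℂ) h2

/-- The square of a Dirac symbol with mass term `b` is scalar. -/
theorem IsClifford.add_mul_self {α : Fin d → Matrix (Fin n) (Fin n) ℂ} (hα : IsClifford α)
    {b : Matrix (Fin n) (Fin n) ℂ} {ε : ℂ} (hb : ∀ j, α j * b + b * α j = 0) (hb2 : b * b = ε • 1) (η : E d) :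
    (∑ j, (η j : ℂ) • α j + b) * (∑ j, (η j : ℂ) • α j + b) = (((‖η‖ ^ 2 : ℝ) : ℂ) + ε) • 1 := by
  have h : (∑ j, (η j : ℂ) • α j) * b + b * (∑ j, (η j : ℂ) • α j) = 0 := by
    rw [Finset.sum_mul, Finset.mul_sum, ← Finset.sum_add_distrib]
    refine Finset.sum_eq_zero fun j _ => ?_
    rw [smul_mul_assoc, mul_smul_comm, ← smul_add, hb, smul_zero]
  calc _ = (∑ j, (η j : ℂ) • α j) * (∑ j, (η j : ℂ) • α j) +
        ((∑ j, (η j : ℂ) • α j) * b + b * (∑ j, (η j : ℂ) • α j)) + b * b := by noncomm_ring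
    _ = _ := by rw [h, hα.sum_smul_mul_self, hb2, add_zero, add_smul]

/-- After factoring M² - z² the profile is φ(x) = x, with energy (z² - ε)/R² normalized to the unit
circle. -/
theorem exists_resolventExpansion_id : ∃ C u₀ u₁ : ℝ, 0 < u₀ ∧ 0 ≤ C ∧ ∀ z ∈ Metric.sphere (0 : ℂ) 1,
    ResolventExpansion (fun x => x) 1 z C u₀ u₁ := by
  refine exists_resolventExpansion (φ := fun x => x) one_pos continuousOn_id (c₀ := 1) (B := 1) one_pos (fun x hx => ?_)
    (isCompact_sphere _ _) (fun z₀ hz₀ => ?_)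
  · rw [Real.rpow_one, abs_of_nonneg hx]
    linarith
  · have hz : ‖z₀‖ = 1 := by simpa using hz₀
    have key : ∀ x : ℝ, 0 ≤ x → (x : ℂ) = z₀ → x = 1 := by
      intro x hx h
      rwa [← h, Complex.norm_real, Real.norm_of_nonneg hx] at hz
    by_cases h1 : z₀ = 1
    · exact Or.inr ⟨1, one_pos, by rw [h1]; simp, fun x hx hne h => hne (key x hx h), fun ζ => ζ, analyticAt_id,
        by simp, fun x _ => rfl⟩
    · refine Or.inl fun x hx h => h1 ?_
      rw [← h, key x hx h, Complex.ofReal_one]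

variable (α : Fin d → Matrix (Fin n) (Fin n) ℂ) (b : Matrix (Fin n) (Fin n) ℂ)

/-- The sum of the absolute values of all entries. -/
def entrySum : ℝ := ∑ j, ∑ i, ∑ k, ‖α j i k‖

theorem entrySum_nonneg : 0 ≤ entrySum α := by unfold entrySum; positivity

variable {α b}

theorem sum_norm_entry_le (i k : Fin n) : ∑ j, ‖α j i k‖ ≤ entrySum α := by
  refine Finset.sum_le_sum fun j _ => ?_
  exact (Finset.single_le_sum (f := fun k => ‖α j i k‖) (fun _ _ => norm_nonneg _) (Finset.mem_univ k)).trans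
    (Finset.single_le_sum (f := fun i => ∑ k, ‖α j i k‖) (fun _ _ => by positivity) (Finset.mem_univ i))

theorem norm_entry_le (j : Fin d) (i k : Fin n) : ‖α j i k‖ ≤ entrySum α :=
  (Finset.single_le_sum (f := fun j => ‖α j i k‖) (fun _ _ => norm_nonneg _) (Finset.mem_univ j)).trans
    (sum_norm_entry_le i k)

variable (α b) in
/-- The Dirac symbol with mass term `b`. -/
def massDiracSymbol (η : E d) : EuclideanSpace ℂ (Fin n) →L[ℂ] EuclideanSpace ℂ (Fin n) :=
  Matrix.toEuclideanCLM (𝕜 := ℂ) (∑ j, (η j : ℂ) • α j + b)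

theorem massDiracSymbol_apply (η : E d) (v : EuclideanSpace ℂ (Fin n)) (i : Fin n) :
    massDiracSymbol α b η v i = ∑ k, (∑ j, (η j : ℂ) * α j i k + b i k) * v k := by
  rw [massDiracSymbol, Matrix.ofLp_toEuclideanCLM]
  simp only [Matrix.mulVec, dotProduct, Matrix.add_apply, Matrix.sum_apply, Matrix.smul_apply, smul_eq_mul]

theorem massDiracSymbol_massDiracSymbol (hα : IsClifford α) {ε : ℂ} (hb : ∀ j, α j * b + b * α j = 0)
    (hb2 : b * b = ε • 1) (η : E d) (v : EuclideanSpace ℂ (Fin n)) :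
    massDiracSymbol α b η (massDiracSymbol α b η v) = (((‖η‖ ^ 2 : ℝ) : ℂ) + ε) • v := by
  have h : massDiracSymbol α b η * massDiracSymbol α b η = (((‖η‖ ^ 2 : ℝ) : ℂ) + ε) • 1 := by
    unfold massDiracSymbol
    rw [← map_mul, hα.add_mul_self hb hb2, map_smul, map_one]
  have := congrArg (fun A => A v) h
  simpa using this

/-- Factorization of `M² - z²` for a Dirac symbol `M`. -/
theorem massDiracSymbol_add_apply_sub (hα : IsClifford α) {ε : ℂ} (hb : ∀ j, α j * b + b * α j = 0)
    (hb2 : b * b = ε • 1) (η : E d) (z : ℂ) (v : EuclideanSpace ℂ (Fin n)) :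
    massDiracSymbol α b η (massDiracSymbol α b η v - z • v) + z • (massDiracSymbol α b η v - z • v) =
      (((‖η‖ ^ 2 : ℝ) : ℂ) + ε - z ^ 2) • v := by
  rw [map_sub, map_smul, massDiracSymbol_massDiracSymbol hα hb hb2, sub_smul, pow_two z, mul_smul, smul_sub]
  abel

/-- The resolvent of the Dirac operator in Fourier space. -/
theorem fourier_resolvent_massDirac_ae (hα : IsClifford α) {ε : ℂ} (hb : ∀ j, α j * b + b * α j = 0)
    (hb2 : b * b = ε • 1) {z : ℂ}
    (hne : ∀ᵐ ξ : E d, ((‖(2 * Real.pi) • ξ‖ ^ 2 : ℝ) : ℂ) + ε - z ^ 2 ≠ 0)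
    (f : (resolvent (ofSymbol (massDiracSymbol α b)) z).domain) (i : Fin n) :
    ∀ᵐ ξ : E d, (((‖(2 * Real.pi) • ξ‖ ^ 2 : ℝ) : ℂ) + ε - z ^ 2) *
      (𝓕 (((ContractiveCoordinates.euclidean n).coord i).compLp
        (resolvent (ofSymbol (massDiracSymbol α b)) z f)) : L2 d ℂ) ξ =
      ∑ k, (∑ j, (2 * Real.pi * ξ j : ℂ) * α j i k + b i k + z * (1 : Matrix (Fin n) (Fin n) ℂ) i k) *
        (𝓕 (((ContractiveCoordinates.euclidean n).coord k).compLp (f : L2 d (EuclideanSpace ℂ (Fin n)))) :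
          L2 d ℂ) ξ := by
  have hres := fourier_resolvent_ae (T := massDiracSymbol α b) (z := z) (by
    filter_upwards [hne] with ξ hξ v hv
    have h := massDiracSymbol_add_apply_sub hα hb hb2 ((2 * Real.pi) • ξ) z v
    rw [hv, map_zero, smul_zero, add_zero] at h
    exact (smul_eq_zero.1 h.symm).resolve_left hξ) f
  have hk := ae_all_iff.2 fun k => fourier_coord_ae ((ContractiveCoordinates.euclidean n).coord k)
    (f : L2 d (EuclideanSpace ℂ (Fin n)))
  filter_upwards [hres, hk, fourier_coord_ae ((ContractiveCoordinates.euclidean n).coord i)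
    (resolvent (ofSymbol (massDiracSymbol α b)) z f)] with ξ h1 h2 h3
  -- Applying M + z to the resolvent equation (M - z)ĝ = f̂ leaves a scalar factor times ĝ.
  have h := massDiracSymbol_add_apply_sub hα hb hb2 ((2 * Real.pi) • ξ) z
    ((𝓕 (resolvent (ofSymbol (massDiracSymbol α b)) z f) : L2 d (EuclideanSpace ℂ (Fin n))) ξ)
  rw [← h1] at h
  have hi := congrArg (fun v : EuclideanSpace ℂ (Fin n) => v i) h
  simp only [PiLp.add_apply, PiLp.smul_apply, massDiracSymbol_apply, smul_eq_mul] at hi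
  rw [h3]
  simp only [h2]
  have hcoord : ∀ (k : Fin n) (v : EuclideanSpace ℂ (Fin n)),
      (ContractiveCoordinates.euclidean n).coord k v = v k := fun _ _ => rfl
  simp only [hcoord]
  rw [← hi]
  simp only [add_mul _ (z * _), Finset.sum_add_distrib]
  congr 1
  · refine Finset.sum_congr rfl fun k _ => ?_
    simp
  · simp [Matrix.one_apply]

/-- Uniform split bounds for the resolvents of a Dirac operator, at frequency scale `R`. -/
theorem exists_splitBound_massDirac (hd : 1 < d) (hα : IsClifford α) {ε : ℂ} (hb : ∀ j, α j * b + b * α j = 0)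
    (hb2 : b * b = ε • 1) {R₁ b₀ : ℝ} (hR₁ : 1 ≤ R₁) (hb₀ : 0 ≤ b₀) :
    ∃ C' : ℝ, 0 ≤ C' ∧ ∀ (z : ℂ) (R : ℝ), 0 < R → R ≤ R₁ → ‖z ^ 2 - ε‖ = R ^ 2 →
      (∀ i k, ‖b i k + z * (1 : Matrix (Fin n) (Fin n) ℂ) i k‖ ≤ b₀ * R) →
      ∀ (f : (resolvent (ofSymbol (massDiracSymbol α b)) z).domain) (i : Fin n), SplitBound 1 C'
        (fun j : Option (Fin d) × Fin n => ((ContractiveCoordinates.euclidean n).coord j.2).compLp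
          (f : L2 d (EuclideanSpace ℂ (Fin n))))
        (((ContractiveCoordinates.euclidean n).coord i).compLp
          (resolvent (ofSymbol (massDiracSymbol α b)) z f)) := by
  have hd0 : 0 < d := by omega
  have hd1 : (1 : ℝ) < d := by exact_mod_cast hd
  obtain ⟨C, u₀, u₁, hu₀, hC, hexp⟩ := exists_resolventExpansion_id
  obtain ⟨L, hL1, hL⟩ := exists_bilinearMultiplier_gaussian d
  have ha := entrySum_nonneg α
  have hL0 : 0 ≤ L := zero_le_one.trans hL1
  -- The remainder decays with σ = 1 and the numerator grows with β = 1/2, so σ - β = 1/2 = s/2. The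
  -- lower bound on R is vacuous, since 1 < 2d/(d+1) for d ≥ 2.
  obtain ⟨C', hC', h⟩ := exists_splitBound hd0 one_pos hd1 (Fintype.card (Option (Fin d) × Fin n)) (σ := 1)
    (β := 1 / 2) (by norm_num) (u₁ := u₁) hC hu₀ (L := (entrySum α + b₀) * L) (by positivity) one_pos le_rfl hR₁
    zero_le_one
  refine ⟨C', hC', fun z R hR hRR hzR hbR f i => ?_⟩
  have hR0 : (R : ℂ) ≠ 0 := by exact_mod_cast hR.ne'
  have hκ : 0 < 2 * Real.pi / R := by positivity
  set w : ℂ := (z ^ 2 - ε) / (R ^ 2 : ℝ) with hw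
  have hexpw : ResolventExpansion (fun x => x) 1 w C u₀ u₁ := by
    refine hexp w ?_
    rw [mem_sphere_zero_iff_norm, hw, norm_div, hzR, Complex.norm_real, Real.norm_of_nonneg (by positivity),
      div_self (by positivity)]
  have hfac : ∀ ξ : E d, ((‖(2 * Real.pi) • ξ‖ ^ 2 : ℝ) : ℂ) + ε - z ^ 2 =
      (R : ℂ) ^ 2 * ((((2 * Real.pi / R) ^ 2 * ‖ξ‖ ^ 2 : ℝ) : ℂ) - w) := by
    intro ξ
    rw [norm_smul, Real.norm_of_nonneg (by positivity), hw]
    push_cast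
    field_simp
    ring
  have hne := hexpw.ae_ne (d := d) hu₀ hκ
  have hres := fourier_resolvent_massDirac_ae hα hb hb2 (z := z) (by
    filter_upwards [hne] with ξ hξ
    rw [hfac]
    exact mul_ne_zero (pow_ne_zero 2 hR0) hξ) f i
  -- The entries of (M + z)/R: `some l` indexes the terms linear in ξ_l, `none` the constant term.
  -- With the denominator R²(x - w) this leaves the prefactor R^{-1}.
  set N : Option (Fin d) × Fin n → E d → ℂ := fun j ξ => match j.1 with
    | some l => α l i j.2 * ((2 * Real.pi / R * ξ l : ℝ) : ℂ)
    | none => (b i j.2 + z * (1 : Matrix (Fin n) (Fin n) ℂ) i j.2) / R with hN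
  have hnone : ∀ k, ‖(b i k + z * (1 : Matrix (Fin n) (Fin n) ℂ) i k) / R‖ ≤ b₀ := by
    intro k
    rw [norm_div, Complex.norm_real, Real.norm_of_nonneg hR.le, div_le_iff₀ hR]
    exact hbR i k
  refine h (fun x => x) w (R : ℂ)⁻¹ R _ N _ _ le_rfl hexpw hR hRR (fun h => ?_) ?_ ?_ ?_ ?_
  · rw [div_le_iff₀ (by positivity)] at h
    linarith
  · rw [norm_inv, Complex.norm_real, Real.norm_of_nonneg hR.le, Real.rpow_neg_one, one_mul]
  · rintro ⟨_ | l, k⟩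
    · refine (((hL _ hκ).1).const_mul _).mono (mul_le_mul_of_nonneg_right ((hnone k).trans ?_) hL0)
      linarith
    · have := (((hL _ hκ).2 l).const_mul (α l i k)).mono (mul_le_mul_of_nonneg_right
        ((norm_entry_le l i k).trans (le_add_of_nonneg_right hb₀)) hL0)
      simpa only [hN, mul_assoc] using this
  · rintro ⟨_ | l, k⟩ ξ
    · refine (hnone k).trans ?_
      have h1 : (1 : ℝ) ≤ (1 + (2 * Real.pi / R) ^ 2 * ‖ξ‖ ^ 2) ^ (1 / 2 : ℝ) :=
        Real.one_le_rpow (by nlinarith [mul_nonneg (sq_nonneg (2 * Real.pi / R)) (sq_nonneg ‖ξ‖)]) (by norm_num)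
      calc b₀ ≤ (entrySum α + b₀) * 1 * 1 := by linarith
        _ ≤ _ := by gcongr
    · have h1 : ‖((2 * Real.pi / R * ξ l : ℝ) : ℂ)‖ ≤ (1 + (2 * Real.pi / R) ^ 2 * ‖ξ‖ ^ 2) ^ (1 / 2 : ℝ) := by
        rw [Complex.norm_real, norm_mul, Real.norm_of_nonneg hκ.le, ← Real.sqrt_eq_rpow]
        refine Real.le_sqrt_of_sq_le ?_
        have := PiLp.norm_apply_le ξ l
        calc (2 * Real.pi / R * ‖ξ l‖) ^ 2 ≤ (2 * Real.pi / R * ‖ξ‖) ^ 2 := by gcongr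
          _ = (2 * Real.pi / R) ^ 2 * ‖ξ‖ ^ 2 := by ring
          _ ≤ _ := by linarith
      calc ‖N (some l, k) ξ‖ = ‖α l i k‖ * ‖((2 * Real.pi / R * ξ l : ℝ) : ℂ)‖ := norm_mul _ _
        _ ≤ (entrySum α + b₀) * L * (1 + (2 * Real.pi / R) ^ 2 * ‖ξ‖ ^ 2) ^ (1 / 2 : ℝ) := by
          refine mul_le_mul ?_ h1 (norm_nonneg _) (by positivity)
          calc ‖α l i k‖ ≤ (entrySum α + b₀) * 1 := by linarith [norm_entry_le (α := α) l i k]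
            _ ≤ _ := by gcongr
  · filter_upwards [hres, hne] with ξ h1 h2
    rw [hfac] at h1
    have h3 : ∑ j, N j ξ * (𝓕 (((ContractiveCoordinates.euclidean n).coord j.2).compLp
        (f : L2 d (EuclideanSpace ℂ (Fin n)))) : L2 d ℂ) ξ = (R : ℂ)⁻¹ * ((R : ℂ) ^ 2 *
        ((((2 * Real.pi / R) ^ 2 * ‖ξ‖ ^ 2 : ℝ) : ℂ) - w) *
        (𝓕 (((ContractiveCoordinates.euclidean n).coord i).compLp
          (resolvent (ofSymbol (massDiracSymbol α b)) z f)) : L2 d ℂ) ξ) := by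
      rw [h1, Fintype.sum_prod_type_right, Finset.mul_sum]
      refine Finset.sum_congr rfl fun k _ => ?_
      simp only [← Finset.sum_mul, hN]
      rw [Fintype.sum_option, ← mul_assoc]
      congr 1
      rw [add_assoc, mul_add, add_comm, Finset.mul_sum]
      congr 1
      · refine Finset.sum_congr rfl fun l _ => ?_
        push_cast
        field_simp
      · exact div_eq_inv_mul _ _
    rw [h3]
    generalize (((2 * Real.pi / R) ^ 2 * ‖ξ‖ ^ 2 : ℝ) : ℂ) - w = y at h2 ⊢
    field_simp

/-- The uniform Sobolev inequalities for a Dirac operator, away from the threshold. -/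
theorem uniformSobolev_massDirac_of_le (hd : 1 < d) (hα : IsClifford α) {ε : ℂ}
    (hb : ∀ j, α j * b + b * α j = 0) (hb2 : b * b = ε • 1) {K : Set ℂ} {R₁ b₀ K₀ : ℝ} (hR₁ : 1 ≤ R₁)
    (hb₀ : 0 ≤ b₀)
    (h : ∀ z ∈ K, (∃ R, 0 < R ∧ R ≤ R₁ ∧ ‖z ^ 2 - ε‖ = R ^ 2 ∧
      ∀ i k, ‖b i k + z * (1 : Matrix (Fin n) (Fin n) ℂ) i k‖ ≤ b₀ * R) ∨
      ∀ (f : (resolvent (ofSymbol (massDiracSymbol α b)) z).domain) (i : Fin n), SplitBound 1 K₀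
        (fun j : Option (Fin d) × Fin n => ((ContractiveCoordinates.euclidean n).coord j.2).compLp
          (f : L2 d (EuclideanSpace ℂ (Fin n))))
        (((ContractiveCoordinates.euclidean n).coord i).compLp
          (resolvent (ofSymbol (massDiracSymbol α b)) z f))) :
    UniformSobolev (ofSymbol (massDiracSymbol α b)) 1 K := by
  obtain ⟨C', -, hC'⟩ := exists_splitBound_massDirac hd hα hb hb2 hR₁ hb₀
  refine uniformSobolev_of_splitBound (by omega) one_pos (by exact_mod_cast hd)
    (ContractiveCoordinates.euclidean n) (fun j : Option (Fin d) × Fin n => j.2) _ K (max C' K₀) fun z hz f i => ?_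
  rcases h z hz with ⟨R, hR, hRR, h1, h2⟩ | h
  · exact (hC' z R hR hRR h1 h2 f i).mono (le_max_left _ _)
  · exact (h f i).mono (le_max_right _ _)

theorem norm_one_entry_le (i k : Fin n) : ‖(1 : Matrix (Fin n) (Fin n) ℂ) i k‖ ≤ 1 := by
  rw [Matrix.one_apply]
  split_ifs <;> simp

/-- The split bound for the massless Dirac operator at the energy `0`. -/
theorem splitBound_massless_zero (hd : 1 < d) (hα : IsClifford α)
    (f : (resolvent (ofSymbol (massDiracSymbol α 0)) 0).domain) (i : Fin n) :
    SplitBound 1 (sobolevConst d 1 ^ 2 * (entrySum α * (Fintype.card (Option (Fin d) × Fin n) + 1)))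
      (fun j : Option (Fin d) × Fin n => ((ContractiveCoordinates.euclidean n).coord j.2).compLp
        (f : L2 d (EuclideanSpace ℂ (Fin n))))
      (((ContractiveCoordinates.euclidean n).coord i).compLp
        (resolvent (ofSymbol (massDiracSymbol α 0)) 0 f)) := by
  have hd0 : 0 < d := by omega
  have hd1 : (1 : ℝ) < d := by exact_mod_cast hd
  have hnz : ∀ᵐ ξ : E d, ξ ≠ 0 := by
    have : Nontrivial (E d) := by
      have : Nonempty (Fin d) := ⟨⟨0, hd0⟩⟩
      infer_instance
    exact measure_eq_zero_iff_ae_notMem.1 (measure_singleton (0 : E d))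
  have hfac : ∀ ξ : E d, ((‖(2 * Real.pi) • ξ‖ ^ 2 : ℝ) : ℂ) + 0 - 0 ^ 2 = (((2 * Real.pi * ‖ξ‖) ^ 2 : ℝ) : ℂ) := by
    intro ξ
    rw [norm_smul, Real.norm_of_nonneg (by positivity)]
    ring
  have hpos : ∀ ξ : E d, ξ ≠ 0 → 0 < 2 * Real.pi * ‖ξ‖ := fun ξ h => by
    have := norm_pos_iff.2 h
    positivity
  have hres := fourier_resolvent_massDirac_ae hα (b := 0) (ε := 0) (by simp) (by simp) (z := 0) (by
    filter_upwards [hnz] with ξ hξ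
    rw [hfac]
    exact_mod_cast (pow_pos (hpos ξ hξ) 2).ne') f i
  -- At zero energy the inverse symbol is Σ α_j η_j / |η|², whose entries are of size |η|^{-1}.
  refine splitBound_of_norm_fourier_le hd0 one_pos hd1 (fun h => ?_) _ _ (entrySum_nonneg α) ?_
  · rw [div_le_iff₀ (by positivity)] at h
    linarith
  · filter_upwards [hres, hnz] with ξ h1 h2
    set F : Fin n → ℝ := fun k => ‖(𝓕 (((ContractiveCoordinates.euclidean n).coord k).compLp
      (f : L2 d (EuclideanSpace ℂ (Fin n)))) : L2 d ℂ) ξ‖ with hF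
    have hξ := norm_pos_iff.2 h2
    have hp := hpos ξ h2
    have hsum : ∑ k, F k ≤ ∑ j : Option (Fin d) × Fin n, F j.2 := by
      rw [Fintype.sum_prod_type]
      exact Finset.single_le_sum (f := fun _ : Option (Fin d) => ∑ k, F k)
        (fun _ _ => Finset.sum_nonneg fun _ _ => norm_nonneg _) (Finset.mem_univ none)
    have hentry : ∀ k, ‖∑ j, (2 * Real.pi * ξ j : ℂ) * α j i k‖ ≤ 2 * Real.pi * ‖ξ‖ * entrySum α := by
      intro k
      refine (norm_sum_le _ _).trans ?_
      calc ∑ j, ‖(2 * Real.pi * ξ j : ℂ) * α j i k‖ ≤ ∑ j, 2 * Real.pi * ‖ξ‖ * ‖α j i k‖ := by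
            refine Finset.sum_le_sum fun j _ => ?_
            have e : (2 * Real.pi * ξ j : ℂ) = ((2 * Real.pi * ξ j : ℝ) : ℂ) := by push_cast; ring
            rw [norm_mul, e, Complex.norm_real, norm_mul, Real.norm_of_nonneg (by positivity : 0 ≤ 2 * Real.pi)]
            have := PiLp.norm_apply_le ξ j
            gcongr
        _ = 2 * Real.pi * ‖ξ‖ * ∑ j, ‖α j i k‖ := (Finset.mul_sum _ _ _).symm
        _ ≤ _ := by gcongr; exact sum_norm_entry_le i k
    have h3 := congrArg norm h1
    rw [hfac, norm_mul, Complex.norm_real, Real.norm_of_nonneg (by positivity)] at h3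
    simp only [Matrix.zero_apply, add_zero, zero_mul] at h3
    have h4 := h3.le.trans ((norm_sum_le _ _).trans (Finset.sum_le_sum fun k _ =>
      (norm_mul_le _ _).trans (mul_le_mul_of_nonneg_right (hentry k) (norm_nonneg _))))
    rw [← Finset.mul_sum] at h4
    have h5 := h4.trans (mul_le_mul_of_nonneg_left hsum (by have := entrySum_nonneg α; positivity))
    set g := ‖(𝓕 (((ContractiveCoordinates.euclidean n).coord i).compLp
        (resolvent (ofSymbol (massDiracSymbol α 0)) 0 f)) : L2 d ℂ) ξ‖
    set S := ∑ j : Option (Fin d) × Fin n, F j.2 with hS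
    have hS0 : 0 ≤ S := Finset.sum_nonneg fun _ _ => norm_nonneg _
    have h6 : 2 * Real.pi * ‖ξ‖ * g ≤ entrySum α * S := by
      refine le_of_mul_le_mul_left (le_trans (le_of_eq ?_) (h5.trans (le_of_eq ?_))) hp <;> ring
    have hg : ‖ξ‖ * g ≤ entrySum α * S := by
      refine le_trans ?_ h6
      have : 0 ≤ ‖ξ‖ * g := mul_nonneg hξ.le (norm_nonneg _)
      nlinarith [Real.pi_gt_three]
    rw [Real.rpow_neg_one]
    calc g = ‖ξ‖⁻¹ * (‖ξ‖ * g) := by field_simp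
      _ ≤ ‖ξ‖⁻¹ * (entrySum α * S) := by gcongr
      _ = _ := by ring

/-- With scale R = |z| the constant term z of the numerator is at most R entrywise, so small
energies are uniform; z = 0 is the pure Sobolev case. -/
theorem uniformSobolev_diracSymbol (hd : 1 < d) (hα : IsClifford α) {K : Set ℂ} (hK : IsCompact K) :
    UniformSobolev (ofSymbol (diracSymbol α)) 1 K := by
  obtain ⟨r, hr⟩ := hK.isBounded.exists_norm_le
  have e : diracSymbol α = massDiracSymbol α 0 := by
    funext η
    rw [diracSymbol, massDiracSymbol, add_zero]
  rw [e]
  refine uniformSobolev_massDirac_of_le hd hα (b := 0) (ε := 0) (by simp) (by simp) (le_max_left 1 r) zero_le_one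
    (K₀ := sobolevConst d 1 ^ 2 * (entrySum α * (Fintype.card (Option (Fin d) × Fin n) + 1)))
    fun z hz => ?_
  rcases eq_or_ne z 0 with rfl | hz0
  · exact Or.inr (splitBound_massless_zero hd hα)
  · refine Or.inl ⟨‖z‖, norm_pos_iff.2 hz0, (hr z hz).trans (le_max_right _ _), by simp, fun i k => ?_⟩
    rw [Matrix.zero_apply, zero_add, norm_mul, mul_comm]
    exact mul_le_mul_of_nonneg_right (norm_one_entry_le i k) (norm_nonneg _)

theorem one_mem_massiveDiracCritical : (1 : ℝ) ∈ massiveDiracCritical d := by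
  refine Or.inl ⟨0, ?_, by simp⟩
  simpa only [Real.sqrt_eq_rpow] using hasFDerivAt_one_add_norm_sq_rpow (1 / 2)

theorem neg_one_mem_massiveDiracCritical : (-1 : ℝ) ∈ massiveDiracCritical d := by
  refine Or.inr ⟨0, ?_, by simp⟩
  simpa only [Real.sqrt_eq_rpow, neg_zero] using (hasFDerivAt_one_add_norm_sq_rpow (1 / 2)).fun_neg

/-- Here R² = |z² - 1|, bounded below on K because the thresholds ±1 are critical values. The
bounded entries of β + z are then at most a constant times R. -/
theorem uniformSobolev_massiveDiracSymbol (hd : 1 < d) {α : Fin (d + 1) → Matrix (Fin n) (Fin n) ℂ}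
    (hα : IsClifford α) {K : Set ℂ} (hK : IsCompactAvoiding K (massiveDiracCritical d)) :
    UniformSobolev (ofSymbol (massiveDiracSymbol α)) 1 K := by
  obtain ⟨r, hr⟩ := hK.1.isBounded.exists_norm_le
  have h1 : (1 : ℂ) ∉ K := by simpa using hK.2 1 one_mem_massiveDiracCritical
  have h2 : (-1 : ℂ) ∉ K := by simpa using hK.2 (-1) neg_one_mem_massiveDiracCritical
  obtain ⟨δ, hδ, hδK⟩ := hK.1.exists_forall_le' (a := 0) (f := fun z : ℂ => ‖z ^ 2 - 1‖) (by fun_prop)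
    (fun z hz => norm_pos_iff.2 fun h => by
      rcases sq_eq_sq_iff_eq_or_eq_neg.1 ((sub_eq_zero.1 h).trans (one_pow 2).symm) with rfl | rfl
      · exact h1 hz
      · exact h2 hz)
  have hα' : IsClifford fun j : Fin d => α j.castSucc := fun i j => by
    simpa using hα i.castSucc j.castSucc
  have hb : ∀ j : Fin d, α j.castSucc * α (Fin.last d) + α (Fin.last d) * α j.castSucc = 0 := fun j => by
    rw [hα, if_neg (Fin.castSucc_lt_last j).ne]
  have hb2 : α (Fin.last d) * α (Fin.last d) = (1 : ℂ) • 1 := by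
    have h := hα (Fin.last d) (Fin.last d)
    rw [if_pos rfl, ← two_smul ℂ] at h
    refine smul_right_injective _ (two_ne_zero' ℂ) ?_
    simp only [one_smul]
    rw [h, two_smul, one_add_one_eq_two]
  have ha := entrySum_nonneg α
  have hr' : 0 ≤ max r 0 := le_max_right _ _
  refine uniformSobolev_massDirac_of_le hd hα' hb hb2 (R₁ := max 1 √(max r 0 ^ 2 + 1)) (K₀ := 0)
    (b₀ := (entrySum α + max r 0) / √δ) (le_max_left _ _) (by positivity) fun z hz => Or.inl ?_
  have hzr : ‖z‖ ≤ max r 0 := (hr z hz).trans (le_max_left _ _)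
  have hδz : δ ≤ ‖z ^ 2 - 1‖ := hδK z hz
  refine ⟨√‖z ^ 2 - 1‖, Real.sqrt_pos.2 (hδ.trans_le hδz), le_trans ?_ (le_max_right _ _),
    (Real.sq_sqrt (norm_nonneg _)).symm, fun i k => ?_⟩
  · refine Real.sqrt_le_sqrt ((norm_sub_le _ _).trans ?_)
    rw [norm_pow, norm_one]
    gcongr
  · have hsq : √δ ≤ √‖z ^ 2 - 1‖ := Real.sqrt_le_sqrt hδz
    have hs0 : 0 < √δ := Real.sqrt_pos.2 hδ
    calc _ ≤ ‖α (Fin.last d) i k‖ + ‖z * (1 : Matrix (Fin n) (Fin n) ℂ) i k‖ := norm_add_le _ _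
      _ ≤ entrySum α + max r 0 * 1 := by
        rw [norm_mul]
        have := norm_entry_le (α := α) (Fin.last d) i k
        have := norm_one_entry_le i k
        gcongr
      _ = (entrySum α + max r 0) / √δ * √δ := by field_simp
      _ ≤ _ := by gcongr

end Dirac

end

end FreeHamiltonian

end

open FreeHamiltonian in
theorem theorem3p1 (d : ℕ) :
    (∀ s : ℝ, 0 < s → s < d →
      ∀ K : Set ℂ, IsCompactAvoiding K (criticalValues (fracSymbol d s)) →
        UniformSobolev (ofSymbol (scalarSymbol (fracSymbol d s))) s K) ∧
    (∀ s : ℝ, 0 < s → s < d →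
      ∀ K : Set ℂ, IsCompactAvoiding K (criticalValues (besselSymbol d s)) →
        UniformSobolev (ofSymbol (scalarSymbol (besselSymbol d s))) s K) ∧
    (1 < d → ∀ (n : ℕ) (α : Fin d → Matrix (Fin n) (Fin n) ℂ), IsClifford α →
      ∀ K : Set ℂ, IsCompactAvoiding K (diracCritical d) →
        UniformSobolev (ofSymbol (diracSymbol α)) 1 K) ∧
    (1 < d → ∀ (n : ℕ) (α : Fin (d + 1) → Matrix (Fin n) (Fin n) ℂ), IsClifford α →
      ∀ K : Set ℂ, IsCompactAvoiding K (massiveDiracCritical d) →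
        UniformSobolev (ofSymbol (massiveDiracSymbol α)) 1 K) :=
  ⟨fun _ hs hsd _ hK => uniformSobolev_fracSymbol hs hsd hK,
    fun _ hs hsd _ hK => uniformSobolev_besselSymbol hs hsd hK,
    fun hd _ _ hα _ hK => uniformSobolev_diracSymbol hd hα hK.1,
    fun hd _ _ hα _ hK => uniformSobolev_massiveDiracSymbol hd hα hK⟩
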